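/- Let $F$ be a non-Archimedean local field with ring of integers $\mathfrak o$, maximal ideal $\mathfrak p$ and uniformizer $\varpi$, let $E/F$ be an unramified extension of degree $n$, let $\mathfrak O$ be the integral closure of $\mathfrak o$ in $E$ and $\mathfrak P=\varpi\mathfrak O$ its maximal ideal. Put $\mathfrak o_k=\mathfrak o/\mathfrak p^k$ and $\mathfrak O_k=\mathfrak O/\mathfrak P^k$, and assume $k>1$. Choosing an $\mathfrak o$-basis of $\mathfrak O$, let $\mathfrak O_k$ act on itself by multiplication; this embeds $\mathfrak O_m$ in $M_n(\mathfrak o_m)$ for all $m$, and $\mathfrak O_k^\times$ in $\mathrm{GL}_n(\mathfrak o_k)$. Let $N_r=\ker(\mathrm{GL}_n(\mathfrak o_k)\to \mathrm{GL}_n(\mathfrak o_r))$ and $L=\ker(\mathfrak O_k^\times\to\mathfrak O_1^\times)$. Fix an additive character $\psi$ of $F$ that is trivial on $\mathfrak o$ but not on $\mathfrak p^{-1}$. For $r\ge k/2$ and $A\in M_n(\mathfrak o_{k-r})$ let $\psi_A$ be the character $1+\varpi^{r}B\mapsto\psi(\varpi^{r-k}\operatorname{tr}(AB))$ of $N_r$.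 All representations are complex. An irreducible representation $\rho$ of $\mathrm{GL}_n(\mathfrak o_k)$ is called strongly cuspidal if every matrix $A\in M_n(\mathfrak o_1)$ for which $\psi_A$ occurs in $\rho|_{N_{k-1}}$ is irreducible, i.e. leaves no nontrivial proper subspace of $\mathfrak o_1^n$ invariant. A character $\omega:\mathfrak O_k^\times\to\mathbb C^\times$ is called strongly primitive if the character $x\mapsto\omega(1+\varpi^{k-1}x)$ of $\mathfrak O_1$ does not factor through the trace map $\mathfrak O_1\to K$ for any field $K$ with $\mathfrak o_1\subseteq K\subsetneq\mathfrak O_1$. An element of $\mathfrak O_k^\times$ is called regular elliptic if its image in $\mathfrak O_1$ lies in no such $K$. Let $l=\lceil k/2\rceil$ and $l'=\lfloor k/2\rfloor$. Given a strongly primitive character $\omega$, let $a\in\mathfrak O_{k-l}$ be the element for which $\omega$ and $\psi_a$ agree on $N_l\cap\mathfrak O_k^\times$. Let $\tau'_\omega$ be the following representation of $N_{l'}\mathfrak O_k^\times$. If $k$ is even, it is the one-dimensional representation $xu\mapsto\psi_a(x)\omega(u)$ for $x\in N_l$, $u\in\mathfrak O_k^\times$. If $k$ is odd, it is the irreducible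 representation (unique up to isomorphism) whose restriction to $N_lL$ is isotypic for the character $xu\mapsto\psi_a(x)\omega(u)$ ($x\in N_l$, $u\in L$), whose character vanishes at all elements that are not conjugate in $N_{l'}\mathfrak O_k^\times$ to an element of $N_l\mathfrak O_k^\times$, and whose character takes the value $(-1)^{n-1}\omega(u)$ at every regular elliptic $u\in\mathfrak O_k^\times$. Let $\rho_\omega$ be the representation of $\mathrm{GL}_n(\mathfrak o_k)$ induced from $\tau'_\omega$. Then: (1) For each strongly primitive character $\omega$ of $\mathfrak O_k^\times$, the representation $\rho_\omega$ exists, and it is irreducible and strongly cuspidal. (2) Every strongly cuspidal representation of $\mathrm{GL}_n(\mathfrak o_k)$ is isomorphic to $\rho_\omega$ for some strongly primitive character $\omega$ of $\mathfrak O_k^\times$. (3) For strongly primitive characters $\omega,\omega'$ of $\mathfrak O_k^\times$, $\rho_\omega\cong\rho_{\omega'}$ if and only if $\omega'=\omega\circ\gamma$ for some $\gamma\in\mathrm{Gal}(E/F)$. -/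

import Mathlib

universe u v w w'

open ValuativeRel

noncomputable section

namespace UnramifiedGL

section Rings

variable (F : Type u) [Field F] [ValuativeRel F] [TopologicalSpace F]
  [IsNonarchimedeanLocalField F]
variable (E : Type v) [Field E] [Algebra F E]

/-- The ring `𝔒`: the integral closure in `E` of the ring of integers `𝔬 = 𝒪[F]` of `F`. -/
abbrev OE : Type v := integralClosure 𝒪[F] E

/-- The ideal `𝔓 = 𝔭𝔒` of `𝔒`; it is the maximal ideal of `𝔒` when `E / F` is unramified. -/
abbrev PE : Ideal (OE F E) := (𝓂[F]).map (algebraMap 𝒪[F] (OE F E))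

/-- `E / F` is unramified: `𝔭𝔒` is the maximal ideal of `𝔒`, i.e. the ramification index is `1`.
The residue fields are finite, so the residue extension is automatically separable. -/
class IsUnramifiedExtension : Prop where
  isMaximal : (PE F E).IsMaximal

instance [IsUnramifiedExtension F E] : (PE F E).IsMaximal := IsUnramifiedExtension.isMaximal

/-- `𝔬_k = 𝔬 / 𝔭 ^ k`. -/
abbrev oQuot (k : ℕ) : Type u := 𝒪[F] ⧸ 𝓂[F] ^ k

/-- `𝔒_k = 𝔒 / 𝔓 ^ k`. -/
abbrev OQuot (k : ℕ) : Type v := OE F E ⧸ PE F E ^ k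

/-- The residue field `𝔒_1 = 𝔒 / 𝔓` of `E`. (The residue field `𝔬_1` of `F` is `𝓀[F]`.) -/
abbrev OResidue : Type v := OE F E ⧸ PE F E

instance [IsUnramifiedExtension F E] : Field (OResidue F E) := Ideal.Quotient.field (PE F E)

/-- The natural map `𝔬 / 𝔭 → 𝔒 / 𝔓`. -/
instance : Algebra (𝒪[F] ⧸ 𝓂[F]) (OE F E ⧸ PE F E) :=
  Ideal.Quotient.algebraQuotientOfLEComap Ideal.le_comap_map

/-- The residue field of `E` as an extension of the residue field of `F`. -/
instance : Algebra 𝓀[F] (OResidue F E) :=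
  inferInstanceAs (Algebra (𝒪[F] ⧸ 𝓂[F]) (OE F E ⧸ PE F E))

variable {F E} in
lemma pe_pow_le {k : ℕ} (hk : 2 ≤ k) : PE F E ^ k ≤ PE F E :=
  Ideal.pow_le_self (by omega)

/-- Reduction `𝔒_k → 𝔒_1`. -/
def redOne {k : ℕ} (hk : 2 ≤ k) : OQuot F E k →+* OResidue F E :=
  Ideal.Quotient.factor (pe_pow_le hk)

variable {F E}

lemma pe_pow_le_comap_gal [FiniteDimensional F E] (k : ℕ) (γ : E ≃ₐ[F] E) :
    PE F E ^ k ≤ (PE F E ^ k).comap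
      (galRestrict 𝒪[F] F E (OE F E) γ : OE F E ≃ₐ[𝒪[F]] OE F E).toRingEquiv.toRingHom := by
  rw [← Ideal.map_pow, Ideal.map_le_iff_le_comap]
  intro x hx
  rw [Ideal.mem_comap, Ideal.mem_comap]
  have h : (galRestrict 𝒪[F] F E (OE F E) γ : OE F E ≃ₐ[𝒪[F]] OE F E).toRingEquiv.toRingHom
      (algebraMap 𝒪[F] (OE F E) x) = algebraMap 𝒪[F] (OE F E) x :=
    (galRestrict 𝒪[F] F E (OE F E) γ).commutes x
  rw [h]
  exact Ideal.mem_map_of_mem _ hx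

/-- The action of `γ ∈ Gal(E/F)` on `𝔒_k^×`. -/
def galUnits [FiniteDimensional F E] (k : ℕ) (γ : E ≃ₐ[F] E) :
    (OQuot F E k)ˣ →* (OQuot F E k)ˣ :=
  Units.map (Ideal.quotientMap (PE F E ^ k)
    (galRestrict 𝒪[F] F E (OE F E) γ : OE F E ≃ₐ[𝒪[F]] OE F E).toRingEquiv.toRingHom
    (pe_pow_le_comap_gal k γ) : OQuot F E k →* OQuot F E k)

/-- The character `ω` of `𝔒_k^×` is strongly primitive (`k > 1`): for no proper intermediate field
`𝔬_1 ⊆ K ⊊ 𝔒_1` does the character `x ↦ ω (1 + ϖ ^ (k - 1) x)` of `𝔒_1` (where `ϖ` is a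
uniformizer of `F`) factor through the trace map `𝔒_1 → K`. -/
def IsStronglyPrimitive [IsUnramifiedExtension F E] (ϖ : 𝒪[F]) {k : ℕ}
    (ω : (OQuot F E k)ˣ →* ℂˣ) : Prop :=
  ∀ K : IntermediateField 𝓀[F] (OResidue F E), K ≠ ⊤ →
    ¬ ∃ χ : AddChar K ℂ, ∀ (x : OE F E) (y : (OQuot F E k)ˣ),
      (y : OQuot F E k) =
        Ideal.Quotient.mk (PE F E ^ k) (1 + algebraMap 𝒪[F] (OE F E) ϖ ^ (k - 1) * x) →
      (ω y : ℂ) = χ (Algebra.trace K (OResidue F E) (Ideal.Quotient.mk (PE F E) x))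

/-- `y ∈ 𝔒_k^×` is regular elliptic: its image in `𝔒_1` lies in no proper subfield
containing `𝔬_1`. -/
def IsRegularElliptic [IsUnramifiedExtension F E] {k : ℕ} (hk : 2 ≤ k) (y : (OQuot F E k)ˣ) :
    Prop :=
  ∀ K : IntermediateField 𝓀[F] (OResidue F E), K ≠ ⊤ → redOne F E hk (y : OQuot F E k) ∉ K

/-- `L`, the kernel of `𝔒_k^× → 𝔒_1^×`. -/
def kerL {k : ℕ} (hk : 2 ≤ k) : Subgroup (OQuot F E k)ˣ :=
  (Units.map (redOne F E hk : OQuot F E k →* OResidue F E)).ker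

end Rings

section Groups

variable {F : Type u} [Field F] [ValuativeRel F] [TopologicalSpace F]
  [IsNonarchimedeanLocalField F]
variable {E : Type v} [Field E] [Algebra F E]
variable {n : ℕ}

/-- The group `GL_n(𝔬_k)`. -/
abbrev GLk (F : Type u) [Field F] [ValuativeRel F] [TopologicalSpace F]
    [IsNonarchimedeanLocalField F] (n k : ℕ) : Type u :=
  Matrix.GeneralLinearGroup (Fin n) (oQuot F k)

/-- `N_r`, the kernel of `GL_n(𝔬_k) → GL_n(𝔬_r)`, for `r ≤ k`. -/
def congrN (n : ℕ) {r k : ℕ} (h : r ≤ k) : Subgroup (GLk F n k) :=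
  (Matrix.GeneralLinearGroup.map (n := Fin n) (Ideal.Quotient.factorPow 𝓂[F] h)).ker

/-- The matrix `1 + ϖ ^ r B` over `𝔬_k`, where `B` is a matrix over `𝔬`. -/
def oneAdd (ϖ : 𝒪[F]) (k r : ℕ) (B : Matrix (Fin n) (Fin n) 𝒪[F]) :
    Matrix (Fin n) (Fin n) (oQuot F k) :=
  (1 + ϖ ^ r • B).map (Ideal.Quotient.mk (𝓂[F] ^ k))

/-- The number `ψ_A(B) = ψ(ϖ ^ (-m) tr(A B))` for matrices `A`, `B` over `𝔬`. When `ψ` is trivial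
on `𝔬` it only depends on the classes of `A` and `B` in `M_n(𝔬_m)`. -/
def psiMat (ψ : AddChar F ℂ) (ϖ : 𝒪[F]) (m : ℕ) (A B : Matrix (Fin n) (Fin n) 𝒪[F]) : ℂ :=
  ψ (((A * B).trace : F) / (ϖ : F) ^ m)

/-- The ring homomorphism `𝔒_k → M_n(𝔬_k)` giving the action of `𝔒_k` on itself by
multiplication, in terms of the basis `b`. -/
def embMat (b : Module.Basis (Fin n) 𝒪[F] (OE F E)) (k : ℕ) :
    OQuot F E k →+* Matrix (Fin n) (Fin n) (oQuot F k) :=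
  Ideal.Quotient.lift (PE F E ^ k)
    ((Ideal.Quotient.mk (𝓂[F] ^ k)).mapMatrix.comp (Algebra.leftMulMatrix b).toRingHom) (by
      suffices h : PE F E ^ k ≤ RingHom.ker ((Ideal.Quotient.mk (𝓂[F] ^ k)).mapMatrix.comp
          (Algebra.leftMulMatrix b).toRingHom) from fun a ha => h ha
      rw [← Ideal.map_pow, Ideal.map_le_iff_le_comap]
      intro x hx
      rw [Ideal.mem_comap, RingHom.mem_ker]
      have h : (Algebra.leftMulMatrix b).toRingHom (algebraMap 𝒪[F] (OE F E) x)
          = algebraMap 𝒪[F] (Matrix (Fin n) (Fin n) 𝒪[F]) x :=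
        (Algebra.leftMulMatrix b).commutes x
      rw [RingHom.comp_apply, h]
      ext i j
      by_cases hij : i = j <;>
        simp [Matrix.algebraMap_matrix_apply, hij, Ideal.Quotient.eq_zero_iff_mem.mpr hx])

/-- The resulting embedding `𝔒_k^× → GL_n(𝔬_k)`. -/
def emb (b : Module.Basis (Fin n) 𝒪[F] (OE F E)) (k : ℕ) : (OQuot F E k)ˣ →* GLk F n k :=
  Units.map (embMat b k : OQuot F E k →* Matrix (Fin n) (Fin n) (oQuot F k))

/-- The subgroup `N_r 𝔒_k^×` of `GL_n(𝔬_k)`. -/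
def groupNO (b : Module.Basis (Fin n) 𝒪[F] (OE F E)) {r k : ℕ} (h : r ≤ k) :
    Subgroup (GLk F n k) :=
  congrN n h ⊔ (emb b k).range

/-- The subgroup `N_{l'} 𝔒_k^×`, where `l' = ⌊k/2⌋`. -/
def groupJ (b : Module.Basis (Fin n) 𝒪[F] (OE F E)) (k : ℕ) : Subgroup (GLk F n k) :=
  groupNO b (Nat.div_le_self k 2)

/-- With `l = ⌈k/2⌉` and `l' = k - l = ⌊k/2⌋`: the restriction of `ω` to
`N_l ∩ 𝔒_k^× = 1 + ϖ ^ l 𝔒_k` is the character `1 + ϖ ^ l x ↦ ψ(ϖ ^ (-l') tr(a x))`,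
with `a` and `x` acting on `𝔒` by multiplication; `a` matters only modulo `𝔓 ^ l'`. -/
def RestrictsTo (b : Module.Basis (Fin n) 𝒪[F] (OE F E)) (ψ : AddChar F ℂ) (ϖ : 𝒪[F]) {k : ℕ}
    (ω : (OQuot F E k)ˣ →* ℂˣ) (a : OE F E) : Prop :=
  ∀ (x : OE F E) (y : (OQuot F E k)ˣ),
    (y : OQuot F E k) =
      Ideal.Quotient.mk (PE F E ^ k) (1 + algebraMap 𝒪[F] (OE F E) ϖ ^ (k - k / 2) * x) →
    (ω y : ℂ) = psiMat ψ ϖ (k / 2) (Algebra.leftMulMatrix b a) (Algebra.leftMulMatrix b x)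

/-- Every `x y`, with `x = 1 + ϖ ^ l B ∈ N_l` and `y` in the subgroup `T` of `𝔒_k^×`, acts by the
scalar `ψ_a(B) ω(y)`. -/
def ActsByScalars (b : Module.Basis (Fin n) 𝒪[F] (OE F E)) (ψ : AddChar F ℂ) (ϖ : 𝒪[F]) {k : ℕ}
    (ω : (OQuot F E k)ˣ →* ℂˣ) (a : OE F E) (T : Subgroup (OQuot F E k)ˣ)
    {M : Type w} [AddCommGroup M] [Module ℂ M] (τ : Representation ℂ (groupJ b k) M) : Prop :=
  ∀ (B : Matrix (Fin n) (Fin n) 𝒪[F]) (x : GLk F n k) (y : (OQuot F E k)ˣ) (g : groupJ b k),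
    (x : Matrix (Fin n) (Fin n) (oQuot F k)) = oneAdd ϖ k (k - k / 2) B → y ∈ T →
    (g : GLk F n k) = x * emb b k y →
    ∀ v : M, τ g v = (psiMat ψ ϖ (k / 2) (Algebra.leftMulMatrix b a) B * (ω y : ℂ)) • v

/-- `τ` is the representation `τ'_ω` of `N_{l'} 𝔒_k^×` attached to `ω` (unique up to isomorphism).
* If `k` is even, `τ` is the one-dimensional representation `x y ↦ ψ_a(x) ω(y)`, for `x ∈ N_l` and
  `y ∈ 𝔒_k^×` (here `l = l'`).
* If `k` is odd, `τ` is irreducible, its restriction to `N_l L` is isotypic for the character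
  `x y ↦ ψ_a(x) ω(y)`, for `x ∈ N_l` and `y ∈ L`, its character vanishes on the elements that are
  not conjugate in `N_{l'} 𝔒_k^×` to an element of `N_l 𝔒_k^×`, and is `(-1) ^ (n - 1) ω(y)` at
  every regular elliptic `y ∈ 𝔒_k^×`. -/
def IsTau [IsUnramifiedExtension F E] (b : Module.Basis (Fin n) 𝒪[F] (OE F E)) (ψ : AddChar F ℂ)
    (ϖ : 𝒪[F]) {k : ℕ} (hk : 2 ≤ k) (ω : (OQuot F E k)ˣ →* ℂˣ)
    {M : Type w} [AddCommGroup M] [Module ℂ M] (τ : Representation ℂ (groupJ b k) M) : Prop :=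
  ∃ a : OE F E, RestrictsTo b ψ ϖ ω a ∧
    (Even k → Module.finrank ℂ M = 1 ∧ ActsByScalars b ψ ϖ ω a ⊤ τ) ∧
    (Odd k → τ.IsIrreducible ∧ ActsByScalars b ψ ϖ ω a (kerL hk) τ ∧
      (∀ g : groupJ b k,
        (¬ ∃ h : groupJ b k, ((h * g * h⁻¹ : groupJ b k) : GLk F n k) ∈
          groupNO b (Nat.sub_le k (k / 2))) →
        LinearMap.trace ℂ M (τ g) = 0) ∧
      (∀ (y : (OQuot F E k)ˣ) (g : groupJ b k), (g : GLk F n k) = emb b k y →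
        IsRegularElliptic hk y →
        LinearMap.trace ℂ M (τ g) = (-1) ^ (n - 1) * (ω y : ℂ)))

/-- The representation of `GL_n(𝔬_k)` induced from a representation `τ` of `N_{l'} 𝔒_k^×`. For
`τ = τ'_ω` this is `ρ_ω`. -/
def rho (b : Module.Basis (Fin n) 𝒪[F] (OE F E)) {k : ℕ}
    {M : Type w} [AddCommGroup M] [Module ℂ M] (τ : Representation ℂ (groupJ b k) M) :
    Representation ℂ (GLk F n k) (Representation.IndV (groupJ b k).subtype τ) :=
  Representation.ind (groupJ b k).subtype τ

/-- The similarity class `Ω_1(ρ) ⊆ M_n(𝔬_1)`: the matrices `A` such that the character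
`1 + ϖ ^ (k - 1) B ↦ ψ_A(B) = ψ(ϖ⁻¹ tr(A B))` occurs in the restriction of `ρ` to `N_{k-1}`. -/
def omegaOne (ψ : AddChar F ℂ) (ϖ : 𝒪[F]) {k : ℕ}
    {V : Type w} [AddCommGroup V] [Module ℂ V] (ρ : Representation ℂ (GLk F n k) V) :
    Set (Matrix (Fin n) (Fin n) 𝓀[F]) :=
  {A | ∃ A' : Matrix (Fin n) (Fin n) 𝒪[F], A'.map (IsLocalRing.residue 𝒪[F]) = A ∧
    ∃ v : V, v ≠ 0 ∧ ∀ (B : Matrix (Fin n) (Fin n) 𝒪[F]) (x : GLk F n k),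
      (x : Matrix (Fin n) (Fin n) (oQuot F k)) = oneAdd ϖ k (k - 1) B →
      ρ x v = psiMat ψ ϖ 1 A' B • v}

/-- A square matrix over a field is irreducible if it leaves no nontrivial proper subspace
invariant. -/
def IsIrreducibleMatrix {K : Type w} [Field K] (A : Matrix (Fin n) (Fin n) K) : Prop :=
  ∀ W : Submodule K (Fin n → K), (∀ x ∈ W, A.mulVec x ∈ W) → W = ⊥ ∨ W = ⊤

/-- Strong cuspidality of a representation of `GL_n(𝔬_k)`, for `k > 1`: it is irreducible, and the
matrices in `Ω_1(ρ)` are irreducible. -/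
def IsStronglyCuspidal (ψ : AddChar F ℂ) (ϖ : 𝒪[F]) {k : ℕ}
    {V : Type w} [AddCommGroup V] [Module ℂ V] (ρ : Representation ℂ (GLk F n k) V) : Prop :=
  ρ.IsIrreducible ∧ ∀ A ∈ omegaOne ψ ϖ ρ, IsIrreducibleMatrix A

end Groups

end UnramifiedGL

end

open UnramifiedGL

/-! Put `l = k - k / 2` and `l' = k / 2`. Since `2l ≥ k`, the group `N_l` is abelian. Nondegeneracy
of the trace form over the residue field, lifted one power of `ϖ` at a time, shows that its
characters are the `ψ_A` with `A` taken modulo `ϖ ^ l'` (`exists_trChar_eq`). The same duality on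
`𝔒` attaches `a` to `ω`, and `ω` is strongly primitive exactly when the residue of `a` generates the
residue field `K` of `E` (`isStronglyPrimitive_iff`), that is, when multiplication by `a` is
residually irreducible.

For such `a` the stabilizer of `ψ_a` in `GL_n(𝔬_k)` is `J = N_{l'} 𝔒_k^×` (`mem_groupJ_iff`),
because a matrix commuting with `a` modulo `ϖ ^ l'` is congruent to an element of `𝔒`. Clifford
theory then matches the irreducible representations of `J` on which `N_l` acts by `ψ_a` with those
of the whole group containing `ψ_a` (`isIrreducible_ind`, `nonempty_equiv_ind_eigRep`,
`nonempty_equiv_of_ind`). A strongly cuspidal representation contains some `ψ_A` with `A` residually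
irreducible. Hensel's lemma finds a root of the characteristic polynomial of `A` in `𝔒`, and cyclic
vectors conjugate `A` to that root (`exists_conj_leftMulMatrix`). Conjugate characters come from
elements that are Galois conjugate modulo `ϖ ^ l'` (`exists_gal_of_conj`), and a Galois automorphism
of the torus is conjugation by its own matrix. Everything is thus reduced to classifying the
representations of `J` over `ψ_a` by characters `ω` (`exists_isTau`,
`exists_isTau_of_isIrreducible`, `IsTau.nonempty_equiv`, `IsTau.eq_of_equiv`).

For even `k` one has `J = N_l 𝔒_k^×`, and these representations are one-dimensional. For odd `k` the
quotient `N_{l'} / N_l` is the algebra of endomorphisms of `K` over the residue field of `F`, and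
commutators are measured by `(X, Y) ↦ φ (tr (a (XY - YX)))`. In the expansion of endomorphisms as
sums of `x σ ^ i`, with `σ` the Frobenius, degree `i` pairs only with degree `n - i`, through the
factor `a - σ ^ i a`. So the radical is the degree zero part, `N_{l'} L` is a Heisenberg group, and
`J / N_{l'} L` is the cyclic group `Kˣ`. Two irreducible representations of `J` with the same
central character are intertwined on `N_{l'} L`, hence differ by a twist; a nonzero trace at a
generator of `Kˣ` pins the twist down.

The trace is computed on an isotropic subspace, spanned by the degrees `0 < i < n / 2`, whose
orthogonal complement has the degrees `0 ≤ i ≤ n / 2`. Take an irreducible representation containing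
the common extension of `ψ_a` and `ω` to the isotropic part. At an elliptic `u` its trace equals the
trace on the eigenspace of the isotropic part, because conjugation by `u` has no fixed vectors in
nonzero degrees. For odd `n` that eigenspace is a line on which `u` acts by `ω u`. For even `n` the
middle degree survives and the eigenspace has dimension `Q` with `Q ^ 2 = #K`. There a lift of a
generator of `Kˣ` has scalar `(Q + 1)`-st power, and its other powers have traces of modulus one
(`IsHeisenberg.trace_mul_trace`). This forces all admissible eigenvalues but one to occur, each once
(`exists_trace_pow_eq_neg`), so the traces are `-ω u` up to a character of `Kˣ`, which a twist
removes. -/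

noncomputable section

namespace UnramifiedGL

/-! ### Clifford theory for a character of a subgroup and its stabilizer. -/

section RepTheory

attribute [local instance] Fintype.ofFinite

variable {G : Type*} [Group G] {V : Type*} [AddCommGroup V] [Module ℂ V]
  {V' : Type*} [AddCommGroup V'] [Module ℂ V']

lemma isIrreducible_iff (ρ : Representation ℂ G V) :
    ρ.IsIrreducible ↔ Nontrivial V ∧ ∀ W : Submodule ℂ V, (∀ g, ∀ w ∈ W, ρ g w ∈ W) →
      W = ⊥ ∨ W = ⊤ := by
  constructor
  · intro h
    refine ⟨?_, fun W hW => ?_⟩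
    · obtain ⟨a, b, hab⟩ := h.toNontrivial
      by_contra hV
      rw [not_nontrivial_iff_subsingleton] at hV
      apply hab
      apply SetLike.ext
      intro x
      rw [Subsingleton.elim x 0]
      exact ⟨fun _ => b.toSubmodule.zero_mem, fun _ => a.toSubmodule.zero_mem⟩
    · rcases h.eq_bot_or_eq_top (⟨W, fun g w hw => hW g w hw⟩ : Subrepresentation ρ) with h1 | h1
      · left
        exact congrArg Subrepresentation.toSubmodule h1
      · right
        exact congrArg Subrepresentation.toSubmodule h1
  · rintro ⟨hV, h⟩
    have : Nontrivial (Subrepresentation ρ) := by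
      refine ⟨⊥, ⊤, fun hbt => ?_⟩
      have := congrArg Subrepresentation.toSubmodule hbt
      exact bot_ne_top (α := Submodule ℂ V) this
    refine ⟨fun W => ?_⟩
    rcases h W.toSubmodule (fun g w hw => W.apply_mem_toSubmodule g hw) with h1 | h1
    · left
      exact Subrepresentation.toSubmodule_injective h1
    · right
      exact Subrepresentation.toSubmodule_injective h1

lemma eq_top_of_isIrreducible {ρ : Representation ℂ G V} (hρ : ρ.IsIrreducible)
    (W : Submodule ℂ V) (hW : ∀ g, ∀ w ∈ W, ρ g w ∈ W) {v : V} (hv : v ∈ W) (hv0 : v ≠ 0) :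
    W = ⊤ := by
  rcases ((isIrreducible_iff ρ).1 hρ).2 W hW with h | h
  · exact absurd (by simpa [h] using hv) hv0
  · exact h

lemma finiteDimensional_of_isIrreducible [Finite G] {ρ : Representation ℂ G V}
    (hρ : ρ.IsIrreducible) : FiniteDimensional ℂ V := by
  have := ((isIrreducible_iff ρ).1 hρ).1
  obtain ⟨v, hv⟩ := exists_ne (0 : V)
  have htop : Submodule.span ℂ (Set.range fun g => ρ g v) = ⊤ := by
    refine eq_top_of_isIrreducible hρ _ (fun g w hw => ?_)
      (Submodule.subset_span ⟨1, by simp⟩) hv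
    induction hw using Submodule.span_induction with
    | mem x hx =>
      obtain ⟨h, rfl⟩ := hx
      exact Submodule.subset_span ⟨g * h, by simp⟩
    | zero => simp
    | add x y _ _ hx hy => simpa using add_mem hx hy
    | smul c x _ hx => simpa using Submodule.smul_mem _ c hx
  exact ⟨htop ▸ Submodule.fg_span (Set.finite_range _)⟩

/-- Schur's lemma: an eigenspace of `T` is invariant, hence the whole space. -/
lemma exists_smul_of_commute [Finite G] {ρ : Representation ℂ G V} (hρ : ρ.IsIrreducible)
    (T : V →ₗ[ℂ] V) (hT : ∀ g v, T (ρ g v) = ρ g (T v)) : ∃ c : ℂ, ∀ v, T v = c • v := by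
  have := finiteDimensional_of_isIrreducible hρ
  have := ((isIrreducible_iff ρ).1 hρ).1
  obtain ⟨c, hc⟩ := Module.End.exists_eigenvalue T
  obtain ⟨v, hv⟩ := hc.exists_hasEigenvector
  refine ⟨c, fun w => ?_⟩
  have htop := eq_top_of_isIrreducible hρ (Module.End.eigenspace T c) (fun g w hw => by
    rw [Module.End.mem_eigenspace_iff] at hw ⊢
    rw [hT, hw, map_smul]) hv.1 hv.2
  exact Module.End.mem_eigenspace_iff.1 (htop ▸ Submodule.mem_top)

lemma nonempty_equiv_of_ne_zero {ρ : Representation ℂ G V} {ρ' : Representation ℂ G V'}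
    (hρ : ρ.IsIrreducible) (hρ' : ρ'.IsIrreducible) (f : V →ₗ[ℂ] V')
    (hf : ∀ g v, f (ρ g v) = ρ' g (f v)) (hf0 : f ≠ 0) : Nonempty (ρ.Equiv ρ') := by
  have hker : LinearMap.ker f = ⊥ :=
    (((isIrreducible_iff ρ).1 hρ).2 (LinearMap.ker f) (fun g w hw => by
      rw [LinearMap.mem_ker] at hw ⊢
      rw [hf, hw, map_zero])).resolve_right fun h => hf0 (LinearMap.ker_eq_top.1 h)
  have hran : LinearMap.range f = ⊤ :=
    (((isIrreducible_iff ρ').1 hρ').2 (LinearMap.range f) (by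
      rintro g _ ⟨w, rfl⟩
      exact ⟨ρ g w, hf g w⟩)).resolve_left fun h => hf0 (LinearMap.range_eq_bot.1 h)
  exact ⟨Representation.Equiv.mk
    (LinearEquiv.ofBijective f ⟨LinearMap.ker_eq_bot.1 hker, LinearMap.range_eq_top.1 hran⟩)
    fun g => LinearMap.ext fun v => hf g v⟩

/-- `χ` restricts to a character of the subgroup `N`. -/
structure IsCharOn (N : Subgroup G) (χ : G → ℂ) : Prop where
  one : χ 1 = 1
  mul : ∀ x ∈ N, ∀ y ∈ N, χ (x * y) = χ x * χ y

lemma IsCharOn.ne_zero {N : Subgroup G} {χ : G → ℂ} (hχ : IsCharOn N χ) {x : G} (hx : x ∈ N) :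
    χ x ≠ 0 := by
  intro h
  have := hχ.mul x hx x⁻¹ (inv_mem hx)
  rw [mul_inv_cancel, hχ.one, h, zero_mul] at this
  exact one_ne_zero this

lemma IsCharOn.inv {N : Subgroup G} {χ : G → ℂ} (hχ : IsCharOn N χ) {x : G} (hx : x ∈ N) :
    χ x⁻¹ = (χ x)⁻¹ := by
  have := hχ.mul x hx x⁻¹ (inv_mem hx)
  rw [mul_inv_cancel, hχ.one] at this
  exact (inv_eq_of_mul_eq_one_right this.symm).symm

lemma IsCharOn.comap {G' : Type*} [Group G'] {N : Subgroup G} {χ : G → ℂ} (hχ : IsCharOn N χ)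
    (f : G' →* G) : IsCharOn (N.comap f) (fun x => χ (f x)) :=
  ⟨by simp [hχ.one], fun x hx y hy => by simp [hχ.mul _ hx _ hy]⟩

/-- The vectors on which the subgroup `N` acts by `χ`. -/
def eig (ρ : Representation ℂ G V) (N : Subgroup G) (χ : G → ℂ) : Submodule ℂ V where
  carrier := {v | ∀ x ∈ N, ρ x v = χ x • v}
  add_mem' {a b} ha hb x hx := by rw [map_add, ha x hx, hb x hx, smul_add]
  zero_mem' x _ := by simp
  smul_mem' c v hv x hx := by rw [map_smul, hv x hx, smul_comm]

/-- `g` normalizes `N` and fixes the character `χ` of `N`. -/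
def Fixes (N : Subgroup G) (χ : G → ℂ) (g : G) : Prop :=
  ∀ x ∈ N, g⁻¹ * x * g ∈ N ∧ χ (g⁻¹ * x * g) = χ x

lemma Fixes.apply_mem_eig {ρ : Representation ℂ G V} {N : Subgroup G} {χ : G → ℂ} {g : G}
    (hg : Fixes N χ g) {v : V} (hv : v ∈ eig ρ N χ) : ρ g v ∈ eig ρ N χ := by
  intro x hx
  obtain ⟨h1, h2⟩ := hg x hx
  have h : x * g = g * (g⁻¹ * x * g) := by group
  rw [← Module.End.mul_apply, ← map_mul, h, map_mul, Module.End.mul_apply, hv _ h1, map_smul, h2]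

/-- A subgroup fixing `χ` acts on the eigenspace of `χ`. -/
def eigRep (ρ : Representation ℂ G V) {N : Subgroup G} {χ : G → ℂ} (S : Subgroup G)
    (hS : ∀ s ∈ S, Fixes N χ s) : Representation ℂ S (eig ρ N χ) where
  toFun s := (ρ s).restrict fun _ hv => (hS s s.2).apply_mem_eig hv
  map_one' := by ext; simp
  map_mul' a b := by ext; simp

@[simp] lemma coe_eigRep (ρ : Representation ℂ G V) {N : Subgroup G} {χ : G → ℂ} (S : Subgroup G)
    (hS : ∀ s ∈ S, Fixes N χ s) (s : S) (v : eig ρ N χ) :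
    (eigRep ρ S hS s v : V) = ρ s v := rfl

lemma eig_eq_top {ρ : Representation ℂ G V} (hρ : ρ.IsIrreducible) {N : Subgroup G} {χ : G → ℂ}
    (hfix : ∀ g, Fixes N χ g) {v : V} (hv : v ∈ eig ρ N χ) (hv0 : v ≠ 0) : eig ρ N χ = ⊤ :=
  eq_top_of_isIrreducible hρ _ (fun g _ hw => (hfix g).apply_mem_eig hw) hv hv0

section Proj

variable [Finite G] (ρ : Representation ℂ G V) {N : Subgroup G} {χ : G → ℂ}

/-- The projection onto the eigenspace of `χ`. -/
def eigProj (ρ : Representation ℂ G V) (N : Subgroup G) (χ : G → ℂ) : V →ₗ[ℂ] V :=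
  (Nat.card N : ℂ)⁻¹ • ∑ x : N, (χ x)⁻¹ • ρ x

lemma eigProj_apply (v : V) :
    eigProj ρ N χ v = (Nat.card N : ℂ)⁻¹ • ∑ x : N, (χ x)⁻¹ • ρ x v := by
  simp [eigProj, LinearMap.sum_apply]

lemma eigProj_of_mem (hχ : IsCharOn N χ) {v : V} (hv : v ∈ eig ρ N χ) :
    eigProj ρ N χ v = v := by
  rw [eigProj_apply]
  have : ∀ x : N, (χ x)⁻¹ • ρ x v = v := fun x => by
    rw [hv x x.2, smul_smul, inv_mul_cancel₀ (hχ.ne_zero x.2), one_smul]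
  simp only [this, Finset.sum_const, Finset.card_univ, Fintype.card_eq_nat_card]
  rw [← Nat.cast_smul_eq_nsmul ℂ, smul_smul, inv_mul_cancel₀, one_smul]
  exact_mod_cast Nat.card_pos.ne'

lemma eigProj_mem (hχ : IsCharOn N χ) (v : V) : eigProj ρ N χ v ∈ eig ρ N χ := by
  intro y hy
  rw [eigProj_apply, map_smul, map_sum, smul_comm (χ y)]
  refine congrArg _ ?_
  rw [Finset.smul_sum]
  refine Fintype.sum_equiv (Equiv.mulLeft (⟨y, hy⟩ : N)) _ _ fun x => ?_
  simp only [map_smul, Equiv.coe_mulLeft, Subgroup.coe_mul, map_mul, Module.End.mul_apply, smul_smul]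
  congr 1
  rw [hχ.mul y hy x x.2, mul_inv, mul_inv_cancel_left₀ (hχ.ne_zero hy)]

lemma eigProj_apply_apply (hχ : IsCharOn N χ) {y : G} (hy : y ∈ N) (v : V) :
    eigProj ρ N χ (ρ y v) = χ y • eigProj ρ N χ v := by
  rw [eigProj_apply, eigProj_apply, smul_comm (χ y)]
  refine congrArg _ ?_
  rw [Finset.smul_sum]
  refine Fintype.sum_equiv (Equiv.mulRight (⟨y, hy⟩ : N)) _ _ fun x => ?_
  simp only [Equiv.coe_mulRight, Subgroup.coe_mul, map_mul, Module.End.mul_apply, smul_smul]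
  congr 1
  rw [hχ.mul x x.2 y hy, mul_inv]
  field_simp [hχ.ne_zero hy]

lemma eigProj_apply_eq_zero (hχ : IsCharOn N χ) {v : V} {x : G} {c : ℂ} (hx : x ∈ N)
    (hv : ρ x v = c • v) (hc : c ≠ χ x) : eigProj ρ N χ v = 0 := by
  have := eigProj_apply_apply ρ hχ hx v
  rw [hv, map_smul, ← sub_eq_zero, ← sub_smul, smul_eq_zero, sub_eq_zero] at this
  exact this.resolve_left hc

/-- `g` moves the character `χ` of `N` to a different one. -/
def Moves (N : Subgroup G) (χ : G → ℂ) (g : G) : Prop :=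
  ∃ x ∈ N, g⁻¹ * x * g ∈ N ∧ χ (g⁻¹ * x * g) ≠ χ x

lemma Moves.eigProj_eq_zero {ρ : Representation ℂ G V} (hχ : IsCharOn N χ) {g : G}
    (hg : Moves N χ g) {v : V} (hv : v ∈ eig ρ N χ) : eigProj ρ N χ (ρ g v) = 0 := by
  obtain ⟨x, hx, h1, h2⟩ := hg
  refine eigProj_apply_eq_zero ρ hχ hx (c := χ (g⁻¹ * x * g)) ?_ h2
  have h : x * g = g * (g⁻¹ * x * g) := by group
  rw [← Module.End.mul_apply, ← map_mul, h, map_mul, Module.End.mul_apply, hv _ h1, map_smul]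

/-- Clifford theory: the eigenspace of `χ` in an irreducible representation is irreducible under
the stabilizer of `χ`. -/
lemma isIrreducible_eigRep {ρ : Representation ℂ G V} (hρ : ρ.IsIrreducible) (hχ : IsCharOn N χ)
    (S : Subgroup G) (hS : ∀ s ∈ S, Fixes N χ s) (hmove : ∀ g ∉ S, Moves N χ g)
    (hne : eig ρ N χ ≠ ⊥) : (eigRep ρ S hS).IsIrreducible := by
  rw [isIrreducible_iff]
  refine ⟨Submodule.nontrivial_iff_ne_bot.2 hne, fun W hW => ?_⟩
  by_cases hW0 : W = ⊥
  · exact Or.inl hW0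
  right
  obtain ⟨w, hwW, hw0⟩ := Submodule.exists_mem_ne_zero_of_ne_bot hW0
  -- The translates of `W` by the whole group span `V`.
  have htop := eq_top_of_isIrreducible hρ
    (Submodule.span ℂ {y | ∃ g, ∃ x ∈ W, y = ρ g (x : V)}) (fun g y hy => by
      induction hy using Submodule.span_induction with
      | mem x hx =>
        obtain ⟨h, x, hx, rfl⟩ := hx
        exact Submodule.subset_span ⟨g * h, x, hx, by simp⟩
      | zero => simp
      | add x y _ _ hx hy => simpa using add_mem hx hy
      | smul c x _ hx => simpa using Submodule.smul_mem _ c hx)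
    (v := (w : V)) (Submodule.subset_span ⟨1, w, hwW, by simp⟩) (by simpa using hw0)
  -- The projector keeps the translates by `S`, which stay in `W`, and kills all others; so its
  -- image, the full eigenspace, lies in `W`.
  have key : ∀ y : V, eigProj ρ N χ y ∈ W.map (eig ρ N χ).subtype := fun y => by
    have hy : y ∈ Submodule.span ℂ {y | ∃ g, ∃ x ∈ W, y = ρ g (x : V)} := htop ▸ Submodule.mem_top
    induction hy using Submodule.span_induction with
    | mem x hx =>
      obtain ⟨h, x, hx, rfl⟩ := hx
      by_cases hh : h ∈ S
      · rw [eigProj_of_mem ρ hχ ((hS h hh).apply_mem_eig x.2)]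
        exact ⟨eigRep ρ S hS ⟨h, hh⟩ x, hW _ _ hx, rfl⟩
      · rw [(hmove h hh).eigProj_eq_zero hχ x.2]
        exact zero_mem _
    | zero => simp
    | add x y _ _ hx hy => simpa using add_mem hx hy
    | smul c x _ hx => simpa using Submodule.smul_mem _ c hx
  rw [eq_top_iff]
  rintro ⟨y, hy⟩ -
  have := key y
  rw [eigProj_of_mem ρ hχ hy] at this
  obtain ⟨z, hz, hzy⟩ := this
  rwa [show (⟨y, hy⟩ : eig ρ N χ) = z from Subtype.ext hzy.symm]

end Proj

section Ind

variable {S : Subgroup G} {M : Type*} [AddCommGroup M] [Module ℂ M]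
  (τ : Representation ℂ S M)

/-- The canonical map from a representation to the induced one. -/
def toInd : M →ₗ[ℂ] Representation.IndV S.subtype τ := Representation.IndV.mk S.subtype τ 1

lemma ind_toInd (g : G) (m : M) :
    Representation.ind S.subtype τ g (toInd τ m) = Representation.IndV.mk S.subtype τ g⁻¹ m := by
  rw [toInd, Representation.ind_mk, one_mul]

lemma indV_mk_mul (s : S) (g : G) (m : M) :
    Representation.IndV.mk S.subtype τ (s * g) (τ s m) = Representation.IndV.mk S.subtype τ g m := by
  have := Representation.Coinvariants.mk_self_apply
    (Representation.tprod ((Representation.leftRegular ℂ G).comp S.subtype) τ) s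
    (TensorProduct.tmul ℂ (MonoidAlgebra.single g 1) m)
  simpa using this

lemma toInd_apply (s : S) (m : M) :
    toInd τ (τ s m) = Representation.ind S.subtype τ s (toInd τ m) := by
  rw [ind_toInd, ← indV_mk_mul τ s]
  simp [toInd]

lemma indV_induction {p : Representation.IndV S.subtype τ → Prop} (h0 : p 0)
    (hadd : ∀ x y, p x → p y → p (x + y))
    (hind : ∀ g m, p (Representation.ind S.subtype τ g (toInd τ m))) (x) : p x := by
  obtain ⟨x, rfl⟩ := Representation.Coinvariants.mk_surjective _ x
  induction x using TensorProduct.induction_on with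
  | zero => simpa using h0
  | add x y hx hy => simpa using hadd _ _ hx hy
  | tmul f m =>
    induction f using MonoidAlgebra.induction_linear with
    | zero => simpa using h0
    | add x y hx hy => simpa [TensorProduct.add_tmul] using hadd _ _ hx hy
    | single g c =>
      have := hind g⁻¹ (c • m)
      rw [ind_toInd, inv_inv] at this
      have h2 : (MonoidAlgebra.single g c : MonoidAlgebra ℂ G) = c • MonoidAlgebra.single g 1 := by
        simp
      rw [h2, TensorProduct.smul_tmul]
      exact this

/-- The map out of an induced representation given by a compatible family of maps. -/
def indDesc (F : G → M →ₗ[ℂ] V) (hF : ∀ (s : S) g m, F (s * g) (τ s m) = F g m) :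
    Representation.IndV S.subtype τ →ₗ[ℂ] V :=
  Representation.Coinvariants.lift _
    (TensorProduct.lift <| (Finsupp.lift _ ℂ _ F) ∘ₗ
      (MonoidAlgebra.coeffLinearEquiv ℂ).toLinearMap)
    fun s ↦ by
      ext g m
      simpa using hF s g m

lemma indDesc_mk (F : G → M →ₗ[ℂ] V) (hF : ∀ (s : S) g m, F (s * g) (τ s m) = F g m) (g : G)
    (m : M) : indDesc τ F hF (Representation.IndV.mk S.subtype τ g m) = F g m := by
  simp [indDesc]

/-- A left inverse is the projection onto the component of the trivial coset of `S`. -/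
lemma toInd_injective : Function.Injective (toInd τ) := by
  classical
  have hF : ∀ (s : S) (g : G) (m : M), (if h : (s : G) * g ∈ S then τ (⟨s * g, h⟩ : S)⁻¹ else 0)
      (τ s m) = (if h : g ∈ S then τ (⟨g, h⟩ : S)⁻¹ else 0) m := fun s g m => by
    by_cases hg : g ∈ S
    · have : (⟨s * g, mul_mem s.2 hg⟩ : S)⁻¹ = (⟨g, hg⟩ : S)⁻¹ * s⁻¹ := by ext; simp
      rw [dif_pos hg, dif_pos (mul_mem s.2 hg), this, map_mul, Module.End.mul_apply]
      simp
    · rw [dif_neg hg, dif_neg fun h => hg ((Subgroup.mul_mem_cancel_left S s.2).1 h)]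
      simp
  refine Function.LeftInverse.injective (g := indDesc τ (fun g => if h : g ∈ S then τ (⟨g, h⟩ : S)⁻¹ else 0) hF) fun m => ?_
  rw [toInd, indDesc_mk, dif_pos (one_mem S)]
  have : (⟨1, one_mem S⟩ : S) = 1 := rfl
  simp [this]

/-- Frobenius reciprocity: the map out of an induced representation. -/
def indLift (ρ : Representation ℂ G V) (f : M →ₗ[ℂ] V)
    (hf : ∀ (s : S) m, f (τ s m) = ρ s (f m)) :
    Representation.IndV S.subtype τ →ₗ[ℂ] V :=
  indDesc τ (fun g => ρ g⁻¹ ∘ₗ f) fun s g m => by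
    simp only [LinearMap.coe_comp, Function.comp_apply, hf, mul_inv_rev, map_mul,
      Module.End.mul_apply, Representation.inv_self_apply]

lemma indLift_ind (ρ : Representation ℂ G V) (f : M →ₗ[ℂ] V)
    (hf : ∀ (s : S) m, f (τ s m) = ρ s (f m)) (g : G) (x : Representation.IndV S.subtype τ) :
    indLift τ ρ f hf (Representation.ind S.subtype τ g x) = ρ g (indLift τ ρ f hf x) := by
  induction x using indV_induction with
  | h0 => simp
  | hadd x y hx hy => rw [map_add, map_add, hx, hy, map_add, map_add]
  | hind h m =>
    rw [← Module.End.mul_apply, ← map_mul, ind_toInd, ind_toInd, indLift, indDesc_mk, indDesc_mk]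
    simp

lemma indLift_toInd (ρ : Representation ℂ G V) (f : M →ₗ[ℂ] V)
    (hf : ∀ (s : S) m, f (τ s m) = ρ s (f m)) (m : M) : indLift τ ρ f hf (toInd τ m) = f m := by
  rw [indLift, toInd, indDesc_mk]
  simp

variable [Finite G] {N : Subgroup G} {χ : G → ℂ}

omit [Finite G] in
variable {τ} in
lemma toInd_mem_eig (hN : N ≤ S) (hτ : ∀ (s : S), (s : G) ∈ N → ∀ m, τ s m = χ s • m) (m : M) :
    toInd τ m ∈ eig (Representation.ind S.subtype τ) N χ := fun x hx => by
  rw [← toInd_apply τ ⟨x, hN hx⟩, hτ _ hx, map_smul]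

variable {τ} in
/-- The eigenspace of `χ` in the induced representation is the inducing representation. -/
lemma eig_ind (hχ : IsCharOn N χ) (hmove : ∀ g ∉ S, Moves N χ g)
    (hN : N ≤ S) (hτ : ∀ (s : S), (s : G) ∈ N → ∀ m, τ s m = χ s • m) :
    eig (Representation.ind S.subtype τ) N χ = LinearMap.range (toInd τ) := by
  apply le_antisymm
  · have key : ∀ x, eigProj (Representation.ind S.subtype τ) N χ x ∈ LinearMap.range (toInd τ) := by
      intro x
      induction x using indV_induction with
      | h0 => simp
      | hadd x y hx hy => simpa using add_mem hx hy
      | hind h m =>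
        by_cases hh : h ∈ S
        · rw [← toInd_apply τ ⟨h, hh⟩, eigProj_of_mem _ hχ (toInd_mem_eig hN hτ _)]
          exact ⟨_, rfl⟩
        · rw [(hmove h hh).eigProj_eq_zero hχ (toInd_mem_eig hN hτ _)]
          exact zero_mem _
    intro x hx
    rw [← eigProj_of_mem _ hχ hx]
    exact key x
  · rintro _ ⟨m, rfl⟩
    exact toInd_mem_eig hN hτ m

variable {τ} in
-- The sum of all conjugates of the projector is the scalar `|S|`: on the translate by `h` of an
-- inducing vector, the terms with `g ∈ hS` act as the identity and the others vanish. So the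
-- projector cannot vanish on every translate of a nonzero vector. This stands in for a
-- decomposition of the induced space into cosets.
lemma exists_eigProj_ne_zero (hχ : IsCharOn N χ) (hS : ∀ s ∈ S, Fixes N χ s)
    (hmove : ∀ g ∉ S, Moves N χ g) (hN : N ≤ S)
    (hτ : ∀ (s : S), (s : G) ∈ N → ∀ m, τ s m = χ s • m) {x : Representation.IndV S.subtype τ}
    (hx : x ≠ 0) : ∃ g, eigProj (Representation.ind S.subtype τ) N χ
      (Representation.ind S.subtype τ g x) ≠ 0 := by
  classical
  by_contra! hzero
  set ρ := Representation.ind S.subtype τ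
  have key : ∀ y, ∑ g : G, ρ g (eigProj ρ N χ (ρ g⁻¹ y)) = (Nat.card S : ℂ) • y := by
    intro y
    induction y using indV_induction with
    | h0 => simp
    | hadd x y hx hy => simp [Finset.sum_add_distrib, hx, hy]
    | hind h m =>
      have : ∀ g : G, ρ g (eigProj ρ N χ (ρ g⁻¹ (ρ h (toInd τ m)))) =
          if g⁻¹ * h ∈ S then ρ h (toInd τ m) else 0 := fun g => by
        rw [← Module.End.mul_apply (ρ g⁻¹), ← map_mul]
        split_ifs with hg
        · rw [eigProj_of_mem _ hχ ((hS _ hg).apply_mem_eig (toInd_mem_eig hN hτ m)),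
            ← Module.End.mul_apply, ← map_mul, mul_inv_cancel_left]
        · rw [(hmove _ hg).eigProj_eq_zero hχ (toInd_mem_eig hN hτ m), map_zero]
      simp only [ρ] at this ⊢
      have hcard : (Finset.univ.filter fun g : G => g⁻¹ * h ∈ S).card = Nat.card S := by
        rw [← Fintype.card_eq_nat_card, ← Fintype.card_subtype]
        exact Fintype.card_congr
          { toFun := fun g => ⟨g.1⁻¹ * h, g.2⟩
            invFun := fun s => ⟨h * s⁻¹, by simp⟩
            left_inv := fun g => by ext; simp
            right_inv := fun s => by ext; simp }
      rw [Finset.sum_congr rfl fun g _ => this g, Finset.sum_ite, Finset.sum_const, hcard,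
        Finset.sum_const, smul_zero, add_zero, Nat.cast_smul_eq_nsmul ℂ]
  have := key x
  simp only [hzero, map_zero, Finset.sum_const_zero] at this
  have h0 : (Nat.card S : ℂ) ≠ 0 := by exact_mod_cast Nat.card_pos.ne'
  exact hx ((smul_eq_zero.1 this.symm).resolve_left h0)

variable {τ} in
/-- Clifford theory: inducing from the stabilizer of a character preserves irreducibility. -/
lemma isIrreducible_ind (hχ : IsCharOn N χ) (hS : ∀ s ∈ S, Fixes N χ s)
    (hmove : ∀ g ∉ S, Moves N χ g) (hN : N ≤ S)
    (hτ : ∀ (s : S), (s : G) ∈ N → ∀ m, τ s m = χ s • m) (hirr : τ.IsIrreducible) :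
    (Representation.ind S.subtype τ).IsIrreducible := by
  rw [isIrreducible_iff]
  have := ((isIrreducible_iff τ).1 hirr).1
  refine ⟨(toInd_injective τ).nontrivial, fun W hW => ?_⟩
  by_cases hW0 : W = ⊥
  · exact Or.inl hW0
  right
  obtain ⟨w, hwW, hw0⟩ := Submodule.exists_mem_ne_zero_of_ne_bot hW0
  obtain ⟨g, hg⟩ := exists_eigProj_ne_zero hχ hS hmove hN hτ hw0
  have hmem : eigProj (Representation.ind S.subtype τ) N χ (Representation.ind S.subtype τ g w) ∈ W := by
    rw [eigProj_apply]
    exact W.smul_mem _ (W.sum_mem fun x _ => W.smul_mem _ (hW _ _ (hW _ _ hwW)))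
  -- The projected vector is a nonzero element of `W` inside the copy of `τ`, so by irreducibility
  -- `W` contains that copy, and then everything it generates.
  have hr := eigProj_mem (Representation.ind S.subtype τ) hχ (Representation.ind S.subtype τ g w)
  rw [eig_ind hχ hmove hN hτ] at hr
  obtain ⟨m, hm⟩ := hr
  have htop := eq_top_of_isIrreducible hirr (W.comap (toInd τ)) (fun s m hm => by
    rw [Submodule.mem_comap, toInd_apply]
    exact hW _ _ hm) (v := m) (by rwa [Submodule.mem_comap, hm]) (by
      rintro rfl
      exact hg (by rw [← hm, map_zero]))
  rw [eq_top_iff]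
  rintro x -
  induction x using indV_induction with
  | h0 => simp
  | hadd x y hx hy => exact add_mem hx hy
  | hind h m => exact hW _ _ (show m ∈ W.comap (toInd τ) from htop ▸ Submodule.mem_top)

/-- If a character of `N` occurs in a representation induced from one which is isotypic on `N`,
then it is a conjugate of the character of the latter. -/
lemma exists_conj_of_mem_eig_ind {τ : Representation ℂ S M} {N' : Subgroup G} {χ' : G → ℂ}
    (hχ' : IsCharOn N' χ')
    (hN : ∀ g, ∀ x ∈ N', g⁻¹ * x * g ∈ N) (hNS : N ≤ S)
    (hτ : ∀ (s : S), (s : G) ∈ N → ∀ m, τ s m = χ s • m)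
    {v : Representation.IndV S.subtype τ} (hv : v ∈ eig (Representation.ind S.subtype τ) N' χ')
    (hv0 : v ≠ 0) : ∃ g, ∀ x ∈ N', χ (g⁻¹ * x * g) = χ' x := by
  by_contra! h
  apply hv0
  rw [← eigProj_of_mem _ hχ' hv]
  clear hv hv0
  induction v using indV_induction with
  | h0 => simp
  | hadd x y hx hy => rw [map_add, hx, hy, add_zero]
  | hind g m =>
    obtain ⟨x, hx, hne⟩ := h g
    refine eigProj_apply_eq_zero _ hχ' hx (c := χ (g⁻¹ * x * g)) ?_ hne
    have hc : x * g = g * (g⁻¹ * x * g) := by group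
    rw [← Module.End.mul_apply, ← map_mul, hc, map_mul, Module.End.mul_apply,
      toInd_mem_eig hNS hτ m _ (hN g x hx), map_smul]

/-- If two representations induced from the stabilizer of the same character are isomorphic, then
so are the inducing representations. -/
lemma nonempty_equiv_of_ind {M' : Type*} [AddCommGroup M'] [Module ℂ M']
    {τ : Representation ℂ S M} {τ' : Representation ℂ S M'}
    (hχ : IsCharOn N χ) (hmove : ∀ g ∉ S, Moves N χ g) (hN : N ≤ S)
    (hτ : ∀ (s : S), (s : G) ∈ N → ∀ m, τ s m = χ s • m)
    (hτ' : ∀ (s : S), (s : G) ∈ N → ∀ m, τ' s m = χ s • m)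
    (e : (Representation.ind S.subtype τ).Equiv (Representation.ind S.subtype τ')) :
    Nonempty (τ.Equiv τ') := by
  have he : ∀ g x, e (Representation.ind S.subtype τ g x) = Representation.ind S.subtype τ' g (e x) :=
    fun g x => e.toIntertwiningMap.isIntertwining _ _ g x
  -- An equivalence carries the eigenspace of `χ` to the eigenspace of `χ`, and by `eig_ind` these
  -- are the copies of `τ` and `τ'`.
  have h1 : ∀ m, ∃ m', toInd τ' m' = e (toInd τ m) := fun m => by
    have : e (toInd τ m) ∈ eig (Representation.ind S.subtype τ') N χ := fun x hx => by
      rw [← he, toInd_mem_eig hN hτ m x hx, map_smul]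
    rwa [eig_ind hχ hmove hN hτ'] at this
  have h2 : ∀ m', ∃ m, e (toInd τ m) = toInd τ' m' := fun m' => by
    have : e.symm (toInd τ' m') ∈ eig (Representation.ind S.subtype τ) N χ := fun x hx => by
      apply e.toLinearEquiv.injective
      change e _ = e _
      rw [he, map_smul, e.apply_symm_apply, toInd_mem_eig hN hτ' m' x hx]
    rw [eig_ind hχ hmove hN hτ] at this
    obtain ⟨m, hm⟩ := this
    exact ⟨m, by rw [hm, e.apply_symm_apply]⟩
  choose f hf using h1
  have hinj := toInd_injective τ'
  let F : M →ₗ[ℂ] M' :=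
    { toFun := f
      map_add' := fun a b => hinj (by simp only [map_add, hf])
      map_smul' := fun c a => hinj (by simp only [map_smul, hf, RingHom.id_apply]) }
  have hF : ∀ m, toInd τ' (F m) = e (toInd τ m) := hf
  refine ⟨Representation.Equiv.mk (LinearEquiv.ofBijective F ⟨fun a b hab => ?_, fun b => ?_⟩)
    fun g => LinearMap.ext fun m => hinj ?_⟩
  · have := congrArg (toInd τ') hab
    rw [hF, hF] at this
    exact toInd_injective τ (e.toLinearEquiv.injective this)
  · obtain ⟨m, hm⟩ := h2 b
    exact ⟨m, hinj (by rw [hF, hm])⟩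
  · change toInd τ' (F (τ g m)) = toInd τ' (τ' g (F m))
    rw [hF, toInd_apply, toInd_apply, hF, he]

/-- An irreducible representation in which the character `χ` of `N` occurs is induced from the
`χ`-eigenspace. -/
lemma nonempty_equiv_ind_eigRep {ρ : Representation ℂ G V} (hρ : ρ.IsIrreducible)
    (hχ : IsCharOn N χ) (hS : ∀ s ∈ S, Fixes N χ s) (hmove : ∀ g ∉ S, Moves N χ g) (hN : N ≤ S)
    (hne : eig ρ N χ ≠ ⊥) :
    Nonempty (ρ.Equiv (Representation.ind S.subtype (eigRep ρ S hS))) := by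
  have hirr := isIrreducible_ind hχ hS hmove hN (τ := eigRep ρ S hS)
    (fun s hs m => Subtype.ext (m.2 _ hs)) (isIrreducible_eigRep hρ hχ S hS hmove hne)
  obtain ⟨e⟩ := nonempty_equiv_of_ne_zero hirr hρ
    (indLift (eigRep ρ S hS) ρ (eig ρ N χ).subtype fun s m => rfl)
    (indLift_ind _ _ _ _) (fun h => hne (by
      rw [eq_bot_iff]
      intro v hv
      have := indLift_toInd (eigRep ρ S hS) ρ (eig ρ N χ).subtype (fun s m => rfl) ⟨v, hv⟩
      rw [h] at this
      exact this.symm))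
  exact ⟨e.symm⟩

end Ind

end RepTheory

/-! ### Representations of Heisenberg groups: uniqueness, dimension and traces. -/

section Heisenberg

attribute [local instance] Fintype.ofFinite

variable {G : Type*} [Group G] {V : Type*} [AddCommGroup V] [Module ℂ V]
  {V' : Type*} [AddCommGroup V'] [Module ℂ V']

/-- The restriction of a representation along a group homomorphism. -/
abbrev res {G' : Type*} [Group G'] (ρ : Representation ℂ G V) (f : G' →* G) :
    Representation ℂ G' V := MonoidHom.comp ρ f

lemma equiv_apply {ρ : Representation ℂ G V} {ρ' : Representation ℂ G V'} (e : ρ.Equiv ρ')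
    (g : G) (v : V) : e (ρ g v) = ρ' g (e v) :=
  e.toIntertwiningMap.isIntertwining _ _ g v

lemma isIrreducible_of_equiv {ρ : Representation ℂ G V} {ρ' : Representation ℂ G V'}
    (e : ρ.Equiv ρ') (hρ : ρ.IsIrreducible) : ρ'.IsIrreducible := by
  have hnt := ((isIrreducible_iff ρ).1 hρ).1
  rw [isIrreducible_iff]
  refine ⟨e.toLinearEquiv.injective.nontrivial, fun W hW => ?_⟩
  have hmem : ∀ v, v ∈ W.comap e.toLinearEquiv.toLinearMap ↔ e v ∈ W := fun v => Iff.rfl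
  rcases ((isIrreducible_iff ρ).1 hρ).2 (W.comap e.toLinearEquiv.toLinearMap) (fun g w hw => by
    rw [hmem] at hw ⊢
    rw [equiv_apply]
    exact hW g _ hw) with h | h
  · left
    rw [eq_bot_iff]
    intro w hw
    have : e.symm w ∈ W.comap e.toLinearEquiv.toLinearMap := by
      rwa [hmem, e.apply_symm_apply]
    rw [h, Submodule.mem_bot] at this
    rw [Submodule.mem_bot, ← e.apply_symm_apply w, this]
    exact map_zero e.toLinearEquiv
  · right
    rw [eq_top_iff]
    rintro w -
    have : e.symm w ∈ W.comap e.toLinearEquiv.toLinearMap := h ▸ Submodule.mem_top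
    rwa [hmem, e.apply_symm_apply] at this

lemma trace_of_equiv {ρ : Representation ℂ G V} {ρ' : Representation ℂ G V'}
    (e : ρ.Equiv ρ') (g : G) : LinearMap.trace ℂ V' (ρ' g) = LinearMap.trace ℂ V (ρ g) := by
  rw [← LinearMap.trace_conj' (ρ g) e.toLinearEquiv]
  congr 1
  refine LinearMap.ext fun v => ?_
  rw [LinearEquiv.conj_apply_apply]
  change _ = e (ρ g (e.symm v))
  rw [equiv_apply, e.apply_symm_apply]

lemma exists_equiv_fin (ρ : Representation ℂ G V) [FiniteDimensional ℂ V] :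
    ∃ (d : ℕ) (ρ' : Representation ℂ G (Fin d → ℂ)), Nonempty (ρ.Equiv ρ') := by
  let e : V ≃ₗ[ℂ] (Fin (Module.finrank ℂ V) → ℂ) := (Module.finBasis ℂ V).equivFun
  refine ⟨_, ⟨⟨fun g => e.conj (ρ g), ?_⟩, ?_⟩, ⟨Representation.Equiv.mk e fun g => ?_⟩⟩
  · rw [map_one]
    exact LinearEquiv.conj_id e
  · intro a b
    change e.conj (ρ (a * b)) = _
    rw [map_mul]
    exact LinearEquiv.conj_comp e _ _
  · refine LinearMap.ext fun v => ?_
    simp [LinearEquiv.conj_apply_apply]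

/-- Subspaces of a finite-dimensional space are well-founded, so a minimal nonzero invariant
subspace below `U` exists. -/
lemma exists_isIrreducible_subrepresentation (ρ : Representation ℂ G V) [FiniteDimensional ℂ V]
    {U : Submodule ℂ V} (hU : ∀ g, ∀ w ∈ U, ρ g w ∈ U) (hU0 : U ≠ ⊥) :
    ∃ (W : Submodule ℂ V) (hW : ∀ g, W ≤ W.comap (ρ g)), W ≤ U ∧ W ≠ ⊥ ∧
      (ρ.subrepresentation W hW).IsIrreducible := by
  obtain ⟨W, ⟨hWU, hW, hW0⟩, hmin⟩ := WellFounded.has_min (r := ((· < ·) : Submodule ℂ V → _ → _))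
    wellFounded_lt {W | W ≤ U ∧ (∀ g, W ≤ W.comap (ρ g)) ∧ W ≠ ⊥} ⟨U, le_rfl, hU, hU0⟩
  refine ⟨W, hW, hWU, hW0, (isIrreducible_iff _).2
    ⟨Submodule.nontrivial_iff_ne_bot.2 hW0, fun Y hY => ?_⟩⟩
  by_cases hY0 : Y = ⊥
  · exact Or.inl hY0
  right
  have h1 : Y.map W.subtype ≤ W := Submodule.map_subtype_le W Y
  have h2 : ¬ Y.map W.subtype < W := hmin _ ⟨h1.trans hWU, fun g => by
    rintro _ ⟨y, hy, rfl⟩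
    exact ⟨_, hY g y hy, rfl⟩, fun h => hY0 (by
      rw [eq_bot_iff]
      intro y hy
      have : (y : V) ∈ Y.map W.subtype := ⟨y, hy, rfl⟩
      rw [h, Submodule.mem_bot] at this
      exact Subtype.ext this)⟩
  have h3 : Y.map W.subtype = W := eq_of_le_of_not_lt h1 h2
  rw [eq_top_iff]
  rintro ⟨y, hy⟩ -
  rw [← h3] at hy
  obtain ⟨z, hz, hzy⟩ := hy
  rwa [show (⟨y, _⟩ : W) = z from Subtype.ext hzy.symm]

/-- Every character of a subgroup occurs in an irreducible representation of the group. -/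
lemma exists_isIrreducible_eig_ne_bot [Finite G] {B : Subgroup G} {χ : G → ℂ}
    (hχ : IsCharOn B χ) : ∃ (d : ℕ) (ρ : Representation ℂ G (Fin d → ℂ)),
      ρ.IsIrreducible ∧ eig ρ B χ ≠ ⊥ := by
  classical
  -- The induced representation is realized as the functions which are left equivariant under `B`,
  -- with `G` acting by right translation.
  let R : Representation ℂ G (G → ℂ) :=
    { toFun := fun g => LinearMap.funLeft ℂ ℂ (fun x => x * g)
      map_one' := by ext; simp [LinearMap.funLeft]
      map_mul' := fun a b => by
        refine LinearMap.ext fun f => funext fun x => ?_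
        simp [LinearMap.funLeft, mul_assoc] }
  have hR : ∀ g f x, R g f x = f (x * g) := fun g f x => rfl
  let U : Submodule ℂ (G → ℂ) :=
    { carrier := {f | ∀ b ∈ B, ∀ x, f (b * x) = χ b * f x}
      add_mem' := fun {f f'} hf hf' b hb x => by
        simp only [Pi.add_apply, hf b hb x, hf' b hb x, mul_add]
      zero_mem' := fun b _ x => by simp
      smul_mem' := fun c f hf b hb x => by
        simp only [Pi.smul_apply, hf b hb x, smul_eq_mul]; ring }
  have hUR : ∀ g, ∀ w ∈ U, R g w ∈ U := fun g w hw b hb x => by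
    rw [hR, hR, mul_assoc, hw b hb]
  have hU0 : U ≠ ⊥ := by
    intro h
    have : (fun x => if x ∈ B then χ x else 0) ∈ U := fun b hb x => by
      by_cases hx : x ∈ B
      · simp only [if_pos hx, if_pos (mul_mem hb hx), hχ.mul b hb x hx]
      · simp only [if_neg hx, if_neg fun h => hx ((Subgroup.mul_mem_cancel_left B hb).1 h), mul_zero]
    rw [h, Submodule.mem_bot] at this
    have := congrFun this 1
    simp [one_mem, hχ.one] at this
  obtain ⟨W, hW, hWU, hW0, hirr⟩ := exists_isIrreducible_subrepresentation R hUR hU0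
  set ρ := R.subrepresentation W hW with hρ
  have hρc : ∀ g (w : W), ((ρ g w : W) : G → ℂ) = R g w := fun g w => rfl
  have heig : eig ρ B χ ≠ ⊥ := by
    intro h
    obtain ⟨f, hf, hf0⟩ := Submodule.exists_mem_ne_zero_of_ne_bot hW0
    obtain ⟨x, hx⟩ : ∃ x, f x ≠ 0 := by
      by_contra! h
      exact hf0 (funext h)
    -- After translating by `x` the function is nonzero at `1`; left equivariance shows that its
    -- projection still takes the value `f x` there.
    have hm := eigProj_mem ρ hχ (ρ x ⟨f, hf⟩)
    rw [h, Submodule.mem_bot] at hm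
    have := congrFun (congrArg Subtype.val hm) 1
    rw [eigProj_apply] at this
    simp only [Submodule.coe_smul, Submodule.coe_sum, hρc, Pi.smul_apply, Finset.sum_apply, hR] at this
    have h2 : ∀ b : B, f (1 * b * x) = χ b * f x := fun b => by
      rw [one_mul]
      exact hWU hf b b.2 x
    simp only [h2, smul_eq_mul, inv_mul_cancel_left₀ (hχ.ne_zero (Subtype.prop _)), Finset.sum_const,
      Finset.card_univ, Fintype.card_eq_nat_card, nsmul_eq_mul, ZeroMemClass.coe_zero,
      Pi.zero_apply] at this
    rw [inv_mul_cancel_left₀ (by exact_mod_cast Nat.card_pos.ne')] at this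
    exact hx this
  obtain ⟨d, ρ', ⟨e⟩⟩ := exists_equiv_fin ρ
  refine ⟨d, ρ', isIrreducible_of_equiv e hirr, fun h => heig ?_⟩
  rw [eq_bot_iff]
  intro w hw
  have : e w ∈ eig ρ' B χ := fun x hx => by rw [← equiv_apply, hw x hx, map_smul]
  rw [h, Submodule.mem_bot] at this
  exact e.toLinearEquiv.injective (this.trans (map_zero e.toLinearEquiv).symm)


/-- A set of elements acting by scalars, modulo which the group is a Heisenberg group: each other
element has a commutator with some element which acts by a nontrivial scalar. -/
structure IsHeisenberg (Z : Subgroup G) (ζ : G → ℂ) : Prop where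
  char : IsCharOn Z ζ
  nondeg : ∀ h ∉ Z, ∃ k, k * h * k⁻¹ * h⁻¹ ∈ Z ∧ ζ (k * h * k⁻¹ * h⁻¹) ≠ 1

/-- Two representations of a Heisenberg group with the same central character are not disjoint. -/
lemma IsHeisenberg.exists_intertwining [Finite G] {Z : Subgroup G} {ζ : G → ℂ}
    (hZ : IsHeisenberg Z ζ) (ρ : Representation ℂ G V) (ρ' : Representation ℂ G V')
    (hρ : ∀ z ∈ Z, ∀ v, ρ z v = ζ z • v) (hρ' : ∀ z ∈ Z, ∀ v, ρ' z v = ζ z • v)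
    [Nontrivial V] [Nontrivial V'] :
    ∃ f : V →ₗ[ℂ] V', f ≠ 0 ∧ ∀ g v, f (ρ g v) = ρ' g (f v) := by
  classical
  obtain ⟨v, hv⟩ := exists_ne (0 : V)
  obtain ⟨v', hv'⟩ := exists_ne (0 : V')
  obtain ⟨f, hf⟩ : ∃ f : Module.Dual ℂ V, f v ≠ 0 := by
    by_contra! h
    exact hv ((Module.forall_dual_apply_eq_zero_iff ℂ v).1 h)
  -- Averages over the group of the rank one maps `x ↦ f x • v'`; each of them is an intertwiner.
  let F : Module.Dual ℂ V → V →ₗ[ℂ] V' := fun f => ∑ h : G, (f ∘ₗ ρ h⁻¹).smulRight (ρ' h v')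
  have hF : ∀ f x, F f x = ∑ h : G, f (ρ h⁻¹ x) • ρ' h v' := fun f x => by
    simp [F, LinearMap.sum_apply]
  have hFint : ∀ f g x, F f (ρ g x) = ρ' g (F f x) := fun f g x => by
    rw [hF, hF, map_sum]
    refine Fintype.sum_equiv (Equiv.mulLeft g⁻¹) _ _ fun h => ?_
    simp only [Equiv.coe_mulLeft, map_smul, ← Module.End.mul_apply, ← map_mul, mul_inv_rev, inv_inv,
      mul_inv_cancel_left]
  by_contra! hcon
  have hzero : ∀ f, F f = 0 := fun f => by
    by_contra h
    obtain ⟨g, x, hgx⟩ := hcon (F f) h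
    exact hgx (hFint f g x)
  -- If all averages vanished, so would this sum. But summing over `k` kills the terms with `h ∉ Z`,
  -- each being multiplied by a nontrivial commutator scalar, while every `h ∈ Z` contributes the
  -- same nonzero multiple of `v'`.
  have hsum : ∑ k : G, F (f ∘ₗ ρ k) (ρ k⁻¹ v) = 0 := by simp [hzero]
  have hexp : ∑ k : G, F (f ∘ₗ ρ k) (ρ k⁻¹ v)
      = ∑ h : G, (∑ k : G, f (ρ (k * h⁻¹ * k⁻¹) v)) • ρ' h v' := by
    simp only [hF, Finset.sum_smul]
    rw [Finset.sum_comm]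
    simp only [LinearMap.coe_comp, Function.comp_apply, ← Module.End.mul_apply, ← map_mul, mul_assoc]
  have hterm : ∀ h : G, (∑ k : G, f (ρ (k * h⁻¹ * k⁻¹) v)) • ρ' h v' =
      if h ∈ Z then ((Nat.card G : ℂ) * f v) • v' else 0 := fun h => by
    split_ifs with hh
    · have : ∀ k : G, f (ρ (k * h⁻¹ * k⁻¹) v) = (ζ h)⁻¹ * f v := fun k => by
        rw [map_mul, map_mul, Module.End.mul_apply, Module.End.mul_apply, hρ _ (inv_mem hh),
          map_smul, ← Module.End.mul_apply, ← map_mul, mul_inv_cancel, map_one, map_smul,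
          hZ.char.inv hh]
        rfl
      simp only [this, Finset.sum_const, Finset.card_univ, Fintype.card_eq_nat_card, nsmul_eq_mul,
        hρ' h hh, smul_smul]
      congr 1
      field_simp [hZ.char.ne_zero hh]
    · obtain ⟨k₀, hk₀, hne⟩ := hZ.nondeg h⁻¹ fun h' => hh (by simpa using inv_mem h')
      set z := k₀ * h⁻¹ * k₀⁻¹ * h⁻¹⁻¹ with hz
      have hs : ∑ k : G, f (ρ (k * h⁻¹ * k⁻¹) v) = ζ z * ∑ k : G, f (ρ (k * h⁻¹ * k⁻¹) v) := by
        rw [Finset.mul_sum]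
        refine (Fintype.sum_equiv (Equiv.mulRight k₀) _ _ fun k => ?_).symm
        have : k * k₀ * h⁻¹ * (k * k₀)⁻¹ = k * (z * (h⁻¹ * k⁻¹)) := by rw [hz]; group
        have h2 : ρ (k * (z * (h⁻¹ * k⁻¹))) v = ζ z • ρ (k * h⁻¹ * k⁻¹) v := by
          rw [map_mul, Module.End.mul_apply, map_mul, Module.End.mul_apply, hρ z hk₀, map_smul,
            mul_assoc k, map_mul ρ k, Module.End.mul_apply]
        rw [Equiv.coe_mulRight, this, h2, map_smul, smul_eq_mul]
      have : ∑ k : G, f (ρ (k * h⁻¹ * k⁻¹) v) = 0 := by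
        have h0 : (1 - ζ z) * ∑ k : G, f (ρ (k * h⁻¹ * k⁻¹) v) = 0 := by
          rw [sub_mul, one_mul, ← hs, sub_self]
        exact (mul_eq_zero.1 h0).resolve_left (sub_ne_zero.2 (Ne.symm hne))
      rw [this, zero_smul]
  rw [hexp, Finset.sum_congr rfl fun h _ => hterm h, Finset.sum_ite, Finset.sum_const,
    Finset.sum_const_zero, add_zero, ← Nat.cast_smul_eq_nsmul ℂ, smul_smul, smul_eq_zero] at hsum
  rcases hsum with h | h
  · refine mul_ne_zero ?_ (mul_ne_zero ?_ hf) h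
    · have : 1 ∈ Finset.univ.filter fun x => x ∈ Z := by simp [one_mem]
      exact_mod_cast (Finset.card_pos.2 ⟨1, this⟩).ne'
    · exact_mod_cast Nat.card_pos.ne'
  · exact hv' h

/-- An irreducible representation of a group is still irreducible on a normal Heisenberg subgroup
with cyclic quotient. -/
lemma IsHeisenberg.isIrreducible_comp_subtype [Finite G] {ρ : Representation ℂ G V}
    (hρ : ρ.IsIrreducible) {H : Subgroup G} {Z : Subgroup H} {ζ : H → ℂ} (hZ : IsHeisenberg Z ζ)
    (hζ : ∀ z ∈ Z, ∀ v, ρ z v = ζ z • v) {t : G} (ht : ∀ h ∈ H, t * h * t⁻¹ ∈ H)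
    (hgen : ∀ g, ∃ h ∈ H, ∃ i : ℕ, g = h * t ^ i) :
    (res ρ H.subtype).IsIrreducible := by
  classical
  have := finiteDimensional_of_isIrreducible hρ
  have := ((isIrreducible_iff ρ).1 hρ).1
  obtain ⟨W, hW, -, hW0, hirr⟩ := exists_isIrreducible_subrepresentation (res ρ H.subtype)
    (U := ⊤) (fun _ _ _ => Submodule.mem_top) top_ne_bot
  set η := (res ρ H.subtype).subrepresentation W hW with hη
  have hηc : ∀ (h : H) (w : W), ((η h w : W) : V) = ρ h w := fun h w => rfl
  have hWnt := ((isIrreducible_iff _).1 hirr).1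
  let c : H →* H :=
    { toFun := fun h => ⟨t * h * t⁻¹, ht h h.2⟩
      map_one' := by ext; simp
      map_mul' := fun a b => by ext; simp [mul_assoc] }
  have hc : ∀ h : H, (c h : G) = t * h * t⁻¹ := fun h => rfl
  have hscal : ∀ z ∈ Z, ∀ v, ρ (c z) v = ζ z • v := fun z hz v => by
    rw [hc, map_mul, map_mul, Module.End.mul_apply, Module.End.mul_apply, hζ z hz, map_smul,
      ← Module.End.mul_apply, ← map_mul, mul_inv_cancel, map_one]
    rfl
  -- Conjugation by `t` does not change the central character, so `W` is isomorphic to its own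
  -- conjugate.
  obtain ⟨φ, hφ0, hφ⟩ := hZ.exists_intertwining η (res η c)
    (fun z hz w => Subtype.ext (hζ z hz w)) (fun z hz w => Subtype.ext (hscal z hz w))
  have hφ' : ∀ (h : H) w, φ (η h w) = η (c h) (φ w) := hφ
  have hφinj : LinearMap.ker φ = ⊥ :=
    (((isIrreducible_iff _).1 hirr).2 (LinearMap.ker φ) fun g w hw => by
      rw [LinearMap.mem_ker] at hw ⊢
      rw [hφ', hw, map_zero]).resolve_right fun h => hφ0 (LinearMap.ker_eq_top.1 h)
  have hφsurj : Function.Surjective φ :=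
    LinearMap.surjective_of_injective (LinearMap.ker_eq_bot.1 hφinj)
  -- the space of embeddings of `W` carries an endomorphism
  let 𝓗 : Submodule ℂ (W →ₗ[ℂ] V) :=
    { carrier := {f | ∀ (h : H) w, f (η h w) = ρ h (f w)}
      add_mem' := fun {a b} ha hb h w => by simp [ha h w, hb h w]
      zero_mem' := fun h w => by simp
      smul_mem' := fun c a ha h w => by simp [ha h w] }
  let Φ : (W →ₗ[ℂ] V) →ₗ[ℂ] (W →ₗ[ℂ] V) :=
    { toFun := fun f => ρ t⁻¹ ∘ₗ f ∘ₗ φ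
      map_add' := fun a b => by ext; simp
      map_smul' := fun c a => by ext; simp }
  have hΦ : ∀ f w, Φ f w = ρ t⁻¹ (f (φ w)) := fun f w => rfl
  have hΦ𝓗 : ∀ f ∈ 𝓗, Φ f ∈ 𝓗 := fun f hf h w => by
    rw [hΦ, hφ', hf, hΦ, hc, ← Module.End.mul_apply, ← map_mul, ← Module.End.mul_apply, ← map_mul]
    congr 2
    group
  have : Nontrivial 𝓗 := by
    refine ⟨⟨W.subtype, fun h w => rfl⟩, 0, fun h => ?_⟩
    obtain ⟨w, hw⟩ := exists_ne (0 : W)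
    exact hw (Subtype.ext (LinearMap.congr_fun (congrArg Subtype.val h) w))
  obtain ⟨μ, hμ⟩ := Module.End.exists_eigenvalue (Φ.restrict hΦ𝓗)
  obtain ⟨⟨f, hf⟩, hfμ⟩ := hμ.exists_hasEigenvector
  have hf0 : f ≠ 0 := fun h => hfμ.2 (Subtype.ext h)
  have hfe : ∀ w, f (φ w) = μ • ρ t (f w) := fun w => by
    have h1 := LinearMap.congr_fun (congrArg Subtype.val (Module.End.mem_eigenspace_iff.1 hfμ.1)) w
    have h2 : ρ t⁻¹ (f (φ w)) = μ • f w := h1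
    rw [← map_smul, ← h2, ← Module.End.mul_apply, ← map_mul, mul_inv_cancel, map_one]
    rfl
  have hμ0 : μ ≠ 0 := by
    rintro rfl
    refine hf0 (LinearMap.ext fun w => ?_)
    obtain ⟨w, rfl⟩ := hφsurj w
    simp [hfe]
  -- An embedding which is an eigenvector has an image stable under `t` as well as under `H`, hence
  -- under the whole group.
  have hrt : ∀ v ∈ LinearMap.range f, ρ t v ∈ LinearMap.range f := by
    rintro _ ⟨w, rfl⟩
    refine ⟨μ⁻¹ • φ w, ?_⟩
    rw [map_smul, hfe, smul_smul, inv_mul_cancel₀ hμ0, one_smul]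
  have hrti : ∀ i : ℕ, ∀ v ∈ LinearMap.range f, ρ (t ^ i) v ∈ LinearMap.range f := fun i => by
    induction i with
    | zero => simp
    | succ i ih =>
      intro v hv
      rw [pow_succ, map_mul, Module.End.mul_apply]
      exact ih _ (hrt v hv)
  obtain ⟨w, hw⟩ : ∃ w, f w ≠ 0 := by
    by_contra! h
    exact hf0 (LinearMap.ext h)
  have hrange : LinearMap.range f = ⊤ := eq_top_of_isIrreducible hρ _ (fun g v hv => by
    obtain ⟨h, hh, i, rfl⟩ := hgen g
    rw [map_mul, Module.End.mul_apply]
    obtain ⟨w, hw⟩ := hrti i v hv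
    rw [← hw]
    exact ⟨η ⟨h, hh⟩ w, hf ⟨h, hh⟩ w⟩) ⟨w, rfl⟩ hw
  have hfinj : LinearMap.ker f = ⊥ :=
    (((isIrreducible_iff _).1 hirr).2 (LinearMap.ker f) fun g w hw => by
      rw [LinearMap.mem_ker] at hw ⊢
      rw [hf, hw, map_zero]).resolve_right fun h => hf0 (LinearMap.ker_eq_top.1 h)
  exact isIrreducible_of_equiv (Representation.Equiv.mk
    (LinearEquiv.ofBijective f ⟨LinearMap.ker_eq_bot.1 hfinj, LinearMap.range_eq_top.1 hrange⟩)
    fun g => LinearMap.ext fun v => hf g v) hirr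

section Trace

variable {ρ : Representation ℂ G V}

/-- By Schur's lemma the sum of the conjugates is a scalar, which taking traces identifies. The
dimension is kept on the left to avoid a division. -/
lemma sum_conj_eq [Finite G] (hρ : ρ.IsIrreducible) (X : V →ₗ[ℂ] V) :
    (Module.finrank ℂ V : ℂ) • ∑ h : G, ρ h * X * ρ h⁻¹
      = ((Nat.card G : ℂ) * LinearMap.trace ℂ V X) • 1 := by
  have := finiteDimensional_of_isIrreducible hρ
  obtain ⟨c, hc⟩ := exists_smul_of_commute hρ (∑ h : G, ρ h * X * ρ h⁻¹) (fun g v => by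
    simp only [LinearMap.sum_apply, map_sum]
    refine Fintype.sum_equiv (Equiv.mulLeft g⁻¹) _ _ fun h => ?_
    simp only [Equiv.coe_mulLeft, mul_inv_rev, inv_inv, ← Module.End.mul_apply, ← mul_assoc,
      ← map_mul, mul_inv_cancel, one_mul]
    simp only [mul_assoc, ← map_mul])
  have hc' : ∑ h : G, ρ h * X * ρ h⁻¹ = c • 1 := LinearMap.ext hc
  have ht := congrArg (LinearMap.trace ℂ V) hc'
  have h1 : ∀ h : G, LinearMap.trace ℂ V (ρ h * X * ρ h⁻¹) = LinearMap.trace ℂ V X := fun h => by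
    rw [LinearMap.trace_mul_comm, ← mul_assoc, ← map_mul, inv_mul_cancel, map_one, one_mul]
  simp only [map_sum, h1, Finset.sum_const, Finset.card_univ, Fintype.card_eq_nat_card,
    nsmul_eq_mul, map_smul, LinearMap.trace_one, smul_eq_mul] at ht
  rw [hc', ht, smul_smul, mul_comm]

/-- Conjugation by a suitable `k` multiplies `ρ h` by a scalar different from `1` without changing
its trace. -/
lemma IsHeisenberg.trace_eq_zero {Z : Subgroup G} {ζ : G → ℂ} (hZ : IsHeisenberg Z ζ)
    (hζ : ∀ z ∈ Z, ∀ v, ρ z v = ζ z • v) {h : G} (hh : h ∉ Z) :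
    LinearMap.trace ℂ V (ρ h) = 0 := by
  obtain ⟨k, hk, hne⟩ := hZ.nondeg h hh
  set z := k * h * k⁻¹ * h⁻¹ with hz
  have h1 : ρ k * ρ h * ρ k⁻¹ = ζ z • ρ h := by
    rw [← map_mul, ← map_mul, show k * h * k⁻¹ = z * h by rw [hz]; group, map_mul]
    exact LinearMap.ext fun v => hζ z hk _
  have h2 := congrArg (LinearMap.trace ℂ V) h1
  rw [LinearMap.trace_mul_comm, ← mul_assoc, ← map_mul, inv_mul_cancel, map_one, one_mul,
    map_smul, smul_eq_mul] at h2
  have : (1 - ζ z) * LinearMap.trace ℂ V (ρ h) = 0 := by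
    rw [sub_mul, one_mul, ← h2, sub_self]
  exact (mul_eq_zero.1 this).resolve_left (sub_ne_zero.2 (Ne.symm hne))

/-- Orthogonality gives `∑ tr (ρ h) tr (ρ h⁻¹) = |G|`. The character vanishes off `Z`, and each
element of `Z` contributes the square of the dimension. -/
lemma IsHeisenberg.finrank_sq [Finite G] (hρ : ρ.IsIrreducible) {Z : Subgroup G} {ζ : G → ℂ}
    (hZ : IsHeisenberg Z ζ) (hζ : ∀ z ∈ Z, ∀ v, ρ z v = ζ z • v) :
    Module.finrank ℂ V ^ 2 * Nat.card Z = Nat.card G := by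
  classical
  have := finiteDimensional_of_isIrreducible hρ
  have := ((isIrreducible_iff ρ).1 hρ).1
  set d := Module.finrank ℂ V with hd
  have hd0 : (d : ℂ) ≠ 0 := by exact_mod_cast Module.finrank_pos.ne'
  let b := Module.finBasis ℂ V
  have htr : ∀ X : V →ₗ[ℂ] V, LinearMap.trace ℂ V X = ∑ i, b.coord i (X (b i)) := fun X => by
    rw [LinearMap.trace_eq_matrix_trace ℂ b]
    simp [Matrix.trace, LinearMap.toMatrix_apply]
  have h1 : ∑ h : G, LinearMap.trace ℂ V (ρ h) * LinearMap.trace ℂ V (ρ h⁻¹) = Nat.card G := by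
    -- Schur orthogonality of matrix coefficients, from `sum_conj_eq` applied to rank one operators.
    have hij : ∀ i j, (d : ℂ) * ∑ h : G, b.coord i (ρ h (b i)) * b.coord j (ρ h⁻¹ (b j))
        = if i = j then (Nat.card G : ℂ) else 0 := fun i j => by
      have h2 := congrArg (fun X => b.coord i (X (b j)))
        (sum_conj_eq hρ ((b.coord j).smulRight (b i)))
      simp only [LinearMap.smul_apply, LinearMap.sum_apply, map_smul, map_sum, Module.End.mul_apply,
        LinearMap.smulRight_apply, smul_eq_mul, Module.End.one_apply, LinearMap.trace_smulRight] at h2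
      simp only [mul_comm (b.coord i _)]
      refine h2.trans ?_
      by_cases h : i = j
      · subst h
        simp
      · simp [h, Ne.symm h]
    apply mul_left_cancel₀ hd0
    simp only [htr, Finset.sum_mul_sum]
    rw [Finset.sum_comm]
    simp only [Finset.sum_comm (s := (Finset.univ : Finset G)), Finset.mul_sum]
    simp only [← Finset.mul_sum, hij]
    simp [mul_comm, hd]
  have h3 : ∀ h : G, LinearMap.trace ℂ V (ρ h) * LinearMap.trace ℂ V (ρ h⁻¹)
      = if h ∈ Z then (d : ℂ) ^ 2 else 0 := fun h => by
    split_ifs with hh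
    · have hs : ∀ z ∈ Z, ρ z = ζ z • 1 := fun z hz => LinearMap.ext (hζ z hz)
      rw [hs h hh, hs _ (inv_mem hh), map_smul, map_smul, LinearMap.trace_one, hZ.char.inv hh,
        smul_eq_mul, smul_eq_mul]
      field_simp [hZ.char.ne_zero hh]
      rw [hd]
    · rw [hZ.trace_eq_zero hζ hh, zero_mul]
  rw [Finset.sum_congr rfl fun h _ => h3 h, Finset.sum_ite, Finset.sum_const,
    Finset.sum_const_zero, add_zero, nsmul_eq_mul] at h1
  have h4 : (Finset.univ.filter fun x => x ∈ Z).card = Nat.card Z := by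
    rw [← Fintype.card_eq_nat_card, ← Fintype.card_subtype]
  rw [h4] at h1
  rw [mul_comm]
  exact_mod_cast h1

/-- Compute `∑ tr (ρ h T ρ h⁻¹ T')` in two ways. By `sum_conj_eq` it is `|G| / d` times the product
of the traces of `T` and `T'`, where `d` is the dimension. Termwise it is `∑ tr ρ (h (σ h)⁻¹)`,
which only sees `Z`, since `hσZ` says that `T` fixes no nontrivial class modulo `Z`; this gives `d
|Z|`. Now `d ^ 2 |Z| = |G|`. -/
lemma IsHeisenberg.trace_mul_trace [Finite G] (hρ : ρ.IsIrreducible) {Z : Subgroup G} {ζ : G → ℂ}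
    (hZ : IsHeisenberg Z ζ) (hζ : ∀ z ∈ Z, ∀ v, ρ z v = ζ z • v) {T T' : V →ₗ[ℂ] V}
    (hT : T * T' = 1) (hT' : T' * T = 1) (σ : G → G) (hσ : ∀ h, T * ρ h * T' = ρ (σ h))
    (hσZ : ∀ h ∉ Z, h * (σ h)⁻¹ ∉ Z) :
    LinearMap.trace ℂ V T * LinearMap.trace ℂ V T' = 1 := by
  classical
  have := finiteDimensional_of_isIrreducible hρ
  have := ((isIrreducible_iff ρ).1 hρ).1
  set d := Module.finrank ℂ V with hd
  have hd0 : (d : ℂ) ≠ 0 := by exact_mod_cast Module.finrank_pos.ne'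
  have hG0 : (Nat.card G : ℂ) ≠ 0 := by exact_mod_cast Nat.card_pos.ne'
  have h1 := congrArg (fun X => LinearMap.trace ℂ V (X * T')) (sum_conj_eq hρ T)
  have h2 : ∀ h : G, LinearMap.trace ℂ V (ρ h * T * ρ h⁻¹ * T') = if h ∈ Z then (d : ℂ) else 0 :=
    fun h => by
      have h3 : ρ h * T * ρ h⁻¹ * T' = ρ h * (T * ρ h⁻¹ * T') := by simp only [mul_assoc]
      have h4 : (T * ρ h⁻¹ * T') = ρ (σ h)⁻¹ := by
        have h5 : (T * ρ h⁻¹ * T') * ρ (σ h) = 1 := by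
          rw [← hσ]
          calc T * ρ h⁻¹ * T' * (T * ρ h * T') = T * ρ h⁻¹ * (T' * T) * ρ h * T' := by
                simp only [mul_assoc]
            _ = T * (ρ h⁻¹ * ρ h) * T' := by rw [hT']; simp only [mul_assoc, one_mul]
            _ = 1 := by rw [← map_mul, inv_mul_cancel, map_one, mul_one, hT]
        calc T * ρ h⁻¹ * T' = T * ρ h⁻¹ * T' * (ρ (σ h) * ρ (σ h)⁻¹) := by
              rw [← map_mul, mul_inv_cancel, map_one, mul_one]
          _ = ρ (σ h)⁻¹ := by rw [← mul_assoc, h5, one_mul]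
      split_ifs with hh
      · have hs : ∀ z ∈ Z, ρ z = ζ z • 1 := fun z hz => LinearMap.ext (hζ z hz)
        rw [hs h hh, hs _ (inv_mem hh), hZ.char.inv hh]
        simp only [smul_mul_assoc, one_mul, mul_smul_comm, mul_one, hT, smul_smul]
        rw [inv_mul_cancel₀ (hZ.char.ne_zero hh), one_smul, LinearMap.trace_one]
      · rw [h3, h4, ← map_mul, hZ.trace_eq_zero hζ (hσZ h hh)]
  simp only [smul_mul_assoc, Finset.sum_mul, map_smul, map_sum, h2, one_mul, smul_eq_mul] at h1
  rw [Finset.sum_ite, Finset.sum_const, Finset.sum_const_zero, add_zero, nsmul_eq_mul] at h1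
  have h4 : (Finset.univ.filter fun x => x ∈ Z).card = Nat.card Z := by
    rw [← Fintype.card_eq_nat_card, ← Fintype.card_subtype]
  have h5 : (d : ℂ) ^ 2 * Nat.card Z = Nat.card G := by exact_mod_cast hZ.finrank_sq hρ hζ
  rw [h4, show (d : ℂ) * (Nat.card Z * d) = d ^ 2 * Nat.card Z by ring, h5, mul_assoc] at h1
  exact (mul_left_cancel₀ hG0 (by rw [mul_one]; exact h1)).symm

end Trace

end Heisenberg

/-! ### Operators of finite order determined by the traces of their powers. -/

section CyclicTrace

variable {V : Type*} [AddCommGroup V] [Module ℂ V]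

lemma exists_nat_trace_of_isIdempotentElem [FiniteDimensional ℂ V] {p : Module.End ℂ V} (hp : IsIdempotentElem p) :
    ∃ k : ℕ, LinearMap.trace ℂ V p = k :=
  ⟨_, LinearMap.IsProj.trace ((LinearMap.isProj_range_iff_isIdempotentElem p).2 hp)⟩

lemma mul_sum_pow_of_pow_eq_one {A : Module.End ℂ V} {m : ℕ} (hA : A ^ m = 1) (i : ℕ) :
    A ^ i * ∑ j ∈ Finset.range m, A ^ j = ∑ j ∈ Finset.range m, A ^ j := by
  induction i with
  | zero => simp
  | succ i ih =>
    rw [pow_succ, mul_assoc, Finset.mul_sum]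
    have : ∑ j ∈ Finset.range m, A * A ^ j = ∑ j ∈ Finset.range m, A ^ j := by
      have h1 := Finset.sum_range_succ (fun j => A ^ j) m
      rw [Finset.sum_range_succ', hA, pow_zero] at h1
      simpa [pow_succ'] using add_right_cancel h1
    rw [this, ih]

lemma isIdempotentElem_sum_pow {A : Module.End ℂ V} {m : ℕ} (hm : m ≠ 0) (hA : A ^ m = 1) :
    IsIdempotentElem ((m : ℂ)⁻¹ • ∑ j ∈ Finset.range m, A ^ j) := by
  have hm' : (m : ℂ) ≠ 0 := by exact_mod_cast hm
  rw [IsIdempotentElem, smul_mul_smul_comm, Finset.sum_mul]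
  simp only [mul_sum_pow_of_pow_eq_one hA, Finset.sum_const, Finset.card_range]
  rw [← Nat.cast_smul_eq_nsmul ℂ, smul_smul]
  congr 1
  field_simp

/-- The inverse runs through the same cyclic group. This lets one multiplicity be written with
traces of positive or of negative powers, so that no complex conjugation is needed. -/
lemma sum_pow_eq_sum_pow_of_mul_eq_one {A A' : Module.End ℂ V} {m : ℕ} (hA : A ^ m = 1)
    (h : A * A' = 1) (h' : A' * A = 1) :
    ∑ j ∈ Finset.range m, A ^ j = ∑ j ∈ Finset.range m, A' ^ j := by
  have hcomm : Commute A A' := h.trans h'.symm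
  have hA' : A' ^ m = 1 := by
    have := hcomm.mul_pow m
    rwa [h, one_pow, hA, one_mul, eq_comm] at this
  have h1 : ∀ i ∈ Finset.range m, A ^ (m - 1 - i) = A' ^ (i + 1) := fun i hi => by
    rw [Finset.mem_range] at hi
    have h2 : A ^ (m - 1 - i) * A ^ (i + 1) = 1 := by
      rw [← pow_add, show m - 1 - i + (i + 1) = m by omega, hA]
    have h3 : A ^ (i + 1) * A' ^ (i + 1) = 1 := by rw [← hcomm.mul_pow, h, one_pow]
    exact left_inv_eq_right_inv h2 h3
  rw [← Finset.sum_range_reflect, Finset.sum_congr rfl h1]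
  have h4 := Finset.sum_range_succ (fun j => A' ^ j) m
  rw [Finset.sum_range_succ', hA', pow_zero] at h4
  exact add_right_cancel h4

lemma sum_pow_mul_inv_pow {m : ℕ} {ε : ℂ} (hε : IsPrimitiveRoot ε m) {i j : ℕ} (hi : i < m)
    (hj : j < m) : ∑ s ∈ Finset.range m, (ε ^ j * (ε⁻¹) ^ i) ^ s = if i = j then (m : ℂ) else 0 := by
  have hε0 : ε ≠ 0 := hε.ne_zero (by omega)
  split_ifs with h
  · subst h
    simp [hε0]
  · have h1 : ε ^ j * ε⁻¹ ^ i ≠ 1 := fun h1 => h (by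
      rw [inv_pow, ← div_eq_mul_inv, div_eq_one_iff_eq (pow_ne_zero _ hε0)] at h1
      exact (hε.pow_inj hj hi h1).symm)
    have h2 : (ε ^ j * ε⁻¹ ^ i) ^ m = 1 := by
      rw [mul_pow, ← pow_mul, ← pow_mul, mul_comm j, mul_comm i, pow_mul, pow_mul, inv_pow ε m,
        hε.pow_eq_one]
      simp
    rw [geom_sum_eq h1, h2, sub_self, zero_div]

/-- An operator of order dividing `m` on a space of dimension `m - 1`, the traces of whose
nontrivial powers have modulus one, has all `m`-th roots of unity but one as simple eigenvalues. -/
lemma exists_trace_pow_eq_neg [FiniteDimensional ℂ V] {m : ℕ} (hm : Module.finrank ℂ V + 1 = m) {T T' : Module.End ℂ V}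
    (hT : T ^ m = 1) (h : T * T' = 1) (h' : T' * T = 1)
    (htr : ∀ i, 0 < i → i < m → LinearMap.trace ℂ V (T ^ i) * LinearMap.trace ℂ V (T' ^ i) = 1) :
    ∃ ζ : ℂ, ζ ^ m = 1 ∧ ∀ i, ¬ m ∣ i → LinearMap.trace ℂ V (T ^ i) = - ζ ^ i := by
  have hm0 : m ≠ 0 := by omega
  have hmC : (m : ℂ) ≠ 0 := by exact_mod_cast hm0
  set ε : ℂ := Complex.exp (2 * Real.pi * Complex.I / m) with hεdef
  have hε : IsPrimitiveRoot ε m := Complex.isPrimitiveRoot_exp m hm0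
  have hε0 : ε ≠ 0 := hε.ne_zero hm0
  -- The fixed space of `A s` is the eigenspace of `T` for `ε ^ s`, so the trace `k s` of the
  -- averaging idempotent is the multiplicity of that eigenvalue.
  let A : ℕ → Module.End ℂ V := fun s => (ε⁻¹) ^ s • T
  let A' : ℕ → Module.End ℂ V := fun s => ε ^ s • T'
  have hAA' : ∀ s, A s * A' s = 1 := fun s => by
    simp only [A, A', smul_mul_smul_comm, h]
    rw [← mul_pow, inv_mul_cancel₀ hε0, one_pow, one_smul]
  have hA'A : ∀ s, A' s * A s = 1 := fun s => by
    simp only [A, A', smul_mul_smul_comm, h']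
    rw [← mul_pow, mul_inv_cancel₀ hε0, one_pow, one_smul]
  have hAm : ∀ s, A s ^ m = 1 := fun s => by
    simp only [A, smul_pow, hT]
    rw [← pow_mul, mul_comm, pow_mul, inv_pow, hε.pow_eq_one, inv_one, one_pow, one_smul]
  choose k hk using fun s => exists_nat_trace_of_isIdempotentElem (isIdempotentElem_sum_pow hm0 (hAm s))
  set t : ℕ → ℂ := fun i => LinearMap.trace ℂ V (T ^ i)
  set t' : ℕ → ℂ := fun i => LinearMap.trace ℂ V (T' ^ i)
  have hk1 : ∀ s, (m : ℂ) * k s = ∑ i ∈ Finset.range m, (ε⁻¹ ^ i) ^ s * t i := fun s => by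
    rw [← hk, map_smul, smul_eq_mul, mul_inv_cancel_left₀ hmC, map_sum]
    refine Finset.sum_congr rfl fun i _ => ?_
    simp only [A, smul_pow, map_smul, smul_eq_mul, t, ← pow_mul, mul_comm]
  have hk2 : ∀ s, (m : ℂ) * k s = ∑ i ∈ Finset.range m, (ε ^ i) ^ s * t' i := fun s => by
    rw [← hk, sum_pow_eq_sum_pow_of_mul_eq_one (hAm s) (hAA' s) (hA'A s), map_smul, smul_eq_mul,
      mul_inv_cancel_left₀ hmC, map_sum]
    refine Finset.sum_congr rfl fun i _ => ?_
    simp only [A', smul_pow, map_smul, smul_eq_mul, t', ← pow_mul, mul_comm]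
  have hpos : 0 < m := by omega
  have ht0 : t 0 = m - 1 := by
    simp only [t, pow_zero, LinearMap.trace_one, ← hm]
    push_cast
    ring
  have ht0' : t' 0 = m - 1 := by
    simp only [t', pow_zero, LinearMap.trace_one, ← hm]
    push_cast
    ring
  have hinv : ∀ j < m, ∑ s ∈ Finset.range m, (ε ^ j) ^ s * ((m : ℂ) * k s) = m * t j := fun j hj => by
    simp only [hk1, Finset.mul_sum]
    rw [Finset.sum_comm]
    have : ∀ i ∈ Finset.range m, ∑ s ∈ Finset.range m, (ε ^ j) ^ s * ((ε⁻¹ ^ i) ^ s * t i)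
        = if i = j then m * t i else 0 := fun i hi => by
      simp only [← mul_assoc, ← Finset.sum_mul, ← mul_pow]
      rw [sum_pow_mul_inv_pow hε (Finset.mem_range.1 hi) hj]
      split_ifs <;> simp
    rw [Finset.sum_congr rfl this, Finset.sum_ite_eq' , if_pos (Finset.mem_range.2 hj)]
  -- Parseval's identity for the multiplicities: the trivial power contributes `(m - 1) ^ 2`, each
  -- of the other `m - 1` powers contributes `1`.
  have hsq : ∑ s ∈ Finset.range m, ((m : ℂ) * k s) * (m * k s) = m * (m * (m - 1)) := by
    have h1 : ∀ s ∈ Finset.range m, ((m : ℂ) * k s) * (m * k s)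
        = ∑ j ∈ Finset.range m, t' j * ((ε ^ j) ^ s * (m * k s)) := fun s _ => by
      nth_rw 1 [hk2]
      rw [Finset.sum_mul]
      exact Finset.sum_congr rfl fun j _ => by ring
    rw [Finset.sum_congr rfl h1, Finset.sum_comm]
    have h2 : ∀ j ∈ Finset.range m, ∑ s ∈ Finset.range m, t' j * ((ε ^ j) ^ s * ((m : ℂ) * k s))
        = m * (t' j * t j) := fun j hj => by
      rw [← Finset.mul_sum, hinv j (Finset.mem_range.1 hj)]
      ring
    rw [Finset.sum_congr rfl h2, ← Finset.mul_sum]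
    congr 1
    obtain ⟨m', rfl⟩ : ∃ m', m = m' + 1 := ⟨m - 1, by omega⟩
    rw [Finset.sum_range_succ', ht0, ht0']
    have h3 : ∀ j ∈ Finset.range m', t' (j + 1) * t (j + 1) = 1 := fun j hj => by
      rw [mul_comm]
      exact htr _ (by omega) (by have := Finset.mem_range.1 hj; omega)
    rw [Finset.sum_congr rfl h3]
    simp
    ring
  have hlin : ∑ s ∈ Finset.range m, k s = m - 1 := by
    have h1 := hinv 0 hpos
    simp only [pow_zero, one_pow, one_mul, ← Finset.mul_sum, ht0] at h1
    have h2 := mul_left_cancel₀ hmC h1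
    have : ((∑ s ∈ Finset.range m, k s : ℕ) : ℂ) = ((m - 1 : ℕ) : ℂ) := by
      rw [Nat.cast_sub (by omega)]
      push_cast
      exact h2
    exact_mod_cast this
  have hsq' : ∑ s ∈ Finset.range m, k s * k s = m - 1 := by
    have h2 : ∑ s ∈ Finset.range m, (k s : ℂ) * k s = m - 1 := by
      apply mul_left_cancel₀ hmC
      apply mul_left_cancel₀ hmC
      rw [← hsq, Finset.mul_sum, Finset.mul_sum]
      exact Finset.sum_congr rfl fun j _ => by ring
    have : ((∑ s ∈ Finset.range m, k s * k s : ℕ) : ℂ) = ((m - 1 : ℕ) : ℂ) := by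
      rw [Nat.cast_sub (by omega)]
      push_cast
      exact h2
    exact_mod_cast this
  -- The multiplicities and their squares have the same sum `m - 1`. As they are natural numbers,
  -- each is `0` or `1`, and exactly one is `0`.
  have hle : ∀ s ∈ Finset.range m, k s ≤ k s * k s := fun s _ => Nat.le_mul_self _
  have heq := (Finset.sum_eq_sum_iff_of_le hle).1 (hlin.trans hsq'.symm)
  have h01 : ∀ s ∈ Finset.range m, k s ≤ 1 := fun s hs => by
    have := heq s hs
    by_contra! hgt
    nlinarith
  have hcompl : ∑ s ∈ Finset.range m, (1 - k s) = 1 := by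
    rw [Finset.sum_tsub_distrib _ h01, hlin]
    simp
    omega
  obtain ⟨s₀, hs₀, hs₀1, hs₀'⟩ : ∃ s₀ ∈ Finset.range m, 1 - k s₀ = 1 ∧
      ∀ s ∈ Finset.range m, s ≠ s₀ → 1 - k s = 0 := by
    obtain ⟨s₀, hs₀, hne⟩ := Finset.exists_ne_zero_of_sum_ne_zero (hcompl.trans_ne one_ne_zero)
    have h1 := Finset.add_sum_erase _ (fun s => 1 - k s) hs₀
    rw [hcompl] at h1
    have h2 : ∑ s ∈ (Finset.range m).erase s₀, (1 - k s) = 0 := by omega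
    refine ⟨s₀, hs₀, by omega, fun s hs hss => ?_⟩
    exact Finset.sum_eq_zero_iff.1 h2 s (Finset.mem_erase.2 ⟨hss, hs⟩)
  have hkval : ∀ s ∈ Finset.range m, (k s : ℂ) = 1 - if s = s₀ then 1 else 0 := fun s hs => by
    split_ifs with h
    · subst h
      have : k s = 0 := by omega
      simp [this]
    · have h1 := hs₀' s hs h
      have h2 := h01 s hs
      have : k s = 1 := by omega
      simp [this]
  refine ⟨ε ^ s₀, by rw [← pow_mul, mul_comm, pow_mul, hε.pow_eq_one, one_pow], ?_⟩
  -- The `j`-th powers of all `m`-th roots of unity sum to zero, so the trace is minus the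
  -- contribution of the missing root.
  have hlt : ∀ j, 0 < j → j < m → t j = -(ε ^ s₀) ^ j := fun j hj0 hj => by
    have h1 := hinv j hj
    apply mul_left_cancel₀ hmC
    rw [← h1]
    have h2 : ∀ s ∈ Finset.range m, (ε ^ j) ^ s * ((m : ℂ) * k s)
        = m * (ε ^ j * ε⁻¹ ^ 0) ^ s - if s = s₀ then m * (ε ^ j) ^ s else 0 := fun s hs => by
      rw [hkval s hs]
      split_ifs
      · simp
      · simp [mul_comm]
    rw [Finset.sum_congr rfl h2, Finset.sum_sub_distrib, ← Finset.mul_sum,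
      sum_pow_mul_inv_pow hε hpos hj, if_neg hj0.ne, Finset.sum_ite_eq', if_pos hs₀, ← pow_mul,
      ← pow_mul, mul_comm j]
    ring
  intro i hi
  have h1 : T ^ i = T ^ (i % m) := by
    conv_lhs => rw [← Nat.div_add_mod i m, pow_add, pow_mul, hT, one_pow, one_mul]
  have h2 : (ε ^ s₀) ^ i = (ε ^ s₀) ^ (i % m) := by
    conv_lhs => rw [← Nat.div_add_mod i m, pow_add, pow_mul, ← pow_mul ε, mul_comm s₀, pow_mul ε,
      hε.pow_eq_one, one_pow, one_pow, one_mul]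
  rw [h1, h2]
  exact hlt _ (Nat.pos_of_ne_zero fun h => hi (Nat.dvd_of_mod_eq_zero h)) (Nat.mod_lt _ hpos)

end CyclicTrace

/-! ### Gluing a character of a normalized subgroup with a character of a second group. -/

section Join

variable {G : Type*} [Group G] {B : Type*} [Group B]

lemma mem_sup_range_iff {A : Subgroup G} (e : B →* G)
    (hA : ∀ b, ∀ x ∈ A, (e b)⁻¹ * x * e b ∈ A) {g : G} :
    g ∈ A ⊔ e.range ↔ ∃ x ∈ A, ∃ b, g = x * e b := by
  let K : Subgroup G :=
    { carrier := {g | ∃ x ∈ A, ∃ b, g = x * e b}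
      one_mem' := ⟨1, one_mem A, 1, by simp⟩
      mul_mem' := by
        rintro _ _ ⟨x, hx, b, rfl⟩ ⟨x', hx', b', rfl⟩
        have h := hA b⁻¹ x' hx'
        refine ⟨x * (e b * x' * (e b)⁻¹), mul_mem hx (by simpa using h), b * b', ?_⟩
        rw [map_mul]
        group
      inv_mem' := by
        rintro _ ⟨x, hx, b, rfl⟩
        refine ⟨(e b)⁻¹ * x⁻¹ * e b, hA b _ (inv_mem hx), b⁻¹, ?_⟩
        rw [map_inv]
        group }
  constructor
  · intro hg
    have : A ⊔ e.range ≤ K := sup_le (fun x hx => ⟨x, hx, 1, by simp⟩) (by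
      rintro _ ⟨b, rfl⟩
      exact ⟨1, one_mem A, b, by simp⟩)
    exact this hg
  · rintro ⟨x, hx, b, rfl⟩
    exact mul_mem (Subgroup.mem_sup_left hx) (Subgroup.mem_sup_right ⟨b, rfl⟩)

/-- Characters of a subgroup `A` and of a group `B` normalizing it, which agree where both are
defined, extend to a common character. -/
lemma exists_isCharOn_sup_range {A : Subgroup G} {α : G → ℂ} (hα : IsCharOn A α) (e : B →* G)
    (β : B →* ℂˣ) (hfix : ∀ b, Fixes A α (e b)) (hagree : ∀ b, e b ∈ A → α (e b) = β b) :
    ∃ χ : G → ℂ, IsCharOn (A ⊔ e.range) χ ∧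
      (∀ g, g ∈ A ⊔ e.range ↔ ∃ x ∈ A, ∃ b, g = x * e b) ∧
      ∀ x ∈ A, ∀ b, χ (x * e b) = α x * β b := by
  classical
  have hmem : ∀ g, g ∈ A ⊔ e.range ↔ ∃ x ∈ A, ∃ b, g = x * e b := fun g =>
    mem_sup_range_iff e fun b x hx => (hfix b x hx).1
  -- Two factorizations differ by an element of the intersection, where the two characters agree.
  have hwd : ∀ x ∈ A, ∀ x' ∈ A, ∀ b b', x * e b = x' * e b' → α x * β b = α x' * β b' := by
    intro x hx x' hx' b b' h
    have h1 : x'⁻¹ * x = e (b' * b⁻¹) := by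
      rw [map_mul, map_inv, inv_mul_eq_iff_eq_mul, ← mul_assoc, ← h, mul_inv_cancel_right]
    have h2 := hagree (b' * b⁻¹) (h1 ▸ mul_mem (inv_mem hx') hx)
    rw [← h1, hα.mul _ (inv_mem hx') _ hx, hα.inv hx', map_mul, map_inv] at h2
    push_cast at h2
    have h3 := hα.ne_zero hx'
    have h4 : (β b : ℂ) ≠ 0 := (β b).ne_zero
    field_simp at h2
    linear_combination h2
  let χ : G → ℂ := fun g => if h : ∃ x ∈ A, ∃ b, g = x * e b then
    α h.choose * β h.choose_spec.2.choose else 0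
  have hχ : ∀ x ∈ A, ∀ b, χ (x * e b) = α x * β b := fun x hx b => by
    have h : ∃ x' ∈ A, ∃ b', x * e b = x' * e b' := ⟨x, hx, b, rfl⟩
    simp only [χ]
    rw [dif_pos h]
    exact (hwd x hx _ h.choose_spec.1 b _ h.choose_spec.2.choose_spec).symm
  refine ⟨χ, ⟨?_, ?_⟩, hmem, hχ⟩
  · have := hχ 1 (one_mem A) 1
    rwa [map_one, mul_one, hα.one, map_one, Units.val_one, mul_one] at this
  · intro g hg g' hg'
    obtain ⟨x, hx, b, rfl⟩ := (hmem g).1 hg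
    obtain ⟨x', hx', b', rfl⟩ := (hmem g').1 hg'
    obtain ⟨h1, h2⟩ := hfix b⁻¹ x' hx'
    rw [map_inv, inv_inv] at h1 h2
    have h3 : x * e b * (x' * e b') = x * (e b * x' * (e b)⁻¹) * e (b * b') := by
      rw [map_mul]; group
    rw [h3, hχ _ (mul_mem hx h1), hχ x hx, hχ x' hx', hα.mul _ hx _ h1, h2, map_mul]
    push_cast
    ring

end Join

/-! ### Endomorphisms of a cyclic extension as sums of `x σ ^ i`, and the commutator pairing. -/

section FrobeniusDecomposition

variable {k : Type u} {K : Type v} [Field k] [Field K] [Algebra k K]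

/-- `a` lies in no proper subfield of `K` containing `k`. -/
def IsPrimitiveElt (k : Type u) {K : Type v} [Field k] [Field K] [Algebra k K] (a : K) : Prop :=
  ∀ L : IntermediateField k K, L ≠ ⊤ → a ∉ L

lemma IsPrimitiveElt.adjoin_eq_top [FiniteDimensional k K] {a : K} (ha : IsPrimitiveElt k a) :
    Algebra.adjoin k {a} = ⊤ := by
  have h : IntermediateField.adjoin k {a} = ⊤ := by
    by_contra h
    exact ha _ h (IntermediateField.mem_adjoin_simple_self k a)
  have h2 := IntermediateField.adjoin_simple_toSubalgebra_of_isAlgebraic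
    (Algebra.IsAlgebraic.isAlgebraic (R := k) a)
  rw [← h2, h]
  rfl

/-- Provides an elliptic element at which the prescribed trace can be tested: a subfield containing
`c` contains all its powers. -/
lemma isPrimitiveElt_of_forall_mem_zpowers {c : Kˣ} (hc : ∀ x : Kˣ, x ∈ Subgroup.zpowers c) :
    IsPrimitiveElt k (c : K) := by
  intro L hL hcL
  apply hL
  rw [eq_top_iff]
  rintro x -
  by_cases hx : x = 0
  · rw [hx]
    exact L.zero_mem
  · obtain ⟨i, hi⟩ := hc (Units.mk0 x hx)
    have : x = (c : K) ^ i := by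
      have := congrArg Units.val hi
      simpa using this.symm
    rw [this]
    exact zpow_mem hcL i

lemma not_dvd_of_lt {n i : ℕ} (h0 : 0 < i) (h1 : i < n) : ¬ n ∣ i := fun h => absurd (Nat.le_of_dvd h0 h) (by omega)

/-- The degrees of a maximal isotropic subspace invariant under multiplications. -/
abbrev lowDegs (n : ℕ) : Finset ℕ := Finset.Ico 1 ((n + 1) / 2)

/-- The degrees of the orthogonal complement. -/
abbrev orthDegs (n : ℕ) : Finset ℕ := Finset.range (n / 2 + 1)

/-- The endomorphism `x σ ^ i` of `K`. -/
def mono (σ : K ≃ₐ[k] K) (x : K) (i : ℕ) : Module.End k K :=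
  LinearMap.mulLeft k x * (σ ^ i).toLinearMap

@[simp] lemma mono_apply (σ : K ≃ₐ[k] K) (x : K) (i : ℕ) (y : K) :
    mono σ x i y = x * (σ ^ i) y := rfl

variable {σ : K ≃ₐ[k] K}

lemma mono_mul_mono (x y : K) (i j : ℕ) :
    mono σ x i * mono σ y j = mono σ (x * (σ ^ i) y) (i + j) := by
  ext z
  simp [pow_add, mul_assoc]

lemma mulLeft_mul_mono (x y : K) (i : ℕ) :
    LinearMap.mulLeft k x * mono σ y i = mono σ (x * y) i := by
  ext z
  simp [mul_assoc]

lemma mono_mul_mulLeft (x y : K) (i : ℕ) :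
    mono σ y i * LinearMap.mulLeft k x = mono σ (y * (σ ^ i) x) i := by
  ext z
  simp [mul_assoc]

lemma mono_zero_right (x : K) : mono σ x 0 = LinearMap.mulLeft k x := by
  ext z
  simp

lemma mono_add (x y : K) (i : ℕ) : mono σ (x + y) i = mono σ x i + mono σ y i := by
  ext z
  simp [add_mul]

lemma mono_neg (x : K) (i : ℕ) : mono σ (-x) i = - mono σ x i := by
  ext z
  simp

lemma mono_sub (x y : K) (i : ℕ) : mono σ (x - y) i = mono σ x i - mono σ y i := by
  ext z
  simp [sub_mul]

@[simp] lemma mono_zero (i : ℕ) : mono σ (0 : K) i = 0 := by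
  ext z
  simp

variable (hσ : orderOf σ = Module.finrank k K)

lemma trace_mulLeft (x : K) :
    LinearMap.trace k K (LinearMap.mulLeft k x) = Algebra.trace k K x := rfl

lemma trace_conj_eq {x : K} (hx : x ≠ 0) (X : Module.End k K) :
    LinearMap.trace k K (LinearMap.mulLeft k x * X * LinearMap.mulLeft k x⁻¹)
      = LinearMap.trace k K X := by
  rw [LinearMap.trace_mul_comm, ← mul_assoc]
  congr 1
  ext z
  simp [hx]

variable [FiniteDimensional k K]

include hσ

/-- If `σ ^ i` moves some `c`, conjugation by `c` multiplies the coefficient by `d = c / σ ^ i c ≠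
1` and preserves the trace. Every coefficient is a multiple of `1 - d`, so the trace vanishes. -/
lemma trace_mono (x : K) (i : ℕ) : LinearMap.trace k K (mono σ x i) =
    if Module.finrank k K ∣ i then Algebra.trace k K x else 0 := by
  split_ifs with h
  · have : σ ^ i = 1 := by rwa [← hσ, orderOf_dvd_iff_pow_eq_one] at h
    rw [← trace_mulLeft]
    congr 1
    ext z
    simp [this]
  · have hne : σ ^ i ≠ 1 := by rwa [← hσ, orderOf_dvd_iff_pow_eq_one] at h
    obtain ⟨c, hc⟩ : ∃ c, (σ ^ i) c ≠ c := by
      by_contra! hcon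
      exact hne (AlgEquiv.ext hcon)
    have hc0 : c ≠ 0 := fun h => hc (by rw [h, map_zero])
    have hsc : (σ ^ i) c ≠ 0 := (map_ne_zero_iff _ (σ ^ i).injective).2 hc0
    set d := c * ((σ ^ i) c)⁻¹ with hd
    have hd1 : 1 - d ≠ 0 := by
      rw [sub_ne_zero]
      intro h
      apply hc
      rw [hd, ← div_eq_mul_inv, eq_div_iff hsc, one_mul] at h
      exact h
    have key : ∀ y, LinearMap.trace k K (mono σ ((1 - d) * y) i) = 0 := fun y => by
      have h1 := trace_conj_eq hc0 (mono σ y i)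
      rw [mulLeft_mul_mono, mono_mul_mulLeft, map_inv₀] at h1
      rw [sub_mul, one_mul, mono_sub, map_sub, sub_eq_zero, ← h1]
      congr 2
      rw [hd]
      ring
    have := key ((1 - d)⁻¹ * x)
    rwa [mul_inv_cancel_left₀ hd1] at this

/-- The powers of `σ` are independent over `K` by Dedekind, and their number is the dimension of the
endomorphism algebra over `K`. -/
lemma exists_eq_sum_mono (X : Module.End k K) :
    ∃ x : ℕ → K, X = ∑ i ∈ Finset.range (Module.finrank k K), mono σ (x i) i := by
  set n := Module.finrank k K with hn
  have hli : LinearIndependent K (fun i : Fin n => ((σ ^ (i : ℕ) : K ≃ₐ[k] K) : K →ₐ[k] K).toLinearMap) := by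
    refine (linearIndependent_algHom_toLinearMap k K K).comp
      (fun i : Fin n => ((σ ^ (i : ℕ) : K ≃ₐ[k] K) : K →ₐ[k] K)) fun i j hij => ?_
    have h1 : σ ^ (i : ℕ) = σ ^ (j : ℕ) := AlgEquiv.ext fun x => DFunLike.congr_fun hij x
    exact Fin.ext (pow_injOn_Iio_orderOf (by simp [hσ]) (by simp [hσ]) h1)
  have hspan := hli.span_eq_top_of_card_eq_finrank' (by
    rw [Fintype.card_fin, Module.finrank_linearMap_self])
  have hX : X ∈ Submodule.span K (Set.range fun i : Fin n =>
    ((σ ^ (i : ℕ) : K ≃ₐ[k] K) : K →ₐ[k] K).toLinearMap) := hspan ▸ Submodule.mem_top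
  obtain ⟨c, hc⟩ := (Submodule.mem_span_range_iff_exists_fun K).1 hX
  refine ⟨fun i => if h : i < n then c ⟨i, h⟩ else 0, ?_⟩
  rw [Finset.sum_range, ← hc]
  refine Finset.sum_congr rfl fun i _ => ?_
  ext z
  simp

lemma IsPrimitiveElt.pow_apply_ne {a : K} (ha : IsPrimitiveElt k a) {i : ℕ} (h0 : 0 < i)
    (h1 : i < Module.finrank k K) : (σ ^ i) a ≠ a := by
  intro h
  have h2 : ((σ ^ i : K ≃ₐ[k] K) : K →ₐ[k] K) = AlgHom.id k K :=
    AlgHom.ext_of_adjoin_eq_top ha.adjoin_eq_top (by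
      rintro x rfl
      exact h)
  have h3 : σ ^ i = 1 := AlgEquiv.ext fun x => DFunLike.congr_fun h2 x
  rw [← orderOf_dvd_iff_pow_eq_one, hσ] at h3
  exact not_dvd_of_lt h0 h1 h3

/-- The commutator pairing of a sum of monomials with a single monomial only sees the coefficient
in the complementary degree. -/
lemma trace_commutator_mono (a y : K) (x : ℕ → K) {S : Finset ℕ}
    (hS : ∀ i ∈ S, i < Module.finrank k K) {j : ℕ} (hj0 : 0 < j) (hj : j < Module.finrank k K) :
    LinearMap.trace k K (LinearMap.mulLeft k a * ((∑ i ∈ S, mono σ (x i) i)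
      * mono σ y (Module.finrank k K - j) - mono σ y (Module.finrank k K - j) *
        ∑ i ∈ S, mono σ (x i) i)) =
      if j ∈ S then Algebra.trace k K ((a - (σ ^ j) a) * (x j * (σ ^ j) y)) else 0 := by
  set n := Module.finrank k K with hn
  -- The degree `i + (n - j)` lies strictly between `0` and `2n`, so it is divisible by `n` only
  -- when it equals `n`.
  have hdvd : ∀ i ∈ S, n ∣ i + (n - j) ↔ i = j := fun i hi => by
    have := hS i hi
    constructor
    · rintro ⟨c, hc⟩
      have h1 : c = 1 := by
        have h2 : 0 < n * c := by omega
        have h3 : n * c < n * 2 := by omega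
        have h4 : 0 < c := Nat.pos_of_mul_pos_left h2
        have h5 : c < 2 := Nat.lt_of_mul_lt_mul_left h3
        omega
      subst h1
      omega
    · rintro rfl
      exact ⟨1, by omega⟩
  have h1 : ∀ i ∈ S, LinearMap.trace k K (LinearMap.mulLeft k a * (mono σ (x i) i * mono σ y (n - j)
      - mono σ y (n - j) * mono σ (x i) i)) =
      if i = j then Algebra.trace k K ((a - (σ ^ j) a) * (x j * (σ ^ j) y)) else 0 := fun i hi => by
    rw [mul_sub, mono_mul_mono, mono_mul_mono, mulLeft_mul_mono, mulLeft_mul_mono, map_sub,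
      trace_mono hσ, trace_mono hσ, add_comm (n - j), ← hn]
    simp only [hdvd i hi]
    split_ifs with h
    · subst h
      -- Applying `σ ^ i` under the trace brings both orders of the product to the same shape; their
      -- difference then shows the factor `a - σ ^ i a`.
      have h2 : Algebra.trace k K (a * (y * (σ ^ (n - i)) (x i)))
          = Algebra.trace k K ((σ ^ i) (a * y) * x i) := by
        rw [← Algebra.trace_eq_of_algEquiv (σ ^ i)]
        congr 1
        rw [← mul_assoc, map_mul, ← AlgEquiv.mul_apply, ← pow_add, show i + (n - i) = n by omega,
          ← hσ, pow_orderOf_eq_one, AlgEquiv.one_apply]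
      rw [h2, ← map_sub]
      congr 1
      rw [map_mul]
      ring
    · rw [sub_zero]
  rw [Finset.sum_mul, Finset.mul_sum, ← Finset.sum_sub_distrib, Finset.mul_sum, map_sum,
    Finset.sum_congr rfl h1, Finset.sum_ite_eq']

omit hσ
omit [FiniteDimensional k K]

/-- The endomorphisms whose expansion in powers of `σ` is supported on `S`. -/
def degs (σ : K ≃ₐ[k] K) (S : Finset ℕ) : AddSubgroup (Module.End k K) where
  carrier := {X | ∃ x : ℕ → K, X = ∑ i ∈ S, mono σ (x i) i}
  zero_mem' := ⟨0, by simp⟩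
  add_mem' := by
    rintro _ _ ⟨x, rfl⟩ ⟨y, rfl⟩
    exact ⟨x + y, by simp [mono_add, Finset.sum_add_distrib]⟩
  neg_mem' := by
    rintro _ ⟨x, rfl⟩
    exact ⟨-x, by simp [mono_neg]⟩

lemma mono_mem_degs {S : Finset ℕ} {i : ℕ} (hi : i ∈ S) (x : K) : mono σ x i ∈ degs σ S := by
  classical
  refine ⟨fun j => if j = i then x else 0, ?_⟩
  rw [Finset.sum_eq_single i (fun j _ hj => by simp [hj]) (fun h => absurd hi h)]
  simp

lemma degs_mono {S T : Finset ℕ} (h : S ⊆ T) : degs σ S ≤ degs σ T := by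
  rintro _ ⟨x, rfl⟩
  exact sum_mem fun i hi => mono_mem_degs (h hi) _

lemma conj_mem_degs {S : Finset ℕ} {X : Module.End k K} (hX : X ∈ degs σ S) (x y : K) :
    LinearMap.mulLeft k x * X * LinearMap.mulLeft k y ∈ degs σ S := by
  obtain ⟨z, rfl⟩ := hX
  rw [Finset.mul_sum, Finset.sum_mul]
  refine sum_mem fun i hi => ?_
  rw [mulLeft_mul_mono, mono_mul_mulLeft]
  exact mono_mem_degs hi _

/-- The commutator of `c` with `X`, in coordinates. -/
lemma sub_conj_sum_mono {c : K} {S : Finset ℕ} (x : ℕ → K) :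
    ∑ i ∈ S, mono σ (x i) i - LinearMap.mulLeft k c * (∑ i ∈ S, mono σ (x i) i)
      * LinearMap.mulLeft k c⁻¹ = ∑ i ∈ S, mono σ ((1 - c * ((σ ^ i) c)⁻¹) * x i) i := by
  rw [Finset.mul_sum, Finset.sum_mul, ← Finset.sum_sub_distrib]
  refine Finset.sum_congr rfl fun i _ => ?_
  rw [mulLeft_mul_mono, mono_mul_mulLeft, ← mono_sub, map_inv₀]
  congr 1
  ring

lemma one_sub_mul_inv_ne_zero {c : K} (hc : c ≠ 0) {i : ℕ} (h : (σ ^ i) c ≠ c) :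
    1 - c * ((σ ^ i) c)⁻¹ ≠ 0 := by
  have hsc : (σ ^ i) c ≠ 0 := (map_ne_zero_iff _ (σ ^ i).injective).2 hc
  rw [sub_ne_zero]
  intro h1
  rw [← div_eq_mul_inv, eq_div_iff hsc, one_mul] at h1
  exact h h1

variable [FiniteDimensional k K]

include hσ

/-- The pairing with monomials of complementary degrees detects coefficients. -/
lemma eq_zero_of_forall_trace_commutator [Algebra.IsSeparable k K] {φ : AddChar k ℂ} (hφ : φ ≠ 1)
    {a : K} (ha : IsPrimitiveElt k a) {x : ℕ → K} {S : Finset ℕ}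
    (hS : ∀ i ∈ S, i < Module.finrank k K) {j : ℕ} (hj0 : 0 < j) (hj : j ∈ S)
    (h : ∀ y, φ (LinearMap.trace k K (LinearMap.mulLeft k a * ((∑ i ∈ S, mono σ (x i) i)
      * mono σ y (Module.finrank k K - j) - mono σ y (Module.finrank k K - j) *
        ∑ i ∈ S, mono σ (x i) i))) = 1) : x j = 0 := by
  by_contra hx
  apply hφ
  refine DFunLike.ext _ _ fun t => ?_
  obtain ⟨z, hz⟩ := Algebra.trace_surjective k K t
  have hne : a - (σ ^ j) a ≠ 0 :=
    sub_ne_zero.2 (Ne.symm (ha.pow_apply_ne hσ hj0 (hS j hj)))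
  -- The coefficient is chosen so that the pairing becomes the trace of `z`, an arbitrary element of
  -- `k`.
  have := h ((σ ^ j).symm ((x j)⁻¹ * ((a - (σ ^ j) a)⁻¹ * z)))
  rw [trace_commutator_mono hσ a _ x hS hj0 (hS j hj), if_pos hj, AlgEquiv.apply_symm_apply,
    mul_inv_cancel_left₀ hx, mul_inv_cancel_left₀ hne, hz] at this
  rw [this, AddChar.one_apply]

lemma trace_mulLeft_mul_eq_zero {S : Finset ℕ} (hS : ∀ i ∈ S, 0 < i ∧ i < Module.finrank k K)
    {X : Module.End k K} (hX : X ∈ degs σ S) (a : K) :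
    LinearMap.trace k K (LinearMap.mulLeft k a * X) = 0 := by
  obtain ⟨x, rfl⟩ := hX
  rw [Finset.mul_sum, map_sum]
  refine Finset.sum_eq_zero fun i hi => ?_
  rw [mulLeft_mul_mono, trace_mono hσ, if_neg (not_dvd_of_lt (hS i hi).1 (hS i hi).2)]

/-- Only degrees divisible by `n` have a trace, and no degree of the product is one. -/
lemma trace_mulLeft_mul_mul_eq_zero {S T : Finset ℕ}
    (hST : ∀ i ∈ S, ∀ j ∈ T, 0 < i + j ∧ i + j < Module.finrank k K)
    {X Y : Module.End k K} (hX : X ∈ degs σ S) (hY : Y ∈ degs σ T) (a : K) :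
    LinearMap.trace k K (LinearMap.mulLeft k a * (X * Y)) = 0 := by
  obtain ⟨x, rfl⟩ := hX
  obtain ⟨y, rfl⟩ := hY
  rw [Finset.sum_mul_sum, Finset.mul_sum, map_sum]
  refine Finset.sum_eq_zero fun i hi => ?_
  rw [Finset.mul_sum, map_sum]
  refine Finset.sum_eq_zero fun j hj => ?_
  rw [mono_mul_mono, mulLeft_mul_mono, trace_mono hσ,
    if_neg (not_dvd_of_lt (hST i hi j hj).1 (hST i hi j hj).2)]

lemma eq_zero_of_mulLeft_mem_degs [Algebra.IsSeparable k K] {S : Finset ℕ}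
    (hS : ∀ i ∈ S, 0 < i ∧ i < Module.finrank k K)
    {z : K} (hz : LinearMap.mulLeft k z ∈ degs σ S) : z = 0 := by
  by_contra hz0
  obtain ⟨w, hw⟩ := Algebra.trace_surjective k K 1
  have := trace_mulLeft_mul_eq_zero hσ hS hz (w * z⁻¹)
  rw [show LinearMap.mulLeft k (w * z⁻¹) * LinearMap.mulLeft k z = LinearMap.mulLeft k w by
    ext y; simp [hz0], trace_mulLeft, hw] at this
  exact one_ne_zero this

/-- An endomorphism whose commutators pair trivially with everything is a multiplication. -/
lemma exists_eq_mulLeft_of_trace_commutator [Algebra.IsSeparable k K] {φ : AddChar k ℂ}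
    (hφ : φ ≠ 1) {a : K} (ha : IsPrimitiveElt k a) {X : Module.End k K}
    (h : ∀ Y, φ (LinearMap.trace k K (LinearMap.mulLeft k a * (X * Y - Y * X))) = 1) :
    ∃ z, X = LinearMap.mulLeft k z := by
  obtain ⟨x, rfl⟩ := exists_eq_sum_mono hσ X
  refine ⟨x 0, ?_⟩
  rw [Finset.sum_eq_single 0, mono_zero_right]
  · intro j hj hj0
    rw [eq_zero_of_forall_trace_commutator hσ hφ ha (fun i hi => Finset.mem_range.1 hi)
      (Nat.pos_of_ne_zero hj0) hj (fun y => h _), mono_zero]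
  · intro h0
    exact absurd (Finset.mem_range.2 Module.finrank_pos) h0

/-- A degree above `n / 2` is dual to one in `lowDegs`, so the pairing detects its coefficient. -/
lemma mem_degs_orthDegs_of_trace_commutator [Algebra.IsSeparable k K] {φ : AddChar k ℂ}
    (hφ : φ ≠ 1) {a : K} (ha : IsPrimitiveElt k a) {X : Module.End k K}
    (h : ∀ Y ∈ degs σ (lowDegs (Module.finrank k K)),
      φ (LinearMap.trace k K (LinearMap.mulLeft k a * (X * Y - Y * X))) = 1) :
    X ∈ degs σ (orthDegs (Module.finrank k K)) := by
  obtain ⟨x, rfl⟩ := exists_eq_sum_mono hσ X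
  refine sum_mem fun i hi => ?_
  rw [Finset.mem_range] at hi
  by_cases hin : i ∈ orthDegs (Module.finrank k K)
  · exact mono_mem_degs hin _
  · simp only [orthDegs, Finset.mem_range, not_lt] at hin
    rw [eq_zero_of_forall_trace_commutator hσ hφ ha (fun i hi => Finset.mem_range.1 hi)
      (by omega) (Finset.mem_range.2 hi) (fun y => h _ (mono_mem_degs (by
        rw [Finset.mem_Ico]; omega) y)), mono_zero]
    exact zero_mem _

/-- Besides degree zero, only a middle degree `n / 2`, for even `n`, separates `orthDegs` from
`lowDegs`. It is dual to itself, so pairing within `orthDegs` detects it. -/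
lemma exists_sub_mulLeft_mem_degs_lowDegs [Algebra.IsSeparable k K] {φ : AddChar k ℂ}
    (hφ : φ ≠ 1) {a : K} (ha : IsPrimitiveElt k a) {X : Module.End k K}
    (hX : X ∈ degs σ (orthDegs (Module.finrank k K)))
    (h : ∀ Y ∈ degs σ (orthDegs (Module.finrank k K)),
      φ (LinearMap.trace k K (LinearMap.mulLeft k a * (X * Y - Y * X))) = 1) :
    ∃ z, X - LinearMap.mulLeft k z ∈ degs σ (lowDegs (Module.finrank k K)) := by
  have hpos := Module.finrank_pos (R := k) (M := K)
  obtain ⟨x, rfl⟩ := hX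
  refine ⟨x 0, ?_⟩
  rw [Finset.sum_range_succ', mono_zero_right, add_sub_cancel_right]
  refine sum_mem fun i hi => ?_
  rw [Finset.mem_range] at hi
  by_cases hin : i + 1 ∈ lowDegs (Module.finrank k K)
  · exact mono_mem_degs hin _
  · rw [Finset.mem_Ico] at hin
    rw [eq_zero_of_forall_trace_commutator hσ hφ ha (j := i + 1)
      (fun i hi => by rw [Finset.mem_range] at hi; omega)
      (by omega) (Finset.mem_range.2 (by omega)) (fun y => h _ (mono_mem_degs (by
        rw [Finset.mem_range]; omega) y)), mono_zero]
    exact zero_mem _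

/-- In degree `i` the map `W ↦ W - c W c⁻¹` multiplies coefficients by `1 - c / σ ^ i c`, which is
nonzero because `c` is fixed by no nontrivial power of `σ`. -/
lemma IsPrimitiveElt.exists_sub_conj_eq {c : K} (hc : IsPrimitiveElt k c) (hc0 : c ≠ 0)
    {S : Finset ℕ} (hS : ∀ i ∈ S, 0 < i ∧ i < Module.finrank k K) {X : Module.End k K}
    (hX : X ∈ degs σ S) : ∃ W ∈ degs σ S,
      W - LinearMap.mulLeft k c * W * LinearMap.mulLeft k c⁻¹ = X := by
  obtain ⟨x, rfl⟩ := hX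
  refine ⟨_, ⟨fun i => (1 - c * ((σ ^ i) c)⁻¹)⁻¹ * x i, rfl⟩, ?_⟩
  rw [sub_conj_sum_mono]
  refine Finset.sum_congr rfl fun i hi => ?_
  rw [mul_inv_cancel_left₀
    (one_sub_mul_inv_ne_zero hc0 (hc.pow_apply_ne hσ (hS i hi).1 (hS i hi).2))]

/-- Degrees whose power of `σ` moves `c` lie in the image of `W ↦ W - c W c⁻¹`. In a nonzero degree
whose power of `σ` fixes `c`, the dual monomials commute with `c`, so the hypothesis kills the
coefficient. Degree zero is absorbed by `z`. This decides which elements of `J` are conjugate into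
`N_l 𝔒_k^×`. -/
lemma exists_sub_conj_add_mulLeft_eq [Algebra.IsSeparable k K] {φ : AddChar k ℂ}
    (hφ : φ ≠ 1) {a : K} (ha : IsPrimitiveElt k a) {c : K} (hc0 : c ≠ 0) {X : Module.End k K}
    (h : ∀ Y, LinearMap.mulLeft k c * Y = Y * LinearMap.mulLeft k c →
      φ (LinearMap.trace k K (LinearMap.mulLeft k a * (X * Y - Y * X))) = 1) :
    ∃ W z, W - LinearMap.mulLeft k c * W * LinearMap.mulLeft k c⁻¹ + LinearMap.mulLeft k z = X := by
  classical
  have hpos := Module.finrank_pos (R := k) (M := K)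
  obtain ⟨x, rfl⟩ := exists_eq_sum_mono hσ X
  have hfix : ∀ j ∈ Finset.range (Module.finrank k K), 0 < j → (σ ^ j) c = c → x j = 0 :=
    fun j hj hj0 hjc => eq_zero_of_forall_trace_commutator hσ hφ ha
      (fun i hi => Finset.mem_range.1 hi) hj0 hj fun y => h _ (by
        have h1 : (σ ^ (Module.finrank k K - j)) c = c := by
          conv_lhs => rw [← hjc]
          rw [← AlgEquiv.mul_apply, ← pow_add, Nat.sub_add_cancel (Finset.mem_range.1 hj).le, ← hσ,
            pow_orderOf_eq_one, AlgEquiv.one_apply]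
        rw [mulLeft_mul_mono, mono_mul_mulLeft, h1, mul_comm])
  -- Where `σ ^ i` fixes `c` the inverse is `0⁻¹ = 0`, so `W` has no component in that degree.
  refine ⟨∑ i ∈ Finset.range (Module.finrank k K), mono σ ((1 - c * ((σ ^ i) c)⁻¹)⁻¹ * x i) i,
    x 0, ?_⟩
  have h0 : LinearMap.mulLeft k (x 0) = ∑ i ∈ Finset.range (Module.finrank k K),
      mono σ (if i = 0 then x i else 0) i := by
    rw [Finset.sum_eq_single 0 (fun i _ hi => by simp [hi])
      (fun hn => absurd (Finset.mem_range.2 hpos) hn), if_pos rfl, mono_zero_right]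
  rw [sub_conj_sum_mono, h0, ← Finset.sum_add_distrib]
  refine Finset.sum_congr rfl fun i hi => ?_
  rw [← mono_add]
  congr 1
  split_ifs with hi0
  · subst hi0
    simp [hc0]
  · rw [add_zero]
    by_cases hic : (σ ^ i) c = c
    · rw [hfix i hi (Nat.pos_of_ne_zero hi0) hic, mul_zero, mul_zero]
    · rw [mul_inv_cancel_left₀ (one_sub_mul_inv_ne_zero hc0 hic)]

/-- In even degree, the middle monomials represent the orthogonal complement modulo the maximal
isotropic subspace. -/
lemma exists_sub_mono_mem_degs {X : Module.End k K} (hn : Even (Module.finrank k K))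
    (hX : X ∈ degs σ (orthDegs (Module.finrank k K))) :
    ∃ y z, X - LinearMap.mulLeft k z - mono σ y (Module.finrank k K / 2) ∈
      degs σ (lowDegs (Module.finrank k K)) := by
  obtain ⟨x, rfl⟩ := hX
  obtain ⟨m, hm⟩ := hn
  have hpos := Module.finrank_pos (R := k) (M := K)
  refine ⟨x (Module.finrank k K / 2), x 0, ?_⟩
  obtain ⟨m', hm'⟩ : ∃ m', Module.finrank k K / 2 = m' + 1 :=
    ⟨Module.finrank k K / 2 - 1, by omega⟩
  rw [orthDegs, Finset.sum_range_succ, hm', Finset.sum_range_succ', mono_zero_right]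
  have : ∀ A B C : Module.End k K, A + B + C - B - C = A := fun A B C => by abel
  rw [this]
  refine sum_mem fun i hi => mono_mem_degs ?_ _
  rw [Finset.mem_range] at hi
  rw [Finset.mem_Ico]
  omega

/-- Multiply by a monomial of degree `n / 2` and take traces: neither the low degrees nor degree
zero can reach degree `n`, while the middle coefficient does and can be given trace `1`. -/
lemma eq_zero_of_mono_mem_degs [Algebra.IsSeparable k K] (hn : Even (Module.finrank k K))
    {y z : K} (h : LinearMap.mulLeft k z + mono σ y (Module.finrank k K / 2) ∈
      degs σ (lowDegs (Module.finrank k K))) : y = 0 := by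
  by_contra hy0
  obtain ⟨m, hm⟩ := hn
  have hpos := Module.finrank_pos (R := k) (M := K)
  obtain ⟨w, hw⟩ := Algebra.trace_surjective k K 1
  have h1 := trace_mulLeft_mul_mul_eq_zero hσ
    (S := lowDegs (Module.finrank k K)) (T := {Module.finrank k K / 2})
    (fun i hi j hj => by
      rw [Finset.mem_Ico] at hi
      rw [Finset.mem_singleton] at hj
      omega) h (mono_mem_degs (Finset.mem_singleton_self _) ((σ ^ (Module.finrank k K / 2)).symm 
        (y⁻¹ * w))) 1
  have h2 : Module.finrank k K / 2 + Module.finrank k K / 2 = Module.finrank k K := by omega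
  rw [add_mul, mulLeft_mul_mono, mono_mul_mono, mul_add, mulLeft_mul_mono, mulLeft_mul_mono,
    map_add, trace_mono hσ, trace_mono hσ, h2,
    if_neg (not_dvd_of_lt (by omega) (by omega)), if_pos dvd_rfl, zero_add, one_mul,
    AlgEquiv.apply_symm_apply, mul_inv_cancel_left₀ hy0, hw] at h1
  exact one_ne_zero h1

omit hσ
omit [FiniteDimensional k K]

lemma mono_sub_conj {c y : K} (i : ℕ) :
    mono σ y i - LinearMap.mulLeft k c * mono σ y i * LinearMap.mulLeft k c⁻¹ =
      mono σ ((1 - c * ((σ ^ i) c)⁻¹) * y) i := by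
  rw [mulLeft_mul_mono, mono_mul_mulLeft, ← mono_sub, map_inv₀]
  congr 1
  ring

end FrobeniusDecomposition

/-! ### Duality for a compatible family of additive characters on a ring. -/

section Duality

variable {A : Type u} [Ring A] {ϖ : A} {Ψ : ℕ → AddChar A ℂ}

/-- Testing on multiples of `ϖ ^ m` reduces level `m + 1` to level one, which yields one factor `ϖ`;
cancelling it lowers the level. The ring need not be commutative, so that matrices and `𝔒` are both
covered. -/
lemma exists_eq_pow_mul_of_forall_eq_one (hϖ : ∀ x, Commute ϖ x)
    (hΨ : ∀ m x, Ψ (m + 1) (ϖ * x) = Ψ m x) (h1 : ∀ a, (∀ x, Ψ 1 (a * x) = 1) → ϖ ∣ a)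
    (m : ℕ) {a : A} (ha : ∀ x, Ψ m (a * x) = 1) : ϖ ^ m ∣ a := by
  have hpow : ∀ j m x, Ψ (m + j) (ϖ ^ j * x) = Ψ m x := fun j => by
    induction j with
    | zero => intro m x; simp
    | succ j ih => intro m x; rw [pow_succ', mul_assoc, ← add_assoc, hΨ, ih]
  induction m generalizing a with
  | zero => simp
  | succ m ih =>
    obtain ⟨c, rfl⟩ := h1 a fun x => by
      rw [← hpow m, ← mul_assoc, ((hϖ a).pow_left m).eq, mul_assoc, add_comm]
      exact ha _
    rw [pow_succ']
    exact mul_dvd_mul_left _ (ih fun x => by rw [← hΨ, ← mul_assoc]; exact ha x)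

/-- At level one the pairing embeds the finite group `Q` into its dual, which has the same order.
For higher levels, `f` on `ϖ ^ m A` is a character of level one; dividing `f` by an extension of it
leaves a character of level `m`. -/
lemma exists_forall_eq_of_forall_pow_mul {Q : Type v} [AddCommGroup Q] [Finite Q] {r : A →+ Q}
    (hr : Function.Surjective r) (hker : ∀ x, r x = 0 ↔ ϖ ∣ x) (hϖ : ∀ x, Commute ϖ x)
    (h0 : ∀ x, Ψ 0 x = 1) (hΨ : ∀ m x, Ψ (m + 1) (ϖ * x) = Ψ m x)
    (h1 : ∀ a, (∀ x, Ψ 1 (a * x) = 1) → ϖ ∣ a)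
    (m : ℕ) (f : AddChar A ℂ) (hf : ∀ x, f (ϖ ^ m * x) = 1) :
    ∃ a, ∀ x, f x = Ψ m (a * x) := by
  classical
  have hone : ∀ f : AddChar A ℂ, (∀ x, f (ϖ * x) = 1) → ∃ a, ∀ x, f x = Ψ 1 (a * x) := by
    intro f hf
    cases nonempty_fintype Q
    set s := Function.surjInv hr with hs
    have hrs : ∀ q, r (s q) = q := Function.surjInv_eq hr
    have hwd : ∀ (g : AddChar A ℂ), (∀ x, g (ϖ * x) = 1) → ∀ x y, r x = r y → g x = g y := by
      intro g hg x y hxy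
      obtain ⟨c, hc⟩ := (hker (x - y)).1 (by rw [map_sub, hxy, sub_self])
      rw [← sub_add_cancel x y, hc, AddChar.map_add_eq_mul, hg, one_mul]
    let G : ∀ (g : AddChar A ℂ), (∀ x, g (ϖ * x) = 1) → AddChar Q ℂ := fun g hg =>
      { toFun := fun q => g (s q)
        map_zero_eq_one' := by
          rw [hwd g hg (s 0) 0 (by rw [hrs, map_zero]), AddChar.map_zero_eq_one]
        map_add_eq_mul' := fun p q => by
          rw [← AddChar.map_add_eq_mul, hwd g hg (s (p + q)) (s p + s q)]
          rw [map_add, hrs, hrs, hrs] }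
    let B : A → AddChar A ℂ := fun a =>
      { toFun := fun x => Ψ 1 (a * x)
        map_zero_eq_one' := by simp
        map_add_eq_mul' := fun x y => by rw [mul_add, AddChar.map_add_eq_mul] }
    have hB : ∀ a x, B a (ϖ * x) = 1 := fun a x => by
      change Ψ 1 (a * (ϖ * x)) = 1
      rw [← mul_assoc, ← (hϖ a).eq, mul_assoc, hΨ, h0]
    let D : Q → AddChar Q ℂ := fun q => G (B (s q)) (hB _)
    have hD : Function.Injective D := fun p q hpq => by
      have : ∀ x, Ψ 1 ((s p - s q) * x) = 1 := fun x => by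
        have h2 := DFunLike.congr_fun hpq (r x)
        change B (s p) (s (r x)) = B (s q) (s (r x)) at h2
        rw [hwd _ (hB _) (s (r x)) x (hrs _), hwd _ (hB _) (s (r x)) x (hrs _)] at h2
        change Ψ 1 (s p * x) = Ψ 1 (s q * x) at h2
        have h3 : Ψ 1 (s q * x) ≠ 0 := (AddChar.val_isUnit _ _).ne_zero
        rw [sub_mul, AddChar.map_sub_eq_div, h2, div_self h3]
      have h2 := (hker _).2 (h1 _ this)
      rwa [map_sub, hrs, hrs, sub_eq_zero] at h2
    -- Injectivity becomes surjectivity by counting.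
    have hcard : Fintype.card Q = Fintype.card (AddChar Q ℂ) := AddChar.card_eq.symm
    obtain ⟨q, hq⟩ := ((Fintype.bijective_iff_injective_and_card D).2 ⟨hD, hcard⟩).2 (G f hf)
    refine ⟨s q, fun x => ?_⟩
    have h2 := DFunLike.congr_fun hq (r x)
    change B (s q) (s (r x)) = f (s (r x)) at h2
    rw [hwd _ (hB _) (s (r x)) x (hrs _), hwd _ hf (s (r x)) x (hrs _)] at h2
    exact h2.symm
  have hpow : ∀ j m x, Ψ (m + j) (ϖ ^ j * x) = Ψ m x := fun j => by
    induction j with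
    | zero => intro m x; simp
    | succ j ih => intro m x; rw [pow_succ', mul_assoc, ← add_assoc, hΨ, ih]
  induction m generalizing f with
  | zero =>
    refine ⟨0, fun x => ?_⟩
    rw [h0]
    simpa using hf x
  | succ m ih =>
    obtain ⟨c, hc⟩ := hone
      { toFun := fun x => f (ϖ ^ m * x)
        map_zero_eq_one' := by simp
        map_add_eq_mul' := fun x y => by rw [mul_add, AddChar.map_add_eq_mul] }
      (fun x => by
        change f (ϖ ^ m * (ϖ * x)) = 1
        rw [← mul_assoc, ← pow_succ]
        exact hf x)
    -- The quotient of `f` by `x ↦ Ψ (m + 1) (c * x)` is trivial on `ϖ ^ m A`, so the induction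
    -- hypothesis supplies `d`, and `c + ϖ d` works for `f`.
    obtain ⟨d, hd⟩ := ih
      { toFun := fun x => f x * Ψ (m + 1) (-(c * x))
        map_zero_eq_one' := by simp
        map_add_eq_mul' := fun x y => by
          rw [mul_add, neg_add, AddChar.map_add_eq_mul, AddChar.map_add_eq_mul]
          ring }
      (fun x => by
        change f (ϖ ^ m * x) * Ψ (m + 1) (-(c * (ϖ ^ m * x))) = 1
        have h2 : f (ϖ ^ m * x) = Ψ 1 (c * x) := hc x
        rw [h2, ← mul_assoc, ← ((hϖ c).pow_left m).eq, mul_assoc, ← mul_neg, add_comm m,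
          hpow, ← AddChar.map_add_eq_mul, add_neg_cancel, AddChar.map_zero_eq_one])
    refine ⟨c + ϖ * d, fun x => ?_⟩
    have h2 : f x * Ψ (m + 1) (-(c * x)) = Ψ m (d * x) := hd x
    rw [add_mul, AddChar.map_add_eq_mul, mul_assoc, hΨ, ← h2, mul_comm (f x), ← mul_assoc,
      ← AddChar.map_add_eq_mul, add_neg_cancel, AddChar.map_zero_eq_one, one_mul]

end Duality

/-! ### Trace characters on `M_n(𝔬)` and `𝔒`, and reduction to the residue fields. -/

section Arithmetic

variable {F : Type u} [Field F] [ValuativeRel F] [TopologicalSpace F]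
  [IsNonarchimedeanLocalField F]
variable {E : Type v} [Field E] [Algebra F E]
variable {n : ℕ}

variable {ϖ : 𝒪[F]}

lemma mem_maximalIdeal_pow_iff (hϖ : Irreducible ϖ) (m : ℕ) (x : 𝒪[F]) :
    x ∈ 𝓂[F] ^ m ↔ ϖ ^ m ∣ x := by
  rw [hϖ.maximalIdeal_eq, Ideal.span_singleton_pow, Ideal.mem_span_singleton]

lemma coe_uniformizer_ne_zero (hϖ : Irreducible ϖ) : (ϖ : F) ≠ 0 := fun h =>
  hϖ.ne_zero (Subtype.ext h)

lemma mem_pe_pow_iff (hϖ : Irreducible ϖ) (m : ℕ) (x : OE F E) :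
    x ∈ PE F E ^ m ↔ algebraMap 𝒪[F] (OE F E) ϖ ^ m ∣ x := by
  rw [PE, hϖ.maximalIdeal_eq, Ideal.map_span, Set.image_singleton, Ideal.span_singleton_pow,
    Ideal.mem_span_singleton]

/-- The additive character `X ↦ ψ (ϖ ^ (-m) tr X)` of `M_n(𝔬)`. -/
def trChar (n : ℕ) (ψ : AddChar F ℂ) (ϖ : 𝒪[F]) (m : ℕ) : AddChar (Matrix (Fin n) (Fin n) 𝒪[F]) ℂ where
  toFun X := ψ ((X.trace : F) / (ϖ : F) ^ m)
  map_zero_eq_one' := by simp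
  map_add_eq_mul' X Y := by
    rw [Matrix.trace_add, Subring.coe_add, add_div, AddChar.map_add_eq_mul]

variable {ψ : AddChar F ℂ}

lemma psiMat_eq (m : ℕ) (A B : Matrix (Fin n) (Fin n) 𝒪[F]) :
    psiMat ψ ϖ m A B = trChar n ψ ϖ m (A * B) := rfl

lemma trChar_mul_comm (m : ℕ) (A B : Matrix (Fin n) (Fin n) 𝒪[F]) :
    trChar n ψ ϖ m (A * B) = trChar n ψ ϖ m (B * A) := by
  change ψ _ = ψ _
  rw [Matrix.trace_mul_comm]

lemma trChar_add_smul (hϖ : Irreducible ϖ) (m j : ℕ) (X : Matrix (Fin n) (Fin n) 𝒪[F]) :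
    trChar n ψ ϖ (m + j) (ϖ ^ j • X) = trChar n ψ ϖ m X := by
  change ψ _ = ψ _
  congr 1
  rw [Matrix.trace_smul, smul_eq_mul, Subring.coe_mul, Subring.coe_pow, pow_add, mul_comm,
    mul_div_mul_right _ _ (pow_ne_zero _ (coe_uniformizer_ne_zero hϖ))]

lemma trChar_eq_one (hϖ : Irreducible ϖ) (hψ : ∀ x : 𝒪[F], ψ (x : F) = 1) {m j : ℕ} (h : m ≤ j)
    (X : Matrix (Fin n) (Fin n) 𝒪[F]) : trChar n ψ ϖ m (ϖ ^ j • X) = 1 := by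
  obtain ⟨i, rfl⟩ := Nat.exists_eq_add_of_le h
  rw [pow_add, mul_smul]
  have h2 := trChar_add_smul (ψ := ψ) hϖ 0 m (ϖ ^ i • X)
  rw [zero_add] at h2
  rw [h2]
  change ψ _ = 1
  rw [pow_zero, div_one]
  exact hψ _

lemma exists_residue_char (hϖ : Irreducible ϖ) (hψ : ∀ x : 𝒪[F], ψ (x : F) = 1)
    (hψ' : ∃ x : 𝒪[F], ψ ((x : F) / (ϖ : F)) ≠ 1) :
    ∃ φ : AddChar 𝓀[F] ℂ, φ ≠ 1 ∧
      ∀ x : 𝒪[F], ψ ((x : F) / (ϖ : F)) = φ (IsLocalRing.residue 𝒪[F] x) := by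
  have hs : Function.Surjective (IsLocalRing.residue 𝒪[F]) := IsLocalRing.residue_surjective
  set s := Function.surjInv hs
  have hrs : ∀ q, IsLocalRing.residue 𝒪[F] (s q) = q := Function.surjInv_eq hs
  have hwd : ∀ x y : 𝒪[F], IsLocalRing.residue 𝒪[F] x = IsLocalRing.residue 𝒪[F] y →
      ψ ((x : F) / (ϖ : F)) = ψ ((y : F) / (ϖ : F)) := fun x y h => by
    rw [← sub_eq_zero, ← map_sub, IsLocalRing.residue_eq_zero_iff, ← pow_one 𝓂[F],
      mem_maximalIdeal_pow_iff hϖ, pow_one] at h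
    obtain ⟨c, hc⟩ := h
    have : (x : F) / ϖ = y / ϖ + c := by
      rw [eq_comm, div_add' _ _ _ (coe_uniformizer_ne_zero hϖ)]
      congr 1
      rw [sub_eq_iff_eq_add] at hc
      rw [hc]
      push_cast
      ring
    rw [this, AddChar.map_add_eq_mul, hψ, mul_one]
  refine ⟨{ toFun := fun q => ψ ((s q : F) / ϖ), map_zero_eq_one' := ?_, map_add_eq_mul' := ?_ },
    ?_, ?_⟩
  · rw [hwd (s 0) 0 (by rw [hrs, map_zero])]
    simp
  · intro p q
    rw [← AddChar.map_add_eq_mul, hwd (s (p + q)) (s p + s q) (by rw [map_add, hrs, hrs, hrs]),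
      Subring.coe_add, add_div]
  · obtain ⟨x, hx⟩ := hψ'
    intro h
    apply hx
    have := DFunLike.congr_fun h (IsLocalRing.residue 𝒪[F] x)
    rw [AddChar.one_apply] at this
    rw [← this]
    exact hwd _ _ (hrs _).symm
  · intro x
    exact hwd _ _ (hrs _).symm

lemma finite_OE (b : Module.Basis (Fin n) 𝒪[F] (OE F E)) : Module.Finite 𝒪[F] (OE F E) :=
  Module.Finite.of_basis b

lemma free_OE (b : Module.Basis (Fin n) 𝒪[F] (OE F E)) : Module.Free 𝒪[F] (OE F E) :=
  Module.Free.of_basis b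

/-- The residue field of `E`, with its field structure and its algebra structure only. -/
def ResE (F : Type u) [Field F] [ValuativeRel F] [TopologicalSpace F]
    [IsNonarchimedeanLocalField F] (E : Type v) [Field E] [Algebra F E] : Type v := OResidue F E

section

variable [IsUnramifiedExtension F E]

instance : Field (ResE F E) := inferInstanceAs (Field (OResidue F E))

instance : Algebra 𝓀[F] (ResE F E) := inferInstanceAs (Algebra 𝓀[F] (OResidue F E))

end

/-- The basis of the residue field obtained by reducing a basis of `𝔒`. -/
def resBasis [IsUnramifiedExtension F E] (b : Module.Basis (Fin n) 𝒪[F] (OE F E)) : Module.Basis (Fin n) 𝓀[F] (ResE F E) :=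
  haveI := finite_OE b
  haveI := free_OE b
  IsLocalRing.basisQuotient b

variable (b : Module.Basis (Fin n) 𝒪[F] (OE F E)) 

/-- Reduction `𝔒 → 𝔒_1`. -/
def resO (F : Type u) [Field F] [ValuativeRel F] [TopologicalSpace F]
    [IsNonarchimedeanLocalField F] (E : Type v) [Field E] [Algebra F E] [IsUnramifiedExtension F E] : OE F E →+* ResE F E :=
  (Ideal.Quotient.mk (PE F E) : OE F E →+* OResidue F E)

lemma resO_surjective [IsUnramifiedExtension F E] : Function.Surjective (resO F E) := Ideal.Quotient.mk_surjective

variable [IsUnramifiedExtension F E]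

lemma resBasis_repr (x : OE F E) (i : Fin n) :
    (resBasis b).repr (resO F E x) i = IsLocalRing.residue 𝒪[F] (b.repr x i) := by
  have := finite_OE b
  have := free_OE b
  exact IsLocalRing.basisQuotient_repr b x i

lemma resBasis_apply (i : Fin n) : resBasis b i = resO F E (b i) := by
  have := finite_OE b
  have := free_OE b
  exact IsLocalRing.basisQuotient_apply b i

include b in
lemma finrank_resE : Module.finrank 𝓀[F] (ResE F E) = n := by
  rw [Module.finrank_eq_card_basis (resBasis b), Fintype.card_fin]

include b in
lemma finiteDimensional_resE : FiniteDimensional 𝓀[F] (ResE F E) :=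
  Module.Finite.of_basis (resBasis b)

include b in
lemma finite_resE : Finite (ResE F E) := by
  have := finiteDimensional_resE b
  exact Module.finite_of_finite 𝓀[F]

/-- Reduction `M_n(𝔬) → End(𝔒_1)`. -/
def redMat : Matrix (Fin n) (Fin n) 𝒪[F] →+* Module.End 𝓀[F] (ResE F E) :=
  (Matrix.toLinAlgEquiv (resBasis b)).toRingEquiv.toRingHom.comp (IsLocalRing.residue 𝒪[F]).mapMatrix

lemma redMat_apply (X : Matrix (Fin n) (Fin n) 𝒪[F]) :
    redMat b X = Matrix.toLin (resBasis b) (resBasis b) (X.map (IsLocalRing.residue 𝒪[F])) := rfl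

lemma redMat_surjective : Function.Surjective (redMat b) := by
  intro T
  obtain ⟨M, rfl⟩ := (Matrix.toLinAlgEquiv (resBasis b)).surjective T
  refine ⟨M.map (Function.surjInv (IsLocalRing.residue_surjective (R := 𝒪[F]))), ?_⟩
  rw [redMat_apply]
  change _ = Matrix.toLin (resBasis b) (resBasis b) M
  congr 1
  ext i j
  simp [Function.surjInv_eq]

lemma redMat_eq_zero_iff (hϖ : Irreducible ϖ) (X : Matrix (Fin n) (Fin n) 𝒪[F]) :
    redMat b X = 0 ↔ ∃ Y, X = ϖ • Y := by
  rw [redMat_apply, LinearEquiv.map_eq_zero_iff]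
  constructor
  · intro h
    have h2 : ∀ i j, ϖ ∣ X i j := fun i j => by
      have := congrFun (congrFun h i) j
      rw [Matrix.map_apply, Matrix.zero_apply, IsLocalRing.residue_eq_zero_iff, ← pow_one 𝓂[F],
        mem_maximalIdeal_pow_iff hϖ, pow_one] at this
      exact this
    choose Y hY using h2
    exact ⟨Matrix.of Y, by ext i j; simp [hY]⟩
  · rintro ⟨Y, rfl⟩
    ext i j
    rw [Matrix.map_apply, Matrix.zero_apply, IsLocalRing.residue_eq_zero_iff, ← pow_one 𝓂[F],
        mem_maximalIdeal_pow_iff hϖ, pow_one]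
    exact ⟨Y i j, rfl⟩

lemma redMat_smul_eq_zero (hϖ : Irreducible ϖ) (X : Matrix (Fin n) (Fin n) 𝒪[F]) :
    redMat b (ϖ • X) = 0 := (redMat_eq_zero_iff b hϖ _).2 ⟨X, rfl⟩

lemma trace_redMat (X : Matrix (Fin n) (Fin n) 𝒪[F]) :
    LinearMap.trace 𝓀[F] (ResE F E) (redMat b X) = IsLocalRing.residue 𝒪[F] X.trace := by
  rw [redMat_apply, Matrix.trace_toLin_eq, AddMonoidHom.map_trace]

lemma redMat_leftMulMatrix (x : OE F E) :
    redMat b (Algebra.leftMulMatrix b x) = LinearMap.mulLeft 𝓀[F] (resO F E x) := by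
  rw [redMat_apply, ← LinearMap.toMatrix_symm, LinearEquiv.symm_apply_eq]
  ext i j
  rw [Matrix.map_apply, Algebra.leftMulMatrix_eq_repr_mul, LinearMap.toMatrix_apply,
    resBasis_apply, LinearMap.mulLeft_apply, ← map_mul, resBasis_repr]

lemma resO_eq_zero_iff (hϖ : Irreducible ϖ) (x : OE F E) :
    resO F E x = 0 ↔ algebraMap 𝒪[F] (OE F E) ϖ ∣ x := by
  refine (Ideal.Quotient.eq_zero_iff_mem (I := PE F E)).trans ?_
  rw [← pow_one (PE F E), mem_pe_pow_iff hϖ, pow_one]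

lemma leftMulMatrix_smul (c : 𝒪[F]) (x : OE F E) :
    Algebra.leftMulMatrix b (algebraMap 𝒪[F] (OE F E) c * x) = c • Algebra.leftMulMatrix b x := by
  rw [map_mul, AlgHom.commutes, Algebra.smul_def]

lemma trChar_one_eq {φ : AddChar 𝓀[F] ℂ}
    (hφ : ∀ x : 𝒪[F], ψ ((x : F) / (ϖ : F)) = φ (IsLocalRing.residue 𝒪[F] x))
    (X : Matrix (Fin n) (Fin n) 𝒪[F]) :
    trChar n ψ ϖ 1 X = φ (LinearMap.trace 𝓀[F] (ResE F E) (redMat b X)) := by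
  rw [trace_redMat, ← hφ]
  change ψ _ = ψ _
  rw [pow_one]

omit [IsUnramifiedExtension F E] in
lemma commute_smul_one (X : Matrix (Fin n) (Fin n) 𝒪[F]) : Commute (ϖ • 1) X :=
  (Commute.one_left X).smul_left ϖ

omit [IsUnramifiedExtension F E] in
lemma smul_one_pow (m : ℕ) :
    (ϖ • 1 : Matrix (Fin n) (Fin n) 𝒪[F]) ^ m = ϖ ^ m • 1 := by
  rw [smul_pow, one_pow]

omit [IsUnramifiedExtension F E] in
lemma trChar_succ_smul_mul (hϖ : Irreducible ϖ) (m : ℕ) (X : Matrix (Fin n) (Fin n) 𝒪[F]) :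
    trChar n ψ ϖ (m + 1) (ϖ • 1 * X) = trChar n ψ ϖ m X := by
  rw [smul_mul_assoc, one_mul]
  simpa using trChar_add_smul (ψ := ψ) hϖ m 1 X

section Dual

variable (hϖ : Irreducible ϖ) (hψ : ∀ x : 𝒪[F], ψ (x : F) = 1)
  (hψ' : ∃ x : 𝒪[F], ψ ((x : F) / (ϖ : F)) ≠ 1)

include hϖ hψ hψ'

/-- Elementary matrices single out one entry of `a`; a unit entry would make every value `ψ (x / ϖ)`
trivial. -/
lemma trChar_one_nondegenerate (a : Matrix (Fin n) (Fin n) 𝒪[F])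
    (ha : ∀ x, trChar n ψ ϖ 1 (a * x) = 1) : ϖ • 1 ∣ a := by
  have : ∀ i j, ϖ ∣ a i j := fun i j => by
    by_contra h
    have hu : IsUnit (a i j) := by
      by_contra hu
      have h2 : a i j ∈ 𝓂[F] := hu
      rw [← pow_one 𝓂[F], mem_maximalIdeal_pow_iff hϖ, pow_one] at h2
      exact h h2
    obtain ⟨y, hy⟩ := hu.exists_right_inv
    obtain ⟨x, hx⟩ := hψ'
    apply hx
    rw [← ha (Matrix.single j i (y * x))]
    change _ = ψ _
    rw [Matrix.trace_mul_single, pow_one]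
    have : a i j * (y * x) = x := by rw [← mul_assoc, hy, one_mul]
    rw [MulOpposite.smul_eq_mul_unop, MulOpposite.unop_op, this]
  choose c hc using this
  refine ⟨Matrix.of c, ?_⟩
  ext i j
  simp [hc]

lemma eq_smul_of_forall_trChar_eq_one (m : ℕ) {a : Matrix (Fin n) (Fin n) 𝒪[F]}
    (ha : ∀ x, trChar n ψ ϖ m (a * x) = 1) : ∃ c, a = ϖ ^ m • c := by
  obtain ⟨c, hc⟩ := exists_eq_pow_mul_of_forall_eq_one (Ψ := trChar n ψ ϖ) commute_smul_one
    (trChar_succ_smul_mul hϖ) (trChar_one_nondegenerate hϖ hψ hψ') m ha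
  exact ⟨c, by rw [hc, smul_one_pow, smul_mul_assoc, one_mul]⟩

lemma exists_trChar_eq (m : ℕ) (f : AddChar (Matrix (Fin n) (Fin n) 𝒪[F]) ℂ)
    (hf : ∀ x, f (ϖ ^ m • x) = 1) : ∃ a, ∀ x, f x = trChar n ψ ϖ m (a * x) := by
  refine exists_forall_eq_of_forall_pow_mul (Q := Matrix (Fin n) (Fin n) 𝓀[F]) (ϖ := ϖ • 1)
    (r := (IsLocalRing.residue 𝒪[F]).mapMatrix.toAddMonoidHom) ?_ ?_ commute_smul_one ?_
    (trChar_succ_smul_mul hϖ) (trChar_one_nondegenerate hϖ hψ hψ') m f ?_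
  · intro M
    refine ⟨M.map (Function.surjInv (IsLocalRing.residue_surjective (R := 𝒪[F]))), ?_⟩
    ext i j
    simp [Function.surjInv_eq]
  · intro X
    constructor
    · intro h
      have h2 : ∀ i j, ϖ ∣ X i j := fun i j => by
        have : IsLocalRing.residue 𝒪[F] (X i j) = 0 := congrFun (congrFun h i) j
        rw [IsLocalRing.residue_eq_zero_iff, ← pow_one 𝓂[F],
          mem_maximalIdeal_pow_iff hϖ, pow_one] at this
        exact this
      choose Y hY using h2
      exact ⟨Matrix.of Y, by ext i j; simp [hY]⟩
    · rintro ⟨Y, rfl⟩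
      ext i j
      change IsLocalRing.residue 𝒪[F] ((ϖ • 1 * Y : Matrix (Fin n) (Fin n) 𝒪[F]) i j) = 0
      rw [IsLocalRing.residue_eq_zero_iff, ← pow_one 𝓂[F],
          mem_maximalIdeal_pow_iff hϖ, pow_one]
      exact ⟨Y i j, by simp⟩
  · intro x
    have := trChar_eq_one (m := 0) (j := 0) hϖ hψ le_rfl x
    rwa [pow_zero, one_smul] at this
  · intro x
    rw [smul_one_pow, smul_mul_assoc, one_mul]
    exact hf x

/-- The additive character `x ↦ ψ (ϖ ^ (-m) tr x)` of `𝔒`. -/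
abbrev trCharO (b : Module.Basis (Fin n) 𝒪[F] (OE F E)) (ψ : AddChar F ℂ) (ϖ : 𝒪[F]) (m : ℕ) :
    AddChar (OE F E) ℂ :=
  (trChar n ψ ϖ m).compAddMonoidHom (Algebra.leftMulMatrix b).toRingHom.toAddMonoidHom

omit hψ hψ' in
lemma trCharO_succ_mul (m : ℕ) (x : OE F E) :
    trCharO b ψ ϖ (m + 1) (algebraMap 𝒪[F] (OE F E) ϖ * x) = trCharO b ψ ϖ m x := by
  change trChar n ψ ϖ (m + 1) (Algebra.leftMulMatrix b _) = trChar n ψ ϖ m (Algebra.leftMulMatrix b x)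
  rw [leftMulMatrix_smul]
  simpa using trChar_add_smul (ψ := ψ) hϖ m 1 _

/-- A nonzero residue of `a` could be inverted, and the trace of the residue extension, which is
separable, is surjective; then `φ` would be trivial. -/
lemma trCharO_one_nondegenerate (a : OE F E)
    (ha : ∀ x, trCharO b ψ ϖ 1 (a * x) = 1) : algebraMap 𝒪[F] (OE F E) ϖ ∣ a := by
  obtain ⟨φ, hφ1, hφ⟩ := exists_residue_char hϖ hψ hψ'
  rw [← resO_eq_zero_iff hϖ]
  by_contra h
  apply hφ1
  refine DFunLike.ext _ _ fun t => ?_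
  have := finiteDimensional_resE b
  have := finite_resE b
  obtain ⟨z, hz⟩ := Algebra.trace_surjective 𝓀[F] (ResE F E) t
  obtain ⟨x, hx⟩ := resO_surjective ((resO F E a)⁻¹ * z)
  have := ha x
  change trChar n ψ ϖ 1 (Algebra.leftMulMatrix b (a * x)) = 1 at this
  rw [trChar_one_eq b hφ, redMat_leftMulMatrix, trace_mulLeft, map_mul, hx,
    mul_inv_cancel_left₀ h, hz] at this
  rw [this, AddChar.one_apply]

lemma eq_mul_of_forall_trChar_leftMulMatrix_eq_one (m : ℕ) {a : OE F E}
    (ha : ∀ x, trChar n ψ ϖ m (Algebra.leftMulMatrix b (a * x)) = 1) :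
    algebraMap 𝒪[F] (OE F E) ϖ ^ m ∣ a :=
  exists_eq_pow_mul_of_forall_eq_one (Ψ := trCharO b ψ ϖ) (fun _ => Commute.all _ _)
    (trCharO_succ_mul b hϖ) (trCharO_one_nondegenerate b hϖ hψ hψ') m ha

lemma exists_trChar_leftMulMatrix_eq (m : ℕ) (f : AddChar (OE F E) ℂ)
    (hf : ∀ x, f (algebraMap 𝒪[F] (OE F E) ϖ ^ m * x) = 1) :
    ∃ a, ∀ x, f x = trChar n ψ ϖ m (Algebra.leftMulMatrix b (a * x)) := by
  have := finite_resE b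
  refine exists_forall_eq_of_forall_pow_mul (Q := ResE F E)
    (r := (resO F E).toAddMonoidHom) (Ψ := trCharO b ψ ϖ)
    resO_surjective (resO_eq_zero_iff hϖ) (fun _ => Commute.all _ _) ?_
    (trCharO_succ_mul b hϖ) (trCharO_one_nondegenerate b hϖ hψ hψ') m f hf
  intro x
  have := trChar_eq_one (m := 0) (j := 0) hϖ hψ le_rfl (Algebra.leftMulMatrix b x)
  rwa [pow_zero, one_smul] at this

end Dual

end Arithmetic

/-! ### Cyclic vectors, companion matrices and irreducible matrices. -/

section Krylov

open Matrix Polynomial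

variable {n : ℕ}

/-- The matrix with columns `v, A v, A ^ 2 v, …`. -/
def krylov {R : Type u} [CommRing R] (A : Matrix (Fin n) (Fin n) R) (v : Fin n → R) :
    Matrix (Fin n) (Fin n) R := Matrix.of fun i j => ((A ^ (j : ℕ)) *ᵥ v) i

/-- The companion matrix of a polynomial of degree `n`. -/
def companionMat (n : ℕ) {R : Type u} [CommRing R] (f : R[X]) : Matrix (Fin n) (Fin n) R :=
  Matrix.of fun i j => if (j : ℕ) + 1 < n then (if (i : ℕ) = j + 1 then 1 else 0) else - f.coeff i

/-- Multiplication by `A` shifts the columns by one, and `f(A) = 0` expresses the new last column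
through the old ones. -/
lemma mul_krylov {R : Type u} [CommRing R] {A : Matrix (Fin n) (Fin n) R} (v : Fin n → R)
    {f : R[X]} (hf : f.Monic) (hfn : f.natDegree = n) (hA : aeval A f = 0) :
    A * krylov A v = krylov A v * companionMat n f := by
  have hcol : ∀ j : Fin n, (A * krylov A v).col j = (A ^ ((j : ℕ) + 1)) *ᵥ v := fun j => by
    rw [pow_succ', ← mulVec_mulVec]
    rfl
  ext i j
  have h1 : (A * krylov A v) i j = ((A ^ ((j : ℕ) + 1)) *ᵥ v) i := congrFun (hcol j) i
  rw [h1, mul_apply]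
  simp only [krylov, companionMat, of_apply]
  split_ifs with hj
  · rw [Finset.sum_eq_single ⟨(j : ℕ) + 1, hj⟩]
    · simp
    · intro k _ hk
      rw [if_neg, mul_zero]
      exact fun h => hk (Fin.ext h)
    · intro h
      exact absurd (Finset.mem_univ _) h
  · have hjn : (j : ℕ) + 1 = n := by omega
    rw [hjn]
    have h2 : A ^ n = - ∑ k : Fin n, f.coeff k • A ^ (k : ℕ) := by
      rw [aeval_eq_sum_range, Finset.sum_range_succ, hfn, Finset.sum_range] at hA
      have h3 : f.coeff n = 1 := by rw [← hfn]; exact hf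
      rw [h3, one_smul] at hA
      rw [eq_neg_iff_add_eq_zero, add_comm]
      exact hA
    rw [h2, neg_mulVec, sum_mulVec, Pi.neg_apply, Finset.sum_apply, ← Finset.sum_neg_distrib]
    refine Finset.sum_congr rfl fun k _ => ?_
    rw [smul_mulVec, Pi.smul_apply, smul_eq_mul]
    ring

/-- By Cayley–Hamilton and `mul_krylov` the column space is stable under `A`, and it contains `v ≠
0`; so it is everything. -/
lemma IsIrreducibleMatrix.isUnit_krylov {K : Type u} [Field K] {A : Matrix (Fin n) (Fin n) K}
    (hA : IsIrreducibleMatrix A) {v : Fin n → K} (hv : v ≠ 0) : IsUnit (krylov A v) := by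
  have hn : 0 < n := by
    by_contra h
    obtain rfl : n = 0 := by omega
    exact hv (Subsingleton.elim _ _)
  have hmul := mul_krylov v A.charpoly_monic (by
    rw [Matrix.charpoly_natDegree_eq_dim, Fintype.card_fin]) (Matrix.aeval_self_charpoly A)
  rw [← Matrix.mulVec_surjective_iff_isUnit]
  have htop : LinearMap.range (krylov A v).mulVecLin = ⊤ := by
    refine (hA _ ?_).resolve_left ?_
    · rintro _ ⟨c, rfl⟩
      refine ⟨companionMat n A.charpoly *ᵥ c, ?_⟩
      rw [mulVecLin_apply, mulVecLin_apply, mulVec_mulVec, mulVec_mulVec, hmul]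
    · intro h
      apply hv
      have h2 : v ∈ LinearMap.range (krylov A v).mulVecLin := by
        refine ⟨Pi.single ⟨0, hn⟩ 1, ?_⟩
        rw [mulVecLin_apply, mulVec_single_one]
        ext i
        simp [krylov]
      rw [h] at h2
      exact (Submodule.mem_bot K).1 h2
  exact LinearMap.range_eq_top.1 htop

lemma krylov_map {R : Type u} {K : Type v} [CommRing R] [CommRing K] (r : R →+* K)
    (A : Matrix (Fin n) (Fin n) R) (v : Fin n → R) :
    (krylov A v).map r = krylov (A.map r) (r ∘ v) := by
  ext i j
  rw [map_apply, krylov, krylov, of_apply, of_apply, RingHom.map_mulVec]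
  congr 2
  exact map_pow r.mapMatrix A j

lemma isUnit_of_isUnit_map_residue {R : Type u} [CommRing R] [IsLocalRing R]
    {A : Matrix (Fin n) (Fin n) R} (h : IsUnit (A.map (IsLocalRing.residue R))) : IsUnit A := by
  rw [Matrix.isUnit_iff_isUnit_det] at h ⊢
  change IsUnit (Matrix.det ((IsLocalRing.residue R).mapMatrix A)) at h
  rw [← RingHom.map_det] at h
  exact isUnit_of_map_unit (IsLocalRing.residue R) _ h

/-- Two residually irreducible matrices killed by the same polynomial of degree `n` are
conjugate. -/
lemma exists_conj_of_aeval_eq_zero {R : Type u} [CommRing R] [IsLocalRing R] (hn : 0 < n)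
    {A A' : Matrix (Fin n) (Fin n) R} {f : R[X]} (hf : f.Monic) (hfn : f.natDegree = n)
    (hA : aeval A f = 0) (hA' : aeval A' f = 0)
    (hi : IsIrreducibleMatrix (A.map (IsLocalRing.residue R)))
    (hi' : IsIrreducibleMatrix (A'.map (IsLocalRing.residue R))) :
    ∃ g : (Matrix (Fin n) (Fin n) R)ˣ, g * A = A' * g := by
  -- Any vector with nonzero residue would serve.
  set v : Fin n → R := fun _ => 1
  have hv : (IsLocalRing.residue R) ∘ v ≠ 0 := fun h => by
    have := congrFun h ⟨0, hn⟩
    simp [v] at this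
  have hu : ∀ {A : Matrix (Fin n) (Fin n) R},
      IsIrreducibleMatrix (A.map (IsLocalRing.residue R)) → IsUnit (krylov A v) := fun {A} hi =>
    isUnit_of_isUnit_map_residue (by rw [krylov_map]; exact hi.isUnit_krylov hv)
  obtain ⟨k, hk⟩ := hu hi
  obtain ⟨k', hk'⟩ := hu hi'
  have h1 := mul_krylov v hf hfn hA
  have h2 := mul_krylov v hf hfn hA'
  rw [← hk] at h1
  rw [← hk'] at h2
  -- Both matrices are conjugated to the same companion matrix by their Krylov matrices, which are
  -- invertible because they are so residually.
  refine ⟨k' * k⁻¹, ?_⟩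
  have h3 : (k⁻¹ : (Matrix (Fin n) (Fin n) R)ˣ) * A = companionMat n f * (k⁻¹ : (Matrix (Fin n) (Fin n) R)ˣ) := by
    rw [Units.inv_mul_eq_iff_eq_mul, ← mul_assoc, ← h1, Units.mul_inv_cancel_right]
  rw [Units.val_mul, ← mul_assoc, h2, mul_assoc, h3, mul_assoc]

/-- A polynomial of smaller degree killing `A` would be a linear relation between the columns of an
invertible Krylov matrix. -/
lemma IsIrreducibleMatrix.le_natDegree {K : Type u} [Field K] (hn : 0 < n)
    {A : Matrix (Fin n) (Fin n) K} (hA : IsIrreducibleMatrix A) {h : K[X]} (hm : h ≠ 0)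
    (h0 : aeval A h = 0) : n ≤ h.natDegree := by
  by_contra hlt
  rw [not_le] at hlt
  set v : Fin n → K := fun _ => 1
  have hv : v ≠ 0 := fun h => one_ne_zero (congrFun h ⟨0, hn⟩)
  have hinj := Matrix.mulVec_injective_iff_isUnit.2 (hA.isUnit_krylov hv)
  have h1 : (fun i : Fin n => h.coeff i) = 0 := by
    apply hinj
    rw [mulVec_zero]
    ext i
    have h2 : (aeval A h *ᵥ v) i = 0 := by rw [h0, zero_mulVec]; rfl
    rw [aeval_eq_sum_range' hlt, Finset.sum_range, sum_mulVec, Finset.sum_apply] at h2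
    rw [Pi.zero_apply, ← h2, mulVec, dotProduct]
    refine Finset.sum_congr rfl fun j _ => ?_
    rw [smul_mulVec, Pi.smul_apply, smul_eq_mul, mul_comm]
    rfl
  apply hm
  have h3 := congrFun h1 ⟨h.natDegree, hlt⟩
  exact leadingCoeff_eq_zero.1 h3

/-- For a factorization `g h` the kernel of `h(A)` is invariant, so either `h(A)` is invertible and
`g(A) = 0`, or `h(A) = 0`. Each contradicts the degree bound `le_natDegree`. -/
lemma IsIrreducibleMatrix.irreducible_charpoly {K : Type u} [Field K] (hn : 0 < n)
    {A : Matrix (Fin n) (Fin n) K} (hA : IsIrreducibleMatrix A) : Irreducible A.charpoly := by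
  have hdeg : A.charpoly.natDegree = n := by
    rw [Matrix.charpoly_natDegree_eq_dim, Fintype.card_fin]
  rw [A.charpoly_monic.irreducible_iff_natDegree']
  refine ⟨fun h => ?_, fun g h hg hh hgh hmem => ?_⟩
  · rw [h, natDegree_one] at hdeg
    omega
  rw [hdeg, Finset.mem_Ioc] at hmem
  have h0 : aeval A g * aeval A h = 0 := by
    rw [← map_mul, hgh, Matrix.aeval_self_charpoly]
  have hsum : g.natDegree + h.natDegree = n := by
    rw [← hg.natDegree_mul hh, hgh, hdeg]
  have hcomm : A * aeval A h = aeval A h * A := by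
    have : aeval A (X * h) = aeval A (h * X) := by rw [mul_comm]
    simpa using this
  rcases hA (LinearMap.ker (aeval A h).mulVecLin) (fun x hx => by
    rw [LinearMap.mem_ker, mulVecLin_apply] at hx ⊢
    rw [mulVec_mulVec, ← hcomm, ← mulVec_mulVec, hx, mulVec_zero]) with hk | hk
  · rw [LinearMap.ker_eq_bot] at hk
    have hu : IsUnit (aeval A h) := Matrix.mulVec_injective_iff_isUnit.1 hk
    have hg0 : aeval A g = 0 := hu.mul_left_eq_zero.1 h0
    have := hA.le_natDegree hn hg.ne_zero hg0
    omega
  · rw [LinearMap.ker_eq_top] at hk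
    have hh0 : aeval A h = 0 := by
      ext i j
      have := congrFun (LinearMap.congr_fun hk (Pi.single j 1)) i
      simpa using this
    have := hA.le_natDegree hn hh.ne_zero hh0
    omega

end Krylov

/-! ### Completeness of `𝔒` and Hensel's lemma. -/

section Hensel

open Polynomial

variable {F : Type u} [Field F] [ValuativeRel F] [TopologicalSpace F]
  [IsNonarchimedeanLocalField F]
variable {E : Type v} [Field E] [Algebra F E]
variable {n : ℕ} {ϖ : 𝒪[F]}

lemma isAdicComplete_integers : IsAdicComplete 𝓂[F] 𝒪[F] := by
  letI := IsTopologicalAddGroup.rightUniformSpace F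
  haveI := isUniformAddGroup_of_addCommGroup (G := F)
  infer_instance

lemma mem_pe_pow_iff_repr (hϖ : Irreducible ϖ) (b : Module.Basis (Fin n) 𝒪[F] (OE F E)) (m : ℕ)
    (x : OE F E) : x ∈ PE F E ^ m ↔ ∀ i, b.repr x i ∈ 𝓂[F] ^ m := by
  simp_rw [mem_pe_pow_iff hϖ, mem_maximalIdeal_pow_iff hϖ]
  constructor
  · rintro ⟨y, rfl⟩ i
    rw [← map_pow, ← Algebra.smul_def, map_smul]
    exact ⟨_, rfl⟩
  · intro h
    choose y hy using h
    refine ⟨∑ i, y i • b i, ?_⟩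
    rw [← map_pow, ← Algebra.smul_def, Finset.smul_sum, ← b.sum_repr x]
    refine Finset.sum_congr rfl fun i _ => ?_
    rw [smul_smul, ← hy]

/-- Since `𝔓` is generated by `ϖ`, congruences modulo its powers can be read off the coordinates in
the basis `b`, and completeness is inherited from `𝔬` coordinatewise. -/
lemma isAdicComplete_OE (hϖ : Irreducible ϖ) (b : Module.Basis (Fin n) 𝒪[F] (OE F E)) :
    IsAdicComplete (PE F E) (OE F E) := by
  have hc := isAdicComplete_integers (F := F)
  have hS : ∀ (m : ℕ) (x y : OE F E), x ≡ y [SMOD (PE F E ^ m • ⊤ : Submodule (OE F E) (OE F E))] ↔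
      ∀ i, b.repr x i ≡ b.repr y i [SMOD (𝓂[F] ^ m • ⊤ : Submodule 𝒪[F] 𝒪[F])] := fun m x y => by
    simp_rw [SModEq.sub_mem, smul_eq_mul, Ideal.mul_top, mem_pe_pow_iff_repr hϖ b, map_sub]
    rfl
  refine { haus' := fun x hx => ?_, prec' := fun f hf => ?_ }
  · refine b.repr.map_eq_zero_iff.1 (Finsupp.ext fun i => ?_)
    exact hc.haus' _ fun m => by simpa using (hS m x 0).1 (hx m) i
  · have := fun i => hc.prec' (fun m => b.repr (f m) i) fun {m k} h => (hS _ _ _).1 (hf h) i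
    choose L hL using this
    refine ⟨∑ i, L i • b i, fun m => (hS _ _ _).2 fun i => ?_⟩
    rw [b.repr_sum_self]
    exact hL i m

variable [IsUnramifiedExtension F E]

/-- Completeness places `𝔓` in the Jacobson radical, so inverses modulo `𝔓` lift. -/
lemma isUnit_of_resO_ne_zero (hϖ : Irreducible ϖ) (b : Module.Basis (Fin n) 𝒪[F] (OE F E))
    {x : OE F E} (hx : resO F E x ≠ 0) : IsUnit x := by
  have := isAdicComplete_OE hϖ b
  obtain ⟨y, hy⟩ := resO_surjective (resO F E x)⁻¹
  have h1 : x * y - 1 ∈ PE F E := by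
    refine (Ideal.Quotient.eq_zero_iff_mem (I := PE F E)).1 ?_
    change resO F E (x * y - 1) = 0
    rw [map_sub, map_mul, hy, mul_inv_cancel₀ hx, map_one, sub_self]
  have h2 := IsAdicComplete.le_jacobson_bot (PE F E) h1
  rw [Ideal.mem_jacobson_bot] at h2
  have h3 := h2 1
  rw [mul_one, sub_add_cancel] at h3
  exact isUnit_of_mul_isUnit_left h3

lemma exists_root_of_simple_root (hϖ : Irreducible ϖ) (b : Module.Basis (Fin n) 𝒪[F] (OE F E))
    {f : 𝒪[F][X]} (hf : f.Monic) {a₀ : OE F E} (h0 : resO F E (aeval a₀ f) = 0)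
    (h1 : resO F E (aeval a₀ (derivative f)) ≠ 0) :
    ∃ a : OE F E, aeval a f = 0 ∧ resO F E a = resO F E a₀ := by
  have := isAdicComplete_OE hϖ b
  have h2 : HenselianRing (OE F E) (PE F E) := inferInstance
  obtain ⟨a, ha, ha'⟩ := h2.is_henselian (f.map (algebraMap 𝒪[F] (OE F E))) (hf.map _) a₀
    (by
      rw [eval_map_algebraMap]
      exact (Ideal.Quotient.eq_zero_iff_mem (I := PE F E)).1 h0)
    (by
      rw [derivative_map, eval_map_algebraMap]
      exact IsUnit.map _ (isUnit_of_resO_ne_zero hϖ b h1))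
  refine ⟨a, ?_, ?_⟩
  · rwa [IsRoot.def, eval_map_algebraMap] at ha
  · rw [← sub_eq_zero, ← map_sub]
    exact (Ideal.Quotient.eq_zero_iff_mem (I := PE F E)).2 ha'

lemma resO_aeval (f : 𝒪[F][X]) (a : OE F E) :
    resO F E (aeval a f) = aeval (resO F E a) (f.map (IsLocalRing.residue 𝒪[F])) := by
  rw [aeval_def, hom_eval₂, aeval_def, eval₂_map]
  rfl

end Hensel

/-! ### Residually irreducible matrices and residually primitive elements of `𝔒`. -/

section Elliptic

open Polynomial

variable {F : Type u} [Field F] [ValuativeRel F] [TopologicalSpace F]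
  [IsNonarchimedeanLocalField F]
variable {E : Type v} [Field E] [Algebra F E] [IsUnramifiedExtension F E]
variable {n : ℕ} {ϖ : 𝒪[F]} (b : Module.Basis (Fin n) 𝒪[F] (OE F E))

include b in
lemma dim_pos : 0 < n := by
  have := finiteDimensional_resE b
  rw [← finrank_resE b]
  exact Module.finrank_pos

lemma isIrreducibleMatrix_iff (A : Matrix (Fin n) (Fin n) 𝒪[F]) :
    IsIrreducibleMatrix (A.map (IsLocalRing.residue 𝒪[F])) ↔
      ∀ W : Submodule 𝓀[F] (ResE F E), (∀ x ∈ W, redMat b A x ∈ W) → W = ⊥ ∨ W = ⊤ := by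
  have key : ∀ x : Fin n → 𝓀[F], redMat b A ((resBasis b).equivFun.symm x) =
      (resBasis b).equivFun.symm ((A.map (IsLocalRing.residue 𝒪[F])).mulVec x) := fun x => by
    rw [LinearEquiv.eq_symm_apply]
    have h1 := LinearMap.toMatrix_mulVec_repr (resBasis b) (resBasis b) (redMat b A)
      ((resBasis b).equivFun.symm x)
    rw [redMat_apply, LinearMap.toMatrix_toLin] at h1
    have h2 : ⇑((resBasis b).repr ((resBasis b).equivFun.symm x)) = x :=
      LinearEquiv.apply_symm_apply (resBasis b).equivFun x
    rw [h2] at h1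
    exact h1.symm
  constructor
  · intro h W hW
    have := h (W.comap (resBasis b).equivFun.symm.toLinearMap) fun x hx => by
      rw [Submodule.mem_comap] at hx ⊢
      have := hW _ hx
      rw [LinearEquiv.coe_coe, key] at this
      exact this
    rcases this with h1 | h1
    · left
      rw [eq_bot_iff]
      intro x hx
      have h2 : (resBasis b).equivFun x ∈ W.comap (resBasis b).equivFun.symm.toLinearMap := by
        rw [Submodule.mem_comap]
        simpa using hx
      rw [h1, Submodule.mem_bot, LinearEquiv.map_eq_zero_iff] at h2
      exact h2
    · right
      rw [eq_top_iff]
      rintro x -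
      have h2 : (resBasis b).equivFun x ∈ W.comap (resBasis b).equivFun.symm.toLinearMap := by
        rw [h1]; trivial
      rw [Submodule.mem_comap] at h2
      simpa using h2
  · intro h W hW
    have := h (W.comap (resBasis b).equivFun.toLinearMap) fun x hx => by
      rw [Submodule.mem_comap] at hx ⊢
      have h1 := key ((resBasis b).equivFun x)
      rw [LinearEquiv.symm_apply_apply] at h1
      rw [h1, LinearEquiv.coe_coe, LinearEquiv.apply_symm_apply]
      exact hW _ hx
    rcases this with h1 | h1
    · left
      rw [eq_bot_iff]
      intro x hx
      have h2 : (resBasis b).equivFun.symm x ∈ W.comap (resBasis b).equivFun.toLinearMap := by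
        rwa [Submodule.mem_comap, LinearEquiv.coe_coe, LinearEquiv.apply_symm_apply]
      rw [h1, Submodule.mem_bot, LinearEquiv.map_eq_zero_iff] at h2
      exact h2
    · right
      rw [eq_top_iff]
      rintro x -
      have h2 : (resBasis b).equivFun.symm x ∈ W.comap (resBasis b).equivFun.toLinearMap := by
        rw [h1]; trivial
      rwa [Submodule.mem_comap, LinearEquiv.coe_coe, LinearEquiv.apply_symm_apply] at h2

/-- A proper subfield containing the residue of `a` is itself an invariant subspace. If there is
none, that residue generates the field as an algebra, so invariant subspaces are ideals of a field.
-/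
lemma isIrreducibleMatrix_leftMulMatrix_iff (a : OE F E) :
    IsIrreducibleMatrix ((Algebra.leftMulMatrix b a).map (IsLocalRing.residue 𝒪[F])) ↔
      IsPrimitiveElt 𝓀[F] (resO F E a) := by
  have := finiteDimensional_resE b
  rw [isIrreducibleMatrix_iff b, redMat_leftMulMatrix]
  constructor
  · intro h L hL haL
    rcases h (Subalgebra.toSubmodule L.toSubalgebra) (fun x hx => L.mul_mem haL hx) with h1 | h1
    · have h2 : (1 : ResE F E) ∈ Subalgebra.toSubmodule L.toSubalgebra := L.one_mem
      rw [h1, Submodule.mem_bot] at h2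
      exact one_ne_zero h2
    · apply hL
      rw [eq_top_iff]
      rintro x -
      have h2 : x ∈ Subalgebra.toSubmodule L.toSubalgebra := by rw [h1]; trivial
      exact h2
  · intro h W hW
    have hall : ∀ y, ∀ x ∈ W, y * x ∈ W := fun y => by
      have hy : y ∈ Algebra.adjoin 𝓀[F] {resO F E a} := by rw [h.adjoin_eq_top]; trivial
      induction hy using Algebra.adjoin_induction with
      | mem z hz =>
        rw [Set.mem_singleton_iff] at hz
        subst hz
        exact hW
      | algebraMap r =>
        intro x hx
        rw [← Algebra.smul_def]
        exact W.smul_mem _ hx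
      | add p q _ _ hp hq =>
        intro x hx
        rw [add_mul]
        exact W.add_mem (hp x hx) (hq x hx)
      | mul p q _ _ hp hq =>
        intro x hx
        rw [mul_assoc]
        exact hp _ (hq x hx)
    by_cases hW0 : W = ⊥
    · exact Or.inl hW0
    · right
      obtain ⟨x, hx, hx0⟩ := (Submodule.ne_bot_iff W).1 hW0
      rw [eq_top_iff]
      rintro y -
      have := hall (y * x⁻¹) x hx
      rwa [inv_mul_cancel_right₀ hx0] at this

variable {b}

/-- The characteristic polynomial of `A` is residually irreducible of degree `n`, so it has a root
in the residue field of `E`; the root is simple because finite fields are perfect, and Hensel lifts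
it to `a`. Then `A` and multiplication by `a` are killed by the same polynomial of degree `n`, and
`exists_conj_of_aeval_eq_zero` applies. -/
lemma exists_conj_leftMulMatrix (hϖ : Irreducible ϖ) {A : Matrix (Fin n) (Fin n) 𝒪[F]}
    (hA : IsIrreducibleMatrix (A.map (IsLocalRing.residue 𝒪[F]))) :
    ∃ a : OE F E, IsPrimitiveElt 𝓀[F] (resO F E a) ∧ ∃ g : (Matrix (Fin n) (Fin n) 𝒪[F])ˣ,
      g * A = Algebra.leftMulMatrix b a * g := by
  have hn := dim_pos b
  have hfd := finiteDimensional_resE b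
  have hfin := finite_resE b
  set f := A.charpoly with hf
  set f' := f.map (IsLocalRing.residue 𝒪[F]) with hf'
  have hf'' : f' = (A.map (IsLocalRing.residue 𝒪[F])).charpoly := (Matrix.charpoly_map A _).symm
  have hirr : Irreducible f' := by rw [hf'']; exact hA.irreducible_charpoly hn
  have hdeg : f'.natDegree = n := by
    rw [hf'', Matrix.charpoly_natDegree_eq_dim, Fintype.card_fin]
  have hmon : f'.Monic := A.charpoly_monic.map _
  haveI : Fact (Irreducible f') := ⟨hirr⟩
  have : FiniteDimensional 𝓀[F] (AdjoinRoot f') :=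
    (AdjoinRoot.powerBasis hirr.ne_zero).finite
  have hfr : Module.finrank 𝓀[F] (AdjoinRoot f') = Module.finrank 𝓀[F] (ResE F E) := by
    rw [(AdjoinRoot.powerBasis hirr.ne_zero).finrank, AdjoinRoot.powerBasis_dim, hdeg,
      finrank_resE b]
  -- The field generated by a root has the same degree as the residue field of `E`, into which it
  -- therefore embeds.
  obtain ⟨ι⟩ := FiniteField.nonempty_algHom_of_finrank_dvd (F := 𝓀[F]) hfr.dvd
  set r := ι (AdjoinRoot.root f') with hr
  have hroot : aeval r f' = 0 := by
    rw [hr, aeval_algHom_apply, AdjoinRoot.aeval_eq, AdjoinRoot.mk_self, map_zero]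
  have hder : aeval r (derivative f') ≠ 0 :=
    (PerfectField.separable_of_irreducible hirr).aeval_derivative_ne_zero hroot
  obtain ⟨a₀, ha₀⟩ := resO_surjective r
  obtain ⟨a, ha, ha'⟩ := exists_root_of_simple_root hϖ b A.charpoly_monic (a₀ := a₀)
    (by rw [resO_aeval, ha₀]; exact hroot)
    (by rw [resO_aeval, ha₀, ← derivative_map]; exact hder)
  have hprim : IsPrimitiveElt 𝓀[F] (resO F E a) := by
    have h1 : f' = minpoly 𝓀[F] (resO F E a) :=
      minpoly.eq_of_irreducible_of_monic hirr (by rw [ha', ha₀]; exact hroot) hmon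
    have h2 : IntermediateField.adjoin 𝓀[F] {resO F E a} = ⊤ := by
      rw [Field.primitive_element_iff_minpoly_natDegree_eq, ← h1, hdeg, finrank_resE b]
    intro L hL haL
    apply hL
    rw [eq_top_iff, ← h2, IntermediateField.adjoin_simple_le_iff]
    exact haL
  refine ⟨a, hprim, exists_conj_of_aeval_eq_zero hn A.charpoly_monic (by
    rw [Matrix.charpoly_natDegree_eq_dim, Fintype.card_fin]) (Matrix.aeval_self_charpoly A) ?_
    hA ((isIrreducibleMatrix_leftMulMatrix_iff b a).2 hprim)⟩
  rw [aeval_algHom_apply, ha, map_zero]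

/-- A matrix commuting with a residually primitive element up to `ϖ ^ m` is in `𝔒` up to
`ϖ ^ m`. -/
lemma exists_eq_leftMulMatrix_add (hϖ : Irreducible ϖ) {a : OE F E}
    (ha : IsPrimitiveElt 𝓀[F] (resO F E a)) (m : ℕ) (g : Matrix (Fin n) (Fin n) 𝒪[F])
    (hg : ∃ Y, g * Algebra.leftMulMatrix b a - Algebra.leftMulMatrix b a * g = ϖ ^ m • Y) :
    ∃ x Y, g = Algebra.leftMulMatrix b x + ϖ ^ m • Y := by
  have hfd := finiteDimensional_resE b
  induction m generalizing g with
  | zero => exact ⟨0, g, by simp⟩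
  | succ m ih =>
    obtain ⟨Y, hY⟩ := hg
    have h1 : redMat b g * LinearMap.mulLeft 𝓀[F] (resO F E a) =
        LinearMap.mulLeft 𝓀[F] (resO F E a) * redMat b g := by
      rw [← redMat_leftMulMatrix b, ← map_mul, ← map_mul, ← sub_eq_zero, ← map_sub, hY, pow_succ',
        mul_smul, redMat_smul_eq_zero b hϖ]
    -- Residually `g` commutes with a generator of the field, hence is linear over it, hence is a
    -- multiplication. Subtracting a lift of it leaves a multiple of `ϖ`, to which the induction
    -- hypothesis applies.
    have h2 : ∀ y z, redMat b g (y * z) = y * redMat b g z := fun y => by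
      have hy : y ∈ Algebra.adjoin 𝓀[F] {resO F E a} := by rw [ha.adjoin_eq_top]; trivial
      induction hy using Algebra.adjoin_induction with
      | mem z hz =>
        rw [Set.mem_singleton_iff] at hz
        subst hz
        exact fun z => LinearMap.congr_fun h1 z
      | algebraMap r =>
        intro z
        rw [← Algebra.smul_def, map_smul, Algebra.smul_def]
      | add p q _ _ hp hq =>
        intro z
        rw [add_mul, map_add, hp, hq, add_mul]
      | mul p q _ _ hp hq =>
        intro z
        rw [mul_assoc, hp, hq, mul_assoc]
    obtain ⟨x, hx⟩ := resO_surjective (redMat b g 1)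
    have h3 : redMat b (g - Algebra.leftMulMatrix b x) = 0 := by
      rw [map_sub, sub_eq_zero, redMat_leftMulMatrix, hx]
      ext y
      rw [LinearMap.mulLeft_apply, mul_comm, ← h2, mul_one]
    obtain ⟨g', hg'⟩ := (redMat_eq_zero_iff b hϖ _).1 h3
    rw [sub_eq_iff_eq_add'] at hg'
    have h4 : g' * Algebra.leftMulMatrix b a - Algebra.leftMulMatrix b a * g' = ϖ ^ m • Y := by
      have h5 : ϖ • (g' * Algebra.leftMulMatrix b a - Algebra.leftMulMatrix b a * g') =
          ϖ • (ϖ ^ m • Y) := by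
        rw [smul_smul, ← pow_succ', ← hY, hg', add_mul, mul_add, ← map_mul, ← map_mul, mul_comm x,
          smul_mul_assoc, mul_smul_comm, smul_sub]
        abel
      exact smul_right_injective _ hϖ.ne_zero h5
    obtain ⟨x', Y', h6⟩ := ih g' ⟨Y, h4⟩
    refine ⟨x + algebraMap 𝒪[F] (OE F E) ϖ * x', Y', ?_⟩
    rw [hg', h6, map_add, leftMulMatrix_smul, smul_add, smul_smul, ← pow_succ', add_assoc]

lemma leftMulMatrix_eq_smul_iff (hϖ : Irreducible ϖ) (m : ℕ) (x : OE F E) :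
    (∃ Y, Algebra.leftMulMatrix b x = ϖ ^ m • Y) ↔ algebraMap 𝒪[F] (OE F E) ϖ ^ m ∣ x := by
  constructor
  · rintro ⟨Y, hY⟩
    rw [← mem_pe_pow_iff hϖ, mem_pe_pow_iff_repr hϖ b]
    intro i
    have h1 := Algebra.leftMulMatrix_mulVec_repr b x 1
    rw [mul_one] at h1
    rw [← h1, hY, Matrix.smul_mulVec, mem_maximalIdeal_pow_iff hϖ]
    exact ⟨_, rfl⟩
  · rintro ⟨y, rfl⟩
    exact ⟨Algebra.leftMulMatrix b y, by rw [← map_pow, leftMulMatrix_smul]⟩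

/-- Two residually primitive elements which are conjugate modulo `ϖ ^ m` are Galois conjugate
modulo `ϖ ^ m`. -/
lemma exists_gal_of_conj [FiniteDimensional F E] (hE : Module.finrank F E = n)
    (hϖ : Irreducible ϖ) {a a' : OE F E}
    (ha : IsPrimitiveElt 𝓀[F] (resO F E a)) {m : ℕ} (hm : 0 < m)
    (g : (Matrix (Fin n) (Fin n) 𝒪[F])ˣ)
    (hg : ∃ Y, g * Algebra.leftMulMatrix b a - Algebra.leftMulMatrix b a' * g = ϖ ^ m • Y) :
    ∃ (γ : E ≃ₐ[F] E) (c : OE F E),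
      a' = galRestrict 𝒪[F] F E (OE F E) γ a + algebraMap 𝒪[F] (OE F E) ϖ ^ m * c := by
  have hn := dim_pos b
  have hfd := finiteDimensional_resE b
  have hfin := finite_resE b
  set A := Algebra.leftMulMatrix b a with hA
  set f := A.charpoly with hf
  set f' := f.map (IsLocalRing.residue 𝒪[F]) with hf'
  have hf'' : f' = (A.map (IsLocalRing.residue 𝒪[F])).charpoly := (Matrix.charpoly_map A _).symm
  have hirr : Irreducible f' := by
    rw [hf'']
    exact ((isIrreducibleMatrix_leftMulMatrix_iff b a).2 ha).irreducible_charpoly hn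
  have hdegf : f.natDegree = n := by
    rw [Matrix.charpoly_natDegree_eq_dim, Fintype.card_fin]
  have hmonf : f.Monic := A.charpoly_monic
  have hfa : aeval a f = 0 := by
    have h1 := Matrix.aeval_self_charpoly A
    rw [← hf, hA, aeval_algHom_apply] at h1
    exact (map_eq_zero_iff _ (Algebra.leftMulMatrix_injective b)).1 h1
  obtain ⟨Y, hY⟩ := hg
  -- `f(a')` vanishes modulo `ϖ ^ m`
  have hfa' : algebraMap 𝒪[F] (OE F E) ϖ ^ m ∣ aeval a' f := by
    rw [← leftMulMatrix_eq_smul_iff (b := b) hϖ, ← aeval_algHom_apply]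
    -- Conjugacy modulo `ϖ ^ m` passes to polynomials in the two matrices.
    have hpoly : ∀ p : 𝒪[F][X], ∃ Z : Matrix (Fin n) (Fin n) 𝒪[F], (g : Matrix (Fin n) (Fin n) 𝒪[F]) * aeval A p
        - aeval (Algebra.leftMulMatrix b a') p * g = ϖ ^ m • Z := fun p => by
      induction p using Polynomial.induction_on' with
      | add p q hp hq =>
        obtain ⟨Z, hZ⟩ := hp
        obtain ⟨Z', hZ'⟩ := hq
        refine ⟨Z + Z', ?_⟩
        rw [smul_add, ← hZ, ← hZ', map_add, map_add, mul_add, add_mul]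
        abel
      | monomial i c =>
        simp only [aeval_monomial, ← Algebra.smul_def]
        suffices h : ∃ Z : Matrix (Fin n) (Fin n) 𝒪[F], (g : Matrix (Fin n) (Fin n) 𝒪[F]) * A ^ i
            - Algebra.leftMulMatrix b a' ^ i * g = ϖ ^ m • Z by
          obtain ⟨Z, hZ⟩ := h
          refine ⟨c • Z, ?_⟩
          rw [smul_comm, ← hZ, smul_sub, mul_smul_comm, smul_mul_assoc]
        induction i with
        | zero => exact ⟨0, by simp⟩
        | succ i ih =>
          obtain ⟨Z, hZ⟩ := ih
          refine ⟨Z * A + Algebra.leftMulMatrix b a' ^ i * Y, ?_⟩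
          rw [smul_add, ← smul_mul_assoc, ← hZ, ← mul_smul_comm, ← hY, pow_succ, pow_succ]
          noncomm_ring
    obtain ⟨Z, hZ⟩ := hpoly f
    rw [hf, Matrix.aeval_self_charpoly, mul_zero, zero_sub, ← hf] at hZ
    refine ⟨-(Z * (g⁻¹ : (Matrix (Fin n) (Fin n) 𝒪[F])ˣ)), ?_⟩
    rw [smul_neg, ← smul_mul_assoc, ← hZ, neg_mul, neg_neg, Units.mul_inv_cancel_right]
  have hroot : aeval (resO F E a') f' = 0 := by
    rw [hf', ← resO_aeval, resO_eq_zero_iff hϖ]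
    exact (dvd_pow_self _ hm.ne').trans hfa'
  have hder : aeval (resO F E a') (derivative f') ≠ 0 :=
    (PerfectField.separable_of_irreducible hirr).aeval_derivative_ne_zero hroot
  have hder' : resO F E (aeval a' (derivative f)) ≠ 0 := by
    rw [resO_aeval, ← derivative_map]
    exact hder
  obtain ⟨α, hα, hαa⟩ := exists_root_of_simple_root hϖ b hmonf (a₀ := a')
    (by rw [resO_aeval]; exact hroot) hder'
  -- `α` agrees with `a'` modulo `ϖ ^ m`
  obtain ⟨c, hc⟩ : algebraMap 𝒪[F] (OE F E) ϖ ^ m ∣ a' - α := by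
    obtain ⟨s, hs⟩ := (f.map (algebraMap 𝒪[F] (OE F E))).binomExpansion α (a' - α)
    rw [add_sub_cancel, eval_map_algebraMap, eval_map_algebraMap, hα, zero_add, derivative_map,
      eval_map_algebraMap] at hs
    have hu : IsUnit (aeval α (derivative f) + s * (a' - α)) := by
      refine isUnit_of_resO_ne_zero hϖ b ?_
      rw [map_add, map_mul, map_sub, hαa, sub_self, mul_zero, add_zero, resO_aeval, hαa,
        ← resO_aeval]
      exact hder'
    -- Taylor expansion at the root `α`: the cofactor is a unit because the root is simple, so `a' -
    -- α` inherits the divisibility of `f(a')`.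
    have h1 : aeval a' f = (aeval α (derivative f) + s * (a' - α)) * (a' - α) := by
      rw [hs]; ring
    rw [h1] at hfa'
    exact hu.dvd_mul_left.1 hfa'
  -- construction of the automorphism
  set fF := f.map (algebraMap 𝒪[F] F) with hfF
  have hirrF : Irreducible fF := by
    have h1 : Irreducible f := hmonf.irreducible_of_irreducible_map (IsLocalRing.residue 𝒪[F]) f hirr
    exact (hmonf.irreducible_iff_irreducible_map_fraction_map (K := F)).1 h1
  haveI : Fact (Irreducible fF) := ⟨hirrF⟩
  have hev : ∀ x : OE F E, aeval x f = 0 → aeval (x : E) fF = 0 := fun x hx => by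
    rw [hfF, aeval_map_algebraMap]
    have := congrArg (algebraMap (OE F E) E) hx
    rwa [map_zero, ← aeval_algebraMap_apply] at this
  let ι : ∀ x : OE F E, aeval x f = 0 → (AdjoinRoot fF →ₐ[F] E) := fun x hx =>
    AdjoinRoot.liftAlgHom fF (Algebra.ofId F E) (x : E) (hev x hx)
  have hι : ∀ x hx, ι x hx (AdjoinRoot.root fF) = x := fun x hx => AdjoinRoot.liftAlgHom_root ..
  have hfinA : FiniteDimensional F (AdjoinRoot fF) := (AdjoinRoot.powerBasis hirrF.ne_zero).finite
  have hbij : ∀ x hx, Function.Bijective (ι x hx) := fun x hx => by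
    have hinj : Function.Injective (ι x hx) := (ι x hx).toRingHom.injective
    refine ⟨hinj, ?_⟩
    refine (LinearMap.injective_iff_surjective_of_finrank_eq_finrank
      (f := (ι x hx).toLinearMap) ?_).1 hinj
    rw [(AdjoinRoot.powerBasis hirrF.ne_zero).finrank, AdjoinRoot.powerBasis_dim, hE,
      hfF, hmonf.natDegree_map, hdegf]
  refine ⟨(AlgEquiv.ofBijective _ (hbij a hfa)).symm.trans (AlgEquiv.ofBijective _ (hbij α hα)), c, ?_⟩
  have : galRestrict 𝒪[F] F E (OE F E) ((AlgEquiv.ofBijective _ (hbij a hfa)).symm.trans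
      (AlgEquiv.ofBijective _ (hbij α hα))) a = α := by
    apply Subtype.ext
    have h1 := algebraMap_galRestrict_apply 𝒪[F] ((AlgEquiv.ofBijective _ (hbij a hfa)).symm.trans
      (AlgEquiv.ofBijective _ (hbij α hα))) a
    refine h1.trans ?_
    change ι α hα ((AlgEquiv.ofBijective _ (hbij a hfa)).symm (a : E)) = α
    rw [← hι α hα]
    congr 1
    rw [AlgEquiv.symm_apply_eq]
    exact (hι a hfa).symm
  rw [this, ← hc]
  ring

end Elliptic

/-! ### Congruence subgroups of `GL_n(𝔬_k)` and their characters. -/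

section Unipotent

variable {F : Type u} [Field F] [ValuativeRel F] [TopologicalSpace F]
  [IsNonarchimedeanLocalField F]
variable {n k r : ℕ} {ϖ : 𝒪[F]}

/-- The ring `M_n(𝔬)`. -/
abbrev MatO (F : Type u) [Field F] [ValuativeRel F] (n : ℕ) : Type u :=
  Matrix (Fin n) (Fin n) 𝒪[F]

/-- Reduction `M_n(𝔬) → M_n(𝔬_k)`. -/
abbrev matQuot (F : Type u) [Field F] [ValuativeRel F] [TopologicalSpace F]
    [IsNonarchimedeanLocalField F] (n k : ℕ) :
    MatO F n →+* Matrix (Fin n) (Fin n) (oQuot F k) :=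
  (Ideal.Quotient.mk (𝓂[F] ^ k)).mapMatrix

lemma matQuot_surjective : Function.Surjective (matQuot F n k) := by
  intro M
  refine ⟨M.map (Function.surjInv (Ideal.Quotient.mk_surjective (I := 𝓂[F] ^ k))), ?_⟩
  ext i j
  exact Function.surjInv_eq (Ideal.Quotient.mk_surjective (I := 𝓂[F] ^ k)) (M i j)

lemma matQuot_eq_iff (hϖ : Irreducible ϖ) {X Y : MatO F n} :
    matQuot F n k X = matQuot F n k Y ↔ ∃ Z, X = Y + ϖ ^ k • Z := by
  constructor
  · intro h
    have h2 : ∀ i j, ϖ ^ k ∣ X i j - Y i j := fun i j => by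
      rw [← mem_maximalIdeal_pow_iff hϖ, ← Ideal.Quotient.eq]
      exact congrFun (congrFun h i) j
    choose Z hZ using h2
    refine ⟨Matrix.of Z, ?_⟩
    ext1 i j
    rw [Matrix.add_apply, Matrix.smul_apply, Matrix.of_apply, smul_eq_mul, ← hZ]
    ring
  · rintro ⟨Z, rfl⟩
    ext1 i j
    refine Ideal.Quotient.eq.2 ?_
    rw [mem_maximalIdeal_pow_iff hϖ]
    exact ⟨Z i j, by rw [Matrix.add_apply, Matrix.smul_apply, smul_eq_mul]; ring⟩

/-- Reduction `GL_n(𝔬) → GL_n(𝔬_k)`. -/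
def toGL (F : Type u) [Field F] [ValuativeRel F] [TopologicalSpace F]
    [IsNonarchimedeanLocalField F] (n k : ℕ) : (MatO F n)ˣ →* GLk F n k :=
  Units.map (matQuot F n k).toMonoidHom

lemma coe_toGL (g : (MatO F n)ˣ) :
    (toGL F n k g : Matrix (Fin n) (Fin n) (oQuot F k)) = matQuot F n k g := rfl

lemma isUnit_of_mul_eq (hϖ : Irreducible ϖ) (hr : 0 < r) {X Y Z : MatO F n}
    (h : X * Y = 1 + ϖ ^ r • Z) : IsUnit X := by
  refine isUnit_of_isUnit_map_residue ?_
  refine IsUnit.of_mul_eq_one (Y.map (IsLocalRing.residue 𝒪[F])) ?_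
  have h1 := congrArg (IsLocalRing.residue 𝒪[F]).mapMatrix h
  rw [map_mul, map_add, map_one] at h1
  have h2 : (IsLocalRing.residue 𝒪[F]).mapMatrix (ϖ ^ r • Z) = 0 := by
    ext1 i j
    refine (IsLocalRing.residue_eq_zero_iff _).2 ?_
    rw [← pow_one 𝓂[F], mem_maximalIdeal_pow_iff hϖ, pow_one]
    exact (dvd_pow_self ϖ hr.ne').mul_right _
  rw [h2, add_zero] at h1
  exact h1

lemma toGL_surjective (hϖ : Irreducible ϖ) (hk : 0 < k) : Function.Surjective (toGL F n k) := by
  intro g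
  obtain ⟨X, hX⟩ := matQuot_surjective (k := k) (g : Matrix (Fin n) (Fin n) (oQuot F k))
  obtain ⟨Y, hY⟩ := matQuot_surjective (k := k)
    ((g⁻¹ : GLk F n k) : Matrix (Fin n) (Fin n) (oQuot F k))
  obtain ⟨Z, hZ⟩ : ∃ Z, X * Y = 1 + ϖ ^ k • Z := by
    rw [← matQuot_eq_iff hϖ, map_mul, hX, hY, map_one, Units.mul_inv]
  obtain ⟨u, hu⟩ := isUnit_of_mul_eq hϖ hk hZ
  refine ⟨u, Units.ext ?_⟩
  rw [coe_toGL, hu, hX]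

lemma toGL_eq_iff (hϖ : Irreducible ϖ) {g h : (MatO F n)ˣ} :
    toGL F n k g = toGL F n k h ↔ ∃ Z, (g : MatO F n) = h + ϖ ^ k • Z := by
  rw [← matQuot_eq_iff hϖ, Units.ext_iff]
  rfl

lemma isUnit_one_add (hϖ : Irreducible ϖ) (hr : 0 < r) (X : MatO F n) :
    IsUnit (1 + ϖ ^ r • X) := isUnit_of_mul_eq hϖ hr (mul_one _)

open Classical in
/-- The element `1 + ϖ ^ r X` of `GL_n(𝔬)`. -/
def uniO (ϖ : 𝒪[F]) (r : ℕ) (X : MatO F n) : (MatO F n)ˣ :=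
  if h : IsUnit (1 + ϖ ^ r • X) then h.unit else 1

lemma coe_uniO (hϖ : Irreducible ϖ) (hr : 0 < r) (X : MatO F n) :
    (uniO ϖ r X : MatO F n) = 1 + ϖ ^ r • X := by
  rw [uniO, dif_pos (isUnit_one_add hϖ hr X)]
  rfl

/-- The element `1 + ϖ ^ r X` of `GL_n(𝔬_k)`. -/
def uni (ϖ : 𝒪[F]) (k r : ℕ) (X : MatO F n) : GLk F n k := toGL F n k (uniO ϖ r X)

lemma coe_uni (hϖ : Irreducible ϖ) (hr : 0 < r) (X : MatO F n) :
    (uni ϖ k r X : Matrix (Fin n) (Fin n) (oQuot F k)) = oneAdd ϖ k r X := by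
  rw [uni, coe_toGL, coe_uniO hϖ hr]
  rfl

lemma eq_uni_iff (hϖ : Irreducible ϖ) (hr : 0 < r) {x : GLk F n k} {X : MatO F n} :
    (x : Matrix (Fin n) (Fin n) (oQuot F k)) = oneAdd ϖ k r X ↔ x = uni ϖ k r X := by
  rw [← coe_uni hϖ hr, Units.ext_iff]

lemma toGL_eq_uni_iff (hϖ : Irreducible ϖ) (hr : 0 < r) {g : (MatO F n)ˣ} {X : MatO F n} :
    toGL F n k g = uni ϖ k r X ↔ ∃ Z, (g : MatO F n) = 1 + ϖ ^ r • X + ϖ ^ k • Z := by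
  rw [uni, toGL_eq_iff hϖ, coe_uniO hϖ hr]

lemma toGL_eq_uni (hϖ : Irreducible ϖ) (hr : 0 < r) {g : (MatO F n)ˣ} {X : MatO F n}
    (h : (g : MatO F n) = 1 + ϖ ^ r • X) : toGL F n k g = uni ϖ k r X :=
  (toGL_eq_uni_iff hϖ hr).2 ⟨0, by rw [h, smul_zero, add_zero]⟩

lemma uni_eq_iff (hϖ : Irreducible ϖ) (hr : 0 < r) (hrk : r ≤ k) {X Y : MatO F n} :
    uni ϖ k r X = uni ϖ k r Y ↔ ∃ Z, X = Y + ϖ ^ (k - r) • Z := by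
  rw [uni, toGL_eq_uni_iff hϖ hr, coe_uniO hϖ hr]
  refine exists_congr fun Z => ?_
  rw [add_assoc, add_right_inj]
  conv_lhs => rw [← Nat.add_sub_cancel' hrk, pow_add, mul_smul, ← smul_add]
  exact (smul_right_injective _ (pow_ne_zero r hϖ.ne_zero)).eq_iff

lemma uni_zero (hϖ : Irreducible ϖ) (hr : 0 < r) : uni ϖ k r (0 : MatO F n) = 1 := by
  rw [← map_one (toGL F n k)]
  exact (toGL_eq_uni hϖ hr (by simp)).symm

lemma uni_mul (hϖ : Irreducible ϖ) (hr : 0 < r) (X Y : MatO F n) :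
    uni ϖ k r X * uni ϖ k r Y = uni ϖ k r (X + Y + ϖ ^ r • (X * Y)) := by
  rw [uni, uni, ← map_mul]
  refine toGL_eq_uni hϖ hr ?_
  rw [Units.val_mul, coe_uniO hϖ hr, coe_uniO hϖ hr, mul_add, mul_one, add_mul, one_mul,
    smul_mul_smul_comm, smul_add, smul_add, smul_smul]
  abel

lemma uni_conj (hϖ : Irreducible ϖ) (hr : 0 < r) (g : (MatO F n)ˣ) (X : MatO F n) :
    toGL F n k g * uni ϖ k r X * (toGL F n k g)⁻¹ =
      uni ϖ k r ((g : MatO F n) * X * ((g⁻¹ : (MatO F n)ˣ) : MatO F n)) := by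
  rw [uni, ← map_inv, ← map_mul, ← map_mul]
  refine toGL_eq_uni hϖ hr ?_
  rw [Units.val_mul, Units.val_mul, coe_uniO hϖ hr, mul_add, mul_one, add_mul, Units.mul_inv,
    mul_smul_comm, smul_mul_assoc]

lemma exists_uni_inv (hϖ : Irreducible ϖ) (hr : 0 < r) (X : MatO F n) :
    ∃ Y, (uni ϖ k r X)⁻¹ = uni ϖ k r (-X + ϖ ^ r • Y) := by
  set V := uniO ϖ r X with hV
  refine ⟨X * X * (V⁻¹ : (MatO F n)ˣ), ?_⟩
  rw [uni, ← hV, ← map_inv]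
  refine toGL_eq_uni hϖ hr ?_
  have h1 := coe_uniO hϖ hr X
  rw [← hV] at h1
  rw [← mul_one (V⁻¹ : (MatO F n)ˣ).val, Units.inv_mul_eq_iff_eq_mul, h1]
  have h2 : ∀ A W : MatO F n, (1 + A) * W = 1 → (1 + A) * (1 - A + A * A * W) = 1 := fun A W h => by
    have : (1 + A) * (1 - A + A * A * W) = 1 - A * A + A * A * ((1 + A) * W) := by noncomm_ring
    rw [this, h, mul_one, sub_add_cancel]
  have h3 := h2 (ϖ ^ r • X) (V⁻¹ : (MatO F n)ˣ) (by rw [← h1, Units.mul_inv])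
  rw [smul_mul_smul_comm] at h3
  refine h3.symm.trans (congrArg _ ?_)
  rw [smul_add, smul_neg, smul_smul, smul_mul_assoc, mul_one]
  abel

lemma uni_add_pow (j : ℕ) (hϖ : Irreducible ϖ) (hr : 0 < r) (X : MatO F n) :
    uni ϖ k (r + j) X = uni ϖ k r (ϖ ^ j • X) := by
  rw [uni]
  refine toGL_eq_uni hϖ hr ?_
  rw [coe_uniO hϖ (by omega), pow_add, mul_smul]

lemma mem_congrN_iff (hϖ : Irreducible ϖ) (hr : 0 < r) (h : r ≤ k) {g : GLk F n k} :
    g ∈ congrN n h ↔ ∃ X, g = uni ϖ k r X := by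
  have hmap : ∀ X : MatO F n, (matQuot F n k X).map (Ideal.Quotient.factorPow 𝓂[F] h) =
      matQuot F n r X := fun X => rfl
  obtain ⟨ĝ, rfl⟩ := toGL_surjective hϖ (hr.trans_le h) g
  rw [congrN, MonoidHom.mem_ker, Units.ext_iff]
  change (matQuot F n k ĝ).map (Ideal.Quotient.factorPow 𝓂[F] h) = 1 ↔ _
  rw [hmap, ← map_one (matQuot F n r), matQuot_eq_iff hϖ]
  constructor
  · rintro ⟨X, hX⟩
    exact ⟨X, toGL_eq_uni hϖ hr hX⟩
  · rintro ⟨X, hX⟩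
    obtain ⟨Z, hZ⟩ := (toGL_eq_uni_iff hϖ hr).1 hX
    have hpk : ϖ ^ k = ϖ ^ r * ϖ ^ (k - r) := by rw [← pow_add, Nat.add_sub_cancel' h]
    exact ⟨X + ϖ ^ (k - r) • Z, by rw [hZ, hpk, smul_add, smul_smul, add_assoc]⟩

lemma uni_mem_congrN (hϖ : Irreducible ϖ) (hr : 0 < r) (h : r ≤ k) (X : MatO F n) :
    uni ϖ k r X ∈ congrN n h := (mem_congrN_iff hϖ hr h).2 ⟨X, rfl⟩

instance finite_oQuot : Finite (oQuot F k) :=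
  haveI : Finite (𝒪[F] ⧸ 𝓂[F]) := inferInstanceAs (Finite 𝓀[F])
  Ideal.finite_quotient_pow (IsNoetherian.noetherian _) k

instance finite_GLk : Finite (GLk F n k) :=
  haveI : Finite (Matrix (Fin n) (Fin n) (oQuot F k)) := Matrix.instFinite ..
  inferInstanceAs (Finite (Matrix (Fin n) (Fin n) (oQuot F k))ˣ)

open Classical in
/-- The function `1 + ϖ ^ r X ↦ ψ(ϖ ^ (r - k) tr (A X))` on `N_r`. -/
def chr (ψ : AddChar F ℂ) (ϖ : 𝒪[F]) (k r : ℕ) (A : MatO F n) (g : GLk F n k) : ℂ :=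
  if h : ∃ X, g = uni ϖ k r X then trChar n ψ ϖ (k - r) (A * h.choose) else 0

variable {ψ : AddChar F ℂ}

lemma trChar_add_smul_self (hϖ : Irreducible ϖ) (hψ : ∀ x : 𝒪[F], ψ (x : F) = 1) {m : ℕ}
    (X Y : MatO F n) : trChar n ψ ϖ m (X + ϖ ^ m • Y) = trChar n ψ ϖ m X := by
  rw [AddChar.map_add_eq_mul, trChar_eq_one hϖ hψ le_rfl, mul_one]

section

variable (hϖ : Irreducible ϖ) (hψ : ∀ x : 𝒪[F], ψ (x : F) = 1)
include hϖ hψ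

lemma chr_uni (hr : 0 < r) (hrk : r ≤ k) (A X : MatO F n) :
    chr ψ ϖ k r A (uni ϖ k r X) = trChar n ψ ϖ (k - r) (A * X) := by
  have h : ∃ Y, uni ϖ k r X = uni ϖ k r Y := ⟨X, rfl⟩
  rw [chr, dif_pos h]
  obtain ⟨Z, hZ⟩ := (uni_eq_iff hϖ hr hrk).1 h.choose_spec
  conv_rhs => rw [hZ, mul_add, mul_smul_comm, trChar_add_smul_self hϖ hψ]

/-- The quadratic term of a product enters through `ϖ ^ r (X Y)`, which is invisible at level `k -
r` as soon as `k ≤ 2r`. -/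
lemma isCharOn_chr (hr : 0 < r) (h : r ≤ k) (h2 : k ≤ r + r) (A : MatO F n) :
    IsCharOn (congrN n h) (chr ψ ϖ k r A) := by
  refine ⟨?_, fun x hx y hy => ?_⟩
  · rw [← uni_zero hϖ hr, chr_uni hϖ hψ hr h, mul_zero, AddChar.map_zero_eq_one]
  · obtain ⟨X, rfl⟩ := (mem_congrN_iff hϖ hr h).1 hx
    obtain ⟨Y, rfl⟩ := (mem_congrN_iff hϖ hr h).1 hy
    rw [uni_mul hϖ hr, chr_uni hϖ hψ hr h, chr_uni hϖ hψ hr h, chr_uni hϖ hψ hr h, mul_add,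
      mul_smul_comm, AddChar.map_add_eq_mul, trChar_eq_one hϖ hψ (by omega), mul_one, mul_add,
      AddChar.map_add_eq_mul]

lemma chr_conj (hr : 0 < r) (hrk : r ≤ k) (A X : MatO F n) (g : (MatO F n)ˣ) :
    chr ψ ϖ k r A ((toGL F n k g)⁻¹ * uni ϖ k r X * toGL F n k g) =
      trChar n ψ ϖ (k - r) ((g : MatO F n) * A * (g⁻¹ : (MatO F n)ˣ) * X) := by
  have h1 := uni_conj (k := k) hϖ hr g⁻¹ X
  rw [map_inv, inv_inv, inv_inv] at h1
  rw [h1, chr_uni hϖ hψ hr hrk, mul_assoc, mul_assoc, mul_assoc, trChar_mul_comm _ (g : MatO F n)]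
  simp only [mul_assoc]

omit hψ in
lemma conj_mem_congrN (h : r ≤ k) (g x : GLk F n k) (hx : x ∈ congrN n h) :
    g⁻¹ * x * g ∈ congrN n h := by
  have h1 : (congrN (F := F) n h).Normal := MonoidHom.normal_ker _
  simpa using h1.conj_mem x hx g⁻¹

lemma fixes_chr (hr : 0 < r) (h : r ≤ k) {A : MatO F n} {g : (MatO F n)ˣ}
    (hg : ∃ Y, (g : MatO F n) * A - A * g = ϖ ^ (k - r) • Y) :
    Fixes (congrN n h) (chr ψ ϖ k r A) (toGL F n k g) := by
  intro x hx
  refine ⟨conj_mem_congrN hϖ h _ _ hx, ?_⟩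
  obtain ⟨X, rfl⟩ := (mem_congrN_iff hϖ hr h).1 hx
  obtain ⟨Y, hY⟩ := hg
  rw [chr_conj hϖ hψ hr h, chr_uni hϖ hψ hr h, sub_eq_iff_eq_add'.1 hY, add_mul,
    Units.mul_inv_cancel_right, add_mul, smul_mul_assoc, smul_mul_assoc,
    trChar_add_smul_self hϖ hψ]

/-- Conjugation by `g` replaces `A` by `g A g⁻¹`. If no element of `N_r` distinguished the two
characters, nondegeneracy of the trace pairing would make `g A g⁻¹ - A` divisible by `ϖ ^ (k - r)`.
-/
lemma moves_chr (hψ' : ∃ x : 𝒪[F], ψ ((x : F) / (ϖ : F)) ≠ 1) (hr : 0 < r) (h : r ≤ k)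
    {A : MatO F n} {g : (MatO F n)ˣ}
    (hg : ¬ ∃ Y, (g : MatO F n) * A - A * g = ϖ ^ (k - r) • Y) :
    Moves (congrN n h) (chr ψ ϖ k r A) (toGL F n k g) := by
  by_contra hcon
  apply hg
  have h1 : ∀ X, trChar n ψ ϖ (k - r) (((g : MatO F n) * A * (g⁻¹ : (MatO F n)ˣ) - A) * X) = 1 := fun X => by
    by_contra hX
    refine hcon ⟨uni ϖ k r X, uni_mem_congrN hϖ hr h X,
      conj_mem_congrN hϖ h _ _ (uni_mem_congrN hϖ hr h X), fun heq => hX ?_⟩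
    rw [chr_conj hϖ hψ hr h, chr_uni hϖ hψ hr h] at heq
    rw [sub_mul, AddChar.map_sub_eq_div, heq, div_self (AddChar.val_isUnit _ _).ne_zero]
  obtain ⟨c, hc⟩ := eq_smul_of_forall_trChar_eq_one hϖ hψ hψ' _ h1
  refine ⟨c * g, ?_⟩
  rw [← smul_mul_assoc, ← hc, sub_mul, Units.inv_mul_cancel_right]

end

end Unipotent

/-! ### The torus `𝔒_k^×` and the stabilizer `J`. -/

section Torus

variable {F : Type u} [Field F] [ValuativeRel F] [TopologicalSpace F]
  [IsNonarchimedeanLocalField F]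
variable {E : Type v} [Field E] [Algebra F E] [IsUnramifiedExtension F E]
variable {n k r : ℕ} {ϖ : 𝒪[F]} (b : Module.Basis (Fin n) 𝒪[F] (OE F E))

/-- Reduction `𝔒^× → 𝔒_k^×`. -/
def quotU (F : Type u) [Field F] [ValuativeRel F] [TopologicalSpace F]
    [IsNonarchimedeanLocalField F] (E : Type v) [Field E] [Algebra F E] (k : ℕ) :
    (OE F E)ˣ →* (OQuot F E k)ˣ := Units.map (Ideal.Quotient.mk (PE F E ^ k)).toMonoidHom

/-- The embedding of `𝔒^×` into `GL_n(𝔬)`. -/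
def lamU : (OE F E)ˣ →* (MatO F n)ˣ := Units.map (Algebra.leftMulMatrix b : OE F E →* MatO F n)

lemma coe_lamU (u : (OE F E)ˣ) : (lamU b u : MatO F n) = Algebra.leftMulMatrix b u := rfl

/-- Reduction `𝔒_k^× → 𝔒_1^×`. -/
def resU (F : Type u) [Field F] [ValuativeRel F] [TopologicalSpace F]
    [IsNonarchimedeanLocalField F] (E : Type v) [Field E] [Algebra F E] [IsUnramifiedExtension F E] (hk : 2 ≤ k) : (OQuot F E k)ˣ →* (ResE F E)ˣ :=
  Units.map (redOne F E hk : OQuot F E k →* OResidue F E)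

lemma coe_resU_quotU (hk : 2 ≤ k) (u : (OE F E)ˣ) :
    (resU F E hk (quotU F E k u) : ResE F E) = resO F E u := rfl

lemma emb_quotU (u : (OE F E)ˣ) : emb b k (quotU F E k u) = toGL F n k (lamU b u) := rfl

lemma mem_kerL_iff (hk : 2 ≤ k) (u : (OQuot F E k)ˣ) : u ∈ kerL hk ↔ resU F E hk u = 1 := Iff.rfl

include b in
lemma quotU_surjective (hϖ : Irreducible ϖ) (hk : 2 ≤ k) :
    Function.Surjective (quotU F E k) := by
  intro u
  obtain ⟨x, hx⟩ := Ideal.Quotient.mk_surjective (u : OQuot F E k)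
  have h1 : resO F E x ≠ 0 := by
    have : resO F E x = (resU F E hk u : ResE F E) := by
      change _ = redOne F E hk (u : OQuot F E k)
      rw [← hx]
      rfl
    rw [this]
    exact Units.ne_zero _
  obtain ⟨v, hv⟩ := isUnit_of_resO_ne_zero hϖ b h1
  exact ⟨v, Units.ext (by rw [← hx, ← hv]; rfl)⟩

include b in
lemma exists_unit_eq_one_add (hϖ : Irreducible ϖ) (hr : 0 < r) (x : OE F E) :
    ∃ u : (OE F E)ˣ, (u : OE F E) = 1 + algebraMap 𝒪[F] (OE F E) ϖ ^ r * x := by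
  have h1 : resO F E (1 + algebraMap 𝒪[F] (OE F E) ϖ ^ r * x) ≠ 0 := by
    rw [map_add, (resO_eq_zero_iff hϖ _).2 ((dvd_pow_self _ hr.ne').mul_right x), map_one, add_zero]
    exact one_ne_zero
  exact isUnit_of_resO_ne_zero hϖ b h1

lemma lamU_eq_uni (hϖ : Irreducible ϖ) (hr : 0 < r) {x : OE F E} {u : (OE F E)ˣ}
    (hu : (u : OE F E) = 1 + algebraMap 𝒪[F] (OE F E) ϖ ^ r * x) :
    toGL F n k (lamU b u) = uni ϖ k r (Algebra.leftMulMatrix b x) := by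
  refine toGL_eq_uni hϖ hr ?_
  rw [coe_lamU, hu, map_add, map_one, ← map_pow, leftMulMatrix_smul]

lemma mem_groupNO_iff (hϖ : Irreducible ϖ) (hr : 0 < r) (h : r ≤ k) {g : GLk F n k} :
    g ∈ groupNO b h ↔ ∃ X u, g = uni ϖ k r X * emb b k u := by
  rw [groupNO, mem_sup_range_iff _ fun u x hx => conj_mem_congrN hϖ h _ _ hx]
  constructor
  · rintro ⟨x, hx, u, rfl⟩
    obtain ⟨X, rfl⟩ := (mem_congrN_iff hϖ hr h).1 hx
    exact ⟨X, u, rfl⟩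
  · rintro ⟨X, u, rfl⟩
    exact ⟨_, uni_mem_congrN hϖ hr h X, u, rfl⟩

variable {b}

/-- Describes the intersection of `N_r` with the torus, on which characters of the two must be
compared before they can be glued. -/
lemma exists_eq_of_uni_eq_toGL (hϖ : Irreducible ϖ) (hr : 0 < r) (hrk : r ≤ k) {X : MatO F n}
    {u : (OE F E)ˣ} (h : uni ϖ k r X = toGL F n k (lamU b u)) :
    ∃ x Z, (u : OE F E) = 1 + algebraMap 𝒪[F] (OE F E) ϖ ^ r * x ∧
      X = Algebra.leftMulMatrix b x + ϖ ^ (k - r) • Z := by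
  obtain ⟨Z, hZ⟩ := (toGL_eq_uni_iff hϖ hr).1 h.symm
  rw [coe_lamU] at hZ
  obtain ⟨x, hx⟩ := (leftMulMatrix_eq_smul_iff (b := b) hϖ r (u - 1)).1
    ⟨X + ϖ ^ (k - r) • Z, by
      rw [map_sub, hZ, map_one, smul_add, smul_smul, ← pow_add, Nat.add_sub_cancel' hrk]
      abel⟩
  rw [sub_eq_iff_eq_add'] at hx
  refine ⟨x, ?_⟩
  obtain ⟨Z', hZ'⟩ := (uni_eq_iff hϖ hr hrk).1 (h.trans (lamU_eq_uni b hϖ hr hx))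
  exact ⟨Z', hx, hZ'⟩

/-- The group `J` is the stabilizer of the character attached to a residually primitive element. -/
lemma mem_groupJ_iff (hϖ : Irreducible ϖ) (hk : 2 ≤ k) {a : OE F E}
    (ha : IsPrimitiveElt 𝓀[F] (resO F E a)) (g : (MatO F n)ˣ) :
    toGL F n k g ∈ groupJ b k ↔
      ∃ Y, (g : MatO F n) * Algebra.leftMulMatrix b a - Algebra.leftMulMatrix b a * g =
        ϖ ^ (k / 2) • Y := by
  have hpos : 0 < k / 2 := by omega
  have hle := Nat.div_le_self k 2
  rw [groupJ, mem_groupNO_iff b hϖ hpos]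
  constructor
  · rintro ⟨X, u, hg⟩
    obtain ⟨u, rfl⟩ := quotU_surjective b hϖ hk u
    rw [emb_quotU, uni, ← map_mul] at hg
    obtain ⟨Z, hZ⟩ := (toGL_eq_iff hϖ).1 hg
    have hpk : ϖ ^ k = ϖ ^ (k / 2) * ϖ ^ (k - k / 2) := by rw [← pow_add, Nat.add_sub_cancel' hle]
    rw [Units.val_mul, coe_uniO hϖ hpos, coe_lamU, hpk, mul_smul] at hZ
    refine ⟨(X * Algebra.leftMulMatrix b u + ϖ ^ (k - k / 2) • Z) * Algebra.leftMulMatrix b a -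
      Algebra.leftMulMatrix b a * (X * Algebra.leftMulMatrix b u + ϖ ^ (k - k / 2) • Z), ?_⟩
    have hc : Algebra.leftMulMatrix b (u : OE F E) * Algebra.leftMulMatrix b a =
        Algebra.leftMulMatrix b a * Algebra.leftMulMatrix b (u : OE F E) := by
      rw [← map_mul, ← map_mul, mul_comm]
    rw [add_mul, one_mul, smul_mul_assoc, add_assoc, ← smul_add] at hZ
    rw [hZ, add_mul, mul_add, hc, smul_mul_assoc, mul_smul_comm, smul_sub]
    abel
  · intro hg
    obtain ⟨x, Y, hxY⟩ := exists_eq_leftMulMatrix_add hϖ ha (k / 2) _ hg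
    -- The approximating element `x` of `𝔒` is a unit because `g` is residually multiplication by it
    -- and is invertible.
    have hx0 : resO F E x ≠ 0 := by
      have h1 : redMat b g = LinearMap.mulLeft 𝓀[F] (resO F E x) := by
        obtain ⟨j, hj⟩ := Nat.exists_eq_succ_of_ne_zero hpos.ne'
        rw [hxY, map_add, hj, pow_succ', mul_smul, redMat_smul_eq_zero b hϖ, add_zero,
          redMat_leftMulMatrix]
      intro h0
      have h2 : IsUnit (redMat b g) := g.isUnit.map (redMat b)
      rw [h1, h0] at h2
      have h3 : LinearMap.mulLeft 𝓀[F] (0 : ResE F E) = 0 := by ext; simp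
      rw [h3] at h2
      have hne : (1 : Module.End 𝓀[F] (ResE F E)) ≠ 0 := fun h => by
        have := LinearMap.congr_fun h 1
        exact one_ne_zero this
      obtain ⟨v, hv⟩ := h2
      exact hne (by rw [← v.mul_inv, hv, zero_mul])
    obtain ⟨u, hu⟩ := isUnit_of_resO_ne_zero hϖ b hx0
    refine ⟨Y * ((lamU b u)⁻¹ : (MatO F n)ˣ), quotU F E k u, ?_⟩
    rw [emb_quotU, uni, ← map_mul]
    congr 1
    ext1
    rw [Units.val_mul, coe_uniO hϖ hpos, add_mul, one_mul, smul_mul_assoc,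
      Units.inv_mul_cancel_right, coe_lamU, hu, hxY]

variable {ψ : AddChar F ℂ}

section

variable (hϖ : Irreducible ϖ) (hψ : ∀ x : 𝒪[F], ψ (x : F) = 1) (hk : 2 ≤ k)
include hϖ hψ hk

lemma fixes_of_mem_groupJ {a : OE F E} (ha : IsPrimitiveElt 𝓀[F] (resO F E a))
    (g : GLk F n k) (hg : g ∈ groupJ b k) :
    Fixes (congrN n (Nat.sub_le k (k / 2))) (chr ψ ϖ k (k - k / 2) (Algebra.leftMulMatrix b a)) g := by
  obtain ⟨g, rfl⟩ := toGL_surjective hϖ (by omega) g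
  refine fixes_chr hϖ hψ (by omega) _ ?_
  rw [Nat.sub_sub_self (Nat.div_le_self k 2)]
  exact (mem_groupJ_iff hϖ hk ha g).1 hg

lemma moves_of_not_mem_groupJ (hψ' : ∃ x : 𝒪[F], ψ ((x : F) / (ϖ : F)) ≠ 1) {a : OE F E}
    (ha : IsPrimitiveElt 𝓀[F] (resO F E a)) (g : GLk F n k) (hg : g ∉ groupJ b k) :
    Moves (congrN n (Nat.sub_le k (k / 2))) (chr ψ ϖ k (k - k / 2) (Algebra.leftMulMatrix b a)) g := by
  obtain ⟨g, rfl⟩ := toGL_surjective hϖ (by omega) g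
  refine moves_chr hϖ hψ hψ' (by omega) _ ?_
  rw [Nat.sub_sub_self (Nat.div_le_self k 2)]
  exact fun h => hg ((mem_groupJ_iff hϖ hk ha g).2 h)

omit hψ in
lemma congrN_le_groupJ : congrN n (Nat.sub_le k (k / 2)) ≤ groupJ b k := by
  intro g hg
  obtain ⟨X, rfl⟩ := (mem_congrN_iff hϖ (by omega) _).1 hg
  rw [groupJ, mem_groupNO_iff b hϖ (by omega)]
  refine ⟨ϖ ^ (k - k / 2 - k / 2) • X, 1, ?_⟩
  rw [map_one, mul_one, ← uni_add_pow _ hϖ (by omega)]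
  congr 1
  omega

end

end Torus

/-! ### The element `a` attached to `ω`, and strong primitivity. -/

section Primitive

variable {F : Type u} [Field F] [ValuativeRel F] [TopologicalSpace F]
  [IsNonarchimedeanLocalField F]
variable {E : Type v} [Field E] [Algebra F E] [IsUnramifiedExtension F E]
variable {n k r : ℕ} {ϖ : 𝒪[F]} {b : Module.Basis (Fin n) 𝒪[F] (OE F E)} {ψ : AddChar F ℂ}

lemma exists_quotU_eq_mk_one_add (hϖ : Irreducible ϖ) (b : Module.Basis (Fin n) 𝒪[F] (OE F E))
    (hr : 0 < r) (x : OE F E) : ∃ y : (OQuot F E k)ˣ, (y : OQuot F E k) =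
      Ideal.Quotient.mk (PE F E ^ k) (1 + algebraMap 𝒪[F] (OE F E) ϖ ^ r * x) := by
  obtain ⟨u, hu⟩ := exists_unit_eq_one_add b hϖ hr x
  exact ⟨quotU F E k u, by rw [← hu]; rfl⟩

lemma isStronglyPrimitive_iff_resE {ω : (OQuot F E k)ˣ →* ℂˣ} : IsStronglyPrimitive ϖ ω ↔
    ∀ K : IntermediateField 𝓀[F] (ResE F E), K ≠ ⊤ →
      ¬ ∃ χ : AddChar K ℂ, ∀ (x : OE F E) (y : (OQuot F E k)ˣ),
        (y : OQuot F E k) =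
          Ideal.Quotient.mk (PE F E ^ k) (1 + algebraMap 𝒪[F] (OE F E) ϖ ^ (k - 1) * x) →
        (ω y : ℂ) = χ (Algebra.trace K (ResE F E) (resO F E x)) := Iff.rfl

variable (hϖ : Irreducible ϖ) (hψ : ∀ x : 𝒪[F], ψ (x : F) = 1)
include hϖ hψ

omit hψ in
lemma mk_pe_eq_of_dvd {x y : OE F E}
    (h : algebraMap 𝒪[F] (OE F E) ϖ ^ k ∣ x - y) :
    Ideal.Quotient.mk (PE F E ^ k) x = Ideal.Quotient.mk (PE F E ^ k) y := by
  rw [Ideal.Quotient.eq, mem_pe_pow_iff hϖ]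
  exact h

/-- Since `2 (k - k / 2) ≥ k`, the map `x ↦ ω (1 + ϖ ^ (k - k / 2) x)` is an additive character; it
is trivial on multiples of `ϖ ^ (k / 2)`, so duality on `𝔒` represents it. -/
lemma exists_restrictsTo (hψ' : ∃ x : 𝒪[F], ψ ((x : F) / (ϖ : F)) ≠ 1) (hk : 2 ≤ k)
    (b : Module.Basis (Fin n) 𝒪[F] (OE F E)) (ω : (OQuot F E k)ˣ →* ℂˣ) :
    ∃ a, RestrictsTo b ψ ϖ ω a := by
  choose y hy using exists_quotU_eq_mk_one_add (k := k) hϖ b (r := k - k / 2) (by omega)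
  have hmul : ∀ x x', y (x + x') = y x * y x' := fun x x' => by
    ext1
    rw [Units.val_mul, hy, hy, hy, ← map_mul]
    refine mk_pe_eq_of_dvd hϖ ?_
    have h1 : algebraMap 𝒪[F] (OE F E) ϖ ^ k ∣
        algebraMap 𝒪[F] (OE F E) ϖ ^ (k - k / 2) * algebraMap 𝒪[F] (OE F E) ϖ ^ (k - k / 2) := by
      rw [← pow_add]
      exact pow_dvd_pow _ (by omega)
    have h2 := h1.mul_right (-(x * x'))
    convert h2 using 1
    ring
  have hone : ∀ x, y (algebraMap 𝒪[F] (OE F E) ϖ ^ (k / 2) * x) = 1 := fun x => by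
    ext1
    rw [hy, Units.val_one, ← map_one (Ideal.Quotient.mk (PE F E ^ k))]
    refine mk_pe_eq_of_dvd hϖ ?_
    rw [add_sub_cancel_left, ← mul_assoc, ← pow_add, Nat.sub_add_cancel (Nat.div_le_self k 2)]
    exact dvd_mul_right _ _
  obtain ⟨a, ha⟩ := exists_trChar_leftMulMatrix_eq b hϖ hψ hψ' (k / 2)
    { toFun := fun x => (ω (y x) : ℂ)
      map_zero_eq_one' := by
        have := hone 0
        rw [mul_zero] at this
        rw [this, map_one, Units.val_one]
      map_add_eq_mul' := fun x x' => by rw [hmul, map_mul, Units.val_mul] }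
    (fun x => by
      change (ω (y _) : ℂ) = 1
      rw [hone, map_one, Units.val_one])
  refine ⟨a, fun x z hz => ?_⟩
  have h1 : z = y x := Units.ext (by rw [hz, hy])
  have h2 : (ω (y x) : ℂ) = _ := ha x
  rw [h1, h2, psiMat_eq, ← map_mul]

lemma RestrictsTo.congr_add {ω : (OQuot F E k)ˣ →* ℂˣ} {a : OE F E} (h : RestrictsTo b ψ ϖ ω a)
    (c : OE F E) : RestrictsTo b ψ ϖ ω (a + algebraMap 𝒪[F] (OE F E) ϖ ^ (k / 2) * c) := by
  intro x y hy
  rw [h x y hy, psiMat_eq, psiMat_eq, map_add, ← map_pow, leftMulMatrix_smul, add_mul,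
    smul_mul_assoc, trChar_add_smul_self hϖ hψ]

lemma RestrictsTo.eq_add (hψ' : ∃ x : 𝒪[F], ψ ((x : F) / (ϖ : F)) ≠ 1) (hk : 2 ≤ k)
    {ω : (OQuot F E k)ˣ →* ℂˣ} {a a' : OE F E} (h : RestrictsTo b ψ ϖ ω a)
    (h' : RestrictsTo b ψ ϖ ω a') :
    ∃ c, a' = a + algebraMap 𝒪[F] (OE F E) ϖ ^ (k / 2) * c := by
  obtain ⟨c, hc⟩ := eq_mul_of_forall_trChar_leftMulMatrix_eq_one b hϖ hψ hψ' (k / 2)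
    (a := a' - a) fun x => by
      obtain ⟨y, hy⟩ := exists_quotU_eq_mk_one_add (k := k) hϖ b (r := k - k / 2) (by omega) x
      have h1 := h x y hy
      rw [h' x y hy, psiMat_eq, psiMat_eq] at h1
      rw [sub_mul, map_sub, map_mul, map_mul, AddChar.map_sub_eq_div, h1,
        div_self (AddChar.val_isUnit _ _).ne_zero]
  exact ⟨c, by rw [← hc, add_sub_cancel]⟩

/-- On the last layer `1 + ϖ ^ (k - 1) x` only the residue of `a` matters. -/
lemma RestrictsTo.apply_last {φ : AddChar 𝓀[F] ℂ}
    (hφ : ∀ x : 𝒪[F], ψ ((x : F) / (ϖ : F)) = φ (IsLocalRing.residue 𝒪[F] x)) (hk : 2 ≤ k)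
    {ω : (OQuot F E k)ˣ →* ℂˣ} {a : OE F E} (h : RestrictsTo b ψ ϖ ω a) (x : OE F E)
    (y : (OQuot F E k)ˣ) (hy : (y : OQuot F E k) =
      Ideal.Quotient.mk (PE F E ^ k) (1 + algebraMap 𝒪[F] (OE F E) ϖ ^ (k - 1) * x)) :
    (ω y : ℂ) = φ (Algebra.trace 𝓀[F] (ResE F E) (resO F E a * resO F E x)) := by
  have h1 := h (algebraMap 𝒪[F] (OE F E) ϖ ^ (k / 2 - 1) * x) y (by
    rw [hy, ← mul_assoc, ← pow_add]
    congr 5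
    omega)
  have h2 : k / 2 = 1 + (k / 2 - 1) := by omega
  rw [h1, psiMat_eq, ← map_pow, leftMulMatrix_smul, mul_smul_comm]
  conv_lhs => rw [h2]
  rw [Nat.add_sub_cancel_left, trChar_add_smul hϖ, trChar_one_eq b hφ, ← map_mul,
    redMat_leftMulMatrix, trace_mulLeft, map_mul]

/-- On the last layer `ω` is `x ↦ φ (tr (a x))`. If `a` lies in `L`, transitivity of the trace
factors this through the trace to `L`. Conversely, a character factoring in this way is trivial on
the kernel of the trace to `L`, which forces `a` to be an element of `L`. -/
lemma isStronglyPrimitive_iff (hψ' : ∃ x : 𝒪[F], ψ ((x : F) / (ϖ : F)) ≠ 1) (hk : 2 ≤ k)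
    {ω : (OQuot F E k)ˣ →* ℂˣ} {a : OE F E} (h : RestrictsTo b ψ ϖ ω a) :
    IsStronglyPrimitive ϖ ω ↔ IsPrimitiveElt 𝓀[F] (resO F E a) := by
  have hfd := finiteDimensional_resE b
  have hfin := finite_resE b
  obtain ⟨φ, hφ1, hφ⟩ := exists_residue_char hϖ hψ hψ'
  have hsm : ∀ (L : IntermediateField 𝓀[F] (ResE F E)) (c : L) (z : ResE F E),
      Algebra.trace 𝓀[F] L (c * Algebra.trace L (ResE F E) z) =
        Algebra.trace 𝓀[F] (ResE F E) ((c : ResE F E) * z) := fun L c z => by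
    rw [← smul_eq_mul, ← map_smul (Algebra.trace L (ResE F E)), Algebra.trace_trace,
      Algebra.smul_def]
    rfl
  rw [isStronglyPrimitive_iff_resE]
  constructor
  · intro hω L hL haL
    refine hω L hL ⟨⟨fun t => φ (Algebra.trace 𝓀[F] L (⟨resO F E a, haL⟩ * t)), ?_, ?_⟩, ?_⟩
    · simp
    · intro s t
      rw [mul_add, map_add, AddChar.map_add_eq_mul]
    · intro x y hy
      rw [h.apply_last hϖ hψ hφ hk x y hy]
      exact congrArg φ (hsm L ⟨resO F E a, haL⟩ (resO F E x)).symm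
  · rintro ha L hL ⟨χ, hχ⟩
    have hsep : Algebra.IsSeparable L (ResE F E) := inferInstance
    -- Subtracting the trace of `z` times `w` projects `z` to the kernel of the trace. This replaces
    -- `a` by `a - d` with `d ∈ L`, and nondegeneracy gives `a = d`.
    obtain ⟨w, hw⟩ := Algebra.trace_surjective L (ResE F E) 1
    set d : L := Algebra.trace L (ResE F E) (resO F E a * w) with hd
    have hker : ∀ z, Algebra.trace L (ResE F E) z = 0 →
        φ (Algebra.trace 𝓀[F] (ResE F E) (resO F E a * z)) = 1 := fun z hz => by
      obtain ⟨x, rfl⟩ := resO_surjective z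
      obtain ⟨y, hy⟩ := exists_quotU_eq_mk_one_add (k := k) hϖ b (r := k - 1) (by omega) x
      rw [← h.apply_last hϖ hψ hφ hk x y hy, hχ x y hy]
      refine Eq.trans (congrArg χ hz) ?_
      exact AddChar.map_zero_eq_one χ
    have hall : ∀ z, φ (Algebra.trace 𝓀[F] (ResE F E) ((resO F E a - d) * z)) = 1 := fun z => by
      rw [← hker (z - Algebra.trace L (ResE F E) z • w) (by
        rw [map_sub, map_smul, hw, smul_eq_mul, mul_one, sub_self])]
      congr 1
      rw [sub_mul, mul_sub, map_sub, map_sub, mul_smul_comm]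
      congr 1
      rw [← hsm L d z, mul_comm d, hd, hsm, Algebra.smul_def]
      rfl
    have hzero : resO F E a - d = 0 := by
      by_contra h0
      apply hφ1
      refine DFunLike.ext _ _ fun t => ?_
      obtain ⟨z, hz⟩ := Algebra.trace_surjective 𝓀[F] (ResE F E) t
      have := hall ((resO F E a - d)⁻¹ * z)
      rw [mul_inv_cancel_left₀ h0, hz] at this
      rw [this, AddChar.one_apply]
    refine ha L hL ?_
    rw [sub_eq_zero.1 hzero]
    exact d.2

end Primitive

/-! ### The group `J` at odd level: multiplication, conjugation and commutators. -/

section OddCase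

variable {F : Type u} [Field F] [ValuativeRel F] [TopologicalSpace F]
  [IsNonarchimedeanLocalField F]
variable {E : Type v} [Field E] [Algebra F E] [IsUnramifiedExtension F E]
variable {n k : ℕ} {ϖ : 𝒪[F]} {b : Module.Basis (Fin n) 𝒪[F] (OE F E)} {ψ : AddChar F ℂ}
  {φ : AddChar 𝓀[F] ℂ}

/-- The data of a uniformizer and of an additive character `ψ`, inducing the character `φ` of the
residue field, for an odd level `k`. -/
structure OddLevel (ϖ : 𝒪[F]) (ψ : AddChar F ℂ) (φ : AddChar 𝓀[F] ℂ) (k : ℕ) : Prop where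
  irred : Irreducible ϖ
  triv : ∀ x : 𝒪[F], ψ (x : F) = 1
  residue_ne_one : φ ≠ 1
  residue_eq : ∀ x : 𝒪[F], ψ ((x : F) / (ϖ : F)) = φ (IsLocalRing.residue 𝒪[F] x)
  two_le : 2 ≤ k
  odd : Odd k

namespace OddLevel

lemma half_pos (S : OddLevel ϖ ψ φ k) : 0 < k / 2 := by
  have := S.two_le
  omega

lemma sub_half (S : OddLevel ϖ ψ φ k) : k - k / 2 = k / 2 + 1 := by
  obtain ⟨m, hm⟩ := S.odd
  omega

lemma exists_ne_one (S : OddLevel ϖ ψ φ k) : ∃ x : 𝒪[F], ψ ((x : F) / (ϖ : F)) ≠ 1 := by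
  by_contra! h
  apply S.residue_ne_one
  refine DFunLike.ext _ _ fun t => ?_
  obtain ⟨x, rfl⟩ := IsLocalRing.residue_surjective t
  rw [← S.residue_eq, h, AddChar.one_apply]

end OddLevel

open Classical in
/-- The element `1 + ϖ ^ (k / 2) X` of `J`. -/
def jU (b : Module.Basis (Fin n) 𝒪[F] (OE F E)) (ϖ : 𝒪[F]) (k : ℕ) (X : MatO F n) : groupJ b k :=
  if h : uni ϖ k (k / 2) X ∈ groupJ b k then ⟨_, h⟩ else 1

/-- The embedding of `𝔒_k^×` into `J`. -/
def jE (b : Module.Basis (Fin n) 𝒪[F] (OE F E)) (k : ℕ) : (OQuot F E k)ˣ →* groupJ b k :=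
  (emb b k).codRestrict (groupJ b k) fun u =>
    (le_sup_right : (emb b k).range ≤ groupJ b k) ⟨u, rfl⟩

lemma coe_jE (u : (OQuot F E k)ˣ) : (jE b k u : GLk F n k) = emb b k u := rfl

/-- The function `1 + ϖ ^ (k / 2) X ↦ ψ(ϖ ^ (k / 2 - k) tr (a X))`. -/
def chiJ (b : Module.Basis (Fin n) 𝒪[F] (OE F E)) (ψ : AddChar F ℂ) (ϖ : 𝒪[F]) (k : ℕ)
    (a : OE F E) (g : groupJ b k) : ℂ := chr ψ ϖ k (k / 2) (Algebra.leftMulMatrix b a) g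

/-- The pairing `X ↦ φ (tr (a X))` on endomorphisms of the residue field. -/
def trPair (φ : AddChar 𝓀[F] ℂ) (a : OE F E) : AddChar (Module.End 𝓀[F] (ResE F E)) ℂ :=
  φ.compAddMonoidHom ((LinearMap.trace 𝓀[F] (ResE F E)).toAddMonoidHom.comp
    (AddMonoidHom.mulLeft (LinearMap.mulLeft 𝓀[F] (resO F E a))))

lemma trPair_apply (a : OE F E) (X : Module.End 𝓀[F] (ResE F E)) : trPair φ a X =
    φ (LinearMap.trace 𝓀[F] (ResE F E) (LinearMap.mulLeft 𝓀[F] (resO F E a) * X)) := rfl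

variable (S : OddLevel ϖ ψ φ k)
include S

lemma coe_jU (X : MatO F n) : (jU b ϖ k X : GLk F n k) = uni ϖ k (k / 2) X := by
  have h : uni ϖ k (k / 2) X ∈ groupJ b k := by
    rw [groupJ, mem_groupNO_iff b S.irred S.half_pos]
    exact ⟨X, 1, by rw [map_one, mul_one]⟩
  rw [jU, dif_pos h]

lemma jU_mul (X Y : MatO F n) :
    jU b ϖ k X * jU b ϖ k Y = jU b ϖ k (X + Y + ϖ ^ (k / 2) • (X * Y)) := by
  refine Subtype.ext ?_
  rw [Subgroup.coe_mul, coe_jU S, coe_jU S, coe_jU S, uni_mul S.irred S.half_pos]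

lemma exists_jU_inv (X : MatO F n) :
    ∃ Y, (jU b ϖ k X)⁻¹ = jU b ϖ k (-X + ϖ ^ (k / 2) • Y) := by
  obtain ⟨Y, hY⟩ := exists_uni_inv (k := k) S.irred S.half_pos X
  refine ⟨Y, Subtype.ext ?_⟩
  rw [Subgroup.coe_inv, coe_jU S, coe_jU S, hY]

lemma jU_zero : jU b ϖ k 0 = 1 := by
  refine Subtype.ext ?_
  rw [coe_jU S, uni_zero S.irred S.half_pos, Subgroup.coe_one]

lemma exists_eq_jU_mul_jE (g : groupJ b k) : ∃ X u, g = jU b ϖ k X * jE b k u := by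
  obtain ⟨X, u, h⟩ := (mem_groupNO_iff b S.irred S.half_pos (Nat.div_le_self k 2)).1 g.2
  refine ⟨X, u, Subtype.ext ?_⟩
  rw [h, Subgroup.coe_mul, coe_jU S, coe_jE]

lemma redMat_add_smul (X Y : MatO F n) :
    redMat b (X + ϖ ^ (k / 2) • Y) = redMat b X := by
  obtain ⟨j, hj⟩ := Nat.exists_eq_succ_of_ne_zero S.half_pos.ne'
  rw [map_add, hj, pow_succ', mul_smul, redMat_smul_eq_zero b S.irred, add_zero]

lemma chiJ_jU (a : OE F E) (X : MatO F n) : chiJ b ψ ϖ k a (jU b ϖ k X) =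
    trChar n ψ ϖ (k / 2 + 1) (Algebra.leftMulMatrix b a * X) := by
  rw [chiJ, coe_jU S, chr_uni S.irred S.triv S.half_pos (Nat.div_le_self k 2), S.sub_half]

lemma trChar_leftMul_smul (a : OE F E) (X : MatO F n) :
    trChar n ψ ϖ (k / 2 + 1) (Algebra.leftMulMatrix b a * (ϖ ^ (k / 2) • X)) =
      trPair φ a (redMat b X) := by
  rw [mul_smul_comm, add_comm, trChar_add_smul S.irred, trChar_one_eq b S.residue_eq, map_mul,
    redMat_leftMulMatrix, trPair_apply]

/-- At odd level `N_{l'}` is one step too large for `chiJ` to be a character: the quadratic term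
lands in the last layer and leaves a residual factor. This is the cocycle of the Heisenberg group.
-/
lemma chiJ_mul (a : OE F E) (X Y : MatO F n) :
    chiJ b ψ ϖ k a (jU b ϖ k X * jU b ϖ k Y) = chiJ b ψ ϖ k a (jU b ϖ k X) *
      chiJ b ψ ϖ k a (jU b ϖ k Y) * trPair φ a (redMat b X * redMat b Y) := by
  rw [jU_mul S, chiJ_jU S, chiJ_jU S, chiJ_jU S, mul_add, mul_add, AddChar.map_add_eq_mul,
    AddChar.map_add_eq_mul, trChar_leftMul_smul S, (redMat b).map_mul]

lemma chiJ_ne_zero (a : OE F E) (X : MatO F n) : chiJ b ψ ϖ k a (jU b ϖ k X) ≠ 0 := by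
  rw [chiJ_jU S]
  exact (AddChar.val_isUnit _ _).ne_zero

/-- The torus acts on `N_{l'} / N_l` by residual conjugation; it preserves `chiJ` because it
commutes with `a`. -/
lemma exists_jE_conj (u : (OQuot F E k)ˣ) (X : MatO F n) :
    ∃ X', jE b k u * jU b ϖ k X * (jE b k u)⁻¹ = jU b ϖ k X' ∧
      redMat b X' = LinearMap.mulLeft 𝓀[F] (resU F E S.two_le u : ResE F E) * redMat b X *
        LinearMap.mulLeft 𝓀[F] (resU F E S.two_le u : ResE F E)⁻¹ ∧
      ∀ a, chiJ b ψ ϖ k a (jU b ϖ k X') = chiJ b ψ ϖ k a (jU b ϖ k X) := by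
  obtain ⟨u, rfl⟩ := quotU_surjective b S.irred S.two_le u
  have hinv : ((lamU b u)⁻¹ : (MatO F n)ˣ) = lamU b u⁻¹ := (map_inv _ _).symm
  refine ⟨(lamU b u : MatO F n) * X * ((lamU b u)⁻¹ : (MatO F n)ˣ), Subtype.ext ?_, ?_, fun a => ?_⟩
  · rw [Subgroup.coe_mul, Subgroup.coe_mul, Subgroup.coe_inv, coe_jE, emb_quotU, coe_jU S, coe_jU S,
      uni_conj S.irred S.half_pos]
  · rw [map_mul, map_mul, coe_lamU, redMat_leftMulMatrix, hinv, coe_lamU, redMat_leftMulMatrix,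
      coe_resU_quotU]
    congr 2
    have h1 : resO F E u * resO F E ((u⁻¹ : (OE F E)ˣ) : OE F E) = 1 := by
      rw [← map_mul, Units.mul_inv, map_one]
    exact eq_inv_of_mul_eq_one_right h1
  · rw [chiJ_jU S, chiJ_jU S, ← mul_assoc, trChar_mul_comm, ← mul_assoc, ← mul_assoc, hinv, coe_lamU,
      coe_lamU, ← map_mul, ← map_mul]
    congr 3
    rw [mul_right_comm, Units.inv_mul, one_mul]

lemma jU_leftMulMatrix_eq_jE (x : OE F E) : ∃ u : (OQuot F E k)ˣ,
    (u : OQuot F E k) = Ideal.Quotient.mk (PE F E ^ k)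
      (1 + algebraMap 𝒪[F] (OE F E) ϖ ^ (k / 2) * x) ∧ resU F E S.two_le u = 1 ∧
    jU b ϖ k (Algebra.leftMulMatrix b x) = jE b k u := by
  obtain ⟨u, hu⟩ := exists_unit_eq_one_add b S.irred S.half_pos x
  refine ⟨quotU F E k u, by rw [← hu]; rfl, ?_, ?_⟩
  · ext1
    rw [coe_resU_quotU, hu, map_add, (resO_eq_zero_iff S.irred _).2
      ((dvd_pow_self _ S.half_pos.ne').mul_right x), map_one, add_zero, Units.val_one]
  · refine Subtype.ext ?_
    rw [coe_jU S, coe_jE, emb_quotU, lamU_eq_uni b S.irred S.half_pos hu]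

lemma exists_of_jU_eq_jE {X : MatO F n} {u : (OQuot F E k)ˣ} (h : jU b ϖ k X = jE b k u) :
    ∃ x Z, (u : OQuot F E k) = Ideal.Quotient.mk (PE F E ^ k)
      (1 + algebraMap 𝒪[F] (OE F E) ϖ ^ (k / 2) * x) ∧ resU F E S.two_le u = 1 ∧
      X = Algebra.leftMulMatrix b x + ϖ ^ (k / 2 + 1) • Z := by
  obtain ⟨u, rfl⟩ := quotU_surjective b S.irred S.two_le u
  have h1 := congrArg Subtype.val h
  rw [coe_jU S, coe_jE, emb_quotU] at h1
  obtain ⟨x, Z, hu, hX⟩ := exists_eq_of_uni_eq_toGL S.irred S.half_pos (Nat.div_le_self k 2) h1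
  refine ⟨x, Z, by rw [← hu]; rfl, ?_, by rw [← S.sub_half]; exact hX⟩
  ext1
  rw [coe_resU_quotU, hu, map_add, (resO_eq_zero_iff S.irred _).2
    ((dvd_pow_self _ S.half_pos.ne').mul_right x), map_one, add_zero, Units.val_one]

/-- Elements of `N_{l'}` have a well-defined image in the endomorphisms of the residue field. -/
lemma redMat_eq_of_jU_eq {X Y : MatO F n} (h : jU b ϖ k X = jU b ϖ k Y) :
    redMat b X = redMat b Y := by
  have h1 := congrArg Subtype.val h
  rw [coe_jU S, coe_jU S, uni_eq_iff S.irred S.half_pos (Nat.div_le_self k 2), S.sub_half] at h1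
  obtain ⟨Z, rfl⟩ := h1
  rw [pow_succ, mul_smul, redMat_add_smul S]

lemma exists_jU_mul_inv (X Y : MatO F n) : ∃ Z, jU b ϖ k X * (jU b ϖ k Y)⁻¹ = jU b ϖ k Z ∧
    redMat b Z = redMat b X - redMat b Y := by
  obtain ⟨Y', hY'⟩ := exists_jU_inv (b := b) S Y
  refine ⟨_, by rw [hY', jU_mul S], ?_⟩
  rw [redMat_add_smul S, map_add, redMat_add_smul S, map_neg, sub_eq_add_neg]

/-- Conjugating `x u` by an element of `N_{l'}` commuting residually with `u`. -/
lemma exists_conj_jU_mul_jE (a : OE F E) (X Y : MatO F n) (u : (OQuot F E k)ˣ)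
    (hu : LinearMap.mulLeft 𝓀[F] (resU F E S.two_le u : ResE F E) * redMat b Y =
      redMat b Y * LinearMap.mulLeft 𝓀[F] (resU F E S.two_le u : ResE F E)) :
    ∃ Z, redMat b Z = 0 ∧ jU b ϖ k Y * (jU b ϖ k X * jE b k u) * (jU b ϖ k Y)⁻¹ =
      jU b ϖ k Z * (jU b ϖ k X * jE b k u) ∧
      chiJ b ψ ϖ k a (jU b ϖ k Z) =
        (trPair φ a (redMat b X * redMat b Y - redMat b Y * redMat b X))⁻¹ := by
  obtain ⟨Y', hY', hredY', hchi⟩ := exists_jE_conj (b := b) S u Y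
  rw [hu, mul_assoc] at hredY'
  have h1 : LinearMap.mulLeft 𝓀[F] (resU F E S.two_le u : ResE F E) *
      LinearMap.mulLeft 𝓀[F] (resU F E S.two_le u : ResE F E)⁻¹ = 1 := by
    ext z
    simp
  rw [h1, mul_one] at hredY'
  have hA := jU_mul (b := b) S Y X
  have hB := jU_mul (b := b) S X Y'
  obtain ⟨Z, hZ, hredZ⟩ := exists_jU_mul_inv (b := b) S (Y + X + ϖ ^ (k / 2) • (Y * X))
    (X + Y' + ϖ ^ (k / 2) • (X * Y'))
  have hZ0 : redMat b Z = 0 := by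
    rw [hredZ, redMat_add_smul S, redMat_add_smul S, map_add, map_add, hredY']
    abel
  rw [← hA, ← hB] at hZ
  refine ⟨Z, hZ0, ?_, ?_⟩
  · rw [← hZ, ← hY']
    group
  -- Evaluating both sides with the cocycle gives the value at `Z` as the quotient of the pairings
  -- in the two orders.
  · have h2 : jU b ϖ k Z * (jU b ϖ k X * jU b ϖ k Y') = jU b ϖ k Y * jU b ϖ k X := by
      rw [← hZ]
      group
    have h3 := congrArg (chiJ b ψ ϖ k a) h2
    conv_lhs at h3 => rw [hB, chiJ_mul S, hZ0, zero_mul, AddChar.map_zero_eq_one, mul_one, ← hB]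
    rw [chiJ_mul S, chiJ_mul S, hredY', hchi] at h3
    have h4 := chiJ_ne_zero (b := b) S a X
    have h5 := chiJ_ne_zero (b := b) S a Y
    have h6 : trPair φ a (redMat b X * redMat b Y) ≠ 0 := (AddChar.val_isUnit _ _).ne_zero
    have h7 : trPair φ a (redMat b Y * redMat b X) ≠ 0 := (AddChar.val_isUnit _ _).ne_zero
    rw [AddChar.map_sub_eq_div]
    field_simp
    have h8 : chiJ b ψ ϖ k a (jU b ϖ k X) * chiJ b ψ ϖ k a (jU b ϖ k Y) ≠ 0 := mul_ne_zero h4 h5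
    apply mul_left_cancel₀ h8
    linear_combination h3

/-- The elements `1 + ϖ ^ (k / 2) X` with residual image in `P`. -/
def jP (P : AddSubgroup (Module.End 𝓀[F] (ResE F E))) : Subgroup (groupJ b k) where
  carrier := {g | ∃ X, redMat b X ∈ P ∧ g = jU b ϖ k X}
  one_mem' := ⟨0, by rw [map_zero]; exact P.zero_mem, (jU_zero S).symm⟩
  mul_mem' := by
    rintro _ _ ⟨X, hX, rfl⟩ ⟨Y, hY, rfl⟩
    exact ⟨_, by rw [redMat_add_smul S, map_add]; exact P.add_mem hX hY, jU_mul S X Y⟩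
  inv_mem' := by
    rintro _ ⟨X, hX, rfl⟩
    obtain ⟨Y, hY⟩ := exists_jU_inv (b := b) S X
    exact ⟨_, by rw [redMat_add_smul S, map_neg]; exact P.neg_mem hX, hY⟩

lemma jU_mem_jP_iff {P : AddSubgroup (Module.End 𝓀[F] (ResE F E))} {X : MatO F n} :
    jU b ϖ k X ∈ jP (b := b) S P ↔ redMat b X ∈ P := by
  constructor
  · rintro ⟨Y, hY, h⟩
    rwa [redMat_eq_of_jU_eq S h]
  · exact fun h => ⟨X, h, rfl⟩

omit S

/-- Invariance under conjugation by multiplications. -/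
def ConjInv (P : AddSubgroup (Module.End 𝓀[F] (ResE F E))) : Prop :=
  ∀ c : (ResE F E)ˣ, ∀ X ∈ P, LinearMap.mulLeft 𝓀[F] (c : ResE F E) * X *
    LinearMap.mulLeft 𝓀[F] (c : ResE F E)⁻¹ ∈ P

include S

lemma jE_conj_mem_jP {P : AddSubgroup (Module.End 𝓀[F] (ResE F E))} (hP : ConjInv P)
    (u : (OQuot F E k)ˣ) {x : groupJ b k} (hx : x ∈ jP (b := b) S P) :
    jE b k u * x * (jE b k u)⁻¹ ∈ jP (b := b) S P := by
  obtain ⟨X, hX, rfl⟩ := hx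
  obtain ⟨X', hX', hred, -⟩ := exists_jE_conj (b := b) S u X
  rw [hX', jU_mem_jP_iff, hred]
  exact hP _ _ hX

lemma jE_inv_conj_mem_jP {P : AddSubgroup (Module.End 𝓀[F] (ResE F E))} (hP : ConjInv P)
    (u : (OQuot F E k)ˣ) {x : groupJ b k} (hx : x ∈ jP (b := b) S P) :
    (jE b k u)⁻¹ * x * jE b k u ∈ jP (b := b) S P := by
  have := jE_conj_mem_jP S hP u⁻¹ hx
  rwa [map_inv, inv_inv] at this

/-- The subgroup generated by `jP P` and by the image of `T`. -/
def jH (P : AddSubgroup (Module.End 𝓀[F] (ResE F E))) (T : Subgroup (OQuot F E k)ˣ) :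
    Subgroup (groupJ b k) := jP S P ⊔ ((jE b k).comp T.subtype).range

lemma mem_jH_iff {P : AddSubgroup (Module.End 𝓀[F] (ResE F E))} (hP : ConjInv P)
    {T : Subgroup (OQuot F E k)ˣ} {g : groupJ b k} :
    g ∈ jH (b := b) S P T ↔ ∃ X u, redMat b X ∈ P ∧ u ∈ T ∧ g = jU b ϖ k X * jE b k u := by
  rw [jH, mem_sup_range_iff ((jE b k).comp T.subtype) fun u x hx => jE_inv_conj_mem_jP S hP u hx]
  constructor
  · rintro ⟨_, ⟨X, hX, rfl⟩, u, rfl⟩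
    exact ⟨X, u, hX, u.2, rfl⟩
  · rintro ⟨X, u, hX, hu, rfl⟩
    exact ⟨_, ⟨X, hX, rfl⟩, ⟨u, hu⟩, rfl⟩

/-- A subspace on which the pairing vanishes, and which meets the multiplications trivially. -/
structure IsIsotropic (φ : AddChar 𝓀[F] ℂ) (a : OE F E)
    (P : AddSubgroup (Module.End 𝓀[F] (ResE F E))) : Prop where
  conjInv : ConjInv P
  pair : ∀ X ∈ P, ∀ Y ∈ P, trPair φ a (X * Y) = 1
  eq_zero : ∀ z, LinearMap.mulLeft 𝓀[F] z ∈ P → z = 0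

lemma isCharOn_chiJ {a : OE F E} {P : AddSubgroup (Module.End 𝓀[F] (ResE F E))}
    (hP : IsIsotropic φ a P) : IsCharOn (jP (b := b) S P) (chiJ b ψ ϖ k a) := by
  refine ⟨?_, ?_⟩
  · rw [← jU_zero S, chiJ_jU S, mul_zero, AddChar.map_zero_eq_one]
  · rintro _ ⟨X, hX, rfl⟩ _ ⟨Y, hY, rfl⟩
    rw [chiJ_mul S, hP.pair _ hX _ hY, mul_one]

lemma fixes_jE {P : AddSubgroup (Module.End 𝓀[F] (ResE F E))} (hP : ConjInv P) (a : OE F E)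
    (u : (OQuot F E k)ˣ) : Fixes (jP (b := b) S P) (chiJ b ψ ϖ k a) (jE b k u) := by
  intro x hx
  refine ⟨jE_inv_conj_mem_jP S hP u hx, ?_⟩
  obtain ⟨X, hX, rfl⟩ := hx
  obtain ⟨X', hX', -, hchi⟩ := exists_jE_conj (b := b) S u⁻¹ X
  rw [map_inv, inv_inv] at hX'
  rw [hX', hchi]

omit S in
lemma neg_commutator_neg {R M : Type*} [CommRing R] [AddCommGroup M] [Module R M]
    (A B : Module.End R M) : -(A * -B - -B * A) = A * B - B * A := by
  rw [mul_neg, neg_mul]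
  abel

/-- Commutators inside `N_{l'}` vanish residually, so every `jP` is normalized by `N_{l'}`; the
change of `chiJ` is the commutator pairing. -/
lemma jU_conj_mem_jP {P : AddSubgroup (Module.End 𝓀[F] (ResE F E))} {X Y : MatO F n}
    (hY : redMat b Y ∈ P) (a : OE F E) :
    (jU b ϖ k X)⁻¹ * jU b ϖ k Y * jU b ϖ k X ∈ jP (b := b) S P ∧
    chiJ b ψ ϖ k a ((jU b ϖ k X)⁻¹ * jU b ϖ k Y * jU b ϖ k X) = chiJ b ψ ϖ k a (jU b ϖ k Y) *
      trPair φ a (redMat b Y * redMat b X - redMat b X * redMat b Y) := by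
  obtain ⟨X', hX'⟩ := exists_jU_inv (b := b) S X
  obtain ⟨Z, hZ, hconj, hchi⟩ := exists_conj_jU_mul_jE (b := b) S a Y (-X + ϖ ^ (k / 2) • X') 1 (by
    rw [map_one]
    ext z
    simp)
  rw [map_one, mul_one, ← hX', inv_inv] at hconj
  rw [hconj]
  refine ⟨mul_mem ((jU_mem_jP_iff S).2 (by rw [hZ]; exact P.zero_mem)) ((jU_mem_jP_iff S).2 hY), ?_⟩
  rw [chiJ_mul S, hZ, zero_mul, AddChar.map_zero_eq_one, mul_one, hchi, mul_comm]
  congr 1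
  rw [← AddChar.map_neg_eq_inv, redMat_add_smul S, (redMat b).map_neg]
  congr 1
  exact neg_commutator_neg _ _

/-- The extension of the character of `jP P` by a character `ω` compatible with `a`. -/
lemma exists_isCharOn_jH {a : OE F E} {P : AddSubgroup (Module.End 𝓀[F] (ResE F E))}
    (hP : IsIsotropic φ a P) {ω : (OQuot F E k)ˣ →* ℂˣ} (hω : RestrictsTo b ψ ϖ ω a) :
    ∃ Λ : groupJ b k → ℂ, IsCharOn (jH (b := b) S P ⊤) Λ ∧
      ∀ X u, redMat b X ∈ P → Λ (jU b ϖ k X * jE b k u) = chiJ b ψ ϖ k a (jU b ϖ k X) * ω u := by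
  obtain ⟨Λ, h1, -, h2⟩ := exists_isCharOn_sup_range (isCharOn_chiJ (b := b) S hP)
    ((jE b k).comp (⊤ : Subgroup (OQuot F E k)ˣ).subtype) (ω.comp (⊤ : Subgroup (OQuot F E k)ˣ).subtype)
    (fun u => fixes_jE S hP.conjInv a u) (fun u hu => by
      obtain ⟨X, hX, hXu⟩ := hu
      change chiJ b ψ ϖ k a (jE b k u) = ω u
      replace hXu : jE b k u = jU b ϖ k X := hXu
      obtain ⟨x, Z, hu, -, hx⟩ := exists_of_jU_eq_jE S hXu.symm
      -- As `P` contains no nonzero multiplication, a torus element of `jP P` already lies in `N_l`,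
      -- where `ω` is given by `a`.
      have h0 : resO F E x = 0 := hP.eq_zero _ (by
        rw [hx, pow_succ, mul_smul, redMat_add_smul S, redMat_leftMulMatrix] at hX
        exact hX)
      obtain ⟨y, rfl⟩ := (resO_eq_zero_iff S.irred x).1 h0
      rw [hω y u (by rw [hu, ← mul_assoc, ← pow_succ, ← S.sub_half]), hXu, chiJ_jU S, hx, mul_add,
        mul_smul_comm, trChar_add_smul_self S.irred S.triv, leftMulMatrix_smul, psiMat_eq,
        mul_smul_comm]
      simpa using trChar_add_smul (ψ := ψ) S.irred (k / 2) 1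
        (Algebra.leftMulMatrix b a * Algebra.leftMulMatrix b y))
  exact ⟨Λ, h1, fun X u hX => h2 _ ((jU_mem_jP_iff S).2 hX) ⟨u, Subgroup.mem_top u⟩⟩

/-- The multiplication part is realized by an element `1 + ϖ ^ (k / 2) x` of `L` and divided out.
Hence adding `L` to `jP P` enlarges `P` by degree zero, the radical of the pairing. -/
lemma jU_mem_jH_of_sub_mem {P : AddSubgroup (Module.End 𝓀[F] (ResE F E))} (hP : ConjInv P)
    {X : MatO F n} {z : ResE F E} (h : redMat b X - LinearMap.mulLeft 𝓀[F] z ∈ P) :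
    jU b ϖ k X ∈ jH (b := b) S P (kerL S.two_le) := by
  obtain ⟨x, rfl⟩ := resO_surjective z
  obtain ⟨u, -, hu, hux⟩ := jU_leftMulMatrix_eq_jE (b := b) S x
  obtain ⟨Z, hZ, hred⟩ := exists_jU_mul_inv (b := b) S X (Algebra.leftMulMatrix b x)
  rw [mem_jH_iff S hP]
  refine ⟨Z, u, ?_, hu, ?_⟩
  · rw [hred, redMat_leftMulMatrix]
    exact h
  · rw [← hZ, hux, inv_mul_cancel_right]

lemma exists_sub_mem_of_mem_jH {P : AddSubgroup (Module.End 𝓀[F] (ResE F E))} (hP : ConjInv P)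
    {T : Subgroup (OQuot F E k)ˣ} {X : MatO F n} {u : (OQuot F E k)ˣ}
    (h : jU b ϖ k X * jE b k u ∈ jH (b := b) S P T) :
    ∃ z, redMat b X - LinearMap.mulLeft 𝓀[F] z ∈ P := by
  obtain ⟨X', u', hX', hu', heq⟩ := (mem_jH_iff S hP).1 h
  obtain ⟨Y, hY⟩ := exists_jU_inv (b := b) S X'
  have h1 : jU b ϖ k (-X' + ϖ ^ (k / 2) • Y + X + ϖ ^ (k / 2) • ((-X' + ϖ ^ (k / 2) • Y) * X)) =
      jE b k (u' * u⁻¹) := by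
    rw [← jU_mul S, ← hY, map_mul, map_inv, eq_mul_inv_iff_mul_eq, mul_assoc, heq,
      inv_mul_cancel_left]
  obtain ⟨x, Z, -, -, hx⟩ := exists_of_jU_eq_jE S h1
  refine ⟨resO F E x, ?_⟩
  have h2 := congrArg (redMat b) hx
  rw [pow_succ, mul_smul, redMat_add_smul S, redMat_add_smul S, map_add, redMat_add_smul S, map_neg,
    redMat_leftMulMatrix] at h2
  rw [← h2]
  simpa using hX'

end OddCase

/-! ### Comparing representations which agree on the centre of a Heisenberg subgroup with cyclic
quotient. -/

section HeisenbergExtension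

variable {G : Type*} [Group G] {V : Type*} [AddCommGroup V] [Module ℂ V]
  {V' : Type*} [AddCommGroup V'] [Module ℂ V']

lemma trace_conj (ρ : Representation ℂ G V) (w g : G) :
    LinearMap.trace ℂ V (ρ (w * g * w⁻¹)) = LinearMap.trace ℂ V (ρ g) := by
  rw [map_mul, LinearMap.trace_mul_comm, ← map_mul]
  congr 2
  group

lemma trace_eq_zero_of_conj (ρ : Representation ℂ G V) {w g z : G} {c : ℂ} (hc : c ≠ 1)
    (hz : ∀ v, ρ z v = c • v) (h : w * g * w⁻¹ = z * g) : LinearMap.trace ℂ V (ρ g) = 0 := by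
  have h1 := trace_conj ρ w g
  have h2 : ρ (z * g) = c • ρ g := by
    ext v
    rw [map_mul, Module.End.mul_apply, hz, LinearMap.smul_apply]
  rw [h, h2, map_smul, smul_eq_mul] at h1
  have h3 : (c - 1) * LinearMap.trace ℂ V (ρ g) = 0 := by
    rw [sub_mul, h1, one_mul, sub_self]
  exact (mul_eq_zero.1 h3).resolve_left (sub_ne_zero.2 hc)

/-- Two irreducible representations which agree on the centre of a Heisenberg subgroup with cyclic
quotient are twists of each other. -/
lemma IsHeisenberg.exists_twisted_equiv [Finite G] {ρ : Representation ℂ G V}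
    {ρ' : Representation ℂ G V'} (hρ : ρ.IsIrreducible) (hρ' : ρ'.IsIrreducible) {H : Subgroup G}
    {Z : Subgroup H} {ζ : H → ℂ} (hZ : IsHeisenberg Z ζ) (hζ : ∀ z ∈ Z, ∀ v, ρ z v = ζ z • v)
    (hζ' : ∀ z ∈ Z, ∀ v, ρ' z v = ζ z • v) {t : G} (ht : ∀ h ∈ H, t⁻¹ * h * t ∈ H)
    (hgen : ∀ g, ∃ h ∈ H, ∃ i : ℕ, g = h * t ^ i) :
    ∃ (f : V ≃ₗ[ℂ] V') (μ : ℂ), μ ≠ 0 ∧ (∀ h ∈ H, ∀ v, f (ρ h v) = ρ' h (f v)) ∧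
      ∀ v, ρ' t (f v) = μ • f (ρ t v) := by
  have hfd := finiteDimensional_of_isIrreducible hρ
  have hfd' := finiteDimensional_of_isIrreducible hρ'
  have hn := ((isIrreducible_iff ρ).1 hρ).1
  have hn' := ((isIrreducible_iff ρ').1 hρ').1
  obtain ⟨f₀, hf₀, hf₀'⟩ := hZ.exists_intertwining (res ρ H.subtype) (res ρ' H.subtype) hζ hζ'
  let W : Submodule ℂ (V →ₗ[ℂ] V') :=
    { carrier := {f | ∀ h ∈ H, ∀ v, f (ρ h v) = ρ' h (f v)}
      zero_mem' := fun h _ v => by simp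
      add_mem' := fun {f g} hf hg h hh v => by
        rw [LinearMap.add_apply, LinearMap.add_apply, hf h hh, hg h hh, map_add]
      smul_mem' := fun c f hf h hh v => by
        rw [LinearMap.smul_apply, LinearMap.smul_apply, hf h hh, map_smul] }
  have hmemW : ∀ f, f ∈ W ↔ ∀ h ∈ H, ∀ v, f (ρ h v) = ρ' h (f v) := fun f => Iff.rfl
  let T : (V →ₗ[ℂ] V') →ₗ[ℂ] (V →ₗ[ℂ] V') :=
    { toFun := fun f => ρ' t ∘ₗ f ∘ₗ ρ t⁻¹
      map_add' := fun f g => by ext; simp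
      map_smul' := fun c f => by ext; simp }
  have hTapp : ∀ f v, T f v = ρ' t (f (ρ t⁻¹ v)) := fun f v => rfl
  have hT : ∀ f ∈ W, T f ∈ W := fun f hf h hh v => by
    have h1 : t⁻¹ * h = (t⁻¹ * h * t) * t⁻¹ := by group
    have h2 : t * (t⁻¹ * h * t) = h * t := by group
    rw [hTapp, hTapp, ← Module.End.mul_apply, ← map_mul, h1, map_mul, Module.End.mul_apply,
      hf _ (ht h hh), ← Module.End.mul_apply, ← map_mul, h2, map_mul, Module.End.mul_apply]
  have hWn : Nontrivial W := by
    refine ⟨⟨⟨f₀, fun h hh v => hf₀' ⟨h, hh⟩ v⟩, 0, fun h => hf₀ (congrArg Subtype.val h)⟩⟩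
  obtain ⟨μ, hμ⟩ := Module.End.exists_eigenvalue (T.restrict hT)
  -- Conjugation by `t` acts on the nonzero space of `H`-intertwiners; an eigenvector intertwines
  -- `t` up to the scalar `μ`.
  obtain ⟨⟨f, hfW⟩, hf⟩ := hμ.exists_hasEigenvector
  have hf0 : f ≠ 0 := fun h => hf.2 (Subtype.ext h)
  have hfT : T f = μ • f := congrArg Subtype.val hf.apply_eq_smul
  have hft : ∀ v, ρ' t (f v) = μ • f (ρ t v) := fun v => by
    rw [← LinearMap.smul_apply, ← hfT, hTapp, ← Module.End.mul_apply, ← map_mul, inv_mul_cancel,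
      map_one, Module.End.one_apply]
  have hμ0 : μ ≠ 0 := by
    rintro rfl
    apply hf0
    ext v
    have h1 := congrArg (ρ' t⁻¹) (hft v)
    rw [zero_smul, map_zero, ← Module.End.mul_apply, ← map_mul, inv_mul_cancel, map_one,
      Module.End.one_apply] at h1
    rw [h1, LinearMap.zero_apply]
  have hpow : ∀ (i : ℕ) v, ρ' (t ^ i) (f v) = μ ^ i • f (ρ (t ^ i) v) := fun i => by
    induction i with
    | zero => intro v; simp
    | succ i ih =>
      intro v
      rw [pow_succ', map_mul, Module.End.mul_apply, ih, map_smul, hft, smul_smul, ← pow_succ,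
        map_mul, Module.End.mul_apply]
  have hgenf : ∀ g, ∃ c : ℂ, c ≠ 0 ∧ ∀ v, ρ' g (f v) = c • f (ρ g v) := fun g => by
    obtain ⟨h, hh, i, rfl⟩ := hgen g
    refine ⟨μ ^ i, pow_ne_zero _ hμ0, fun v => ?_⟩
    rw [map_mul, Module.End.mul_apply, hpow, map_smul, ← hfW h hh, map_mul, Module.End.mul_apply]
  have hinj : Function.Injective f := by
    rw [← LinearMap.ker_eq_bot]
    refine (((isIrreducible_iff ρ).1 hρ).2 _ fun g v hv => ?_).resolve_right fun h =>
      hf0 (LinearMap.ker_eq_top.1 h)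
    obtain ⟨c, hc, hc'⟩ := hgenf g
    rw [LinearMap.mem_ker] at hv ⊢
    have := hc' v
    rw [hv, map_zero, eq_comm, smul_eq_zero] at this
    exact this.resolve_left hc
  have hsurj : Function.Surjective f := by
    rw [← LinearMap.range_eq_top]
    refine (((isIrreducible_iff ρ').1 hρ').2 _ ?_).resolve_left fun h =>
      hf0 (LinearMap.range_eq_bot.1 h)
    rintro g _ ⟨v, rfl⟩
    obtain ⟨c, -, hc⟩ := hgenf g
    exact ⟨c • ρ g v, by rw [hc, map_smul]⟩
  exact ⟨LinearEquiv.ofBijective f ⟨hinj, hsurj⟩, μ, hμ0, hfW, hft⟩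

lemma trace_twisted {ρ : Representation ℂ G V} {ρ' : Representation ℂ G V'} {H : Subgroup G}
    {t : G} (f : V ≃ₗ[ℂ] V') {μ : ℂ} (hH : ∀ h ∈ H, ∀ v, f (ρ h v) = ρ' h (f v))
    (ht : ∀ v, ρ' t (f v) = μ • f (ρ t v)) {h : G} (hh : h ∈ H) (i : ℕ) :
    LinearMap.trace ℂ V' (ρ' (h * t ^ i)) = μ ^ i * LinearMap.trace ℂ V (ρ (h * t ^ i)) := by
  have hpow : ∀ (i : ℕ) v, ρ' (t ^ i) (f v) = μ ^ i • f (ρ (t ^ i) v) := fun i => by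
    induction i with
    | zero => intro v; simp
    | succ i ih =>
      intro v
      rw [pow_succ', map_mul, Module.End.mul_apply, ih, map_smul, ht, smul_smul, ← pow_succ,
        map_mul, Module.End.mul_apply]
  have h1 : ρ' (h * t ^ i) = μ ^ i • f.conj (ρ (h * t ^ i)) := by
    ext v
    obtain ⟨v, rfl⟩ := f.surjective v
    rw [map_mul, Module.End.mul_apply, hpow, map_smul, ← hH h hh, LinearMap.smul_apply,
      LinearEquiv.conj_apply_apply, LinearEquiv.symm_apply_apply, map_mul, Module.End.mul_apply]
  rw [h1, map_smul, LinearMap.trace_conj', smul_eq_mul]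

/-- The twist between the two representations is the scalar `μ`, and equal nonzero traces at `t`
force `μ = 1`. -/
lemma IsHeisenberg.nonempty_equiv [Finite G] {ρ : Representation ℂ G V}
    {ρ' : Representation ℂ G V'} (hρ : ρ.IsIrreducible) (hρ' : ρ'.IsIrreducible) {H : Subgroup G}
    {Z : Subgroup H} {ζ : H → ℂ} (hZ : IsHeisenberg Z ζ) (hζ : ∀ z ∈ Z, ∀ v, ρ z v = ζ z • v)
    (hζ' : ∀ z ∈ Z, ∀ v, ρ' z v = ζ z • v) {t : G} (ht : ∀ h ∈ H, t⁻¹ * h * t ∈ H)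
    (hgen : ∀ g, ∃ h ∈ H, ∃ i : ℕ, g = h * t ^ i)
    (htr : LinearMap.trace ℂ V (ρ t) = LinearMap.trace ℂ V' (ρ' t))
    (htr0 : LinearMap.trace ℂ V (ρ t) ≠ 0) : Nonempty (ρ.Equiv ρ') := by
  obtain ⟨f, μ, -, hH, hft⟩ := hZ.exists_twisted_equiv hρ hρ' hζ hζ' ht hgen
  have h1 := trace_twisted f hH hft H.one_mem 1
  rw [one_mul, pow_one, pow_one, ← htr] at h1
  have hμ : μ = 1 := (mul_eq_right₀ htr0).1 h1.symm
  subst hμ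
  have hft' : ∀ v, f (ρ t v) = ρ' t (f v) := fun v => by rw [hft, one_smul]
  refine nonempty_equiv_of_ne_zero hρ hρ' f.toLinearMap (fun g v => ?_) fun h0 => ?_
  · obtain ⟨h, hh, i, rfl⟩ := hgen g
    have hpow : ∀ v, f (ρ (t ^ i) v) = ρ' (t ^ i) (f v) := by
      induction i with
      | zero => intro v; simp
      | succ i ih =>
        intro v
        rw [pow_succ, map_mul, map_mul, Module.End.mul_apply, Module.End.mul_apply, ih, hft']
    rw [LinearEquiv.coe_coe, map_mul, map_mul, Module.End.mul_apply, Module.End.mul_apply, hH h hh,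
      hpow]
  · apply htr0
    have : ρ t = 0 := by
      ext v
      apply f.injective
      rw [LinearMap.zero_apply, map_zero]
      exact LinearMap.congr_fun h0 _
    rw [this, map_zero]

end HeisenbergExtension

/-! ### Isotropic subspaces and Heisenberg subgroups of `J`. -/

section OddHeisenberg

variable {F : Type u} [Field F] [ValuativeRel F] [TopologicalSpace F]
  [IsNonarchimedeanLocalField F]
variable {E : Type v} [Field E] [Algebra F E] [IsUnramifiedExtension F E]
variable {n k : ℕ} {ϖ : 𝒪[F]} {b : Module.Basis (Fin n) 𝒪[F] (OE F E)} {ψ : AddChar F ℂ}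
  {φ : AddChar 𝓀[F] ℂ}

include b in
lemma exists_frobenius : ∃ σ : ResE F E ≃ₐ[𝓀[F]] ResE F E,
    orderOf σ = Module.finrank 𝓀[F] (ResE F E) ∧ ∀ x, σ x = x ^ Nat.card 𝓀[F] := by
  have := finiteDimensional_resE b
  have := finite_resE b
  cases nonempty_fintype 𝓀[F]
  refine ⟨FiniteField.frobeniusAlgEquivOfAlgebraic 𝓀[F] (ResE F E),
    FiniteField.orderOf_frobeniusAlgEquivOfAlgebraic _ _, fun x => ?_⟩
  rw [FiniteField.coe_frobeniusAlgEquivOfAlgebraic, Nat.card_eq_fintype_card]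

include b in
lemma exists_generator : ∃ c : (ResE F E)ˣ, ∀ x, x ∈ Subgroup.zpowers c := by
  have := finite_resE b
  exact IsCyclic.exists_generator

include b in
lemma resU_surjective (hϖ : Irreducible ϖ) (hk : 2 ≤ k) :
    Function.Surjective (resU F E hk) := by
  intro c
  obtain ⟨x, hx⟩ := resO_surjective (c : ResE F E)
  obtain ⟨u, hu⟩ := isUnit_of_resO_ne_zero hϖ b (x := x) (by rw [hx]; exact c.ne_zero)
  exact ⟨quotU F E k u, Units.ext (by rw [coe_resU_quotU, hu, hx])⟩

variable (b) in
include b in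
lemma exists_eq_mul_pow (hk : 2 ≤ k) {u₀ : (OQuot F E k)ˣ}
    (hu₀ : ∀ x, x ∈ Subgroup.zpowers (resU F E hk u₀)) (u : (OQuot F E k)ˣ) :
    ∃ v ∈ kerL hk, ∃ i : ℕ, u = v * u₀ ^ i := by
  have := finite_resE b
  obtain ⟨i, hi⟩ := (isOfFinOrder_of_finite _).mem_powers_iff_mem_zpowers.2 (hu₀ (resU F E hk u))
  refine ⟨u * (u₀ ^ i)⁻¹, ?_, i, by rw [inv_mul_cancel_right]⟩
  rw [mem_kerL_iff, map_mul, map_inv, map_pow]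
  exact mul_inv_eq_one.2 hi.symm

lemma conjInv_bot : ConjInv (⊥ : AddSubgroup (Module.End 𝓀[F] (ResE F E))) := by
  rintro c X hX
  rw [AddSubgroup.mem_bot] at hX ⊢
  rw [hX, mul_zero, zero_mul]

lemma conjInv_top : ConjInv (⊤ : AddSubgroup (Module.End 𝓀[F] (ResE F E))) :=
  fun _ _ _ => AddSubgroup.mem_top _

lemma conjInv_degs (σ : ResE F E ≃ₐ[𝓀[F]] ResE F E) (D : Finset ℕ) : ConjInv (degs σ D) :=
  fun _ _ hX => conj_mem_degs hX _ _

lemma isIsotropic_bot (a : OE F E) :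
    IsIsotropic φ a (⊥ : AddSubgroup (Module.End 𝓀[F] (ResE F E))) := by
  refine ⟨conjInv_bot, ?_, ?_⟩
  · rintro X hX Y -
    rw [AddSubgroup.mem_bot.1 hX, zero_mul, AddChar.map_zero_eq_one]
  · intro z hz
    have := LinearMap.congr_fun (AddSubgroup.mem_bot.1 hz) 1
    simpa using this

include b in
-- Two degrees of `lowDegs` add up to a number strictly between `0` and `n`, so their products have
-- no trace against `a`.
lemma isIsotropic_lowDegs {σ : ResE F E ≃ₐ[𝓀[F]] ResE F E}
    (hσ : orderOf σ = Module.finrank 𝓀[F] (ResE F E)) (a : OE F E) :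
    IsIsotropic φ a (degs σ (lowDegs (Module.finrank 𝓀[F] (ResE F E)))) := by
  have := finiteDimensional_resE b
  have := finite_resE b
  refine ⟨conjInv_degs σ _, fun X hX Y hY => ?_, fun z hz => ?_⟩
  · rw [trPair_apply, trace_mulLeft_mul_mul_eq_zero hσ _ hX hY, AddChar.map_zero_eq_one]
    intro i hi j hj
    rw [Finset.mem_Ico] at hi hj
    omega
  · refine eq_zero_of_mulLeft_mem_degs hσ (fun i hi => ?_) hz
    rw [Finset.mem_Ico] at hi
    omega

variable (S : OddLevel ϖ ψ φ k)
include S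

lemma jH_mono_right {P : AddSubgroup (Module.End 𝓀[F] (ResE F E))} {T : Subgroup (OQuot F E k)ˣ} :
    jH (b := b) S P T ≤ jH S P ⊤ := by
  refine sup_le_sup_left ?_ _
  rintro _ ⟨u, rfl⟩
  exact ⟨⟨u, Subgroup.mem_top _⟩, rfl⟩

lemma jU_mul_jE_mem_jH {P : AddSubgroup (Module.End 𝓀[F] (ResE F E))} {T : Subgroup (OQuot F E k)ˣ}
    {X : MatO F n} {u : (OQuot F E k)ˣ} (hX : redMat b X ∈ P) (hu : u ∈ T) :
    jU b ϖ k X * jE b k u ∈ jH S P T :=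
  mul_mem (le_sup_left (b := ((jE b k).comp T.subtype).range) ⟨X, hX, rfl⟩)
    (le_sup_right (a := jP S P) ⟨⟨u, hu⟩, rfl⟩)

lemma jU_mem_jH {P : AddSubgroup (Module.End 𝓀[F] (ResE F E))} {T : Subgroup (OQuot F E k)ˣ}
    {X : MatO F n} (hX : redMat b X ∈ P) : jU b ϖ k X ∈ jH S P T := by
  have := jU_mul_jE_mem_jH S hX T.one_mem
  rwa [map_one, mul_one] at this

/-- An element pairing nontrivially with some `Y ∈ Q` has a commutator with `jU Y` in `N_l` at which
`Λ` is nontrivial; otherwise `hnd` places it in the centre. It is used for the zero subspace inside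
everything, and for `lowSub` inside `orthSub`. -/
lemma isHeisenberg_jH {a : OE F E} {P Q : AddSubgroup (Module.End 𝓀[F] (ResE F E))}
    (hP : IsIsotropic φ a P) (hQ : ConjInv Q)
    (hnd : ∀ X ∈ Q, (∀ Y ∈ Q, trPair φ a (X * Y - Y * X) = 1) →
      ∃ z, X - LinearMap.mulLeft 𝓀[F] z ∈ P) {ω : (OQuot F E k)ˣ →* ℂˣ} {Λ : groupJ b k → ℂ}
    (hΛ : IsCharOn (jH (b := b) S P ⊤) Λ)
    (hΛ' : ∀ X u, redMat b X ∈ P → Λ (jU b ϖ k X * jE b k u) = chiJ b ψ ϖ k a (jU b ϖ k X) * ω u) :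
    IsHeisenberg ((jH (b := b) S P (kerL S.two_le)).subgroupOf (jH (b := b) S Q (kerL S.two_le)))
      (fun h => Λ (h : groupJ b k)) := by
  refine ⟨⟨hΛ.one, fun x hx y hy => hΛ.mul _ (jH_mono_right S hx) _ (jH_mono_right S hy)⟩,
    fun h hh => ?_⟩
  obtain ⟨X, u, hX, hu, hXu⟩ := (mem_jH_iff (b := b) S hQ).1 h.2
  have hu1 : resU F E S.two_le u = 1 := (mem_kerL_iff S.two_le u).1 hu
  by_cases hpair : ∀ Y ∈ Q, trPair φ a (redMat b X * Y - Y * redMat b X) = 1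
  · refine absurd ?_ hh
    rw [Subgroup.mem_subgroupOf, hXu]
    obtain ⟨z, hz⟩ := hnd _ hX hpair
    refine mul_mem (jU_mem_jH_of_sub_mem S hP.conjInv hz) ?_
    have h1 := jU_mul_jE_mem_jH (b := b) S (P := P) (X := 0) (by rw [map_zero]; exact P.zero_mem) hu
    rwa [jU_zero S, one_mul] at h1
  · push Not at hpair
    obtain ⟨Y, hY, hne⟩ := hpair
    obtain ⟨Y, rfl⟩ := redMat_surjective b Y
    obtain ⟨Z, hZ, hconj, hchi⟩ := exists_conj_jU_mul_jE (b := b) S a X Y u (by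
      rw [hu1]
      ext z
      simp)
    have hcomm : jU b ϖ k Y * (jU b ϖ k X * jE b k u) * (jU b ϖ k Y)⁻¹ *
        (jU b ϖ k X * jE b k u)⁻¹ = jU b ϖ k Z := by
      rw [hconj, mul_inv_cancel_right]
    refine ⟨⟨_, jU_mem_jH S hY⟩, ?_, ?_⟩
    · rw [Subgroup.mem_subgroupOf]
      simp only [Subgroup.coe_mul, Subgroup.coe_inv, hXu, hcomm]
      exact jU_mem_jH S (by rw [hZ]; exact P.zero_mem)
    · simp only [Subgroup.coe_mul, Subgroup.coe_inv, hXu, hcomm]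
      have h1 := hΛ' Z 1 (by rw [hZ]; exact P.zero_mem)
      rw [map_one, mul_one, map_one, Units.val_one, mul_one] at h1
      rw [h1, hchi]
      exact fun h => hne (inv_eq_one.1 h)

end OddHeisenberg

/-! ### Traces on eigenspaces, and twists by characters. -/

section EigTrace

variable {G : Type*} [Group G] {V : Type*} [AddCommGroup V] [Module ℂ V]

lemma Fixes.mul {N : Subgroup G} {χ : G → ℂ} {g h : G} (hg : Fixes N χ g) (hh : Fixes N χ h) :
    Fixes N χ (g * h) := by
  intro x hx
  obtain ⟨h1, h2⟩ := hg x hx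
  obtain ⟨h3, h4⟩ := hh _ h1
  have h5 : (g * h)⁻¹ * x * (g * h) = h⁻¹ * (g⁻¹ * x * g) * h := by group
  rw [h5]
  exact ⟨h3, h4.trans h2⟩

/-- If the trace is equivariant under `N` at `g`, it can be computed on the eigenspace. -/
lemma trace_eigRep_eq [Finite G] (ρ : Representation ℂ G V) [FiniteDimensional ℂ V]
    {N : Subgroup G} {χ : G → ℂ} (hχ : IsCharOn N χ) (S : Subgroup G) (hS : ∀ s ∈ S, Fixes N χ s)
    {g : G} (hg : g ∈ S)
    (htr : ∀ x ∈ N, LinearMap.trace ℂ V (ρ (x * g)) = χ x * LinearMap.trace ℂ V (ρ g)) :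
    LinearMap.trace ℂ (eig ρ N χ) (eigRep ρ S hS ⟨g, hg⟩) = LinearMap.trace ℂ V (ρ g) := by
  classical
  have hmem : ∀ v, (eigProj ρ N χ * ρ g) v ∈ eig ρ N χ := fun v => eigProj_mem ρ hχ _
  have h1 := LinearMap.trace_restrict_eq_of_forall_mem (eig ρ N χ) (eigProj ρ N χ * ρ g) hmem
  have h2 : (eigProj ρ N χ * ρ g).restrict (fun v _ => hmem v) = eigRep ρ S hS ⟨g, hg⟩ := by
    ext v
    exact eigProj_of_mem ρ hχ ((hS g hg).apply_mem_eig v.2)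
  rw [h2] at h1
  letI := Fintype.ofFinite N
  have h3 : eigProj ρ N χ * ρ g = (Nat.card N : ℂ)⁻¹ • ∑ x : N, (χ x)⁻¹ • ρ (x * g) := by
    ext v
    rw [Module.End.mul_apply, eigProj_apply, LinearMap.smul_apply, LinearMap.sum_apply]
    congr 1
    refine Finset.sum_congr rfl fun x _ => ?_
    rw [LinearMap.smul_apply, map_mul, Module.End.mul_apply]
  rw [h1, h3, map_smul, map_sum]
  have h4 : ∀ x : N, LinearMap.trace ℂ V ((χ x)⁻¹ • ρ (x * g)) = LinearMap.trace ℂ V (ρ g) := by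
    intro x
    rw [map_smul, htr x x.2, smul_eq_mul, inv_mul_cancel_left₀ (hχ.ne_zero x.2)]
  simp only [h4, Finset.sum_const, Finset.card_univ, Fintype.card_eq_nat_card]
  have h5 : (Nat.card N : ℂ) ≠ 0 := Nat.cast_ne_zero.2 Nat.card_pos.ne'
  rw [nsmul_eq_mul, smul_eq_mul, inv_mul_cancel_left₀ h5]

lemma IsHeisenberg.comap {G' : Type*} [Group G'] {Z : Subgroup G} {ζ : G → ℂ}
    (hZ : IsHeisenberg Z ζ) (e : G' →* G) (he : Function.Surjective e) :
    IsHeisenberg (Z.comap e) (fun x => ζ (e x)) := by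
  refine ⟨hZ.char.comap e, fun h hh => ?_⟩
  obtain ⟨k, hk, hne⟩ := hZ.nondeg (e h) hh
  obtain ⟨k, rfl⟩ := he k
  refine ⟨k, ?_, ?_⟩
  · rw [Subgroup.mem_comap]
    simpa using hk
  · simpa using hne

/-- The twist of a representation by a character. -/
def twist (ρ : Representation ℂ G V) (χ : G →* ℂˣ) : Representation ℂ G V where
  toFun g := (χ g : ℂ) • ρ g
  map_one' := by simp
  map_mul' g h := by
    rw [map_mul, map_mul, Units.val_mul, smul_mul_smul_comm]

lemma twist_apply (ρ : Representation ℂ G V) (χ : G →* ℂˣ) (g : G) (v : V) :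
    twist ρ χ g v = (χ g : ℂ) • ρ g v := rfl

lemma trace_twist (ρ : Representation ℂ G V) (χ : G →* ℂˣ) (g : G) :
    LinearMap.trace ℂ V (twist ρ χ g) = χ g * LinearMap.trace ℂ V (ρ g) := by
  change LinearMap.trace ℂ V ((χ g : ℂ) • ρ g) = _
  rw [map_smul, smul_eq_mul]

lemma isIrreducible_twist {ρ : Representation ℂ G V} (hρ : ρ.IsIrreducible) (χ : G →* ℂˣ) :
    (twist ρ χ).IsIrreducible := by
  rw [isIrreducible_iff] at hρ ⊢
  refine ⟨hρ.1, fun W hW => hρ.2 W fun g w hw => ?_⟩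
  have h1 := W.smul_mem (χ g : ℂ)⁻¹ (hW g w hw)
  rwa [twist_apply, smul_smul, inv_mul_cancel₀ (χ g).ne_zero, one_smul] at h1

end EigTrace

/-! ### Characters of representations of `J` over a primitive `a`, at odd level. -/

section OddCharacters

variable {F : Type u} [Field F] [ValuativeRel F] [TopologicalSpace F]
  [IsNonarchimedeanLocalField F]
variable {E : Type v} [Field E] [Algebra F E] [IsUnramifiedExtension F E]
variable {n k : ℕ} {ϖ : 𝒪[F]} {b : Module.Basis (Fin n) 𝒪[F] (OE F E)} {ψ : AddChar F ℂ}
  {φ : AddChar 𝓀[F] ℂ}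
variable {M : Type*} [AddCommGroup M] [Module ℂ M]

variable (S : OddLevel ϖ ψ φ k)
include S

omit S in
variable (b) in
lemma jE_mul_comm (u w : (OQuot F E k)ˣ) : jE b k u * jE b k w = jE b k w * jE b k u :=
  (map_mul (jE b k) u w).symm.trans ((congrArg _ (Units.ext (mul_comm (u : OQuot F E k) w))).trans (map_mul (jE b k) w u))

lemma coe_jU_smul (B : MatO F n) : (jU b ϖ k (ϖ • B) : GLk F n k) = uni ϖ k (k - k / 2) B := by
  rw [coe_jU S, S.sub_half, uni_add_pow 1 S.irred S.half_pos, pow_one]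

lemma chiJ_jU_smul (a : OE F E) (B : MatO F n) : chiJ b ψ ϖ k a (jU b ϖ k (ϖ • B)) =
    psiMat ψ ϖ (k / 2) (Algebra.leftMulMatrix b a) B := by
  have h1 := trChar_add_smul (ψ := ψ) S.irred (k / 2) 1 (Algebra.leftMulMatrix b a * B)
  rw [pow_one] at h1
  rw [chiJ_jU S, psiMat_eq, mul_smul_comm, h1]

lemma actsByScalars_iff {ω : (OQuot F E k)ˣ →* ℂˣ} {a : OE F E} {T : Subgroup (OQuot F E k)ˣ}
    {τ : Representation ℂ (groupJ b k) M} : ActsByScalars b ψ ϖ ω a T τ ↔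
      ∀ X u, redMat b X = 0 → u ∈ T → ∀ v, τ (jU b ϖ k X * jE b k u) v =
        (chiJ b ψ ϖ k a (jU b ϖ k X) * (ω u : ℂ)) • v := by
  constructor
  · intro h X u hX hu v
    obtain ⟨B, rfl⟩ := (redMat_eq_zero_iff b S.irred X).1 hX
    rw [chiJ_jU_smul S]
    refine h B (uni ϖ k (k - k / 2) B) u _ ?_ hu ?_ v
    · exact (eq_uni_iff S.irred (by have := S.sub_half; omega)).2 rfl
    · rw [Subgroup.coe_mul, coe_jU_smul S, coe_jE]
  · intro h B x u g hx hu hg v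
    rw [eq_uni_iff S.irred (by have := S.sub_half; omega)] at hx
    have h1 : g = jU b ϖ k (ϖ • B) * jE b k u := by
      refine Subtype.ext ?_
      rw [hg, hx, Subgroup.coe_mul, coe_jU_smul S, coe_jE]
    rw [h1, h _ u (redMat_smul_eq_zero b S.irred B) hu, chiJ_jU_smul S]

lemma jU_mul_jE_mem_groupNO {X : MatO F n} (hX : redMat b X = 0) (u : (OQuot F E k)ˣ) :
    ((jU b ϖ k X * jE b k u : groupJ b k) : GLk F n k) ∈ groupNO b (Nat.sub_le k (k / 2)) := by
  obtain ⟨B, rfl⟩ := (redMat_eq_zero_iff b S.irred X).1 hX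
  rw [mem_groupNO_iff b S.irred (by have := S.sub_half; omega)]
  exact ⟨B, u, by rw [Subgroup.coe_mul, coe_jU_smul S, coe_jE]⟩

/-- The character of a representation of `J` lying over `a` vanishes off the conjugates of
`N_l 𝔒_k^×`. -/
lemma trace_eq_zero_of_forall_conj_not_mem {a : OE F E} (ha : IsPrimitiveElt 𝓀[F] (resO F E a))
    {τ : Representation ℂ (groupJ b k) M}
    (hτ : ∀ X, redMat b X = 0 → ∀ v, τ (jU b ϖ k X) v = chiJ b ψ ϖ k a (jU b ϖ k X) • v)
    {g : groupJ b k} (hg : ¬ ∃ h : groupJ b k, ((h * g * h⁻¹ : groupJ b k) : GLk F n k) ∈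
      groupNO b (Nat.sub_le k (k / 2))) :
    LinearMap.trace ℂ M (τ g) = 0 := by
  have := finiteDimensional_resE b
  have := finite_resE b
  obtain ⟨σ, hσ, -⟩ := exists_frobenius (b := b)
  obtain ⟨X, u, rfl⟩ := exists_eq_jU_mul_jE (b := b) S g
  set c := resU F E S.two_le u with hc
  -- If `X` pairs trivially with the centralizer of `c`, then `X = W - c W c⁻¹ + z`, and conjugation
  -- by the inverse of `jU W` moves the element into `N_l 𝔒_k^×`. Otherwise conjugation by some `jU
  -- Y` multiplies its action by a scalar different from `1`.
  by_cases hpair : ∀ Y, LinearMap.mulLeft 𝓀[F] (c : ResE F E) * Y =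
      Y * LinearMap.mulLeft 𝓀[F] (c : ResE F E) → trPair φ a (redMat b X * Y - Y * redMat b X) = 1
  · exfalso
    apply hg
    obtain ⟨W, z, hWz⟩ := exists_sub_conj_add_mulLeft_eq hσ S.residue_ne_one ha c.ne_zero hpair
    obtain ⟨W, rfl⟩ := redMat_surjective b W
    obtain ⟨W', hW', hredW', -⟩ := exists_jE_conj (b := b) S u W
    obtain ⟨W₁, hW₁⟩ := exists_jU_inv (b := b) S W
    obtain ⟨x, rfl⟩ := resO_surjective z
    obtain ⟨u', -, hu', hux⟩ := jU_leftMulMatrix_eq_jE (b := b) S x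
    have h1 : jU b ϖ k X * jU b ϖ k W' =
      jU b ϖ k (X + W' + ϖ ^ (k / 2) • (X * W')) := jU_mul S _ _
    set V := X + W' + ϖ ^ (k / 2) • (X * W') with hV
    have h2 : (jU b ϖ k W)⁻¹ * jU b ϖ k V =
        jU b ϖ k (-W + ϖ ^ (k / 2) • W₁ + V + ϖ ^ (k / 2) • ((-W + ϖ ^ (k / 2) • W₁) * V)) := by
      rw [hW₁, jU_mul S]
    set V' := -W + ϖ ^ (k / 2) • W₁ + V + ϖ ^ (k / 2) • ((-W + ϖ ^ (k / 2) • W₁) * V) with hV'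
    obtain ⟨Z, hZ, hredZ⟩ := exists_jU_mul_inv (b := b) S V' (Algebra.leftMulMatrix b x)
    refine ⟨(jU b ϖ k W)⁻¹, ?_⟩
    have h3 : (jU b ϖ k W)⁻¹ * (jU b ϖ k X * jE b k u) * (jU b ϖ k W)⁻¹⁻¹ =
        jU b ϖ k Z * jE b k (u' * u) := by
      rw [← hZ, map_mul, ← hux, ← h2, ← h1, ← hW']
      group
    rw [h3]
    refine jU_mul_jE_mem_groupNO S ?_ _
    rw [hredZ, hV', redMat_add_smul S, map_add, redMat_add_smul S, hV, redMat_add_smul S, map_add,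
      hredW', redMat_leftMulMatrix, ← hWz, (redMat b).map_neg]
    abel
  · push Not at hpair
    obtain ⟨Y, hY, hne⟩ := hpair
    obtain ⟨Y, rfl⟩ := redMat_surjective b Y
    obtain ⟨Z, hZ, hconj, hchi⟩ := exists_conj_jU_mul_jE (b := b) S a X Y u hY
    exact trace_eq_zero_of_conj τ (fun h => hne (inv_eq_one.1 (hchi ▸ h))) (hτ Z hZ) hconj

/-- For elliptic `u` with residue `c`, `exists_sub_conj_eq` writes the residue of `X` as `W - c W
c⁻¹` with `W` in the same isotropic space. So `jU X * jE u` is, up to `N_l`, a conjugate of `jE u`,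
and isotropy shows that the only scalar left is `chiJ` at `jU X`. -/
lemma trace_jU_mul_jE {a : OE F E} {τ : Representation ℂ (groupJ b k) M}
    (hτ : ∀ X, redMat b X = 0 → ∀ v, τ (jU b ϖ k X) v = chiJ b ψ ϖ k a (jU b ϖ k X) • v)
    {σ : ResE F E ≃ₐ[𝓀[F]] ResE F E} (hσ : orderOf σ = Module.finrank 𝓀[F] (ResE F E))
    {u : (OQuot F E k)ˣ} (hu : IsPrimitiveElt 𝓀[F] (resU F E S.two_le u : ResE F E))
    {X : MatO F n} (hX : redMat b X ∈ degs σ (lowDegs (Module.finrank 𝓀[F] (ResE F E)))) :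
    LinearMap.trace ℂ M (τ (jU b ϖ k X * jE b k u)) =
      chiJ b ψ ϖ k a (jU b ϖ k X) * LinearMap.trace ℂ M (τ (jE b k u)) := by
  have := finiteDimensional_resE b
  have := finite_resE b
  have hiso := isIsotropic_lowDegs (b := b) (φ := φ) hσ a
  obtain ⟨W, hW, hWX⟩ := hu.exists_sub_conj_eq hσ (Units.ne_zero _) (fun i hi => by
    rw [Finset.mem_Ico] at hi
    omega) hX
  obtain ⟨W, rfl⟩ := redMat_surjective b W
  obtain ⟨W', hW', hredW', hchi'⟩ := exists_jE_conj (b := b) S u W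
  obtain ⟨V, hV, hredV⟩ := exists_jU_mul_inv (b := b) S W W'
  rw [hredW', hWX] at hredV
  have hredW'P : redMat b W' ∈ degs σ (lowDegs (Module.finrank 𝓀[F] (ResE F E))) := by
    rw [hredW']
    exact hiso.conjInv _ _ hW
  have hchiV : chiJ b ψ ϖ k a (jU b ϖ k V) = 1 := by
    have h1 : jU b ϖ k V * jU b ϖ k W' = jU b ϖ k W := by rw [← hV, inv_mul_cancel_right]
    have h2 := congrArg (chiJ b ψ ϖ k a) h1
    rw [chiJ_mul S, hredV, hiso.pair _ hX _ hredW'P, mul_one, hchi'] at h2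
    exact (mul_eq_right₀ (chiJ_ne_zero S a W)).1 h2
  obtain ⟨Z, hZ, hredZ⟩ := exists_jU_mul_inv (b := b) S X V
  rw [hredV, sub_self] at hredZ
  have hZV : jU b ϖ k X = jU b ϖ k Z * jU b ϖ k V := by rw [← hZ, inv_mul_cancel_right]
  have hchiX : chiJ b ψ ϖ k a (jU b ϖ k X) = chiJ b ψ ϖ k a (jU b ϖ k Z) := by
    rw [hZV, chiJ_mul S, hredZ, zero_mul, AddChar.map_zero_eq_one, mul_one, hchiV, mul_one]
  have hconj : jU b ϖ k W * jE b k u * (jU b ϖ k W)⁻¹ = jU b ϖ k V * jE b k u := by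
    rw [← hV, ← hW']
    group
  have h3 : τ (jU b ϖ k X * jE b k u) =
      chiJ b ψ ϖ k a (jU b ϖ k X) • τ (jU b ϖ k W * jE b k u * (jU b ϖ k W)⁻¹) := by
    ext v
    rw [hchiX, hconj, hZV, mul_assoc, map_mul, Module.End.mul_apply, hτ Z hredZ,
      LinearMap.smul_apply]
  rw [h3, map_smul, trace_conj, smul_eq_mul]

/-- Residually `N_l` and `L` are trivial, so commutators of `N_l L` with `N_{l'}` lie in the kernel
of the character, and the torus preserves it. Hence `N_l L` acts by scalars in any irreducible
representation of `J` in which the character occurs. -/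
lemma fixes_jH_bot {a : OE F E} {ω : (OQuot F E k)ˣ →* ℂˣ} {Λ : groupJ b k → ℂ}
    (hΛ' : ∀ X u, redMat b X = 0 → Λ (jU b ϖ k X * jE b k u) = chiJ b ψ ϖ k a (jU b ϖ k X) * ω u)
    (g : groupJ b k) : Fixes (jH (b := b) S ⊥ (kerL S.two_le)) Λ g := by
  obtain ⟨Y, w, rfl⟩ := exists_eq_jU_mul_jE (b := b) S g
  refine Fixes.mul ?_ ?_
  · obtain ⟨Y', hY'⟩ := exists_jU_inv (b := b) S Y
    intro x hx
    obtain ⟨X, u, hX, hu, rfl⟩ := (mem_jH_iff S conjInv_bot).1 hx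
    rw [AddSubgroup.mem_bot] at hX
    have hu1 : resU F E S.two_le u = 1 := (mem_kerL_iff S.two_le u).1 hu
    obtain ⟨Z, hZ, hconj, hchi⟩ := exists_conj_jU_mul_jE (b := b) S a X (-Y + ϖ ^ (k / 2) • Y') u
      (by
        rw [hu1]
        ext z
        simp)
    rw [hX, zero_mul, mul_zero, sub_zero, AddChar.map_zero_eq_one, inv_one] at hchi
    rw [← hY', inv_inv, ← mul_assoc (jU b ϖ k Z) (jU b ϖ k X) (jE b k u)] at hconj
    rw [hconj, jU_mul S]
    have hred : redMat b (Z + X + ϖ ^ (k / 2) • (Z * X)) = 0 := by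
      rw [redMat_add_smul S, map_add, hZ, hX, add_zero]
    refine ⟨jU_mul_jE_mem_jH S (by rw [hred]; exact AddSubgroup.zero_mem _) hu, ?_⟩
    rw [hΛ' _ _ hred, hΛ' _ _ hX, ← jU_mul S, chiJ_mul S, hchi, hZ, zero_mul,
      AddChar.map_zero_eq_one, mul_one, one_mul]
  · intro x hx
    obtain ⟨X, u, hX, hu, rfl⟩ := (mem_jH_iff S conjInv_bot).1 hx
    rw [AddSubgroup.mem_bot] at hX
    obtain ⟨X', hX', hredX', hchi⟩ := exists_jE_conj (b := b) S w⁻¹ X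
    rw [hX, mul_zero, zero_mul] at hredX'
    rw [map_inv, inv_inv] at hX'
    have h1 : (jE b k w)⁻¹ * (jU b ϖ k X * jE b k u) * jE b k w = jU b ϖ k X' * jE b k u := by
      have h2 : jE b k u * jE b k w = jE b k w * jE b k u := by
        exact jE_mul_comm b u w
      rw [← hX', mul_assoc, mul_assoc, h2]
      group
    rw [h1]
    refine ⟨jU_mul_jE_mem_jH S (by rw [hredX']; exact AddSubgroup.zero_mem _) hu, ?_⟩
    rw [hΛ' _ _ hredX', hΛ' _ _ hX, hchi]

/-- The Heisenberg structure on `N_{l'} L`. -/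
lemma isHeisenberg_jH_top {a : OE F E} (ha : IsPrimitiveElt 𝓀[F] (resO F E a))
    {ω : (OQuot F E k)ˣ →* ℂˣ} {Λ : groupJ b k → ℂ} (hΛ : IsCharOn (jH (b := b) S ⊥ ⊤) Λ)
    (hΛ' : ∀ X u, redMat b X = 0 → Λ (jU b ϖ k X * jE b k u) = chiJ b ψ ϖ k a (jU b ϖ k X) * ω u) :
    IsHeisenberg ((jH (b := b) S ⊥ (kerL S.two_le)).subgroupOf (jH (b := b) S ⊤ (kerL S.two_le)))
      (fun h => Λ (h : groupJ b k)) := by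
  have := finiteDimensional_resE b
  have := finite_resE b
  obtain ⟨σ, hσ, -⟩ := exists_frobenius (b := b)
  refine isHeisenberg_jH S (isIsotropic_bot a) conjInv_top (fun X _ h => ?_) hΛ
    fun X u hX => hΛ' X u hX
  obtain ⟨z, hz⟩ := exists_eq_mulLeft_of_trace_commutator hσ S.residue_ne_one ha
    fun Y => h Y (AddSubgroup.mem_top Y)
  exact ⟨z, by rw [hz, sub_self]; exact AddSubgroup.zero_mem _⟩

lemma jE_conj_mem_jH {P : AddSubgroup (Module.End 𝓀[F] (ResE F E))} (hP : ConjInv P)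
    {T : Subgroup (OQuot F E k)ˣ} (w : (OQuot F E k)ˣ) {h : groupJ b k} (hh : h ∈ jH (b := b) S P T) :
    jE b k w * h * (jE b k w)⁻¹ ∈ jH (b := b) S P T := by
  obtain ⟨X, u, hX, hu, rfl⟩ := (mem_jH_iff S hP).1 hh
  obtain ⟨X', hX', hredX', -⟩ := exists_jE_conj (b := b) S w X
  have h1 : jE b k w * (jU b ϖ k X * jE b k u) * (jE b k w)⁻¹ = jU b ϖ k X' * jE b k u := by
    have h2 : jE b k u * (jE b k w)⁻¹ = (jE b k w)⁻¹ * jE b k u := by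
      rw [← map_inv, jE_mul_comm b]
    rw [← hX', mul_assoc, mul_assoc, h2]
    group
  rw [h1]
  exact jU_mul_jE_mem_jH S (by rw [hredX']; exact hP _ _ hX) hu

lemma exists_mem_jH_mul_pow {P : AddSubgroup (Module.End 𝓀[F] (ResE F E))} (hP : ConjInv P)
    {u₀ : (OQuot F E k)ˣ} (hu₀ : ∀ x, x ∈ Subgroup.zpowers (resU F E S.two_le u₀))
    {g : groupJ b k} (hg : g ∈ jH (b := b) S P ⊤) :
    ∃ h ∈ jH (b := b) S P (kerL S.two_le), ∃ i : ℕ, g = h * jE b k u₀ ^ i := by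
  obtain ⟨X, u, hX, -, rfl⟩ := (mem_jH_iff S hP).1 hg
  obtain ⟨v, hv, i, rfl⟩ := exists_eq_mul_pow b S.two_le hu₀ u
  exact ⟨_, jU_mul_jE_mem_jH S hX hv, i, by rw [map_mul, map_pow, mul_assoc]⟩

lemma jH_top_top : jH (b := b) S ⊤ ⊤ = ⊤ := by
  rw [eq_top_iff]
  rintro g -
  obtain ⟨X, u, rfl⟩ := exists_eq_jU_mul_jE (b := b) S g
  exact jU_mul_jE_mem_jH S (AddSubgroup.mem_top _) (Subgroup.mem_top u)

include b in
lemma exists_generator_lift : ∃ u₀ : (OQuot F E k)ˣ,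
    ∀ x, x ∈ Subgroup.zpowers (resU F E S.two_le u₀) := by
  obtain ⟨c, hc⟩ := exists_generator (b := b)
  obtain ⟨u₀, rfl⟩ := resU_surjective (b := b) S.irred S.two_le c
  exact ⟨u₀, hc⟩

end OddCharacters

/-- A power of a generator of the multiplicative group of a field with `Q ^ 2` elements lies in the
subfield with `Q` elements if and only if the exponent is divisible by `Q + 1`. -/
lemma pow_pow_eq_iff_dvd {K : Type*} [Field K] [Finite K] {Q : ℕ} (hQ : Q ^ 2 = Nat.card K)
    {c : Kˣ} (hc : ∀ x, x ∈ Subgroup.zpowers c) (i : ℕ) :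
    ((c : K) ^ i) ^ Q = (c : K) ^ i ↔ Q + 1 ∣ i := by
  have hord : orderOf c = (Q + 1) * (Q - 1) := by
    rw [orderOf_eq_card_of_forall_mem_zpowers hc, Nat.card_units, ← hQ, ← Nat.sq_sub_sq]
  have hQ1 : 1 < Q := by
    by_contra h
    have h1 : 1 < Nat.card K := Finite.one_lt_card
    rw [← hQ] at h1
    interval_cases Q <;> simp at h1
  have h1 : ((c : K) ^ i) ^ Q = (c : K) ^ i ↔ c ^ (i * (Q - 1)) = 1 := by
    rw [← Units.val_pow_eq_pow_val, ← Units.val_pow_eq_pow_val, Units.val_inj, ← pow_mul]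
    have h2 : i * Q = i * (Q - 1) + i := by
      obtain ⟨r, rfl⟩ := Nat.exists_eq_add_of_lt hQ1
      rw [show 1 + r + 1 - 1 = 1 + r by omega]
      ring
    rw [h2, pow_add, mul_eq_right]
  rw [h1, ← orderOf_dvd_iff_pow_eq_one, hord]
  exact Nat.mul_dvd_mul_iff_right (by omega)

lemma sub_conj_sub_sub {R K : Type*} [Field R] [Field K] [Algebra R K] {c : K} (hc : c ≠ 0) (z : K)
    (X Y : Module.End R K) : (X - LinearMap.mulLeft R z - Y) -
      LinearMap.mulLeft R c * (X - LinearMap.mulLeft R z - Y) * LinearMap.mulLeft R c⁻¹ =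
      (X - LinearMap.mulLeft R c * X * LinearMap.mulLeft R c⁻¹) -
        (Y - LinearMap.mulLeft R c * Y * LinearMap.mulLeft R c⁻¹) := by
  have h1 : LinearMap.mulLeft R c * LinearMap.mulLeft R z * LinearMap.mulLeft R c⁻¹ =
      LinearMap.mulLeft R z := by
    ext t
    simp only [Module.End.mul_apply, LinearMap.mulLeft_apply]
    field_simp
  rw [mul_sub, mul_sub, sub_mul, sub_mul, h1]
  abel

/-! ### Reduction to the maximal isotropic subspace. -/

section Existence

variable {F : Type u} [Field F] [ValuativeRel F] [TopologicalSpace F]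
  [IsNonarchimedeanLocalField F]
variable {E : Type v} [Field E] [Algebra F E] [IsUnramifiedExtension F E]
variable {n k : ℕ} {ϖ : 𝒪[F]} {b : Module.Basis (Fin n) 𝒪[F] (OE F E)} {ψ : AddChar F ℂ}
  {φ : AddChar 𝓀[F] ℂ}
variable {M : Type*} [AddCommGroup M] [Module ℂ M]

/-- A maximal isotropic subspace. -/
abbrev lowSub (σ : ResE F E ≃ₐ[𝓀[F]] ResE F E) : AddSubgroup (Module.End 𝓀[F] (ResE F E)) :=
  degs σ (lowDegs (Module.finrank 𝓀[F] (ResE F E)))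

/-- The orthogonal complement of the maximal isotropic subspace. -/
abbrev orthSub (σ : ResE F E ≃ₐ[𝓀[F]] ResE F E) : AddSubgroup (Module.End 𝓀[F] (ResE F E)) :=
  degs σ (orthDegs (Module.finrank 𝓀[F] (ResE F E)))

variable {σ : ResE F E ≃ₐ[𝓀[F]] ResE F E}

lemma lowSub_le_orthSub : lowSub σ ≤ orthSub σ := degs_mono fun i hi => by
  rw [Finset.mem_Ico] at hi
  rw [Finset.mem_range]
  omega

include b in
lemma trPair_mul_eq_one (hσ : orderOf σ = Module.finrank 𝓀[F] (ResE F E)) (a : OE F E)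
    {X Y : Module.End 𝓀[F] (ResE F E)} (hX : X ∈ lowSub σ) (hY : Y ∈ orthSub σ) :
    trPair φ a (X * Y) = 1 ∧ trPair φ a (Y * X) = 1 := by
  have := finiteDimensional_resE b
  have := finite_resE b
  constructor
  all_goals
    rw [trPair_apply]
    first
    | rw [trace_mulLeft_mul_mul_eq_zero hσ (fun i hi j hj => ?_) hX hY, AddChar.map_zero_eq_one]
    | rw [trace_mulLeft_mul_mul_eq_zero hσ (fun i hi j hj => ?_) hY hX, AddChar.map_zero_eq_one]
    rw [Finset.mem_Ico, Finset.mem_range] at *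
    omega

variable (S : OddLevel ϖ ψ φ k)
include S

lemma jH_mono_left {P Q : AddSubgroup (Module.End 𝓀[F] (ResE F E))} (h : P ≤ Q)
    {T : Subgroup (OQuot F E k)ˣ} : jH (b := b) S P T ≤ jH S Q T := by
  refine sup_le_sup_right ?_ _
  rintro _ ⟨X, hX, rfl⟩
  exact ⟨X, h hX, rfl⟩

lemma jE_mem_jH {P : AddSubgroup (Module.End 𝓀[F] (ResE F E))} {T : Subgroup (OQuot F E k)ˣ}
    {u : (OQuot F E k)ˣ} (hu : u ∈ T) : jE b k u ∈ jH S P T :=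
  le_sup_right (a := jP S P) ⟨⟨u, hu⟩, rfl⟩

lemma apply_eq_smul_of_eig_ne_bot {a : OE F E} {ω : (OQuot F E k)ˣ →* ℂˣ} {Λ : groupJ b k → ℂ}
    {P : AddSubgroup (Module.End 𝓀[F] (ResE F E))}
    (hΛ' : ∀ X u, redMat b X ∈ P → Λ (jU b ϖ k X * jE b k u) = chiJ b ψ ϖ k a (jU b ϖ k X) * ω u)
    {τ : Representation ℂ (groupJ b k) M} (hτ : τ.IsIrreducible)
    (hne : eig τ (jH (b := b) S P ⊤) Λ ≠ ⊥) (X : MatO F n) (u : (OQuot F E k)ˣ)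
    (hX : redMat b X = 0) (hu : u ∈ kerL S.two_le) (v : M) : τ (jU b ϖ k X * jE b k u) v =
      (chiJ b ψ ϖ k a (jU b ϖ k X) * (ω u : ℂ)) • v := by
  obtain ⟨w, hw, hw0⟩ := Submodule.exists_mem_ne_zero_of_ne_bot hne
  have hΛ₀ : ∀ X u, redMat b X = 0 →
      Λ (jU b ϖ k X * jE b k u) = chiJ b ψ ϖ k a (jU b ϖ k X) * ω u := fun X u hX =>
    hΛ' X u (by rw [hX]; exact P.zero_mem)
  have htop := eig_eq_top hτ (fixes_jH_bot S hΛ₀) (v := w) (fun x hx =>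
    hw x (jH_mono_right S (jH_mono_left S bot_le hx))) hw0
  have hv : v ∈ eig τ (jH (b := b) S ⊥ (kerL S.two_le)) Λ := htop ▸ Submodule.mem_top
  rw [hv _ (jU_mul_jE_mem_jH S (by rw [hX]; exact AddSubgroup.zero_mem _) hu), hΛ₀ X u hX]

/-- With `moves_jH_orthSub`, this identifies the stabilizer in `J` of the character of the isotropic
part: the orthogonal complement together with the torus. -/
lemma fixes_jH_orthSub (hσ : orderOf σ = Module.finrank 𝓀[F] (ResE F E)) (a : OE F E) :
    ∀ g ∈ jH (b := b) S (orthSub σ) ⊤, Fixes (jP S (lowSub σ)) (chiJ b ψ ϖ k a) g := by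
  intro g hg
  obtain ⟨X, u, hX, -, rfl⟩ := (mem_jH_iff S (conjInv_degs σ _)).1 hg
  refine Fixes.mul ?_ (fixes_jE S (conjInv_degs σ _) a u)
  rintro _ ⟨Y, hY, rfl⟩
  obtain ⟨h1, h2⟩ := jU_conj_mem_jP S (X := X) hY a
  refine ⟨h1, ?_⟩
  obtain ⟨h3, h4⟩ := trPair_mul_eq_one (b := b) (φ := φ) hσ a hY hX
  rw [h2, AddChar.map_sub_eq_div, h3, h4, div_one, mul_one]

lemma moves_jH_orthSub (hσ : orderOf σ = Module.finrank 𝓀[F] (ResE F E)) {a : OE F E}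
    (ha : IsPrimitiveElt 𝓀[F] (resO F E a)) :
    ∀ g ∉ jH (b := b) S (orthSub σ) ⊤, Moves (jP S (lowSub σ)) (chiJ b ψ ϖ k a) g := by
  have := finiteDimensional_resE b
  have := finite_resE b
  intro g hg
  obtain ⟨X, u, rfl⟩ := exists_eq_jU_mul_jE (b := b) S g
  obtain ⟨Y, hY, hne⟩ : ∃ Y ∈ lowSub σ, trPair φ a (redMat b X * Y - Y * redMat b X) ≠ 1 := by
    by_contra! h
    exact hg (jU_mul_jE_mem_jH S (mem_degs_orthDegs_of_trace_commutator hσ S.residue_ne_one ha h)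
      (Subgroup.mem_top u))
  obtain ⟨Y, rfl⟩ := redMat_surjective b Y
  obtain ⟨h1, h2⟩ := jU_conj_mem_jP S (X := X) hY a
  obtain ⟨h3, h4⟩ := fixes_jE S (conjInv_degs σ (lowDegs (Module.finrank 𝓀[F] (ResE F E)))) a u _ h1
  have h5 : (jU b ϖ k X * jE b k u)⁻¹ * jU b ϖ k Y * (jU b ϖ k X * jE b k u) =
      (jE b k u)⁻¹ * ((jU b ϖ k X)⁻¹ * jU b ϖ k Y * jU b ϖ k X) * jE b k u := by group
  refine ⟨jU b ϖ k Y, (jU_mem_jP_iff S).2 hY, by rw [h5]; exact h3, ?_⟩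
  rw [h5, h4, h2]
  intro h
  apply hne
  have h6 := (mul_eq_left₀ (chiJ_ne_zero S a Y)).1 h
  rw [← neg_sub, AddChar.map_neg_eq_inv, h6, inv_one]

lemma mem_eig_jP {a : OE F E} {ω : (OQuot F E k)ˣ →* ℂˣ} {Λ : groupJ b k → ℂ}
    {P : AddSubgroup (Module.End 𝓀[F] (ResE F E))}
    (hΛ' : ∀ X u, redMat b X ∈ P → Λ (jU b ϖ k X * jE b k u) = chiJ b ψ ϖ k a (jU b ϖ k X) * ω u)
    {τ : Representation ℂ (groupJ b k) M} {v : M} (hv : v ∈ eig τ (jH (b := b) S P ⊤) Λ) :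
    v ∈ eig τ (jP (b := b) S P) (chiJ b ψ ϖ k a) := by
  rintro _ ⟨X, hX, rfl⟩
  have h1 := hΛ' X 1 hX
  rw [map_one, mul_one, map_one, Units.val_one, mul_one] at h1
  rw [hv _ (jU_mem_jH S hX), h1]

/-- For odd `n` the complement exceeds the isotropic space only by degree zero, which `L` absorbs.
-/
lemma jH_orthSub_le_of_odd (hσ : orderOf σ = Module.finrank 𝓀[F] (ResE F E))
    (hodd : Odd (Module.finrank 𝓀[F] (ResE F E))) :
    jH (b := b) S (orthSub σ) ⊤ ≤ jH S (lowSub σ) ⊤ := by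
  have := finiteDimensional_resE b
  have := finite_resE b
  intro g hg
  obtain ⟨X, u, hX, -, rfl⟩ := (mem_jH_iff S (conjInv_degs σ _)).1 hg
  refine mul_mem (jH_mono_right (T := kerL S.two_le) S ?_) (jE_mem_jH S (Subgroup.mem_top u))
  obtain ⟨x, hx⟩ := hX
  refine jU_mem_jH_of_sub_mem S (conjInv_degs σ _) (z := x 0) ⟨x, ?_⟩
  obtain ⟨m, hm⟩ := hodd
  rw [hx, orthDegs, Finset.range_eq_Ico, Finset.sum_eq_sum_Ico_succ_bot (by omega), mono_zero_right,
    add_sub_cancel_left]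
  congr 2
  omega

/-- A vector on which the extension `Λ` acts spans a line stable under the whole stabilizer, so the
irreducible eigenspace is that line, and `u` acts on it by `ω u`. -/
lemma trace_eigRep_jE_of_odd (hσ : orderOf σ = Module.finrank 𝓀[F] (ResE F E)) {a : OE F E}
    (ha : IsPrimitiveElt 𝓀[F] (resO F E a)) (hodd : Odd (Module.finrank 𝓀[F] (ResE F E)))
    {ω : (OQuot F E k)ˣ →* ℂˣ} {Λ : groupJ b k → ℂ}
    (hΛ' : ∀ X u, redMat b X ∈ lowSub σ →
      Λ (jU b ϖ k X * jE b k u) = chiJ b ψ ϖ k a (jU b ϖ k X) * ω u)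
    {τ : Representation ℂ (groupJ b k) M} (hτ : τ.IsIrreducible)
    (hne : eig τ (jH (b := b) S (lowSub σ) ⊤) Λ ≠ ⊥) (u : (OQuot F E k)ˣ) :
    LinearMap.trace ℂ (eig τ (jP S (lowSub σ)) (chiJ b ψ ϖ k a))
      (eigRep τ (jH (b := b) S (orthSub σ) ⊤) (fixes_jH_orthSub S hσ a)
        ⟨jE b k u, jE_mem_jH S (Subgroup.mem_top u)⟩) = ω u := by
  obtain ⟨v, hv, hv0⟩ := Submodule.exists_mem_ne_zero_of_ne_bot hne
  have hv1 := mem_eig_jP S hΛ' hv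
  have hirr := isIrreducible_eigRep hτ (isCharOn_chiJ S (isIsotropic_lowDegs (b := b) hσ a))
    (jH (b := b) S (orthSub σ) ⊤) (fixes_jH_orthSub S hσ a) (moves_jH_orthSub S hσ ha)
    (fun h => hv0 (by rw [h] at hv1; exact hv1))
  set ρ₁ := eigRep τ (jH (b := b) S (orthSub σ) ⊤) (fixes_jH_orthSub S hσ a) with hρ₁
  have hv1' : (⟨v, hv1⟩ : eig τ (jP S (lowSub σ)) (chiJ b ψ ϖ k a)) ≠ 0 := fun h =>
    hv0 (congrArg Subtype.val h)
  have htop := eq_top_of_isIrreducible hirr (Submodule.span ℂ {⟨v, hv1⟩}) (fun g w hw => by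
    obtain ⟨c, rfl⟩ := Submodule.mem_span_singleton.1 hw
    rw [map_smul]
    refine Submodule.smul_mem _ _ (Submodule.mem_span_singleton.2 ⟨Λ g, Subtype.ext ?_⟩)
    exact (hv g (jH_orthSub_le_of_odd S hσ hodd g.2)).symm) (Submodule.mem_span_singleton_self _)
    hv1'
  have hfin : Module.finrank ℂ (eig τ (jP S (lowSub σ)) (chiJ b ψ ϖ k a)) = 1 := by
    rw [← finrank_top, ← htop, finrank_span_singleton hv1']
  have h1 : ρ₁ ⟨jE b k u, jE_mem_jH S (Subgroup.mem_top u)⟩ = (ω u : ℂ) • 1 := by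
    ext w
    have hw : w ∈ Submodule.span ℂ {(⟨v, hv1⟩ : eig τ (jP S (lowSub σ)) (chiJ b ψ ϖ k a))} := by
      rw [htop]
      exact Submodule.mem_top
    obtain ⟨c, rfl⟩ := Submodule.mem_span_singleton.1 hw
    have h2 := hΛ' 0 u (by rw [map_zero]; exact AddSubgroup.zero_mem _)
    rw [jU_zero S, one_mul] at h2
    have h3 : chiJ b ψ ϖ k a 1 = 1 := by
      rw [← jU_zero S, chiJ_jU S, mul_zero, AddChar.map_zero_eq_one]
    rw [h3, one_mul] at h2
    change τ (jE b k u) (c • v) = (ω u : ℂ) • (c • v)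
    rw [map_smul, hv _ (jE_mem_jH S (Subgroup.mem_top u)), h2, smul_comm]
  have hfd := finiteDimensional_of_isIrreducible hirr
  rw [h1, map_smul, LinearMap.trace_one, hfin, Nat.cast_one, smul_eq_mul, mul_one]

section Even

lemma isHeisenberg_jH_orthSub (hσ : orderOf σ = Module.finrank 𝓀[F] (ResE F E)) {a : OE F E}
    (ha : IsPrimitiveElt 𝓀[F] (resO F E a)) {ω : (OQuot F E k)ˣ →* ℂˣ} {Λ : groupJ b k → ℂ}
    (hΛ : IsCharOn (jH (b := b) S (lowSub σ) ⊤) Λ) (hΛ' : ∀ X u, redMat b X ∈ lowSub σ →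
      Λ (jU b ϖ k X * jE b k u) = chiJ b ψ ϖ k a (jU b ϖ k X) * ω u) :
    IsHeisenberg ((jH (b := b) S (lowSub σ) (kerL S.two_le)).subgroupOf
      (jH (b := b) S (orthSub σ) (kerL S.two_le))) (fun h => Λ (h : groupJ b k)) := by
  have := finiteDimensional_resE b
  have := finite_resE b
  exact isHeisenberg_jH S (isIsotropic_lowDegs (b := b) hσ a) (conjInv_degs σ _) (fun X hX h =>
    exists_sub_mulLeft_mem_degs_lowDegs hσ S.residue_ne_one ha hX h) hΛ hΛ'

/-- For even `n` the middle monomials `y σ ^ (n / 2)` represent the cosets, one for each `y` in the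
residue field. -/
lemma card_jH_orthSub (hσ : orderOf σ = Module.finrank 𝓀[F] (ResE F E))
    (heven : Even (Module.finrank 𝓀[F] (ResE F E))) :
    Nat.card (jH (b := b) S (orthSub σ) (kerL S.two_le)) =
      Nat.card (jH (b := b) S (lowSub σ) (kerL S.two_le)) * Nat.card (ResE F E) := by
  have := finiteDimensional_resE b
  have := finite_resE b
  set m := Module.finrank 𝓀[F] (ResE F E) / 2 with hm
  choose s hs using redMat_surjective b
  have hle : jH (b := b) S (lowSub σ) (kerL S.two_le) ≤ jH S (orthSub σ) (kerL S.two_le) :=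
    jH_mono_left S lowSub_le_orthSub
  have hmono : ∀ y, mono σ y m ∈ orthSub σ := fun y =>
    mono_mem_degs (Finset.mem_range.2 (by omega)) y
  rw [← Nat.card_prod]
  symm
  refine Nat.card_congr (Equiv.ofBijective (fun p => ⟨jU b ϖ k (s (mono σ p.2 m)) * p.1,
    mul_mem (jU_mem_jH S (by rw [hs]; exact hmono _)) (hle p.1.2)⟩) ⟨?_, ?_⟩)
  · rintro ⟨z, y⟩ ⟨z', y'⟩ h
    replace h : jU b ϖ k (s (mono σ y m)) * (z : groupJ b k) = jU b ϖ k (s (mono σ y' m)) * z' :=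
      congrArg Subtype.val h
    obtain ⟨Y, hY⟩ := exists_jU_inv (b := b) S (s (mono σ y' m))
    have h1 : (jU b ϖ k (s (mono σ y' m)))⁻¹ * jU b ϖ k (s (mono σ y m)) = z' * (z : groupJ b k)⁻¹ := by
      rw [eq_mul_inv_iff_mul_eq, mul_assoc, h, inv_mul_cancel_left]
    rw [hY, jU_mul S] at h1
    have h2 : jU b ϖ k (-s (mono σ y' m) + ϖ ^ (k / 2) • Y + s (mono σ y m) +
        ϖ ^ (k / 2) • ((-s (mono σ y' m) + ϖ ^ (k / 2) • Y) * s (mono σ y m))) * jE b k 1 ∈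
        jH (b := b) S (lowSub σ) (kerL S.two_le) := by
      rw [map_one, mul_one, h1]
      exact mul_mem z'.2 (inv_mem z.2)
    obtain ⟨w, hw⟩ := exists_sub_mem_of_mem_jH S (conjInv_degs σ _) h2
    rw [redMat_add_smul S, map_add, redMat_add_smul S, (redMat b).map_neg, hs, hs] at hw
    have h3 : y - y' = 0 := by
      refine eq_zero_of_mono_mem_degs (z := -w) hσ heven ?_
      have h4 : LinearMap.mulLeft 𝓀[F] (-w) + mono σ (y - y') m =
          -mono σ y' m + mono σ y m - LinearMap.mulLeft 𝓀[F] w := by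
        rw [mono_sub]
        ext t
        simp
        ring
      rw [← hm, h4]
      exact hw
    rw [sub_eq_zero] at h3
    subst h3
    exact Prod.ext (Subtype.ext (mul_left_cancel h)) rfl
  · rintro ⟨g, hg⟩
    obtain ⟨X, u, hX, hu, rfl⟩ := (mem_jH_iff S (conjInv_degs σ _)).1 hg
    obtain ⟨y, z, hyz⟩ := exists_sub_mono_mem_degs (σ := σ) hσ heven hX
    obtain ⟨Y, hY⟩ := exists_jU_inv (b := b) S (s (mono σ y m))
    have h1 : (jU b ϖ k (s (mono σ y m)))⁻¹ * jU b ϖ k X ∈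
        jH (b := b) S (lowSub σ) (kerL S.two_le) := by
      rw [hY, jU_mul S]
      refine jU_mem_jH_of_sub_mem S (conjInv_degs σ _) (z := z) ?_
      rw [redMat_add_smul S, map_add, redMat_add_smul S, (redMat b).map_neg, hs]
      have h4 : -mono σ y m + redMat b X - LinearMap.mulLeft 𝓀[F] z =
          redMat b X - LinearMap.mulLeft 𝓀[F] z - mono σ y m := by abel
      rw [h4]
      exact hyz
    refine ⟨⟨⟨(jU b ϖ k (s (mono σ y m)))⁻¹ * jU b ϖ k X * jE b k u,
      mul_mem h1 (jE_mem_jH S hu)⟩, y⟩, Subtype.ext ?_⟩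
    change jU b ϖ k (s (mono σ y m)) * ((jU b ϖ k (s (mono σ y m)))⁻¹ * jU b ϖ k X * jE b k u) = _
    group

/-- The commutator of `jE w` with an element of `jH (orthSub σ)`. -/
lemma exists_mul_conj_inv_eq (w : (OQuot F E k)ˣ) {h : groupJ b k}
    {T : Subgroup (OQuot F E k)ˣ} (hh : h ∈ jH (b := b) S (orthSub σ) T) :
    ∃ X u V, redMat b X ∈ orthSub σ ∧ u ∈ T ∧ h = jU b ϖ k X * jE b k u ∧
      h * (jE b k w * h * (jE b k w)⁻¹)⁻¹ = jU b ϖ k V ∧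
      redMat b V = redMat b X - LinearMap.mulLeft 𝓀[F] (resU F E S.two_le w : ResE F E) * redMat b X *
        LinearMap.mulLeft 𝓀[F] (resU F E S.two_le w : ResE F E)⁻¹ ∧
      ∀ a, chiJ b ψ ϖ k a (jU b ϖ k V) *
        trPair φ a (redMat b V * (LinearMap.mulLeft 𝓀[F] (resU F E S.two_le w : ResE F E) *
          redMat b X * LinearMap.mulLeft 𝓀[F] (resU F E S.two_le w : ResE F E)⁻¹)) = 1 := by
  obtain ⟨X, u, hX, hu, rfl⟩ := (mem_jH_iff S (conjInv_degs σ _)).1 hh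
  obtain ⟨X', hX', hredX', hchi⟩ := exists_jE_conj (b := b) S w X
  obtain ⟨V, hV, hredV⟩ := exists_jU_mul_inv (b := b) S X X'
  refine ⟨X, u, V, hX, hu, rfl, ?_, by rw [hredV, hredX'], fun a => ?_⟩
  · have h1 : jE b k w * (jU b ϖ k X * jE b k u) * (jE b k w)⁻¹ = jU b ϖ k X' * jE b k u := by
      have h2 : jE b k u * (jE b k w)⁻¹ = (jE b k w)⁻¹ * jE b k u := by
        rw [← map_inv, jE_mul_comm b]
      rw [← hX', mul_assoc, mul_assoc, h2]
      group
    rw [h1, ← hV]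
    group
  · have h1 : jU b ϖ k V * jU b ϖ k X' = jU b ϖ k X := by rw [← hV, inv_mul_cancel_right]
    have h2 := congrArg (chiJ b ψ ϖ k a) h1
    rw [chiJ_mul S, hchi, mul_right_comm] at h2
    rw [← hredX']
    exact (mul_eq_right₀ (chiJ_ne_zero S a X)).1 h2

/-- Modulo the centre only the middle coefficient `y` counts, and it becomes `(1 - c / σ ^ (n / 2)
c) y`. This verifies the fixed point hypothesis of `trace_mul_trace`. -/
lemma mul_conj_inv_not_mem (hσ : orderOf σ = Module.finrank 𝓀[F] (ResE F E))
    (heven : Even (Module.finrank 𝓀[F] (ResE F E))) {w : (OQuot F E k)ˣ}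
    (hw : (σ ^ (Module.finrank 𝓀[F] (ResE F E) / 2)) (resU F E S.two_le w : ResE F E) ≠
      resU F E S.two_le w) {h : groupJ b k}
    (hh : h ∈ jH (b := b) S (orthSub σ) (kerL S.two_le))
    (hh' : h ∉ jH (b := b) S (lowSub σ) (kerL S.two_le)) :
    h * (jE b k w * h * (jE b k w)⁻¹)⁻¹ ∉ jH (b := b) S (lowSub σ) (kerL S.two_le) := by
  have := finiteDimensional_resE b
  have := finite_resE b
  obtain ⟨X, u, V, hX, hu, rfl, hV, hredV, -⟩ := exists_mul_conj_inv_eq (b := b) S w hh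
  set m := Module.finrank 𝓀[F] (ResE F E) / 2 with hm
  set c := resU F E S.two_le w with hc
  intro hmem
  apply hh'
  refine mul_mem ?_ (jE_mem_jH S hu)
  rw [hV, ← mul_one (jU b ϖ k V), ← map_one (jE b k)] at hmem
  obtain ⟨z, hz⟩ := exists_sub_mem_of_mem_jH S (conjInv_degs σ _) hmem
  obtain ⟨y, z', hyz⟩ := exists_sub_mono_mem_degs (σ := σ) hσ heven hX
  rw [← hm] at hyz
  have h1 := AddSubgroup.sub_mem _ hyz (conj_mem_degs hyz (c : ResE F E) (c : ResE F E)⁻¹)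
  have h2 : mono σ ((1 - (c : ResE F E) * ((σ ^ m) (c : ResE F E))⁻¹) * y) m +
      LinearMap.mulLeft 𝓀[F] (-z) ∈ lowSub σ := by
    rw [← mono_sub_conj]
    have h3 := AddSubgroup.sub_mem _ hz h1
    rw [hredV, sub_conj_sub_sub c.ne_zero] at h3
    convert h3 using 1
    ext t
    simp
    ring
  rw [add_comm] at h2
  have h3 := eq_zero_of_mono_mem_degs hσ heven h2
  have h4 : y = 0 := (mul_eq_zero.1 h3).resolve_left (one_sub_mul_inv_ne_zero c.ne_zero hw)
  rw [h4, mono_zero, sub_zero] at hyz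
  exact jU_mem_jH_of_sub_mem S (conjInv_degs σ _) hyz

/-- When `w` is fixed by `σ ^ (n / 2)`, it commutes with `jH (orthSub σ)` up to the kernel of the
character of `jP (lowSub σ)`. -/
lemma exists_mul_conj_inv_eq_of_fixed (hσ : orderOf σ = Module.finrank 𝓀[F] (ResE F E))
    (heven : Even (Module.finrank 𝓀[F] (ResE F E))) {w : (OQuot F E k)ˣ}
    (hw : (σ ^ (Module.finrank 𝓀[F] (ResE F E) / 2)) (resU F E S.two_le w : ResE F E) =
      resU F E S.two_le w) {h : groupJ b k}
    (hh : h ∈ jH (b := b) S (orthSub σ) (kerL S.two_le)) (a : OE F E) :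
    h * (jE b k w * h * (jE b k w)⁻¹)⁻¹ ∈ jP S (lowSub σ) ∧
      chiJ b ψ ϖ k a (h * (jE b k w * h * (jE b k w)⁻¹)⁻¹) = 1 := by
  have := finiteDimensional_resE b
  have := finite_resE b
  obtain ⟨X, u, V, hX, hu, rfl, hV, hredV, hchi⟩ := exists_mul_conj_inv_eq (b := b) S w hh
  set m := Module.finrank 𝓀[F] (ResE F E) / 2 with hm
  set c := resU F E S.two_le w with hc
  have hVlow : redMat b V ∈ lowSub σ := by
    obtain ⟨y, z', hyz⟩ := exists_sub_mono_mem_degs (σ := σ) hσ heven hX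
    rw [← hm] at hyz
    have h1 := AddSubgroup.sub_mem _ hyz (conj_mem_degs hyz (c : ResE F E) (c : ResE F E)⁻¹)
    have h2 := mono_sub_conj (σ := σ) (c := (c : ResE F E)) (y := y) m
    rw [hw, mul_inv_cancel₀ c.ne_zero, sub_self, zero_mul, mono_zero] at h2
    rw [hredV]
    rwa [sub_conj_sub_sub c.ne_zero, h2, sub_zero] at h1
  rw [hV]
  refine ⟨(jU_mem_jP_iff S).2 hVlow, ?_⟩
  have h1 := hchi a
  rwa [(trPair_mul_eq_one (b := b) hσ a hVlow (conj_mem_degs hX _ _)).1, mul_one] at h1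

end Even

end Existence

/-- A common eigenvector defines a character. -/
lemma exists_hom_of_forall_smul {B : Type*} [Group B] {V : Type*} [AddCommGroup V] [Module ℂ V]
    (ρ : Representation ℂ B V) {v : V} (hv : v ≠ 0) (h : ∀ u, ∃ c : ℂ, ρ u v = c • v) :
    ∃ ω : B →* ℂˣ, ∀ u, ρ u v = (ω u : ℂ) • v := by
  choose c hc using h
  have hinj : ∀ x y : ℂ, x • v = y • v → x = y := fun x y hxy => smul_left_injective ℂ hv hxy
  let f : B →* ℂ :=
    { toFun := c
      map_one' := hinj _ _ (by rw [← hc, map_one, Module.End.one_apply, one_smul])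
      map_mul' := fun x y => hinj _ _ (by
        rw [← hc, map_mul, Module.End.mul_apply, hc, map_smul, hc, smul_smul, mul_comm]) }
  exact ⟨f.toHomUnits, fun u => hc u⟩

/-- If the powers of `ρ t` not divisible by `Q + 1` have traces of absolute value one, where
`Q = dim ρ` and `ρ (t ^ (Q + 1))` is a scalar, then, up to a character, these traces are `-1`. -/
lemma exists_pow_mul_trace_eq_neg_one {G : Type*} [Group G] {V : Type*} [AddCommGroup V]
    [Module ℂ V] [FiniteDimensional ℂ V] [Nontrivial V] (ρ : Representation ℂ G V) {t : G} {Q : ℕ}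
    (hQ : Module.finrank ℂ V = Q) (hκ : ∃ κ : ℂ, ∀ v, ρ (t ^ (Q + 1)) v = κ • v)
    (htr : ∀ i, ¬ Q + 1 ∣ i → LinearMap.trace ℂ V (ρ (t ^ i)) *
      LinearMap.trace ℂ V (ρ (t ^ i)⁻¹) = 1) :
    ∃ κ η : ℂ, ρ (t ^ (Q + 1)) = κ • 1 ∧ κ * η ^ (Q + 1) = 1 ∧
      ∀ i, ¬ Q + 1 ∣ i → η ^ i * LinearMap.trace ℂ V (ρ (t ^ i)) = -1 := by
  obtain ⟨κ, hκ⟩ := hκ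
  have hκ' : ρ (t ^ (Q + 1)) = κ • 1 := LinearMap.ext hκ
  have hκ0 : κ ≠ 0 := by
    rintro rfl
    have h1 : ρ (t ^ (Q + 1)) * ρ (t ^ (Q + 1))⁻¹ = 1 := by
      rw [← map_mul, mul_inv_cancel, map_one]
    rw [hκ', zero_smul, zero_mul] at h1
    exact zero_ne_one h1
  -- Rescaling by `s` makes the `(Q + 1)`-st power the identity.
  obtain ⟨s, hs⟩ := IsAlgClosed.exists_pow_nat_eq κ⁻¹ (n := Q + 1) (by omega)
  have hs0 : s ≠ 0 := by
    rintro rfl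
    rw [zero_pow (by omega)] at hs
    exact inv_ne_zero hκ0 hs.symm
  have hTpow : ∀ i, (s • ρ t) ^ i = s ^ i • ρ (t ^ i) := fun i => by rw [smul_pow, map_pow]
  have hTpow' : ∀ i, (s⁻¹ • ρ t⁻¹) ^ i = (s ^ i)⁻¹ • ρ (t ^ i)⁻¹ := fun i => by
    rw [smul_pow, ← map_pow, inv_pow, inv_pow]
  obtain ⟨ζ, hζ1, hζtr⟩ := exists_trace_pow_eq_neg (m := Q + 1) (T := s • ρ t)
    (T' := s⁻¹ • ρ t⁻¹) (by rw [hQ])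
    (by rw [hTpow, hκ', hs, smul_smul, inv_mul_cancel₀ hκ0, one_smul])
    (by rw [smul_mul_smul_comm, mul_inv_cancel₀ hs0, ← map_mul, mul_inv_cancel, map_one, one_smul])
    (by rw [smul_mul_smul_comm, inv_mul_cancel₀ hs0, ← map_mul, inv_mul_cancel, map_one, one_smul])
    (fun i h0 hi => by
      rw [hTpow, hTpow', map_smul, map_smul, smul_eq_mul, smul_eq_mul, mul_mul_mul_comm,
        mul_inv_cancel₀ (pow_ne_zero _ hs0), one_mul]
      exact htr i fun h => absurd (Nat.le_of_dvd h0 h) (by omega))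
  have hζ0 : ζ ≠ 0 := by
    rintro rfl
    rw [zero_pow (by omega)] at hζ1
    exact zero_ne_one hζ1
  -- Dividing by the missing eigenvalue `ζ` turns the trace `-ζ ^ i` into `-1`.
  refine ⟨κ, s / ζ, hκ', ?_, fun i hi => ?_⟩
  · rw [div_pow, hs, hζ1, div_one, mul_inv_cancel₀ hκ0]
  · have h1 := hζtr i hi
    rw [hTpow, map_smul, smul_eq_mul] at h1
    rw [div_pow, div_mul_eq_mul_div, h1, neg_div, div_self (pow_ne_zero _ hζ0)]

lemma card_comap_subgroupOfEquivOfLe {G : Type*} [Group G] {K L J : Subgroup G} (hKL : K ≤ L)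
    (hLJ : L ≤ J) : Nat.card ((K.subgroupOf L).comap
      (Subgroup.subgroupOfEquivOfLe hLJ).toMonoidHom) = Nat.card K :=
  Nat.card_congr
    { toFun := fun z => ⟨((z : L.subgroupOf J) : J), z.2⟩
      invFun := fun z => ⟨⟨⟨z, hLJ (hKL z.2)⟩, hKL z.2⟩, z.2⟩
      left_inv := fun _ => rfl
      right_inv := fun _ => rfl }

/-! ### The trace at elliptic elements for even `n`. -/

section Existence

variable {F : Type u} [Field F] [ValuativeRel F] [TopologicalSpace F]
  [IsNonarchimedeanLocalField F]
variable {E : Type v} [Field E] [Algebra F E] [IsUnramifiedExtension F E]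
variable {n k : ℕ} {ϖ : 𝒪[F]} {b : Module.Basis (Fin n) 𝒪[F] (OE F E)} {ψ : AddChar F ℂ}
  {φ : AddChar 𝓀[F] ℂ}
variable {M : Type*} [AddCommGroup M] [Module ℂ M]
variable {σ : ResE F E ≃ₐ[𝓀[F]] ResE F E}

include b in
-- Identifies `σ ^ (n / 2)` with raising to the power `Q`, so that its fixed points among powers of
-- a generator can be counted.
lemma frobenius_half_apply (hσq : ∀ x, σ x = x ^ Nat.card 𝓀[F])
    (heven : Even (Module.finrank 𝓀[F] (ResE F E))) {Q : ℕ} (hQ : Q ^ 2 = Nat.card (ResE F E))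
    (x : ResE F E) : (σ ^ (Module.finrank 𝓀[F] (ResE F E) / 2)) x = x ^ Q := by
  have := finiteDimensional_resE b
  have := finite_resE b
  have hpow : ∀ m : ℕ, (σ ^ m) x = x ^ Nat.card 𝓀[F] ^ m := fun m => by
    induction m with
    | zero => simp
    | succ m ih => rw [pow_succ', AlgEquiv.mul_apply, ih, map_pow, hσq, ← pow_mul, pow_succ']
  rw [hpow]
  congr 1
  obtain ⟨m, hm⟩ := heven
  rw [Module.natCard_eq_pow_finrank (K := 𝓀[F]), hm] at hQ
  rw [hm, ← two_mul, Nat.mul_div_cancel_left _ two_pos]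
  exact Nat.pow_left_injective (n := 2) (by norm_num) (by
    change (Nat.card 𝓀[F] ^ m) ^ 2 = Q ^ 2
    rw [hQ]
    ring)

variable (S : OddLevel ϖ ψ φ k)
include S

/-- Equivariance of the trace at elliptic `u`, from `trace_jU_mul_jE`, means that projecting to the
eigenspace loses nothing. -/
lemma trace_eigRep_jE {a : OE F E} {τ : Representation ℂ (groupJ b k) M} (hτ : τ.IsIrreducible)
    (hτ0 : ∀ X, redMat b X = 0 → ∀ v, τ (jU b ϖ k X) v = chiJ b ψ ϖ k a (jU b ϖ k X) • v)
    (hσ : orderOf σ = Module.finrank 𝓀[F] (ResE F E))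
    {u : (OQuot F E k)ˣ} (hu : IsPrimitiveElt 𝓀[F] (resU F E S.two_le u : ResE F E)) :
    LinearMap.trace ℂ (eig τ (jP S (lowSub σ)) (chiJ b ψ ϖ k a))
      (eigRep τ (jH (b := b) S (orthSub σ) ⊤) (fixes_jH_orthSub S hσ a)
        ⟨jE b k u, jE_mem_jH S (Subgroup.mem_top u)⟩) = LinearMap.trace ℂ M (τ (jE b k u)) := by
  have := finiteDimensional_of_isIrreducible hτ
  refine trace_eigRep_eq τ (isCharOn_chiJ S (isIsotropic_lowDegs (b := b) hσ a)) _ _ _ ?_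
  rintro _ ⟨X, hX, rfl⟩
  exact trace_jU_mul_jE S hτ0 hσ hu hX

set_option maxHeartbeats 1600000 in
/-- For even `n`, the trace at regular elliptic elements, up to a character of the residue
field. -/
lemma exists_trace_jE_mul_pow_of_even (hσ : orderOf σ = Module.finrank 𝓀[F] (ResE F E))
    (hσq : ∀ x, σ x = x ^ Nat.card 𝓀[F]) (heven : Even (Module.finrank 𝓀[F] (ResE F E)))
    {a : OE F E} (ha : IsPrimitiveElt 𝓀[F] (resO F E a))
    {ω : (OQuot F E k)ˣ →* ℂˣ} {Λ : groupJ b k → ℂ} (hΛ : IsCharOn (jH (b := b) S (lowSub σ) ⊤) Λ)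
    (hΛ' : ∀ X u, redMat b X ∈ lowSub σ →
      Λ (jU b ϖ k X * jE b k u) = chiJ b ψ ϖ k a (jU b ϖ k X) * ω u)
    {τ : Representation ℂ (groupJ b k) M} (hτ : τ.IsIrreducible)
    (hne : eig τ (jH (b := b) S (lowSub σ) ⊤) Λ ≠ ⊥) {u₀ : (OQuot F E k)ˣ}
    (hu₀ : ∀ x, x ∈ Subgroup.zpowers (resU F E S.two_le u₀)) :
    ∃ η : ℂ, η ^ Nat.card (ResE F E)ˣ = 1 ∧ ∀ (i : ℕ), ∀ v ∈ kerL S.two_le,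
      IsPrimitiveElt 𝓀[F] (resU F E S.two_le (v * u₀ ^ i) : ResE F E) →
      η ^ i * LinearMap.trace ℂ M (τ (jE b k (v * u₀ ^ i))) = - (ω (v * u₀ ^ i) : ℂ) := by
  have hfdK := finiteDimensional_resE b
  have hfinK := finite_resE b
  have hscal := apply_eq_smul_of_eig_ne_bot S hΛ' hτ hne
  have hτ0 : ∀ X, redMat b X = 0 → ∀ v, τ (jU b ϖ k X) v = chiJ b ψ ϖ k a (jU b ϖ k X) • v :=
    fun X hX v => by simpa using hscal X 1 hX (one_mem _) v
  have hχ1 : chiJ b ψ ϖ k a 1 = 1 := by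
    rw [← jU_zero S, chiJ_jU S, mul_zero, AddChar.map_zero_eq_one]
  have hτL : ∀ u ∈ kerL S.two_le, ∀ v, τ (jE b k u) v = (ω u : ℂ) • v := fun u hu v => by
    have h1 := hscal 0 u (map_zero _) hu v
    rwa [jU_zero S, one_mul, hχ1, one_mul] at h1
  set P₀ := jP (b := b) S (lowSub σ) with hP₀
  set χ := chiJ b ψ ϖ k a with hχ
  set J₀ := jH (b := b) S (orthSub σ) ⊤ with hJ₀
  have hfix := fixes_jH_orthSub (b := b) S hσ a
  have hne1 : eig τ P₀ χ ≠ ⊥ := by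
    obtain ⟨v, hv, hv0⟩ := Submodule.exists_mem_ne_zero_of_ne_bot hne
    intro h
    have hv1 : v ∈ eig τ P₀ χ := mem_eig_jP S hΛ' hv
    rw [h] at hv1
    exact hv0 hv1
  have hirr : (eigRep τ J₀ hfix).IsIrreducible :=
    isIrreducible_eigRep hτ (isCharOn_chiJ S (isIsotropic_lowDegs (b := b) hσ a))
      J₀ hfix (moves_jH_orthSub S hσ ha) hne1
  set ρ₁ := eigRep τ J₀ hfix with hρ₁
  have hle : jH (b := b) S (orthSub σ) (kerL S.two_le) ≤ J₀ := jH_mono_right S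
  let H : Subgroup J₀ := (jH (b := b) S (orthSub σ) (kerL S.two_le)).subgroupOf J₀
  let e : H →* jH (b := b) S (orthSub σ) (kerL S.two_le) :=
    (Subgroup.subgroupOfEquivOfLe hle).toMonoidHom
  have he : Function.Surjective e := (Subgroup.subgroupOfEquivOfLe hle).surjective
  have hecoe : ∀ h : H, ((e h : jH (b := b) S (orthSub σ) (kerL S.two_le)) : groupJ b k) =
    ((h : J₀) : groupJ b k) := fun h => rfl
  have hZ := (isHeisenberg_jH_orthSub (b := b) S hσ ha hΛ hΛ').comap e he
  set Z := ((jH (b := b) S (lowSub σ) (kerL S.two_le)).subgroupOf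
      (jH (b := b) S (orthSub σ) (kerL S.two_le))).comap e with hZdef
  have hmemZ : ∀ h : H, h ∈ Z ↔ ((h : J₀) : groupJ b k) ∈ jH (b := b) S (lowSub σ) (kerL S.two_le) :=
    fun h => Iff.rfl
  have hζ : ∀ z ∈ Z, ∀ v, ρ₁ z v = Λ (e z) • v := by
    intro z hz v
    obtain ⟨X, u, hX, hu, hXu⟩ := (mem_jH_iff S (conjInv_degs σ _)).1 ((hmemZ z).1 hz)
    refine Subtype.ext ?_
    change τ ((z : J₀) : groupJ b k) (v : M) = Λ (e z) • (v : M)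
    rw [hecoe, hXu, hΛ' X u hX, map_mul, Module.End.mul_apply, hτL u hu, map_smul,
      v.2 _ ((jU_mem_jP_iff S).2 hX), smul_smul, mul_comm]
  let t : J₀ := ⟨jE b k u₀, jE_mem_jH S (Subgroup.mem_top u₀)⟩
  have htpow : ∀ i : ℕ, ((t ^ i : J₀) : groupJ b k) = jE b k (u₀ ^ i) := fun i => by
    rw [Subgroup.coe_pow, map_pow]
  have hconj : ∀ (i : ℕ) (h : H), t ^ i * h * (t ^ i)⁻¹ ∈ H := fun i h => by
    change ((t ^ i * h * (t ^ i)⁻¹ : J₀) : groupJ b k) ∈ jH (b := b) S (orthSub σ) (kerL S.two_le)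
    rw [Subgroup.coe_mul, Subgroup.coe_mul, Subgroup.coe_inv, htpow]
    exact jE_conj_mem_jH S (conjInv_degs σ _) _ h.2
  -- The stabilizer is generated by its Heisenberg subgroup and the lift `u₀` of a generator.
  have hirr₂ := hZ.isIrreducible_comp_subtype hirr hζ (t := t)
    (fun h hh => by simpa using hconj 1 ⟨h, hh⟩) (fun g => by
      obtain ⟨h, hh, i, hi⟩ := exists_mem_jH_mul_pow S (conjInv_degs σ _) hu₀ g.2
      exact ⟨⟨h, hle hh⟩, hh, i, Subtype.ext hi⟩)
  have hntM := ((isIrreducible_iff _).1 hirr).1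
  have hfdM := finiteDimensional_of_isIrreducible hirr
  set Q := Module.finrank ℂ (eig τ P₀ χ) with hQdef
  -- The dimension is the square root of the index of the centre, which is the order of the residue
  -- field.
  have hQ : Q ^ 2 = Nat.card (ResE F E) := by
    have h1 := hZ.finrank_sq hirr₂ hζ
    have h2 : Nat.card Z = _ := card_comap_subgroupOfEquivOfLe (jH_mono_left S lowSub_le_orthSub) hle
    have h3 : Nat.card H = _ := Nat.card_congr (Subgroup.subgroupOfEquivOfLe hle).toEquiv
    rw [h2, h3, card_jH_orthSub S hσ heven, mul_comm] at h1
    exact Nat.eq_of_mul_eq_mul_left Nat.card_pos h1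
  have hQ0 : 0 < Q := Module.finrank_pos
  set c := resU F E S.two_le u₀ with hc
  have hfixc : ∀ i, (σ ^ (Module.finrank 𝓀[F] (ResE F E) / 2))
      (resU F E S.two_le (u₀ ^ i) : ResE F E) = resU F E S.two_le (u₀ ^ i) ↔ Q + 1 ∣ i := fun i => by
    rw [frobenius_half_apply (b := b) hσq heven hQ, map_pow, Units.val_pow_eq_pow_val]
    exact pow_pow_eq_iff_dvd hQ hu₀ i
  -- For `i` not divisible by `Q + 1` the residue of `u₀ ^ i` is moved by `σ ^ (n / 2)`, so it fixes
  -- nothing modulo the centre.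
  have htr : ∀ i, ¬ Q + 1 ∣ i → LinearMap.trace ℂ _ (ρ₁ (t ^ i)) *
      LinearMap.trace ℂ _ (ρ₁ (t ^ i)⁻¹) = 1 := fun i hi => by
    refine hZ.trace_mul_trace hirr₂ hζ (by rw [← map_mul, mul_inv_cancel, map_one])
      (by rw [← map_mul, inv_mul_cancel, map_one]) (fun h => ⟨_, hconj i h⟩) (fun h => ?_) ?_
    · change ρ₁ (t ^ i) * ρ₁ h * ρ₁ (t ^ i)⁻¹ = ρ₁ (t ^ i * h * (t ^ i)⁻¹)
      rw [map_mul, map_mul]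
    · intro h hh hmem
      rw [hmemZ] at hh hmem
      refine mul_conj_inv_not_mem S hσ heven (w := u₀ ^ i) (fun h => hi ((hfixc i).1 h)) h.2 hh ?_
      rw [← htpow]
      exact hmem
  -- The residue of `u₀ ^ (Q + 1)` is fixed by `σ ^ (n / 2)`; its commutators with the Heisenberg
  -- subgroup act trivially on the eigenspace, so Schur's lemma applies.
  have hscalar := exists_smul_of_commute hirr₂ (ρ₁ (t ^ (Q + 1))) (fun h v => by
    change ρ₁ (t ^ (Q + 1)) (ρ₁ h v) = ρ₁ h (ρ₁ (t ^ (Q + 1)) v)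
    obtain ⟨h1, h2⟩ := exists_mul_conj_inv_eq_of_fixed S hσ heven (w := u₀ ^ (Q + 1))
      ((hfixc _).2 dvd_rfl) h.2 a
    set p := ((h : J₀) : groupJ b k) *
      (jE b k (u₀ ^ (Q + 1)) * ((h : J₀) : groupJ b k) * (jE b k (u₀ ^ (Q + 1)))⁻¹)⁻¹ with hp
    have h3 : ((h : J₀) : groupJ b k) * jE b k (u₀ ^ (Q + 1)) =
        p * (jE b k (u₀ ^ (Q + 1)) * ((h : J₀) : groupJ b k)) := by
      rw [hp]
      group
    refine Subtype.ext ?_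
    change τ ((t ^ (Q + 1) : J₀) : groupJ b k) (τ ((h : J₀) : groupJ b k) v) =
      τ ((h : J₀) : groupJ b k) (τ ((t ^ (Q + 1) : J₀) : groupJ b k) v)
    have h4 := (ρ₁ (t ^ (Q + 1) * h) v).2 p h1
    rw [show chiJ b ψ ϖ k a p = 1 from h2, one_smul] at h4
    have h5 : ((ρ₁ (t ^ (Q + 1) * h) v : eig τ P₀ χ) : M) =
        τ (jE b k (u₀ ^ (Q + 1)) * ((h : J₀) : groupJ b k)) v := by
      rw [hρ₁, coe_eigRep, Subgroup.coe_mul, htpow]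
    rw [h5, ← Module.End.mul_apply, ← map_mul, ← h3] at h4
    rw [htpow, ← Module.End.mul_apply, ← Module.End.mul_apply, ← map_mul, ← map_mul, h4])
  obtain ⟨κ, η, hκ', hκη, hη⟩ := exists_pow_mul_trace_eq_neg_one ρ₁ hQdef.symm hscalar htr
  have hcard : Nat.card (ResE F E)ˣ = (Q + 1) * (Q - 1) := by
    rw [Nat.card_units, ← hQ, ← Nat.sq_sub_sq]
  -- The power of `u₀` of exponent `(Q + 1) (Q - 1)` lies in `L`, where the action is by `ω`. Hence
  -- `ω u₀ * η` has order dividing that of `Kˣ` and defines a character of it.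
  have hω0 : (ω u₀ : ℂ) ^ Nat.card (ResE F E)ˣ = κ ^ (Q - 1) := by
    obtain ⟨v, hv⟩ := exists_ne (0 : eig τ P₀ χ)
    have hL : u₀ ^ Nat.card (ResE F E)ˣ ∈ kerL S.two_le := by
      rw [mem_kerL_iff, map_pow, pow_card_eq_one']
    have h1 : ρ₁ (t ^ Nat.card (ResE F E)ˣ) v = κ ^ (Q - 1) • v := by
      rw [hcard, pow_mul, map_pow, hκ', smul_pow, one_pow, LinearMap.smul_apply,
        Module.End.one_apply]
    have h2 : ρ₁ (t ^ Nat.card (ResE F E)ˣ) v = (ω u₀ : ℂ) ^ Nat.card (ResE F E)ˣ • v := by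
      refine Subtype.ext ?_
      rw [hρ₁, coe_eigRep, htpow, hτL _ hL, map_pow, Units.val_pow_eq_pow_val]
      rfl
    exact smul_left_injective ℂ hv (h2.symm.trans h1)
  refine ⟨ω u₀ * η, ?_, fun i v hv hprim => ?_⟩
  · rw [mul_pow, hω0, hcard, pow_mul, ← mul_pow, hκη, one_pow]
  -- An elliptic residue generates the field, so `σ ^ (n / 2)` cannot fix it.
  · have hnd : ¬ Q + 1 ∣ i := fun h => by
      rw [map_mul, (mem_kerL_iff S.two_le v).1 hv, one_mul] at hprim
      have hpos := Module.finrank_pos (R := 𝓀[F]) (M := ResE F E)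
      obtain ⟨m, hm⟩ := heven
      exact hprim.pow_apply_ne hσ (i := Module.finrank 𝓀[F] (ResE F E) / 2) (by omega) (by omega)
        ((hfixc i).2 h)
    have h1 := hη i hnd
    have h2 := trace_eigRep_jE S hτ hτ0 hσ hprim
    have h3 : ρ₁ ⟨jE b k (v * u₀ ^ i), jE_mem_jH S (Subgroup.mem_top _)⟩ =
        (ω v : ℂ) • ρ₁ (t ^ i) := by
      ext x
      rw [LinearMap.smul_apply, hρ₁, Submodule.coe_smul, coe_eigRep, coe_eigRep, htpow]
      change τ (jE b k (v * u₀ ^ i)) (x : M) = _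
      rw [map_mul, map_mul, Module.End.mul_apply, hτL v hv]
    rw [← h2]
    change _ * LinearMap.trace ℂ (eig τ P₀ χ) (ρ₁ _) = _
    rw [h3, map_smul, smul_eq_mul, map_mul ω, map_pow ω, Units.val_mul, Units.val_pow_eq_pow_val,
      mul_pow]
    linear_combination (ω u₀ : ℂ) ^ i * ω v * h1

end Existence

/-! ### Existence, uniqueness and exhaustion for odd `k`. -/

section OddClassification

variable {F : Type u} [Field F] [ValuativeRel F] [TopologicalSpace F]
  [IsNonarchimedeanLocalField F]
variable {E : Type v} [Field E] [Algebra F E] [IsUnramifiedExtension F E]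
variable {n k : ℕ} {ϖ : 𝒪[F]} {b : Module.Basis (Fin n) 𝒪[F] (OE F E)} {ψ : AddChar F ℂ}
  {φ : AddChar 𝓀[F] ℂ}
variable {M : Type*} [AddCommGroup M] [Module ℂ M]
variable {σ : ResE F E ≃ₐ[𝓀[F]] ResE F E}

variable (S : OddLevel ϖ ψ φ k)
include S

omit S in
lemma exists_hom_of_pow_card_eq_one {K : Type*} [Group K] [Finite K] {c : K}
    (hc : ∀ x, x ∈ Subgroup.zpowers c) {η : ℂ} (hη : η ^ Nat.card K = 1) :
    ∃ θ : K →* ℂˣ, (θ c : ℂ) = η := by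
  have h0 : η ≠ 0 := by
    rintro rfl
    rw [zero_pow Nat.card_pos.ne'] at hη
    exact zero_ne_one hη
  have h1 : orderOf (Units.mk0 η h0) ∣ orderOf c := by
    rw [orderOf_eq_card_of_forall_mem_zpowers hc, orderOf_dvd_iff_pow_eq_one]
    exact Units.ext (by simpa using hη)
  exact ⟨monoidHomOfForallMemZpowers hc h1, by rw [monoidHomOfForallMemZpowers_apply_gen]; rfl⟩

/-- The inflation to `J` of a character of the residue field. -/
lemma exists_char_groupJ (θ : (ResE F E)ˣ →* ℂˣ) : ∃ θ' : groupJ b k →* ℂˣ,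
    ∀ X u, θ' (jU b ϖ k X * jE b k u) = θ (resU F E S.two_le u) := by
  obtain ⟨χ, hχ, -, h2⟩ := exists_isCharOn_sup_range (A := jP (b := b) S ⊤) (α := fun _ => 1)
    ⟨rfl, fun _ _ _ _ => (mul_one 1).symm⟩ (jE b k) (θ.comp (resU F E S.two_le))
    (fun u x hx => ⟨jE_inv_conj_mem_jP S conjInv_top u hx, rfl⟩) (fun u hu => by
      obtain ⟨X, -, hX⟩ := hu
      obtain ⟨-, -, -, hu1, -⟩ := exists_of_jU_eq_jE S hX.symm
      rw [MonoidHom.comp_apply, hu1, map_one, Units.val_one])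
  have hmem : ∀ g, g ∈ jP (b := b) S ⊤ ⊔ (jE b k).range := fun g => by
    obtain ⟨X, u, rfl⟩ := exists_eq_jU_mul_jE (b := b) S g
    exact mul_mem (le_sup_left (b := (jE b k).range)
      ((jU_mem_jP_iff S).2 (AddSubgroup.mem_top _))) (le_sup_right (a := jP S ⊤) ⟨u, rfl⟩)
  let f : groupJ b k →* ℂ :=
    { toFun := χ
      map_one' := hχ.one
      map_mul' := fun x y => hχ.mul x (hmem x) y (hmem y) }
  refine ⟨f.toHomUnits, fun X u => Units.ext ?_⟩
  change χ _ = _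
  rw [h2 _ ((jU_mem_jP_iff S).2 (AddSubgroup.mem_top _)), one_mul, MonoidHom.comp_apply]

lemma resU_eq_one_of_eq {x : OE F E} {u : (OQuot F E k)ˣ} (hu : (u : OQuot F E k) =
    Ideal.Quotient.mk (PE F E ^ k) (1 + algebraMap 𝒪[F] (OE F E) ϖ ^ (k - k / 2) * x)) :
    jE b k u = jU b ϖ k (ϖ • Algebra.leftMulMatrix b x) ∧ u ∈ kerL S.two_le := by
  obtain ⟨u', hu', hres, hj⟩ := jU_leftMulMatrix_eq_jE (b := b) S (algebraMap 𝒪[F] (OE F E) ϖ * x)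
  have h1 : u = u' := Units.ext (by rw [hu, hu', S.sub_half, pow_succ, mul_assoc])
  subst h1
  rw [leftMulMatrix_smul] at hj
  exact ⟨hj.symm, hres⟩

omit S in
lemma ActsByScalars.congr {ω : (OQuot F E k)ˣ →* ℂˣ} {a c : OE F E} {T : Subgroup (OQuot F E k)ˣ}
    (hϖ : Irreducible ϖ) (hψ : ∀ x : 𝒪[F], ψ (x : F) = 1)
    {τ : Representation ℂ (groupJ b k) M} (h : ActsByScalars b ψ ϖ ω a T τ) :
    ActsByScalars b ψ ϖ ω (a + algebraMap 𝒪[F] (OE F E) ϖ ^ (k / 2) * c) T τ := by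
  intro B x y g hx hy hg v
  rw [h B x y g hx hy hg v, psiMat_eq, psiMat_eq, map_add, ← map_pow, leftMulMatrix_smul, add_mul,
    smul_mul_assoc, trChar_add_smul_self hϖ hψ]

/-- The vanishing condition is automatic by `trace_eq_zero_of_forall_conj_not_mem`, and `a` may be
fixed in advance because it is unique modulo `ϖ ^ (k / 2)`. -/
lemma isTau_iff_of_odd {ω : (OQuot F E k)ˣ →* ℂˣ} {a : OE F E} (hω : RestrictsTo b ψ ϖ ω a)
    (ha : IsPrimitiveElt 𝓀[F] (resO F E a)) {τ : Representation ℂ (groupJ b k) M} :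
    IsTau b ψ ϖ S.two_le ω τ ↔ τ.IsIrreducible ∧
      (∀ X u, redMat b X = 0 → u ∈ kerL S.two_le → ∀ v, τ (jU b ϖ k X * jE b k u) v =
        (chiJ b ψ ϖ k a (jU b ϖ k X) * (ω u : ℂ)) • v) ∧
      ∀ u, IsPrimitiveElt 𝓀[F] (resU F E S.two_le u : ResE F E) →
        LinearMap.trace ℂ M (τ (jE b k u)) = (-1) ^ (n - 1) * (ω u : ℂ) := by
  constructor
  · rintro ⟨a', ha', -, h⟩
    obtain ⟨h1, h2, -, h4⟩ := h S.odd
    obtain ⟨c, rfl⟩ := ha'.eq_add S.irred S.triv S.exists_ne_one S.two_le hω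
    exact ⟨h1, (actsByScalars_iff S).1 (h2.congr S.irred S.triv), fun u hu => h4 u _ rfl hu⟩
  · rintro ⟨h1, h2, h3⟩
    refine ⟨a, hω, fun h => absurd S.odd (Nat.not_odd_iff_even.2 h), fun _ =>
      ⟨h1, (actsByScalars_iff S).2 h2, fun g hg => ?_, fun u g hg hu => ?_⟩⟩
    · exact trace_eq_zero_of_forall_conj_not_mem S ha
        (fun X hX v => by simpa using h2 X 1 hX (one_mem _) v) hg
    · rw [show g = jE b k u from Subtype.ext hg]
      exact h3 u hu

/-- The existence of the representation attached to `ω`, for odd `k`. -/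
lemma exists_isTau_of_odd {ω : (OQuot F E k)ˣ →* ℂˣ} {a : OE F E} (hω : RestrictsTo b ψ ϖ ω a)
    (ha : IsPrimitiveElt 𝓀[F] (resO F E a)) :
    ∃ (d : ℕ) (τ : Representation ℂ (groupJ b k) (Fin d → ℂ)), IsTau b ψ ϖ S.two_le ω τ := by
  have hfdK := finiteDimensional_resE b
  have hfinK := finite_resE b
  obtain ⟨σ, hσ, hσq⟩ := exists_frobenius (b := b)
  obtain ⟨Λ, hΛ, hΛ'⟩ := exists_isCharOn_jH S (isIsotropic_lowDegs (b := b) (φ := φ) hσ a) hω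
  obtain ⟨d, τ, hτ, hne⟩ := exists_isIrreducible_eig_ne_bot hΛ
  have hscal := apply_eq_smul_of_eig_ne_bot S hΛ' hτ hne
  rcases Nat.even_or_odd (Module.finrank 𝓀[F] (ResE F E)) with heven | hodd
  · obtain ⟨u₀, hu₀⟩ := exists_generator_lift (b := b) S
    obtain ⟨η, hη, htr⟩ := exists_trace_jE_mul_pow_of_even S hσ hσq heven ha hΛ hΛ' hτ hne hu₀
    obtain ⟨θ, hθ⟩ := exists_hom_of_pow_card_eq_one hu₀ hη
    obtain ⟨θ', hθ'⟩ := exists_char_groupJ (b := b) S θ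
    -- The twist is trivial on `N_{l'} L`, so only the trace changes, to `-ω u`; the sign is `(-1) ^
    -- (n - 1)` for even `n`.
    refine ⟨d, twist τ θ', (isTau_iff_of_odd S hω ha).2 ⟨isIrreducible_twist hτ θ',
      fun X u hX hu v => ?_, fun u hu => ?_⟩⟩
    · rw [twist_apply, hθ', (mem_kerL_iff S.two_le u).1 hu, map_one, Units.val_one, one_smul,
        hscal X u hX hu]
    · obtain ⟨v, hv, i, rfl⟩ := exists_eq_mul_pow b S.two_le hu₀ u
      have h1 := hθ' 0 (v * u₀ ^ i)
      rw [jU_zero S, one_mul, map_mul (resU F E S.two_le), (mem_kerL_iff S.two_le v).1 hv, one_mul,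
        map_pow, map_pow] at h1
      rw [trace_twist, h1, Units.val_pow_eq_pow_val, hθ, htr i v hv hu, ← finrank_resE b,
        Odd.neg_one_pow, neg_one_mul]
      have hpos := Module.finrank_pos (R := 𝓀[F]) (M := ResE F E)
      obtain ⟨m, hm⟩ := heven
      exact ⟨m - 1, by omega⟩
  · refine ⟨d, τ, (isTau_iff_of_odd S hω ha).2 ⟨hτ, hscal, fun u hu => ?_⟩⟩
    rw [← trace_eigRep_jE S hτ (fun X hX v => by simpa using hscal X 1 hX (one_mem _) v) hσ hu,
      trace_eigRep_jE_of_odd S hσ ha hodd hΛ' hτ hne, ← finrank_resE b, Even.neg_one_pow, one_mul]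
    obtain ⟨m, hm⟩ := hodd
    exact ⟨m, by omega⟩

/-- The uniqueness of the representation attached to `ω`, for odd `k`. -/
lemma IsTau.nonempty_equiv_of_odd {M' : Type*} [AddCommGroup M'] [Module ℂ M']
    {ω : (OQuot F E k)ˣ →* ℂˣ} {a : OE F E} (hω : RestrictsTo b ψ ϖ ω a)
    (ha : IsPrimitiveElt 𝓀[F] (resO F E a)) {τ : Representation ℂ (groupJ b k) M}
    {τ' : Representation ℂ (groupJ b k) M'} (h : IsTau b ψ ϖ S.two_le ω τ)
    (h' : IsTau b ψ ϖ S.two_le ω τ') : Nonempty (τ.Equiv τ') := by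
  have hfinK := finite_resE b
  obtain ⟨hτ, hs, htr⟩ := (isTau_iff_of_odd S hω ha).1 h
  obtain ⟨hτ', hs', htr'⟩ := (isTau_iff_of_odd S hω ha).1 h'
  obtain ⟨Λ, hΛ, hΛ'⟩ := exists_isCharOn_jH S (isIsotropic_bot (φ := φ) a) hω
  obtain ⟨u₀, hu₀⟩ := exists_generator_lift (b := b) S
  -- The generator is elliptic, so the prescribed trace there is nonzero and rules out any twist.
  have hu₀' : IsPrimitiveElt 𝓀[F] (resU F E S.two_le u₀ : ResE F E) :=
    isPrimitiveElt_of_forall_mem_zpowers hu₀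
  refine (isHeisenberg_jH_top S ha hΛ hΛ').nonempty_equiv hτ hτ' (t := jE b k u₀) ?_ ?_ ?_ ?_ ?_ ?_
  · intro z hz v
    obtain ⟨X, u, hX, hu, hXu⟩ := (mem_jH_iff S conjInv_bot).1 (Subgroup.mem_subgroupOf.1 hz)
    rw [hXu, hΛ' X u hX, hs X u hX hu]
  · intro z hz v
    obtain ⟨X, u, hX, hu, hXu⟩ := (mem_jH_iff S conjInv_bot).1 (Subgroup.mem_subgroupOf.1 hz)
    rw [hXu, hΛ' X u hX, hs' X u hX hu]
  · intro h hh
    have := jE_conj_mem_jH S conjInv_top u₀⁻¹ hh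
    rwa [map_inv, inv_inv] at this
  · intro g
    exact exists_mem_jH_mul_pow S conjInv_top hu₀ (by rw [jH_top_top S]; exact Subgroup.mem_top g)
  · rw [htr u₀ hu₀', htr' u₀ hu₀']
  · rw [htr u₀ hu₀']
    exact mul_ne_zero (pow_ne_zero _ (neg_ne_zero.2 one_ne_zero)) (ω u₀).ne_zero

/-- For odd `k`, every irreducible representation of `J` lying over a primitive `a` is attached to
some `ω`. -/
lemma exists_isTau_of_isIrreducible_of_odd {a : OE F E} (ha : IsPrimitiveElt 𝓀[F] (resO F E a))
    {τ : Representation ℂ (groupJ b k) M} (hτ : τ.IsIrreducible)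
    (hτ0 : ∀ X, redMat b X = 0 → ∀ v, τ (jU b ϖ k X) v = chiJ b ψ ϖ k a (jU b ϖ k X) • v) :
    ∃ ω, RestrictsTo b ψ ϖ ω a ∧ IsTau b ψ ϖ S.two_le ω τ := by
  have hfinK := finite_resE b
  obtain ⟨u₀, hu₀⟩ := exists_generator_lift (b := b) S
  have hfd := finiteDimensional_of_isIrreducible hτ
  have hnt := ((isIrreducible_iff τ).1 hτ).1
  -- An element of `L` commutes with `N_{l'}` up to elements of `N_l` at which `chiJ` is `1`, and
  -- with the torus; so it is scalar.
  have hL : ∀ u ∈ kerL S.two_le, ∃ c : ℂ, ∀ v, τ (jE b k u) v = c • v := fun u hu => by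
    have hu1 : resU F E S.two_le u = 1 := (mem_kerL_iff S.two_le u).1 hu
    refine exists_smul_of_commute hτ _ fun g v => ?_
    obtain ⟨Y, w, rfl⟩ := exists_eq_jU_mul_jE (b := b) S g
    obtain ⟨Z, hZ, hconj, hchi⟩ := exists_conj_jU_mul_jE (b := b) S a 0 Y u (by
      rw [hu1]
      ext z
      simp)
    rw [map_zero, zero_mul, mul_zero, sub_zero, AddChar.map_zero_eq_one, inv_one] at hchi
    rw [jU_zero S, one_mul, mul_inv_eq_iff_eq_mul, mul_assoc] at hconj
    have h1 : ∀ v, τ (jU b ϖ k Y) (τ (jE b k u) v) = τ (jE b k u) (τ (jU b ϖ k Y) v) := fun v => by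
      rw [← Module.End.mul_apply, ← map_mul, hconj, map_mul, Module.End.mul_apply, hτ0 Z hZ, hchi,
        one_smul, map_mul, Module.End.mul_apply]
    have h2 : ∀ v, τ (jE b k w) (τ (jE b k u) v) = τ (jE b k u) (τ (jE b k w) v) := fun v => by
      rw [← Module.End.mul_apply, ← map_mul, jE_mul_comm b, map_mul, Module.End.mul_apply]
    rw [map_mul, Module.End.mul_apply, Module.End.mul_apply, h2, h1]
  -- An eigenvector of the generator is one for the whole torus. Its character `ω₀` is only a first
  -- choice: it has the right restriction to `L` and is corrected on `u₀` below.
  obtain ⟨ν, hν⟩ := Module.End.exists_eigenvalue (τ (jE b k u₀))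
  obtain ⟨v, hv⟩ := hν.exists_hasEigenvector
  obtain ⟨ω₀, hω₀⟩ := exists_hom_of_forall_smul (res τ (jE b k)) hv.2 (fun u => by
    obtain ⟨w, hw, i, rfl⟩ := exists_eq_mul_pow b S.two_le hu₀ u
    obtain ⟨c, hc⟩ := hL w hw
    refine ⟨c * ν ^ i, ?_⟩
    change τ (jE b k (w * u₀ ^ i)) v = _
    rw [map_mul, map_mul, Module.End.mul_apply, hc, map_pow, map_pow, mul_smul]
    congr 1
    exact hv.pow_apply i)
  replace hω₀ : ∀ u, τ (jE b k u) v = (ω₀ u : ℂ) • v := hω₀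
  have hL' : ∀ u ∈ kerL S.two_le, ∀ x, τ (jE b k u) x = (ω₀ u : ℂ) • x := fun u hu x => by
    obtain ⟨c, hc⟩ := hL u hu
    have h1 : c = ω₀ u := smul_left_injective ℂ hv.2 ((hc v).symm.trans (hω₀ u))
    rw [hc, h1]
  have hres₀ : RestrictsTo b ψ ϖ ω₀ a := fun x y hy => by
    obtain ⟨h1, -⟩ := resU_eq_one_of_eq (b := b) S hy
    rw [← chiJ_jU_smul S]
    refine smul_left_injective ℂ hv.2 ?_
    change (ω₀ y : ℂ) • v = chiJ b ψ ϖ k a _ • v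
    rw [← hω₀, h1, hτ0 _ (redMat_smul_eq_zero b S.irred _)]
  obtain ⟨d, τ₀, hτ₀⟩ := exists_isTau_of_odd S hres₀ ha
  obtain ⟨hirr₀, hs₀, htr₀⟩ := (isTau_iff_of_odd S hres₀ ha).1 hτ₀
  obtain ⟨Λ, hΛ, hΛ'⟩ := exists_isCharOn_jH S (isIsotropic_bot (φ := φ) a) hres₀
  have hs : ∀ X u, redMat b X = 0 → u ∈ kerL S.two_le → ∀ v, τ (jU b ϖ k X * jE b k u) v =
        (chiJ b ψ ϖ k a (jU b ϖ k X) * (ω₀ u : ℂ)) • v := fun X u hX hu v => by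
    rw [map_mul, Module.End.mul_apply, hL' u hu, map_smul, hτ0 X hX, smul_smul, mul_comm]
  obtain ⟨f, μ, hμ0, hfH, hft⟩ := (isHeisenberg_jH_top S ha hΛ hΛ').exists_twisted_equiv hirr₀ hτ
    (t := jE b k u₀)
    (fun z hz v => by
      obtain ⟨X, u, hX, hu, hXu⟩ := (mem_jH_iff S conjInv_bot).1 (Subgroup.mem_subgroupOf.1 hz)
      rw [hXu, hΛ' X u hX, hs₀ X u hX hu])
    (fun z hz v => by
      obtain ⟨X, u, hX, hu, hXu⟩ := (mem_jH_iff S conjInv_bot).1 (Subgroup.mem_subgroupOf.1 hz)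
      rw [hXu, hΛ' X u hX, hs X u hX hu])
    (fun h hh => by
      have := jE_conj_mem_jH S conjInv_top u₀⁻¹ hh
      rwa [map_inv, inv_inv] at this)
    (fun g => exists_mem_jH_mul_pow S conjInv_top hu₀
      (by rw [jH_top_top S]; exact Subgroup.mem_top g))
  have htrf : ∀ w ∈ kerL S.two_le, ∀ i : ℕ, LinearMap.trace ℂ M (τ (jE b k (w * u₀ ^ i))) =
      μ ^ i * LinearMap.trace ℂ _ (τ₀ (jE b k (w * u₀ ^ i))) := fun w hw i => by
    rw [map_mul, map_pow]
    exact trace_twisted f hfH hft (jE_mem_jH S hw) i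
  -- Writing the identity as an element of `L` times a power of `u₀` compares the two dimensions,
  -- which are equal and nonzero.
  have hμ : μ ^ Nat.card (ResE F E)ˣ = 1 := by
    have hmem : (u₀ ^ Nat.card (ResE F E)ˣ)⁻¹ ∈ kerL S.two_le := by
      rw [mem_kerL_iff, map_inv, map_pow, pow_card_eq_one', inv_one]
    have h1 := htrf _ hmem (Nat.card (ResE F E)ˣ)
    rw [inv_mul_cancel, map_one (jE b k), map_one τ, map_one τ₀, LinearMap.trace_one,
      LinearMap.trace_one, f.finrank_eq] at h1
    have h2 : (Module.finrank ℂ M : ℂ) ≠ 0 := Nat.cast_ne_zero.2 Module.finrank_pos.ne'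
    exact mul_right_cancel₀ h2 (h1.symm.trans (one_mul _).symm)
  obtain ⟨θ, hθ⟩ := exists_hom_of_pow_card_eq_one hu₀ hμ
  have hω : RestrictsTo b ψ ϖ (ω₀ * θ.comp (resU F E S.two_le)) a := fun x y hy => by
    obtain ⟨-, h1⟩ := resU_eq_one_of_eq (b := b) S hy
    rw [MonoidHom.mul_apply, MonoidHom.comp_apply, (mem_kerL_iff S.two_le y).1 h1, map_one, mul_one,
      hres₀ x y hy]
  refine ⟨ω₀ * θ.comp (resU F E S.two_le), hω, (isTau_iff_of_odd S hω ha).2 ⟨hτ, fun X u hX hu v => ?_,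
    fun u hu => ?_⟩⟩
  · rw [MonoidHom.mul_apply, MonoidHom.comp_apply, (mem_kerL_iff S.two_le u).1 hu, map_one, mul_one,
      hs X u hX hu]
  · have h1 := htr₀ u hu
    obtain ⟨w, hw, i, rfl⟩ := exists_eq_mul_pow b S.two_le hu₀ u
    have h2 : θ (resU F E S.two_le (w * u₀ ^ i)) = θ (resU F E S.two_le u₀) ^ i := by
      rw [map_mul, (mem_kerL_iff S.two_le w).1 hw, one_mul, map_pow, map_pow]
    rw [htrf w hw i, h1, MonoidHom.mul_apply, MonoidHom.comp_apply, h2, Units.val_mul,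
      Units.val_pow_eq_pow_val, hθ]
    ring

end OddClassification

lemma isIrreducible_of_finrank_eq_one {G : Type*} [Group G] {V : Type*} [AddCommGroup V]
    [Module ℂ V] (ρ : Representation ℂ G V) (h : Module.finrank ℂ V = 1) : ρ.IsIrreducible := by
  have hfd : FiniteDimensional ℂ V := Module.finite_of_finrank_pos (by omega)
  refine (isIrreducible_iff ρ).2 ⟨Module.nontrivial_of_finrank_pos (R := ℂ) (by omega),
    fun W _ => ?_⟩
  rcases Nat.eq_zero_or_pos (Module.finrank ℂ W) with h0 | h0
  · exact Or.inl (Submodule.finrank_eq_zero.1 h0)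
  · have := Submodule.finrank_le W
    exact Or.inr (Submodule.eq_top_of_finrank_eq (by omega))

/-! ### The representations attached to `ω`, for `k` of either parity. -/

section Tau

variable {F : Type u} [Field F] [ValuativeRel F] [TopologicalSpace F]
  [IsNonarchimedeanLocalField F]
variable {E : Type v} [Field E] [Algebra F E] [IsUnramifiedExtension F E]
variable {n k : ℕ} {ϖ : 𝒪[F]} {b : Module.Basis (Fin n) 𝒪[F] (OE F E)} {ψ : AddChar F ℂ}
variable {M : Type*} [AddCommGroup M] [Module ℂ M] {M' : Type*} [AddCommGroup M'] [Module ℂ M']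
variable (hϖ : Irreducible ϖ) (hψ : ∀ x : 𝒪[F], ψ (x : F) = 1)
  (hψ' : ∃ x : 𝒪[F], ψ ((x : F) / (ϖ : F)) ≠ 1) (hk : 2 ≤ k)
include hϖ hψ hk

omit hψ hk in
lemma emb_eq_uni_of_eq {r : ℕ} (hr : 0 < r) {x : OE F E} {u : (OQuot F E k)ˣ}
    (hu : (u : OQuot F E k) =
      Ideal.Quotient.mk (PE F E ^ k) (1 + algebraMap 𝒪[F] (OE F E) ϖ ^ r * x)) :
    emb b k u = uni ϖ k r (Algebra.leftMulMatrix b x) := by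
  obtain ⟨u', hu'⟩ := exists_unit_eq_one_add b hϖ hr x
  have h1 : u = quotU F E k u' := Units.ext (by rw [hu, ← hu']; rfl)
  rw [h1, emb_quotU, lamU_eq_uni b hϖ hr hu']

lemma ActsByScalars.apply_of_mem_congrN {ω : (OQuot F E k)ˣ →* ℂˣ} {a : OE F E}
    {T : Subgroup (OQuot F E k)ˣ} {τ : Representation ℂ (groupJ b k) M}
    (h : ActsByScalars b ψ ϖ ω a T τ) (s : groupJ b k)
    (hs : (s : GLk F n k) ∈ congrN n (Nat.sub_le k (k / 2))) (m : M) :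
    τ s m = chr ψ ϖ k (k - k / 2) (Algebra.leftMulMatrix b a) s • m := by
  obtain ⟨B, hB⟩ := (mem_congrN_iff hϖ (by omega) _).1 hs
  rw [h B (uni ϖ k (k - k / 2) B) 1 s ((eq_uni_iff hϖ (by omega)).2 rfl) T.one_mem
    (by rw [map_one, mul_one, hB]), map_one, Units.val_one, mul_one, hB,
    chr_uni hϖ hψ (by omega) (by omega), psiMat_eq]
  congr 3
  omega

include hψ' in
lemma IsTau.exists_actsByScalars {ω : (OQuot F E k)ˣ →* ℂˣ} {a : OE F E}
    (hω : RestrictsTo b ψ ϖ ω a) {τ : Representation ℂ (groupJ b k) M}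
    (h : IsTau b ψ ϖ hk ω τ) : ActsByScalars b ψ ϖ ω a (kerL hk) τ := by
  obtain ⟨a', ha', h1, h2⟩ := h
  obtain ⟨c, rfl⟩ := ha'.eq_add hϖ hψ hψ' hk hω
  rcases Nat.even_or_odd k with hk2 | hk2
  · have h3 := (h1 hk2).2.congr (c := c) hϖ hψ
    exact fun B x y g hx _ hg v => h3 B x y g hx (Subgroup.mem_top y) hg v
  · exact (h2 hk2).2.1.congr hϖ hψ

omit hϖ hψ in
lemma IsTau.isIrreducible {ω : (OQuot F E k)ˣ →* ℂˣ} {τ : Representation ℂ (groupJ b k) M}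
    (h : IsTau b ψ ϖ hk ω τ) : τ.IsIrreducible := by
  obtain ⟨a, -, h1, h2⟩ := h
  rcases Nat.even_or_odd k with hk2 | hk2
  · exact isIrreducible_of_finrank_eq_one τ (h1 hk2).1
  · exact (h2 hk2).1

omit hϖ hψ in
lemma IsTau.of_equiv {ω : (OQuot F E k)ˣ →* ℂˣ} {τ : Representation ℂ (groupJ b k) M}
    {τ' : Representation ℂ (groupJ b k) M'} (h : IsTau b ψ ϖ hk ω τ) (e : τ.Equiv τ') :
    IsTau b ψ ϖ hk ω τ' := by
  have hact : ∀ {a : OE F E} {T : Subgroup (OQuot F E k)ˣ}, ActsByScalars b ψ ϖ ω a T τ →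
      ActsByScalars b ψ ϖ ω a T τ' := fun hT B x y g hx hy hg v => by
    obtain ⟨v, rfl⟩ := e.toLinearEquiv.surjective v
    change τ' g (e v) = _ • e v
    rw [← equiv_apply, hT B x y g hx hy hg, map_smul]
  obtain ⟨a, ha, h1, h2⟩ := h
  refine ⟨a, ha, fun h => ⟨e.toLinearEquiv.finrank_eq.symm.trans (h1 h).1, hact (h1 h).2⟩,
    fun h => ?_⟩
  obtain ⟨h3, h4, h5, h6⟩ := h2 h
  refine ⟨isIrreducible_of_equiv e h3, hact h4, fun g hg => ?_, fun y g hg hy => ?_⟩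
  · rw [trace_of_equiv e, h5 g hg]
  · rw [trace_of_equiv e, h6 y g hg hy]

omit hψ in
lemma exists_eq_uni_mul_jE_of_even (hk2 : Even k) (g : groupJ b k) : ∃ X u,
    (g : GLk F n k) = uni ϖ k (k - k / 2) X * emb b k u := by
  have h1 : k - k / 2 = k / 2 := by
    obtain ⟨m, rfl⟩ := hk2
    omega
  rw [h1]
  exact (mem_groupNO_iff b hϖ (by omega) (Nat.div_le_self k 2)).1 g.2

include hψ' in
lemma isTau_iff_of_even (hk2 : Even k) {ω : (OQuot F E k)ˣ →* ℂˣ} {a : OE F E}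
    (hω : RestrictsTo b ψ ϖ ω a) {τ : Representation ℂ (groupJ b k) M} :
    IsTau b ψ ϖ hk ω τ ↔ Module.finrank ℂ M = 1 ∧ ActsByScalars b ψ ϖ ω a ⊤ τ := by
  constructor
  · rintro ⟨a', ha', h1, -⟩
    obtain ⟨c, rfl⟩ := ha'.eq_add hϖ hψ hψ' hk hω
    exact ⟨(h1 hk2).1, (h1 hk2).2.congr hϖ hψ⟩
  · exact fun h => ⟨a, hω, fun _ => h, fun h' => absurd hk2 (Nat.not_even_iff_odd.2 h')⟩

/-- For even `k` the two halves coincide, so `J` is `N_l` times the torus; `ψ_a` and `ω` agree on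
the intersection and glue to a character. -/
lemma exists_isTau_of_even (hk2 : Even k) {ω : (OQuot F E k)ˣ →* ℂˣ} {a : OE F E}
    (hω : RestrictsTo b ψ ϖ ω a) (ha : IsPrimitiveElt 𝓀[F] (resO F E a)) :
    ∃ τ : Representation ℂ (groupJ b k) ℂ, IsTau b ψ ϖ hk ω τ := by
  have hr : 0 < k - k / 2 := by omega
  have hkr : k - (k - k / 2) = k / 2 := by omega
  obtain ⟨χ, hχ, -, hχ'⟩ := exists_isCharOn_sup_range
    (isCharOn_chr hϖ hψ hr (Nat.sub_le k (k / 2)) (by omega) (Algebra.leftMulMatrix b a)) (emb b k) ω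
    (fun u => fixes_of_mem_groupJ hϖ hψ hk ha _
      ((le_sup_right : (emb b k).range ≤ groupJ b k) ⟨u, rfl⟩)) (fun u hu => by
      obtain ⟨X, hX⟩ := (mem_congrN_iff hϖ hr _).1 hu
      obtain ⟨u, rfl⟩ := quotU_surjective b hϖ hk u
      obtain ⟨x, Z, hu', hXx⟩ := exists_eq_of_uni_eq_toGL hϖ hr (Nat.sub_le k (k / 2)) hX.symm
      rw [hω x (quotU F E k u) (by rw [← hu']; rfl), hX, chr_uni hϖ hψ hr (Nat.sub_le k (k / 2)), hXx,
        mul_add, mul_smul_comm, trChar_add_smul_self hϖ hψ, psiMat_eq, hkr])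
  have hmem : ∀ g : groupJ b k, (g : GLk F n k) ∈
      congrN n (Nat.sub_le k (k / 2)) ⊔ (emb b k).range := fun g => by
    obtain ⟨X, u, hg⟩ := exists_eq_uni_mul_jE_of_even hϖ hk hk2 g
    rw [hg]
    exact mul_mem (le_sup_left (b := (emb b k).range) (uni_mem_congrN hϖ hr _ X))
      (le_sup_right (a := congrN n (Nat.sub_le k (k / 2))) ⟨u, rfl⟩)
  refine ⟨{ toFun := fun g => χ g • 1
            map_one' := by rw [Subgroup.coe_one, hχ.one, one_smul]
            map_mul' := fun x y => by
              rw [Subgroup.coe_mul, hχ.mul _ (hmem x) _ (hmem y), smul_mul_smul_comm, mul_one] },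
    a, hω, fun _ => ⟨Module.finrank_self ℂ, fun B x y g hx _ hg v => ?_⟩,
    fun h' => absurd hk2 (Nat.not_even_iff_odd.2 h')⟩
  change χ g • v = _
  rw [eq_uni_iff hϖ hr] at hx
  rw [hg, hx, hχ' _ (uni_mem_congrN hϖ hr _ B), chr_uni hϖ hψ hr (Nat.sub_le k (k / 2)), hkr,
    psiMat_eq]

/-- As `N_l` acts by scalars and the torus is commutative, Schur's lemma makes each torus element a
scalar; these scalars are `ω`, and any vector spans the representation. -/
lemma exists_isTau_of_isIrreducible_of_even (hk2 : Even k) {a : OE F E}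
    {τ : Representation ℂ (groupJ b k) M} (hτ : τ.IsIrreducible)
    (hs : ∀ s : groupJ b k, (s : GLk F n k) ∈ congrN n (Nat.sub_le k (k / 2)) → ∀ m,
      τ s m = chr ψ ϖ k (k - k / 2) (Algebra.leftMulMatrix b a) s • m) :
    ∃ ω, RestrictsTo b ψ ϖ ω a ∧ IsTau b ψ ϖ hk ω τ := by
  have hr : 0 < k - k / 2 := by omega
  have hkr : k - (k - k / 2) = k / 2 := by omega
  have hdec : ∀ g : groupJ b k, ∃ (x : groupJ b k) (u : (OQuot F E k)ˣ),
      (x : GLk F n k) ∈ congrN n (Nat.sub_le k (k / 2)) ∧ g = x * jE b k u := fun g => by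
    obtain ⟨X, u, hg⟩ := exists_eq_uni_mul_jE_of_even hϖ hk hk2 g
    exact ⟨⟨_, congrN_le_groupJ hϖ hk (uni_mem_congrN hϖ hr (Nat.sub_le k (k / 2)) X)⟩, u,
      uni_mem_congrN hϖ hr _ X, Subtype.ext hg⟩
  have hE : ∀ u, ∃ c : ℂ, ∀ v, τ (jE b k u) v = c • v := fun u => by
    refine exists_smul_of_commute hτ _ fun g v => ?_
    obtain ⟨x, w, hx, rfl⟩ := hdec g
    have h1 : τ (jE b k u) (τ (jE b k w) v) = τ (jE b k w) (τ (jE b k u) v) := by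
      rw [← Module.End.mul_apply, ← map_mul, jE_mul_comm b, map_mul, Module.End.mul_apply]
    rw [map_mul, Module.End.mul_apply, Module.End.mul_apply, hs x hx, hs x hx, map_smul, h1]
  have hnt := ((isIrreducible_iff τ).1 hτ).1
  obtain ⟨v, hv⟩ := exists_ne (0 : M)
  obtain ⟨ω, hω⟩ := exists_hom_of_forall_smul (res τ (jE b k)) hv (fun u => by
    obtain ⟨c, hc⟩ := hE u
    exact ⟨c, hc v⟩)
  have hω' : ∀ u x, τ (jE b k u) x = (ω u : ℂ) • x := fun u x => by
    obtain ⟨c, hc⟩ := hE u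
    rw [hc, smul_left_injective ℂ hv ((hc v).symm.trans (hω u))]
  have hres : RestrictsTo b ψ ϖ ω a := fun x y hy => by
    have h1 := emb_eq_uni_of_eq (b := b) hϖ hr hy
    have h2 := hs (jE b k y) (by rw [coe_jE, h1]; exact uni_mem_congrN hϖ hr _ _) v
    rw [hω', coe_jE, h1, chr_uni hϖ hψ hr (Nat.sub_le k (k / 2)), hkr] at h2
    exact smul_left_injective ℂ hv h2
  refine ⟨ω, hres, a, hres, fun _ => ⟨?_, fun B x y g hx _ hg m => ?_⟩,
    fun h' => absurd hk2 (Nat.not_even_iff_odd.2 h')⟩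
  · have htop := eq_top_of_isIrreducible hτ (Submodule.span ℂ {v}) (fun g w hw => by
      obtain ⟨x, u, hx, rfl⟩ := hdec g
      rw [map_mul, Module.End.mul_apply, hω', map_smul, hs x hx]
      exact Submodule.smul_mem _ _ (Submodule.smul_mem _ _ hw))
      (Submodule.mem_span_singleton_self v) hv
    rw [← finrank_top, ← htop, finrank_span_singleton hv]
  · rw [eq_uni_iff hϖ hr] at hx
    subst hx
    have hxm := uni_mem_congrN (k := k) hϖ hr (Nat.sub_le k (k / 2)) B
    have h1 : g = ⟨_, congrN_le_groupJ hϖ hk hxm⟩ * jE b k y := Subtype.ext hg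
    rw [h1, map_mul, Module.End.mul_apply, hω', map_smul, hs _ hxm,
      chr_uni hϖ hψ hr (Nat.sub_le k (k / 2)), hkr, psiMat_eq, smul_smul, mul_comm]

include hψ' in
lemma IsTau.nonempty_equiv_of_even (hk2 : Even k) {ω : (OQuot F E k)ˣ →* ℂˣ} {a : OE F E}
    (hω : RestrictsTo b ψ ϖ ω a) {τ : Representation ℂ (groupJ b k) M}
    {τ' : Representation ℂ (groupJ b k) M'} (h : IsTau b ψ ϖ hk ω τ)
    (h' : IsTau b ψ ϖ hk ω τ') : Nonempty (τ.Equiv τ') := by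
  obtain ⟨h1, h2⟩ := (isTau_iff_of_even hϖ hψ hψ' hk hk2 hω).1 h
  obtain ⟨h1', h2'⟩ := (isTau_iff_of_even hϖ hψ hψ' hk hk2 hω).1 h'
  have hfd : FiniteDimensional ℂ M := Module.finite_of_finrank_pos (by omega)
  have hfd' : FiniteDimensional ℂ M' := Module.finite_of_finrank_pos (by omega)
  let f : M ≃ₗ[ℂ] M' := LinearEquiv.ofFinrankEq M M' (h1.trans h1'.symm)
  refine nonempty_equiv_of_ne_zero h.isIrreducible h'.isIrreducible f.toLinearMap (fun g v => ?_)
    fun h0 => ?_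
  · obtain ⟨X, u, hg⟩ := exists_eq_uni_mul_jE_of_even hϖ hk hk2 g
    have hx := (eq_uni_iff (k := k) hϖ (by omega)).2 (rfl : uni ϖ k (k - k / 2) X = _)
    rw [h2 X _ u g hx (Subgroup.mem_top u) hg, h2' X _ u g hx (Subgroup.mem_top u) hg, map_smul]
  · have := Module.nontrivial_of_finrank_pos (R := ℂ) (M := M) (by omega)
    obtain ⟨v, hv⟩ := exists_ne (0 : M)
    exact hv (f.injective ((LinearMap.congr_fun h0 v).trans (map_zero f).symm))

variable {a : OE F E} (ha : IsPrimitiveElt 𝓀[F] (resO F E a))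
include hψ' ha

lemma exists_isTau {ω : (OQuot F E k)ˣ →* ℂˣ} (hω : RestrictsTo b ψ ϖ ω a) :
    ∃ (d : ℕ) (τ : Representation ℂ (groupJ b k) (Fin d → ℂ)), IsTau b ψ ϖ hk ω τ := by
  rcases Nat.even_or_odd k with hk2 | hk2
  · obtain ⟨τ, hτ⟩ := exists_isTau_of_even hϖ hψ hk hk2 hω ha
    obtain ⟨d, τ', ⟨e⟩⟩ := exists_equiv_fin τ
    exact ⟨d, τ', hτ.of_equiv hk e⟩
  · obtain ⟨φ, hφ, hφ'⟩ := exists_residue_char hϖ hψ hψ'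
    exact exists_isTau_of_odd ⟨hϖ, hψ, hφ, hφ', hk, hk2⟩ hω ha

lemma IsTau.nonempty_equiv {ω : (OQuot F E k)ˣ →* ℂˣ} (hω : RestrictsTo b ψ ϖ ω a)
    {τ : Representation ℂ (groupJ b k) M} {τ' : Representation ℂ (groupJ b k) M'}
    (h : IsTau b ψ ϖ hk ω τ) (h' : IsTau b ψ ϖ hk ω τ') : Nonempty (τ.Equiv τ') := by
  rcases Nat.even_or_odd k with hk2 | hk2
  · exact h.nonempty_equiv_of_even hϖ hψ hψ' hk hk2 hω h'
  · obtain ⟨φ, hφ, hφ'⟩ := exists_residue_char hϖ hψ hψ'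
    exact IsTau.nonempty_equiv_of_odd ⟨hϖ, hψ, hφ, hφ', hk, hk2⟩ hω ha h h'

lemma exists_isTau_of_isIrreducible {τ : Representation ℂ (groupJ b k) M} (hτ : τ.IsIrreducible)
    (hs : ∀ s : groupJ b k, (s : GLk F n k) ∈ congrN n (Nat.sub_le k (k / 2)) → ∀ m,
      τ s m = chr ψ ϖ k (k - k / 2) (Algebra.leftMulMatrix b a) s • m) :
    ∃ ω, RestrictsTo b ψ ϖ ω a ∧ IsTau b ψ ϖ hk ω τ := by
  rcases Nat.even_or_odd k with hk2 | hk2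
  · exact exists_isTau_of_isIrreducible_of_even hϖ hψ hk hk2 hτ hs
  · obtain ⟨φ, hφ, hφ'⟩ := exists_residue_char hϖ hψ hψ'
    have S : OddLevel ϖ ψ φ k := ⟨hϖ, hψ, hφ, hφ', hk, hk2⟩
    refine exists_isTau_of_isIrreducible_of_odd S ha hτ fun X hX v => ?_
    obtain ⟨B, rfl⟩ := (redMat_eq_zero_iff b hϖ X).1 hX
    have h1 := coe_jU_smul (b := b) S B
    rw [hs _ (by rw [h1]; exact uni_mem_congrN hϖ (by omega) _ B), h1, chiJ_jU_smul S,
      chr_uni hϖ hψ (by omega) (Nat.sub_le k (k / 2)), psiMat_eq]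
    congr 3
    omega

/-- The character `ω` is determined by the representation attached to it. -/
lemma IsTau.eq_of_equiv {ω ω' : (OQuot F E k)ˣ →* ℂˣ} (hω : RestrictsTo b ψ ϖ ω a)
    (hω' : RestrictsTo b ψ ϖ ω' a) {τ : Representation ℂ (groupJ b k) M}
    {τ' : Representation ℂ (groupJ b k) M'} (h : IsTau b ψ ϖ hk ω τ)
    (h' : IsTau b ψ ϖ hk ω' τ') (e : τ.Equiv τ') : ω = ω' := by
  have hnt := ((isIrreducible_iff τ).1 h.isIrreducible).1
  obtain ⟨v, hv⟩ := exists_ne (0 : M)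
  have hev : e v ≠ 0 := fun h0 => hv (e.toLinearEquiv.injective (h0.trans (map_zero e).symm))
  have hT : ∀ T : Subgroup (OQuot F E k)ˣ, ActsByScalars b ψ ϖ ω a T τ →
      ActsByScalars b ψ ϖ ω' a T τ' → ∀ u ∈ T, ω u = ω' u := fun T hT hT' u hu => by
    have h1 : ((1 : GLk F n k) : Matrix (Fin n) (Fin n) (oQuot F k)) =
        oneAdd ϖ k (k - k / 2) 0 := (eq_uni_iff hϖ (by omega)).2 (uni_zero hϖ (by omega)).symm
    have h2 := hT 0 1 u (jE b k u) h1 hu (one_mul _).symm v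
    have h3 := hT' 0 1 u (jE b k u) h1 hu (one_mul _).symm (e v)
    rw [psiMat_eq, mul_zero, AddChar.map_zero_eq_one, one_mul] at h2 h3
    rw [← equiv_apply, h2, map_smul] at h3
    exact Units.ext (smul_left_injective ℂ hev h3)
  rcases Nat.even_or_odd k with hk2 | hk2
  · exact MonoidHom.ext fun u => hT ⊤ ((isTau_iff_of_even hϖ hψ hψ' hk hk2 hω).1 h).2
      ((isTau_iff_of_even hϖ hψ hψ' hk hk2 hω').1 h').2 u (Subgroup.mem_top u)
  · obtain ⟨φ, hφ, hφ'⟩ := exists_residue_char hϖ hψ hψ'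
    have S : OddLevel ϖ ψ φ k := ⟨hϖ, hψ, hφ, hφ', hk, hk2⟩
    have hfin := finite_resE b
    -- The scalars determine `ω` on `L`, and the trace at an elliptic generator determines it on the
    -- rest of the torus.
    obtain ⟨u₀, hu₀⟩ := exists_generator_lift (b := b) S
    have hprim : IsPrimitiveElt 𝓀[F] (resU F E hk u₀ : ResE F E) :=
      isPrimitiveElt_of_forall_mem_zpowers hu₀
    have h1 := ((isTau_iff_of_odd S hω ha).1 h).2.2 u₀ hprim
    have h2 := ((isTau_iff_of_odd S hω' ha).1 h').2.2 u₀ hprim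
    rw [trace_of_equiv e, h1] at h2
    have h3 : ω u₀ = ω' u₀ :=
      Units.ext (mul_left_cancel₀ (pow_ne_zero _ (neg_ne_zero.2 one_ne_zero)) h2)
    refine MonoidHom.ext fun u => ?_
    obtain ⟨w, hw, i, rfl⟩ := exists_eq_mul_pow b hk hu₀ u
    rw [map_mul, map_mul, map_pow, map_pow, h3,
      hT _ (h.exists_actsByScalars hϖ hψ hψ' hk hω) (h'.exists_actsByScalars hϖ hψ hψ' hk hω') w hw]

end Tau

/-! ### Conjugate inducing data. -/

section Conj

variable {G : Type*} [Group G] {V : Type*} [AddCommGroup V] [Module ℂ V]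

lemma isIrreducible_res_of_surjective {G' : Type*} [Group G'] {ρ : Representation ℂ G V}
    (hρ : ρ.IsIrreducible) {f : G' →* G} (hf : Function.Surjective f) :
    (res ρ f).IsIrreducible := by
  rw [isIrreducible_iff] at hρ ⊢
  refine ⟨hρ.1, fun W hW => hρ.2 W fun g w hw => ?_⟩
  obtain ⟨g, rfl⟩ := hf g
  exact hW g w hw

/-- Inducing conjugate representations gives equivalent representations. -/
lemma nonempty_equiv_ind_of_conj {S : Subgroup G} {M M' : Type*} [AddCommGroup M] [Module ℂ M]
    [AddCommGroup M'] [Module ℂ M'] {τ : Representation ℂ S M} {τ' : Representation ℂ S M'}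
    (hτ : (Representation.ind S.subtype τ).IsIrreducible)
    (hτ' : (Representation.ind S.subtype τ').IsIrreducible) {g : G} {c : S →* S}
    (hc : ∀ s, (c s : G) = g * s * g⁻¹) (e : τ'.Equiv (res τ c)) :
    Nonempty ((Representation.ind S.subtype τ').Equiv (Representation.ind S.subtype τ)) := by
  -- Moving the copy of `τ` by `g⁻¹` undoes the conjugation, so this map is equivariant under `S`
  -- and Frobenius reciprocity applies.
  let f : M' →ₗ[ℂ] Representation.IndV S.subtype τ :=
    Representation.ind S.subtype τ g⁻¹ ∘ₗ toInd τ ∘ₗ e.toLinearEquiv.toLinearMap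
  have hf : ∀ (s : S) m, f (τ' s m) = Representation.ind S.subtype τ s (f m) := fun s m => by
    change Representation.ind S.subtype τ g⁻¹ (toInd τ (e (τ' s m))) =
      Representation.ind S.subtype τ s (Representation.ind S.subtype τ g⁻¹ (toInd τ (e m)))
    rw [equiv_apply]
    change Representation.ind S.subtype τ g⁻¹ (toInd τ (τ (c s) (e m))) = _
    rw [toInd_apply, hc, ← Module.End.mul_apply, ← Module.End.mul_apply, ← map_mul, ← map_mul]
    congr 2
    group
  refine nonempty_equiv_of_ne_zero hτ' hτ (indLift τ' _ f hf) (indLift_ind _ _ _ _) fun h0 => ?_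
  have hnt : Nontrivial M' := by
    by_contra hM
    rw [not_nontrivial_iff_subsingleton] at hM
    have := ((isIrreducible_iff _).1 hτ').1
    obtain ⟨x, hx⟩ := exists_ne (0 : Representation.IndV S.subtype τ')
    have h0 : ∀ x : Representation.IndV S.subtype τ', x = 0 := fun x => by
      induction x using indV_induction with
      | h0 => rfl
      | hadd x y hx hy => rw [hx, hy, add_zero]
      | hind g m => rw [Subsingleton.elim m 0, map_zero, map_zero]
    exact hx (h0 x)
  obtain ⟨m, hm⟩ := exists_ne (0 : M')
  have h1 := LinearMap.congr_fun h0 (toInd τ' m)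
  rw [indLift_toInd, LinearMap.zero_apply] at h1
  have h2 : toInd τ (e m) = 0 := by
    have h3 := congrArg (Representation.ind S.subtype τ g) h1
    change Representation.ind S.subtype τ g (Representation.ind S.subtype τ g⁻¹ (toInd τ (e m))) = _
      at h3
    rwa [← Module.End.mul_apply, ← map_mul, mul_inv_cancel, map_one, Module.End.one_apply,
      map_zero] at h3
  have h3 : e m = 0 := toInd_injective τ (h2.trans (map_zero _).symm)
  exact hm (e.toLinearEquiv.injective (h3.trans (map_zero e).symm))

lemma IsIrreducibleMatrix.of_conj {n : ℕ} {K : Type*} [Field K] {A B : Matrix (Fin n) (Fin n) K}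
    (hA : IsIrreducibleMatrix A) (g : (Matrix (Fin n) (Fin n) K)ˣ)
    (h : (g : Matrix (Fin n) (Fin n) K) * A = B * g) : IsIrreducibleMatrix B := by
  intro W hW
  have hg : ∀ w, (g : Matrix (Fin n) (Fin n) K).mulVec
      (((g⁻¹ : (Matrix (Fin n) (Fin n) K)ˣ) : Matrix (Fin n) (Fin n) K).mulVec w) = w := fun w => by
    rw [Matrix.mulVec_mulVec, Units.mul_inv, Matrix.one_mulVec]
  rcases hA (W.comap (g : Matrix (Fin n) (Fin n) K).mulVecLin) (fun x hx => by
    rw [Submodule.mem_comap, Matrix.mulVecLin_apply] at hx ⊢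
    rw [Matrix.mulVec_mulVec, h, ← Matrix.mulVec_mulVec]
    exact hW _ hx) with h1 | h1
  · left
    rw [eq_bot_iff]
    intro w hw
    have h2 : ((g⁻¹ : (Matrix (Fin n) (Fin n) K)ˣ) : Matrix (Fin n) (Fin n) K).mulVec w ∈
        W.comap (g : Matrix (Fin n) (Fin n) K).mulVecLin := by
      rw [Submodule.mem_comap, Matrix.mulVecLin_apply, hg]
      exact hw
    rw [h1, Submodule.mem_bot] at h2
    rw [Submodule.mem_bot, ← hg w, h2, Matrix.mulVec_zero]
  · right
    rw [eq_top_iff]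
    intro w _
    have h2 : ((g⁻¹ : (Matrix (Fin n) (Fin n) K)ˣ) : Matrix (Fin n) (Fin n) K).mulVec w ∈
        W.comap (g : Matrix (Fin n) (Fin n) K).mulVecLin := by
      rw [h1]
      exact Submodule.mem_top
    rwa [Submodule.mem_comap, Matrix.mulVecLin_apply, hg] at h2

end Conj

/-! ### Galois automorphisms as conjugations. -/

section Galois

variable {F : Type u} [Field F] [ValuativeRel F] [TopologicalSpace F]
  [IsNonarchimedeanLocalField F]
variable {E : Type v} [Field E] [Algebra F E]
variable {n k : ℕ} {ϖ : 𝒪[F]} {b : Module.Basis (Fin n) 𝒪[F] (OE F E)} {ψ : AddChar F ℂ}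
variable {M : Type*} [AddCommGroup M] [Module ℂ M]

variable (b) in
-- The matrix of `s` in the basis `b` does it: on `𝔒`, conjugating a multiplication by `s` gives
-- multiplication by the image.
lemma exists_matrix_of_algEquiv (s : OE F E ≃ₐ[𝒪[F]] OE F E) : ∃ g : (MatO F n)ˣ,
    ∀ y, (g : MatO F n) * Algebra.leftMulMatrix b y = Algebra.leftMulMatrix b (s y) * g := by
  refine ⟨⟨LinearMap.toMatrix b b s.toLinearMap, LinearMap.toMatrix b b s.symm.toLinearMap, ?_, ?_⟩,
    fun y => ?_⟩
  · rw [← LinearMap.toMatrix_comp, ← LinearMap.toMatrix_id b]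
    congr 1
    ext x
    simp
  · rw [← LinearMap.toMatrix_comp, ← LinearMap.toMatrix_id b]
    congr 1
    ext x
    simp
  · rw [Algebra.leftMulMatrix_apply, Algebra.leftMulMatrix_apply, ← LinearMap.toMatrix_comp,
      ← LinearMap.toMatrix_comp]
    congr 1
    ext x
    simp

variable [FiniteDimensional F E] {γ : E ≃ₐ[F] E} {g : (MatO F n)ˣ}

lemma galUnits_quotU (u : (OE F E)ˣ) : galUnits k γ (quotU F E k u) =
    quotU F E k (Units.map (galRestrict 𝒪[F] F E (OE F E) γ : OE F E →* OE F E) u) := rfl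

lemma leftMulMatrix_gal_mul_conj (hg : ∀ y, (g : MatO F n) * Algebra.leftMulMatrix b y =
      Algebra.leftMulMatrix b (galRestrict 𝒪[F] F E (OE F E) γ y) * g) (m : ℕ) (a : OE F E)
    (X : MatO F n) : trChar n ψ ϖ m (Algebra.leftMulMatrix b (galRestrict 𝒪[F] F E (OE F E) γ a) *
      ((g : MatO F n) * X * (g⁻¹ : (MatO F n)ˣ))) = trChar n ψ ϖ m (Algebra.leftMulMatrix b a * X) := by
  rw [← mul_assoc, ← mul_assoc, ← hg, trChar_mul_comm, ← mul_assoc, ← mul_assoc, Units.inv_mul,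
    one_mul]

lemma RestrictsTo.comp_gal (hg : ∀ y, (g : MatO F n) * Algebra.leftMulMatrix b y =
      Algebra.leftMulMatrix b (galRestrict 𝒪[F] F E (OE F E) γ y) * g)
    {ω : (OQuot F E k)ˣ →* ℂˣ} {a : OE F E}
    (h : RestrictsTo b ψ ϖ ω (galRestrict 𝒪[F] F E (OE F E) γ a)) :
    RestrictsTo b ψ ϖ (ω.comp (galUnits k γ)) a := by
  intro x y hy
  have h1 : ((galUnits k γ y : (OQuot F E k)ˣ) : OQuot F E k) = Ideal.Quotient.mk (PE F E ^ k)
      (1 + algebraMap 𝒪[F] (OE F E) ϖ ^ (k - k / 2) * galRestrict 𝒪[F] F E (OE F E) γ x) := by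
    have h2 : galRestrict 𝒪[F] F E (OE F E) γ (1 + algebraMap 𝒪[F] (OE F E) ϖ ^ (k - k / 2) * x) =
        1 + algebraMap 𝒪[F] (OE F E) ϖ ^ (k - k / 2) * galRestrict 𝒪[F] F E (OE F E) γ x := by
      rw [map_add, map_one, map_mul, map_pow, AlgEquiv.commutes]
    rw [← h2]
    change Ideal.quotientMap (PE F E ^ k)
      (galRestrict 𝒪[F] F E (OE F E) γ : OE F E ≃ₐ[𝒪[F]] OE F E).toRingEquiv.toRingHom
      (pe_pow_le_comap_gal k γ) (y : OQuot F E k) = _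
    rw [hy]
    rfl
  have h3 : Algebra.leftMulMatrix b (galRestrict 𝒪[F] F E (OE F E) γ x) =
      (g : MatO F n) * Algebra.leftMulMatrix b x * (g⁻¹ : (MatO F n)ˣ) := by
    rw [hg, Units.mul_inv_cancel_right]
  rw [MonoidHom.comp_apply, h _ _ h1, psiMat_eq, psiMat_eq, h3, leftMulMatrix_gal_mul_conj hg]

variable [IsUnramifiedExtension F E] (hϖ : Irreducible ϖ) (hk : 2 ≤ k)
include hϖ

lemma emb_galUnits (hk : 2 ≤ k) (hg : ∀ y, (g : MatO F n) * Algebra.leftMulMatrix b y =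
      Algebra.leftMulMatrix b (galRestrict 𝒪[F] F E (OE F E) γ y) * g) (u : (OQuot F E k)ˣ) :
    toGL F n k g * emb b k u * (toGL F n k g)⁻¹ = emb b k (galUnits k γ u) := by
  obtain ⟨u, rfl⟩ := quotU_surjective b hϖ hk u
  rw [galUnits_quotU, emb_quotU, emb_quotU, ← map_inv, ← map_mul, ← map_mul]
  congr 1
  refine Units.ext ?_
  rw [Units.val_mul, Units.val_mul, coe_lamU, coe_lamU, hg, Units.mul_inv_cancel_right]
  rfl

include hk

lemma exists_conj_groupJ (hg : ∀ y, (g : MatO F n) * Algebra.leftMulMatrix b y =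
      Algebra.leftMulMatrix b (galRestrict 𝒪[F] F E (OE F E) γ y) * g) :
    ∃ c : groupJ b k →* groupJ b k, Function.Surjective c ∧
      ∀ s, (c s : GLk F n k) = toGL F n k g * s * (toGL F n k g)⁻¹ := by
  have hmem : ∀ s : groupJ b k, toGL F n k g * s * (toGL F n k g)⁻¹ ∈ groupJ b k := fun s => by
    obtain ⟨X, u, h⟩ := (mem_groupNO_iff b hϖ (by omega) (Nat.div_le_self k 2)).1 s.2
    refine (mem_groupNO_iff b hϖ (by omega) (Nat.div_le_self k 2)).2
      ⟨(g : MatO F n) * X * ((g⁻¹ : (MatO F n)ˣ) : MatO F n), galUnits k γ u, ?_⟩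
    rw [← emb_galUnits hϖ hk hg, ← uni_conj hϖ (by omega), h]
    group
  let c : groupJ b k →* groupJ b k :=
    ((MulAut.conj (toGL F n k g)).toMonoidHom.comp (groupJ b k).subtype).codRestrict (groupJ b k)
      hmem
  have hc : ∀ s, (c s : GLk F n k) = toGL F n k g * s * (toGL F n k g)⁻¹ := fun s => rfl
  refine ⟨c, Finite.surjective_of_injective fun x y h => Subtype.ext ?_, hc⟩
  have h1 := congrArg Subtype.val h
  rw [hc, hc] at h1
  exact mul_left_cancel (mul_right_cancel h1)

lemma ActsByScalars.comp_gal (hg : ∀ y, (g : MatO F n) * Algebra.leftMulMatrix b y =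
      Algebra.leftMulMatrix b (galRestrict 𝒪[F] F E (OE F E) γ y) * g)
    {c : groupJ b k →* groupJ b k} (hc : ∀ s, (c s : GLk F n k) = toGL F n k g * s * (toGL F n k g)⁻¹)
    {ω : (OQuot F E k)ˣ →* ℂˣ} {a : OE F E} {T : Subgroup (OQuot F E k)ˣ}
    (hT : ∀ u ∈ T, galUnits k γ u ∈ T) {τ : Representation ℂ (groupJ b k) M}
    (h : ActsByScalars b ψ ϖ ω (galRestrict 𝒪[F] F E (OE F E) γ a) T τ) :
    ActsByScalars b ψ ϖ (ω.comp (galUnits k γ)) a T (res τ c) := by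
  intro B x y s hx hy hs v
  have hr : 0 < k - k / 2 := by omega
  rw [eq_uni_iff hϖ hr] at hx
  have h1 : (c s : GLk F n k) = uni ϖ k (k - k / 2)
      ((g : MatO F n) * (B : MatO F n) * ((g⁻¹ : (MatO F n)ˣ) : MatO F n)) * emb b k (galUnits k γ y) := by
    rw [hc, hs, hx, ← uni_conj hϖ hr, ← emb_galUnits hϖ hk hg]
    group
  change τ (c s) v = _
  rw [h _ _ _ (c s) ((eq_uni_iff hϖ hr).2 rfl) (hT y hy) h1, psiMat_eq, psiMat_eq,
    leftMulMatrix_gal_mul_conj hg, MonoidHom.comp_apply]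

include b in
lemma galUnits_mem_kerL {u : (OQuot F E k)ˣ} (hu : u ∈ kerL hk) : galUnits k γ u ∈ kerL hk := by
  obtain ⟨u, rfl⟩ := quotU_surjective b hϖ hk u
  rw [mem_kerL_iff] at hu ⊢
  have h1 : resO F E ((u : OE F E) - 1) = 0 := by
    rw [map_sub, ← coe_resU_quotU hk, hu, map_one, Units.val_one, sub_self]
  obtain ⟨x, hx⟩ := (resO_eq_zero_iff hϖ _).1 h1
  have h2 : galRestrict 𝒪[F] F E (OE F E) γ u - 1 =
      algebraMap 𝒪[F] (OE F E) ϖ * galRestrict 𝒪[F] F E (OE F E) γ x := by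
    rw [← AlgEquiv.commutes (galRestrict 𝒪[F] F E (OE F E) γ) ϖ, ← map_mul, ← hx, map_sub, map_one]
  have h3 : resO F E (galRestrict 𝒪[F] F E (OE F E) γ u - 1) = 0 :=
    (resO_eq_zero_iff hϖ _).2 ⟨_, h2⟩
  rw [galUnits_quotU]
  refine Units.ext ?_
  rw [coe_resU_quotU, Units.val_one]
  rw [map_sub, map_one, sub_eq_zero] at h3
  exact h3

omit hk hϖ in
include b in
-- Primitivity is irreducibility of the multiplication matrix, which conjugation preserves; no
-- residual automorphism has to be constructed.
lemma isPrimitiveElt_gal {a : OE F E} (ha : IsPrimitiveElt 𝓀[F] (resO F E a)) :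
    IsPrimitiveElt 𝓀[F] (resO F E (galRestrict 𝒪[F] F E (OE F E) γ a)) := by
  obtain ⟨g, hg⟩ := exists_matrix_of_algEquiv b (galRestrict 𝒪[F] F E (OE F E) γ)
  rw [← isIrreducibleMatrix_leftMulMatrix_iff (b := b)] at ha ⊢
  refine ha.of_conj (Units.map (IsLocalRing.residue 𝒪[F]).mapMatrix.toMonoidHom g) ?_
  have h1 := congrArg (IsLocalRing.residue 𝒪[F]).mapMatrix (hg a)
  rw [map_mul, map_mul] at h1
  exact h1

lemma IsTau.comp_gal (hψ : ∀ x : 𝒪[F], ψ (x : F) = 1)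
    (hψ' : ∃ x : 𝒪[F], ψ ((x : F) / (ϖ : F)) ≠ 1)
    (hg : ∀ y, (g : MatO F n) * Algebra.leftMulMatrix b y =
      Algebra.leftMulMatrix b (galRestrict 𝒪[F] F E (OE F E) γ y) * g)
    {c : groupJ b k →* groupJ b k} (hcs : Function.Surjective c)
    (hc : ∀ s, (c s : GLk F n k) = toGL F n k g * s * (toGL F n k g)⁻¹)
    {ω : (OQuot F E k)ˣ →* ℂˣ} {a : OE F E} (ha : IsPrimitiveElt 𝓀[F] (resO F E a))
    (hω : RestrictsTo b ψ ϖ ω (galRestrict 𝒪[F] F E (OE F E) γ a))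
    {τ : Representation ℂ (groupJ b k) M} (h : IsTau b ψ ϖ hk ω τ) :
    IsTau b ψ ϖ hk (ω.comp (galUnits k γ)) (res τ c) := by
  have hω' := hω.comp_gal hg
  rcases Nat.even_or_odd k with hk2 | hk2
  · rw [isTau_iff_of_even hϖ hψ hψ' hk hk2 hω] at h
    rw [isTau_iff_of_even hϖ hψ hψ' hk hk2 hω']
    exact ⟨h.1, h.2.comp_gal hϖ hk hg hc fun u _ => Subgroup.mem_top _⟩
  · obtain ⟨φ, hφ, hφ'⟩ := exists_residue_char hϖ hψ hψ'
    have S : OddLevel ϖ ψ φ k := ⟨hϖ, hψ, hφ, hφ', hk, hk2⟩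
    obtain ⟨h1, h2, h3⟩ := (isTau_iff_of_odd S hω (isPrimitiveElt_gal (b := b) ha)).1 h
    refine (isTau_iff_of_odd S hω' ha).2 ⟨isIrreducible_res_of_surjective h1 hcs,
      (actsByScalars_iff S).1 (((actsByScalars_iff S).2 h2).comp_gal hϖ hk hg hc
        fun u hu => galUnits_mem_kerL (b := b) hϖ hk hu), fun u hu => ?_⟩
    have h4 : c (jE b k u) = jE b k (galUnits k γ u) := Subtype.ext (by
      rw [hc, coe_jE, coe_jE, emb_galUnits hϖ hk hg])
    change LinearMap.trace ℂ M (τ (c (jE b k u))) = _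
    rw [h4, h3 _ ?_, MonoidHom.comp_apply]
    obtain ⟨u, rfl⟩ := quotU_surjective b hϖ hk u
    exact isPrimitiveElt_gal (b := b) hu

end Galois

/-! ### Strongly cuspidal representations as induced representations. -/

section Induced

/-- A commutative subgroup has a common eigenvector. -/
lemma exists_forall_apply_eq_smul_of_commute {G : Type*} [Group G] [Finite G] {V : Type*}
    [AddCommGroup V] [Module ℂ V] [FiniteDimensional ℂ V] [Nontrivial V] (ρ : Representation ℂ G V)
    (N : Subgroup G) (hN : ∀ x ∈ N, ∀ y ∈ N, x * y = y * x) :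
    ∃ (ω : N →* ℂˣ) (v : V), v ≠ 0 ∧ ∀ x : N, ρ x v = (ω x : ℂ) • v := by
  obtain ⟨W, hW, -, -, hirr⟩ := exists_isIrreducible_subrepresentation (res ρ N.subtype)
    (U := ⊤) (fun _ _ _ => Submodule.mem_top) top_ne_bot
  have := ((isIrreducible_iff _).1 hirr).1
  obtain ⟨v, hv⟩ := exists_ne (0 : W)
  obtain ⟨ω, hω⟩ := exists_hom_of_forall_smul _ hv fun u => by
    obtain ⟨c, hc⟩ := exists_smul_of_commute hirr
      ((res ρ N.subtype).subrepresentation W hW u) fun g w => by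
        rw [← Module.End.mul_apply, ← Module.End.mul_apply, ← map_mul, ← map_mul]
        congr 2
        exact Subtype.ext (hN _ u.2 _ g.2)
    exact ⟨c, hc v⟩
  exact ⟨ω, v, fun h => hv (Subtype.ext h), fun x => congrArg Subtype.val (hω x)⟩

variable {F : Type u} [Field F] [ValuativeRel F] [TopologicalSpace F]
  [IsNonarchimedeanLocalField F]
variable {E : Type v} [Field E] [Algebra F E] [IsUnramifiedExtension F E]
variable {n k : ℕ} {ϖ : 𝒪[F]} {b : Module.Basis (Fin n) 𝒪[F] (OE F E)} {ψ : AddChar F ℂ}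
variable {M : Type*} [AddCommGroup M] [Module ℂ M] {M' : Type*} [AddCommGroup M'] [Module ℂ M']
variable (hϖ : Irreducible ϖ) (hψ : ∀ x : 𝒪[F], ψ (x : F) = 1)
  (hψ' : ∃ x : 𝒪[F], ψ ((x : F) / (ϖ : F)) ≠ 1) (hk : 2 ≤ k)
include hϖ hψ hψ' hk

/-- The group `N_l` is commutative because `2l ≥ k`, so it has a common eigenvector, and duality for
matrices writes the eigencharacter as some `ψ_A`. -/
lemma exists_mem_eig_chr {V : Type*} [AddCommGroup V] [Module ℂ V] {ρ : Representation ℂ (GLk F n k) V}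
    (hρ : ρ.IsIrreducible) :
    ∃ A, ∃ v ∈ eig ρ (congrN n (Nat.sub_le k (k / 2))) (chr ψ ϖ k (k - k / 2) A), v ≠ 0 := by
  have hr : 0 < k - k / 2 := by omega
  have hkr : k - (k - k / 2) = k / 2 := by omega
  have := finiteDimensional_of_isIrreducible hρ
  have := ((isIrreducible_iff _).1 hρ).1
  have hmul : ∀ X Y : MatO F n, uni ϖ k (k - k / 2) X * uni ϖ k (k - k / 2) Y =
      uni ϖ k (k - k / 2) (X + Y) := fun X Y => by
    rw [uni_mul hϖ hr, uni_eq_iff hϖ hr (Nat.sub_le k (k / 2)), hkr]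
    refine ⟨ϖ ^ (k - k / 2 - k / 2) • (X * Y), ?_⟩
    rw [smul_smul, ← pow_add]
    congr 3
    omega
  obtain ⟨ω, v, hv, hωv⟩ := exists_forall_apply_eq_smul_of_commute ρ
    (congrN n (Nat.sub_le k (k / 2))) fun x hx y hy => by
      obtain ⟨X, rfl⟩ := (mem_congrN_iff hϖ hr _).1 hx
      obtain ⟨Y, rfl⟩ := (mem_congrN_iff hϖ hr _).1 hy
      rw [hmul, hmul, add_comm]
  let x : MatO F n → congrN (F := F) n (Nat.sub_le k (k / 2)) := fun X =>
    ⟨uni ϖ k (k - k / 2) X, uni_mem_congrN hϖ hr _ X⟩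
  let f : AddChar (MatO F n) ℂ :=
    { toFun := fun X => (ω (x X) : ℂ)
      map_zero_eq_one' := by
        have h : x 0 = 1 := Subtype.ext (uni_zero hϖ hr)
        rw [h, map_one, Units.val_one]
      map_add_eq_mul' := fun X Y => by
        have h : x (X + Y) = x X * x Y := Subtype.ext (hmul X Y).symm
        rw [h, map_mul, Units.val_mul] }
  obtain ⟨A, hA⟩ := exists_trChar_eq hϖ hψ hψ' (k / 2) f fun X => by
    have h : x (ϖ ^ (k / 2) • X) = 1 := Subtype.ext (by
      refine Eq.trans ?_ (uni_zero hϖ hr)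
      refine (uni_eq_iff hϖ hr (Nat.sub_le k (k / 2))).2 ⟨X, ?_⟩
      rw [hkr, zero_add])
    change (ω (x _) : ℂ) = 1
    rw [h, map_one, Units.val_one]
  refine ⟨A, v, fun y hy => ?_, hv⟩
  obtain ⟨X, rfl⟩ := (mem_congrN_iff hϖ hr _).1 hy
  rw [chr_uni hϖ hψ hr (Nat.sub_le k (k / 2)), hkr, ← hA]
  exact hωv (x X)

omit hψ' in
lemma mem_omegaOne_of_mem_eig_chr {V : Type*} [AddCommGroup V] [Module ℂ V]
    {ρ : Representation ℂ (GLk F n k) V} {A : MatO F n} {v : V} (hv0 : v ≠ 0)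
    (hv : v ∈ eig ρ (congrN n (Nat.sub_le k (k / 2))) (chr ψ ϖ k (k - k / 2) A)) :
    A.map (IsLocalRing.residue 𝒪[F]) ∈ omegaOne ψ ϖ ρ := by
  have hr : 0 < k - k / 2 := by omega
  refine ⟨A, rfl, v, hv0, fun B x hx => ?_⟩
  rw [eq_uni_iff hϖ (by omega)] at hx
  have h1 : k - 1 = k - k / 2 + (k / 2 - 1) := by omega
  rw [h1, uni_add_pow _ hϖ hr] at hx
  rw [hv x (hx ▸ uni_mem_congrN hϖ hr _ _), hx, chr_uni hϖ hψ hr (Nat.sub_le k (k / 2)), psiMat_eq,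
    mul_smul_comm, ← trChar_add_smul hϖ 1 (k / 2 - 1)]
  congr 3
  omega

variable {a a' : OE F E} (ha : IsPrimitiveElt 𝓀[F] (resO F E a))
include ha

lemma IsTau.isIrreducible_rho {ω : (OQuot F E k)ˣ →* ℂˣ} (hω : RestrictsTo b ψ ϖ ω a)
    {τ : Representation ℂ (groupJ b k) M} (h : IsTau b ψ ϖ hk ω τ) : (rho b τ).IsIrreducible :=
  isIrreducible_ind (isCharOn_chr hϖ hψ (by omega) (Nat.sub_le k (k / 2)) (by omega) _)
    (fixes_of_mem_groupJ hϖ hψ hk ha) (moves_of_not_mem_groupJ hϖ hψ hk hψ' ha)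
    (congrN_le_groupJ hϖ hk)
    ((h.exists_actsByScalars hϖ hψ hψ' hk hω).apply_of_mem_congrN hϖ hψ hk) h.isIrreducible

/-- A character of `N_{k-1}` occurring in the induced representation is conjugate to the restriction
of `ψ_a`. Hence its matrix is residually conjugate to multiplication by the primitive `a`, which is
irreducible. -/
lemma IsTau.isStronglyCuspidal_rho {ω : (OQuot F E k)ˣ →* ℂˣ} (hω : RestrictsTo b ψ ϖ ω a)
    {τ : Representation ℂ (groupJ b k) M} (h : IsTau b ψ ϖ hk ω τ) :
    IsStronglyCuspidal ψ ϖ (rho b τ) := by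
  refine ⟨h.isIrreducible_rho hϖ hψ hψ' hk ha hω, ?_⟩
  rintro _ ⟨A, rfl, v, hv0, hv⟩
  have hr : 0 < k - k / 2 := by omega
  have hr1 : 0 < k - 1 := by omega
  have h1 : k - 1 = k - k / 2 + (k / 2 - 1) := by omega
  obtain ⟨g, hg⟩ := exists_conj_of_mem_eig_ind (N := congrN n (Nat.sub_le k (k / 2)))
    (N' := congrN n (Nat.sub_le k 1)) (χ' := chr ψ ϖ k (k - 1) A) (v := v)
    (isCharOn_chr hϖ hψ hr1 (Nat.sub_le k 1) (by omega) A) (fun g x hx => by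
      refine conj_mem_congrN hϖ _ g x ?_
      obtain ⟨X, rfl⟩ := (mem_congrN_iff hϖ hr1 _).1 hx
      rw [h1, uni_add_pow _ hϖ hr]
      exact uni_mem_congrN hϖ hr _ _) (congrN_le_groupJ hϖ hk)
    ((h.exists_actsByScalars hϖ hψ hψ' hk hω).apply_of_mem_congrN hϖ hψ hk)
    (fun x hx => by
      obtain ⟨X, rfl⟩ := (mem_congrN_iff hϖ hr1 _).1 hx
      rw [chr_uni hϖ hψ hr1 (Nat.sub_le k 1), Nat.sub_sub_self (by omega : 1 ≤ k), ← psiMat_eq]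
      exact hv X _ ((eq_uni_iff hϖ hr1).2 rfl)) hv0
  obtain ⟨g, rfl⟩ := toGL_surjective hϖ (by omega) g
  obtain ⟨C, hC⟩ := eq_smul_of_forall_trChar_eq_one hϖ hψ hψ' 1
    (a := (g : MatO F n) * Algebra.leftMulMatrix b a * ((g⁻¹ : (MatO F n)ˣ) : MatO F n) - A)
    fun X => by
      have h2 := hg (uni ϖ k (k - 1) X) (uni_mem_congrN hϖ hr1 _ X)
      rw [chr_uni hϖ hψ hr1 (Nat.sub_le k 1), Nat.sub_sub_self (by omega : 1 ≤ k), h1,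
        uni_add_pow _ hϖ hr, chr_conj hϖ hψ hr (Nat.sub_le k (k / 2)), mul_smul_comm,
        (by omega : k - (k - k / 2) = 1 + (k / 2 - 1)), trChar_add_smul hϖ] at h2
      rw [sub_mul, AddChar.map_sub_eq_div, h2, div_self (AddChar.val_isUnit _ _).ne_zero]
  refine ((isIrreducibleMatrix_leftMulMatrix_iff b a).2 ha).of_conj
    (Units.map (IsLocalRing.residue 𝒪[F]).mapMatrix.toMonoidHom g) ?_
  have h2 : (g : MatO F n) * Algebra.leftMulMatrix b a =
      (A : MatO F n) * (g : MatO F n) + ϖ ^ 1 • ((C : MatO F n) * (g : MatO F n)) := by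
    rw [← smul_mul_assoc, ← hC, ← add_mul, add_sub_cancel, Units.inv_mul_cancel_right]
  have h3 := congrArg (IsLocalRing.residue 𝒪[F]).mapMatrix h2
  have h4 : (IsLocalRing.residue 𝒪[F]).mapMatrix (ϖ ^ 1 • ((C : MatO F n) * (g : MatO F n))) = 0 := by
    ext i j
    refine (IsLocalRing.residue_eq_zero_iff _).2 ?_
    rw [← pow_one 𝓂[F], mem_maximalIdeal_pow_iff hϖ]
    exact ⟨((C : MatO F n) * (g : MatO F n)) i j, rfl⟩
  rw [map_mul, map_add, h4, add_zero, map_mul] at h3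
  exact h3

omit ha in
-- Some `ψ_A` occurs on `N_l`, and strong cuspidality makes `A` residually irreducible. Conjugating
-- `A` into `𝔒` exhibits `ψ_a` in `ρ`, which is then induced from the `ψ_a`-eigenspace, an
-- irreducible representation of `J`.
lemma exists_isTau_of_isStronglyCuspidal (b : Module.Basis (Fin n) 𝒪[F] (OE F E)) {V : Type*}
    [AddCommGroup V] [Module ℂ V]
    {ρ : Representation ℂ (GLk F n k) V} (hρ : IsStronglyCuspidal ψ ϖ ρ) :
    ∃ ω : (OQuot F E k)ˣ →* ℂˣ, IsStronglyPrimitive ϖ ω ∧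
      ∃ (d : ℕ) (τ : Representation ℂ (groupJ b k) (Fin d → ℂ)),
        IsTau b ψ ϖ hk ω τ ∧ Nonempty (ρ.Equiv (rho b τ)) := by
  have hr : 0 < k - k / 2 := by omega
  obtain ⟨A, v, hv, hv0⟩ := exists_mem_eig_chr hϖ hψ hψ' hk hρ.1
  obtain ⟨a, ha, g, hg⟩ := exists_conj_leftMulMatrix (b := b) hϖ
    (hρ.2 _ (mem_omegaOne_of_mem_eig_chr hϖ hψ hk hv0 hv))
  have hg' : (g : MatO F n) * A * ((g⁻¹ : (MatO F n)ˣ) : MatO F n) = Algebra.leftMulMatrix b a := by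
    rw [hg, Units.mul_inv_cancel_right]
  have hne : eig ρ (congrN n (Nat.sub_le k (k / 2)))
      (chr ψ ϖ k (k - k / 2) (Algebra.leftMulMatrix b a)) ≠ ⊥ := fun h0 => by
    have hmem : ρ (toGL F n k g) v ∈ eig ρ (congrN n (Nat.sub_le k (k / 2)))
        (chr ψ ϖ k (k - k / 2) (Algebra.leftMulMatrix b a)) := fun x hx => by
      obtain ⟨X, rfl⟩ := (mem_congrN_iff hϖ hr _).1 hx
      have h1 : uni ϖ k (k - k / 2) X * toGL F n k g = toGL F n k g *
          ((toGL F n k g)⁻¹ * uni ϖ k (k - k / 2) X * toGL F n k g) := by group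
      rw [← Module.End.mul_apply, ← map_mul, h1, map_mul, Module.End.mul_apply,
        hv _ (conj_mem_congrN hϖ _ _ _ (uni_mem_congrN hϖ hr _ X)), map_smul,
        chr_conj hϖ hψ hr (Nat.sub_le k (k / 2)), hg', chr_uni hϖ hψ hr (Nat.sub_le k (k / 2))]
    rw [h0, Submodule.mem_bot] at hmem
    apply hv0
    have h1 := congrArg (ρ (toGL F n k g)⁻¹) hmem
    rwa [← Module.End.mul_apply, ← map_mul, inv_mul_cancel, map_one, Module.End.one_apply,
      map_zero] at h1
  have hχ := isCharOn_chr hϖ hψ hr (Nat.sub_le k (k / 2)) (by omega) (Algebra.leftMulMatrix b a)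
  have hfix := fixes_of_mem_groupJ (b := b) hϖ hψ hk ha
  have hmove := moves_of_not_mem_groupJ (b := b) hϖ hψ hk hψ' ha
  obtain ⟨e⟩ := nonempty_equiv_ind_eigRep hρ.1 hχ hfix hmove (congrN_le_groupJ hϖ hk) hne
  have hirr := isIrreducible_eigRep hρ.1 hχ (groupJ b k) hfix hmove hne
  obtain ⟨ω, hω, hτ⟩ := exists_isTau_of_isIrreducible hϖ hψ hψ' hk ha hirr
    fun s hs m => Subtype.ext (m.2 _ hs)
  have := finiteDimensional_of_isIrreducible hirr
  obtain ⟨d, τ', ⟨e'⟩⟩ := exists_equiv_fin (eigRep ρ (groupJ b k) hfix)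
  have hτ' := hτ.of_equiv hk e'
  -- Conjugation by `1` is used only to pass to an isomorphic inducing representation on a
  -- coordinate space.
  obtain ⟨e''⟩ := nonempty_equiv_ind_of_conj (hτ'.isIrreducible_rho hϖ hψ hψ' hk ha hω)
    (hτ.isIrreducible_rho hϖ hψ hψ' hk ha hω) (g := 1) (c := MonoidHom.id _)
    (fun s => by rw [one_mul, inv_one, mul_one]; rfl) e'
  exact ⟨ω, (isStronglyPrimitive_iff hϖ hψ hψ' hk hω).2 ha, d, τ', hτ', ⟨e.trans e''⟩⟩

variable [FiniteDimensional F E]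

lemma IsTau.nonempty_equiv_rho_comp_gal (γ : E ≃ₐ[F] E) {ω : (OQuot F E k)ˣ →* ℂˣ}
    (hω : RestrictsTo b ψ ϖ ω (galRestrict 𝒪[F] F E (OE F E) γ a))
    {τ : Representation ℂ (groupJ b k) M} {τ' : Representation ℂ (groupJ b k) M'}
    (h : IsTau b ψ ϖ hk ω τ) (h' : IsTau b ψ ϖ hk (ω.comp (galUnits k γ)) τ') :
    Nonempty ((rho b τ').Equiv (rho b τ)) := by
  obtain ⟨g, hg⟩ := exists_matrix_of_algEquiv b (galRestrict 𝒪[F] F E (OE F E) γ)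
  obtain ⟨c, hcs, hc⟩ := exists_conj_groupJ hϖ hk hg
  have hω' := hω.comp_gal hg
  obtain ⟨e⟩ := h'.nonempty_equiv hϖ hψ hψ' hk ha hω'
    (h.comp_gal hϖ hk hψ hψ' hg hcs hc ha hω)
  exact nonempty_equiv_ind_of_conj
    (h.isIrreducible_rho hϖ hψ hψ' hk (isPrimitiveElt_gal (b := b) ha) hω)
    (h'.isIrreducible_rho hϖ hψ hψ' hk ha hω') hc e

/-- Isomorphic induced representations share a character of `N_l`, so `a` and `a'` are conjugate,
hence Galois conjugate, modulo `ϖ ^ l'`. Composing `ω` with the automorphism reduces to a common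
`a`, where the inducing representations are isomorphic and determine the character. -/
lemma IsTau.eq_comp_gal_of_equiv_rho (hn : Module.finrank F E = n)
    (ha' : IsPrimitiveElt 𝓀[F] (resO F E a'))
    {ω ω' : (OQuot F E k)ˣ →* ℂˣ} (hω : RestrictsTo b ψ ϖ ω a) (hω' : RestrictsTo b ψ ϖ ω' a')
    {τ : Representation ℂ (groupJ b k) M} {τ' : Representation ℂ (groupJ b k) M'}
    (h : IsTau b ψ ϖ hk ω τ) (h' : IsTau b ψ ϖ hk ω' τ') (e : (rho b τ).Equiv (rho b τ')) :
    ∃ γ : E ≃ₐ[F] E, ω' = ω.comp (galUnits k γ) := by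
  have hr : 0 < k - k / 2 := by omega
  have hkr : k - (k - k / 2) = k / 2 := by omega
  have hτ := (h.exists_actsByScalars hϖ hψ hψ' hk hω).apply_of_mem_congrN hϖ hψ hk
  have hτ' := (h'.exists_actsByScalars hϖ hψ hψ' hk hω').apply_of_mem_congrN hϖ hψ hk
  have hnt := ((isIrreducible_iff _).1 h'.isIrreducible).1
  obtain ⟨m, hm⟩ := exists_ne (0 : M')
  have hv0 : e.symm (toInd τ' m) ≠ 0 := fun h0 => hm (toInd_injective τ' (by
    rw [map_zero]
    exact e.symm.toLinearEquiv.injective (h0.trans (map_zero e.symm).symm)))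
  obtain ⟨g, hg⟩ := exists_conj_of_mem_eig_ind
    (isCharOn_chr hϖ hψ hr (Nat.sub_le k (k / 2)) (by omega) (Algebra.leftMulMatrix b a'))
    (conj_mem_congrN hϖ _) (congrN_le_groupJ hϖ hk) hτ (v := e.symm (toInd τ' m)) (fun x hx => by
      have h1 := toInd_mem_eig (congrN_le_groupJ hϖ hk) hτ' m x hx
      have h2 := equiv_apply e.symm x (toInd τ' m)
      change e.symm (Representation.ind (groupJ b k).subtype τ' x (toInd τ' m)) = _ at h2
      rw [h1, map_smul] at h2
      exact h2.symm) hv0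
  obtain ⟨g, rfl⟩ := toGL_surjective hϖ (by omega) g
  obtain ⟨C, hC⟩ := eq_smul_of_forall_trChar_eq_one hϖ hψ hψ' (k / 2)
    (a := (g : MatO F n) * Algebra.leftMulMatrix b a * ((g⁻¹ : (MatO F n)ˣ) : MatO F n) -
      Algebra.leftMulMatrix b a') fun X => by
      have h2 := hg _ (uni_mem_congrN hϖ hr _ X)
      rw [chr_uni hϖ hψ hr (Nat.sub_le k (k / 2)), chr_conj hϖ hψ hr (Nat.sub_le k (k / 2)),
        hkr] at h2
      rw [sub_mul, AddChar.map_sub_eq_div, h2, div_self (AddChar.val_isUnit _ _).ne_zero]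
  obtain ⟨γ, c, rfl⟩ := exists_gal_of_conj (b := b) hn hϖ ha (a' := a') (m := k / 2) (by omega) g
    ⟨(C : MatO F n) * (g : MatO F n), by rw [← smul_mul_assoc, ← hC, sub_mul, Units.inv_mul_cancel_right]⟩
  -- Composition acts on characters contragrediently: the character attached to `γ a` is `ω ∘ γ⁻¹`,
  -- so the automorphism produced is `γ⁻¹`.
  have hγ : galRestrict 𝒪[F] F E (OE F E) γ⁻¹ (galRestrict 𝒪[F] F E (OE F E) γ a) = a := by
    rw [← AlgEquiv.mul_apply, ← map_mul, inv_mul_cancel, map_one, AlgEquiv.one_apply]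
  have hω1 : RestrictsTo b ψ ϖ ω (galRestrict 𝒪[F] F E (OE F E) γ⁻¹
    (galRestrict 𝒪[F] F E (OE F E) γ a)) := by rwa [hγ]
  obtain ⟨g', hg'⟩ := exists_matrix_of_algEquiv b (galRestrict 𝒪[F] F E (OE F E) γ⁻¹)
  have hω2 := (hω1.comp_gal hg').congr_add hϖ hψ c
  obtain ⟨d, τ₁, h₁⟩ := exists_isTau hϖ hψ hψ' hk ha' hω2
  obtain ⟨e₁⟩ := h.nonempty_equiv_rho_comp_gal hϖ hψ hψ' hk (isPrimitiveElt_gal (b := b) ha) γ⁻¹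
    hω1 h₁
  obtain ⟨e₂⟩ := nonempty_equiv_of_ind
    (isCharOn_chr hϖ hψ hr (Nat.sub_le k (k / 2)) (by omega) _)
    (moves_of_not_mem_groupJ hϖ hψ hk hψ' ha') (congrN_le_groupJ hϖ hk)
    ((h₁.exists_actsByScalars hϖ hψ hψ' hk hω2).apply_of_mem_congrN hϖ hψ hk) hτ' (e₁.trans e)
  exact ⟨γ⁻¹, (h₁.eq_of_equiv hϖ hψ hψ' hk ha' hω2 hω' h' e₂).symm⟩

end Induced

end UnramifiedGL

end

open UnramifiedGL
theorem theoremB {F : Type u} [Field F] [ValuativeRel F] [TopologicalSpace F]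
    [IsNonarchimedeanLocalField F]
    {E : Type v} [Field E] [Algebra F E] [FiniteDimensional F E] [IsUnramifiedExtension F E]
    {n k : ℕ} (hn : Module.finrank F E = n) (hk : 2 ≤ k)
    -- an identification of `𝔒` with `𝔬 ^ n`, through which `𝔒_k^×` is a subgroup of `GL_n(𝔬_k)`
    (b : Module.Basis (Fin n) 𝒪[F] (OE F E))
    -- a uniformizer of `F`
    (ϖ : 𝒪[F]) (hϖ : Irreducible ϖ)
    -- an additive character of `F`, trivial on `𝔬` but not on `𝔭⁻¹`
    (ψ : AddChar F ℂ) (hψ : ∀ x : 𝒪[F], ψ (x : F) = 1)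
    (hψ' : ∃ x : 𝒪[F], ψ ((x : F) / (ϖ : F)) ≠ 1) :
    -- `ρ_ω` exists, is irreducible and strongly cuspidal
    (∀ ω : (OQuot F E k)ˣ →* ℂˣ, IsStronglyPrimitive ϖ ω →
      (∃ (M : Type) (_ : AddCommGroup M) (_ : Module ℂ M) (τ : Representation ℂ (groupJ b k) M),
        IsTau b ψ ϖ hk ω τ) ∧
      (∀ (M : Type w) [AddCommGroup M] [Module ℂ M] (τ : Representation ℂ (groupJ b k) M),
        IsTau b ψ ϖ hk ω τ →
        (rho b τ).IsIrreducible ∧ IsStronglyCuspidal ψ ϖ (rho b τ))) ∧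
    -- every strongly cuspidal representation is some `ρ_ω`
    (∀ (V : Type w) [AddCommGroup V] [Module ℂ V] (ρ : Representation ℂ (GLk F n k) V),
      IsStronglyCuspidal ψ ϖ ρ →
      ∃ ω : (OQuot F E k)ˣ →* ℂˣ, IsStronglyPrimitive ϖ ω ∧
        ∃ (M : Type) (_ : AddCommGroup M) (_ : Module ℂ M)
          (τ : Representation ℂ (groupJ b k) M),
          IsTau b ψ ϖ hk ω τ ∧ Nonempty (ρ.Equiv (rho b τ))) ∧
    -- `ρ_ω ≅ ρ_ω'` if and only if `ω' = ω ∘ γ` for some `γ ∈ Gal(E/F)`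
    (∀ ω ω' : (OQuot F E k)ˣ →* ℂˣ, IsStronglyPrimitive ϖ ω → IsStronglyPrimitive ϖ ω' →
      ∀ (M : Type w) [AddCommGroup M] [Module ℂ M] (τ : Representation ℂ (groupJ b k) M)
        (M' : Type w') [AddCommGroup M'] [Module ℂ M'] (τ' : Representation ℂ (groupJ b k) M'),
        IsTau b ψ ϖ hk ω τ → IsTau b ψ ϖ hk ω' τ' →
        (Nonempty ((rho b τ).Equiv (rho b τ')) ↔
          ∃ γ : E ≃ₐ[F] E, ω' = ω.comp (galUnits k γ))) := by
  have key : ∀ ω : (OQuot F E k)ˣ →* ℂˣ, IsStronglyPrimitive ϖ ω →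
      ∃ a, RestrictsTo b ψ ϖ ω a ∧ IsPrimitiveElt 𝓀[F] (resO F E a) := fun ω h => by
    obtain ⟨a, ha⟩ := exists_restrictsTo hϖ hψ hψ' hk b ω
    exact ⟨a, ha, (isStronglyPrimitive_iff hϖ hψ hψ' hk ha).1 h⟩
  refine ⟨fun ω h => ?_, fun V _ _ ρ hρ => ?_, fun ω ω' h h' M _ _ τ M' _ _ τ' hτ hτ' => ?_⟩
  · obtain ⟨a, hω, ha⟩ := key ω h
    obtain ⟨d, τ, hτ⟩ := exists_isTau hϖ hψ hψ' hk ha hω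
    exact ⟨⟨Fin d → ℂ, inferInstance, inferInstance, τ, hτ⟩, fun M _ _ τ hτ =>
      ⟨hτ.isIrreducible_rho hϖ hψ hψ' hk ha hω, hτ.isStronglyCuspidal_rho hϖ hψ hψ' hk ha hω⟩⟩
  · obtain ⟨ω, hω, d, τ, hτ, e⟩ := exists_isTau_of_isStronglyCuspidal hϖ hψ hψ' hk b hρ
    exact ⟨ω, hω, Fin d → ℂ, inferInstance, inferInstance, τ, hτ, e⟩
  · obtain ⟨a, hω, ha⟩ := key ω h
    obtain ⟨a', hω', ha'⟩ := key ω' h'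
    constructor
    · rintro ⟨e⟩
      exact hτ.eq_comp_gal_of_equiv_rho hϖ hψ hψ' hk ha hn ha' hω hω' hτ' e
    · rintro ⟨γ, rfl⟩
      -- The element attached to `ω ∘ γ` is `γ⁻¹ a`.
      have hγ : galRestrict 𝒪[F] F E (OE F E) γ (galRestrict 𝒪[F] F E (OE F E) γ⁻¹ a) = a := by
        rw [← AlgEquiv.mul_apply, ← map_mul, mul_inv_cancel, map_one, AlgEquiv.one_apply]
      obtain ⟨e⟩ := hτ.nonempty_equiv_rho_comp_gal hϖ hψ hψ' hk
        (isPrimitiveElt_gal (b := b) (γ := γ⁻¹) ha) γ (by rwa [hγ]) hτ'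
      exact ⟨e.symm⟩
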